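/- Notation. $\langle y\rangle=\sqrt{1+|y|^2}$, $\hat v=v/\langle v\rangle$; $\lambda_\pm(k)=\pm i\langle k\rangle$, $a_\pm(k)=\mp\frac i2\langle k\rangle^{-1}$, and $G^{osc}_\pm(t,x)$ is the kernel on $\mathbb R^3$ with Fourier symbol $e^{\lambda_\pm(k)t}a_\pm(k)$. For an integer $\alpha_0\ge 4$ and a multi-index $\alpha$ (or an integer, in place of $|\alpha|$) put $\delta_\alpha=\frac{|\alpha|}{\alpha_0-1}$. Assumptions on the field. Let $\epsilon>0$, $T\ge 0$, and let $E:[0,T]\times\mathbb R^3\to\mathbb R^3$ be continuous, of the form $$E=\sum_\pm E^{osc}_\pm+E^r,\qquad E^{osc}_\pm(t)=G^{osc}_\pm(t)\star_x\nabla_xS_{0,\pm}+\int_0^tG^{osc}_\pm(t-s)\star_x\nabla_xS_\pm(s)\,ds,$$ with complex-valued $S_{0,\pm}\in L^2(\mathbb R^3)$, measurable complex-valued $S_\pm(t,x)$ and $E^{osc}_\pm,E^r$ with values in $\mathbb C^3$, such that for all $t\in[0,T]$ and both signs (derivatives in the weak sense) * $\|S_\pm(t)\|_{L^p}+\|\partial_xS_\pm(t)\|_{L^p}\le\epsilon\langle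 t\rangle^{-3(1-1/p)}$ and $\|E^r(t)\|_{L^p}\le\epsilon\langle t\rangle^{-3(1-1/p)}$ for $p\in[1,\infty]$; $\|E^{osc}_\pm(t)\|_{L^p}\le\epsilon\langle t\rangle^{-3(1/2-1/p)}$ for $p\in[2,\infty]$; * $\|\partial_x^\alpha S_\pm(t)\|_{L^p}+\|\partial_x^\alpha E^r(t)\|_{L^p}\le\epsilon\langle t\rangle^{-3(1-1/p)+\delta_\alpha}$ for $1\le|\alpha|\le\alpha_0-1$, $p\in[1,\infty]$, and $\|\partial_x^\beta E^r(t)\|_{L^2}\le\epsilon\langle t\rangle^{-3/2+\delta_m}$ for $1\le m\le\alpha_0-1$, $|\beta|=m+1$; * $\|E^{osc}_\pm(t)\|_{H^{\alpha_0}}\le\epsilon$ and $\|E^{osc}_\pm(t)\|_{H^{\alpha_0+1}}+\|E^r(t)\|_{H^{\alpha_0+1}}+\|S_\pm(t)\|_{H^{\alpha_0}}\le\epsilon\langle t\rangle^{\delta_1}$. Let $(X_{s,t}(x,v),V_{s,t}(x,v))$, $0\le s\le t\le T$, be the characteristics: $\partial_sX_{s,t}=\widehat{V}_{s,t}$ (the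 relativistic velocity of $V_{s,t}$), $\partial_sV_{s,t}=E(s,X_{s,t})$, $X_{t,t}=x$, $V_{t,t}=v$. Proposition 3.6. Let $\alpha_0\ge4$ and let $K\subset\mathbb R^3$ be compact. There are constants $\epsilon_1>0$ and $C>0$, depending only on $\alpha_0$ and $K$, such that for all $0<\epsilon\le\epsilon_1$, all $T\ge0$, and every field $E$ as above with its characteristics: for all $0\le s\le t\le T$ and $v\in K$, the maps $x\mapsto X_{s,t}(x,v)$ and $x\mapsto V_{s,t}(x,v)$ are of class $C^{\alpha_0-1}$, and for all multi-indices $\alpha$ with $1\le|\alpha|\le\alpha_0-1$ $$\sup_{x\in\mathbb R^3,\,v\in K}|\partial_x^\alpha(V_{s,t}(x,v)-v)|\le C\epsilon\,\langle s\rangle^{-\frac32(1-\delta_\alpha)}\langle t\rangle^{\delta_\alpha},\qquad \sup_{x\in\mathbb R^3,\,v\in K}|\partial_x^\alpha(X_{s,t}(x,v)-x)|\le C\epsilon\,\langle s\rangle^{-\frac12(1-\delta_\alpha)}\langle t\rangle^{\delta_\alpha}.$$ -/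

import Mathlib

open MeasureTheory Set
open scoped ENNReal FourierTransform ContDiff

noncomputable section

namespace VKG

/-- Physical space and velocity space `ℝ³`, with the Euclidean norm. -/
abbrev R3 : Type := EuclideanSpace ℝ (Fin 3)

/-- `ℂ³`, in which the complex components of the electric field take their values. -/
abbrev C3 : Type := EuclideanSpace ℂ (Fin 3)

/-- The Japanese bracket `⟨y⟩ = √(1 + |y|²)`. -/
def bracket {F : Type*} [NormedAddCommGroup F] (y : F) : ℝ := Real.sqrt (1 + ‖y‖ ^ 2)

/-- The relativistic velocity `v̂ = v / ⟨v⟩`. -/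
def relVel (v : R3) : R3 := (bracket v)⁻¹ • v

/-! ### Partial derivatives, weak derivatives, and norms -/

/-- The length `|α|` of a multi-index. -/
def order (α : Fin 3 → ℕ) : ℕ := ∑ i, α i

/-- The (classical) partial derivative `∂_{x_i} f`. -/
def pderiv {F : Type*} [NormedAddCommGroup F] [NormedSpace ℝ F] (i : Fin 3) (f : R3 → F) :
    R3 → F :=
  fun x => fderiv ℝ f x (EuclideanSpace.single i 1)

/-- The (classical) derivative `∂_x^α f = ∂_{x_1}^{α_1} ∂_{x_2}^{α_2} ∂_{x_3}^{α_3} f`. -/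
def multiDeriv {F : Type*} [NormedAddCommGroup F] [NormedSpace ℝ F] (α : Fin 3 → ℕ)
    (f : R3 → F) : R3 → F :=
  (pderiv 0)^[α 0] ((pderiv 1)^[α 1] ((pderiv 2)^[α 2] f))

/-- `g` is the weak (distributional) derivative `∂_x^α f` on `ℝ³`. -/
def IsWeakDeriv {F : Type*} [NormedAddCommGroup F] [NormedSpace ℝ F] (α : Fin 3 → ℕ)
    (f g : R3 → F) : Prop :=
  LocallyIntegrable f ∧ LocallyIntegrable g ∧
    ∀ φ : R3 → ℝ, ContDiff ℝ ∞ φ → HasCompactSupport φ →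
      ∫ x, multiDeriv α φ x • f x = (-1 : ℝ) ^ order α • ∫ x, φ x • g x

/-- The norm `‖∂_x^α f‖_{L^p}` of the weak derivative, `∞` if there is no such derivative.
The weak derivative is unique almost everywhere, so the infimum has at most one value to
consider. -/
def derivNorm {F : Type*} [NormedAddCommGroup F] [NormedSpace ℝ F] (α : Fin 3 → ℕ)
    (p : ℝ≥0∞) (f : R3 → F) : ℝ≥0∞ :=
  ⨅ (g : R3 → F) (_ : IsWeakDeriv α f g), eLpNorm g p volume

/-- The Sobolev norm `‖f‖_{H^k} = (∑_{|α| ≤ k} ‖∂_x^α f‖_{L²}²)^{1/2}`, with values in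
`[0, ∞]`. -/
def sobolevNorm {F : Type*} [NormedAddCommGroup F] [NormedSpace ℝ F] (k : ℕ)
    (f : R3 → F) : ℝ≥0∞ :=
  (∑ m ∈ Finset.range (k + 1), ∑ α ∈ Finset.piAntidiag (Finset.univ : Finset (Fin 3)) m,
    derivNorm α 2 f ^ 2) ^ (1 / 2 : ℝ)

/-! ### The oscillatory field

Mathlib's Fourier transform uses the phase `e^{-2πi x·ξ}`; the wave number of the Fourier variable
`ξ` is thus `k = 2πξ`, and `∇_x` has the symbol `i k = 2πi ξ`. A sign `±` is an element
of `ℤˣ = {1, -1}`. -/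

/-- `⟨k⟩ = √(1 + |k|²)` for `k = 2πξ`. -/
def freq (ξ : R3) : ℝ := bracket ((2 * Real.pi) • ξ)

/-- `λ_±(k) = ± i ⟨k⟩` at `k = 2πξ`. -/
def lam (σ : ℤˣ) (ξ : R3) : ℂ := ((σ : ℤ) : ℂ) * Complex.I * (freq ξ : ℂ)

/-- `a_±(k) = ∓ (i / 2) ⟨k⟩⁻¹` at `k = 2πξ`. -/
def amp (σ : ℤˣ) (ξ : R3) : ℂ := -((σ : ℤ) : ℂ) * (Complex.I / 2) * ((freq ξ : ℂ))⁻¹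

/-- The Fourier transform in `x` of
`G_±^{osc}(t) ⋆_x ∇_x S₀ + ∫_0^t G_±^{osc}(t - s) ⋆_x ∇_x S(s) ds`, where `G_±^{osc}(t)`
has the symbol `e^{λ_±(k) t} a_±(k)`. -/
def oscSymbol (σ : ℤˣ) (S₀ : Lp ℂ 2 (volume : Measure R3)) (S : ℝ → R3 → ℂ) (t : ℝ) (ξ : R3) :
    C3 :=
  WithLp.toLp 2 fun i =>
    Complex.exp (lam σ ξ * t) * amp σ ξ * (2 * Real.pi * Complex.I * (ξ i : ℂ)) *
      ((𝓕 S₀ : Lp ℂ 2 (volume : Measure R3)) ξ +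
        ∫ s in (0 : ℝ)..t, Complex.exp (-(lam σ ξ * s)) * 𝓕 (S s) ξ)

/-- `E_±^{osc}(t) = G_±^{osc}(t) ⋆_x ∇_x S₀ + (G_±^{osc} ⋆_{t,x} ∇_x S)(t)` in `L²`, for all
`t ∈ [0, T]`. -/
def IsOscField (T : ℝ) (σ : ℤˣ) (S₀ : Lp ℂ 2 (volume : Measure R3)) (S : ℝ → R3 → ℂ)
    (Eosc : ℝ → R3 → C3) : Prop :=
  ∀ t ∈ Icc (0 : ℝ) T, ∃ h : MemLp (Eosc t) 2 (volume : Measure R3),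
    ((𝓕 (h.toLp (Eosc t)) : Lp C3 2 (volume : Measure R3)) : R3 → C3)
      =ᵐ[volume] oscSymbol σ S₀ S t

/-! ### The class of electric fields -/

/-- `ε ⟨t⟩^r`, as an extended nonnegative real. -/
def rate (ε t r : ℝ) : ℝ≥0∞ := ENNReal.ofReal (ε * bracket t ^ r)

/-- `δ_m = m / (α₀ - 1)`. -/
def delta (α₀ m : ℕ) : ℝ := (m : ℝ) / ((α₀ : ℝ) - 1)

/-- `1 / p` for `p ∈ [1, ∞]`, with `1 / ∞ = 0`. -/
def recip (p : ℝ≥0∞) : ℝ := (p⁻¹).toReal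

/-- The real electric field `E` decomposes on `[0, T]` as `E = E_+^{osc} + E_-^{osc} + E^r`, with
oscillatory parts generated by `S₀` and `S`, and with the decay and the bounds of size `ε`
that are listed. -/
structure IsOscillatoryElectricField (α₀ : ℕ) (ε T : ℝ)
    (S₀ : ℤˣ → Lp ℂ 2 (volume : Measure R3)) (S : ℤˣ → ℝ → R3 → ℂ)
    (Eosc : ℤˣ → ℝ → R3 → C3) (Er : ℝ → R3 → C3) (E : ℝ → R3 → R3) : Prop where
  measurable_source : ∀ σ, Measurable fun z : ℝ × R3 => S σ z.1 z.2
  continuous_field : ContinuousOn (fun z : ℝ × R3 => E z.1 z.2) (Icc 0 T ×ˢ univ)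
  decomposition : ∀ t ∈ Icc (0 : ℝ) T, ∀ x i,
    ((E t x i : ℝ) : ℂ) = (∑ σ, Eosc σ t x i) + Er t x i
  osc : ∀ σ, IsOscField T σ (S₀ σ) (S σ) (Eosc σ)
  decay_source : ∀ σ, ∀ t ∈ Icc (0 : ℝ) T, ∀ p : ℝ≥0∞, 1 ≤ p → ∀ α, order α = 1 →
    eLpNorm (S σ t) p volume + derivNorm α p (S σ t) ≤ rate ε t (-3 * (1 - recip p))
  decay_rem : ∀ t ∈ Icc (0 : ℝ) T, ∀ p : ℝ≥0∞, 1 ≤ p →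
    eLpNorm (Er t) p volume ≤ rate ε t (-3 * (1 - recip p))
  decay_osc : ∀ σ, ∀ t ∈ Icc (0 : ℝ) T, ∀ p : ℝ≥0∞, 2 ≤ p →
    eLpNorm (Eosc σ t) p volume ≤ rate ε t (-3 * (1 / 2 - recip p))
  decay_deriv : ∀ σ, ∀ t ∈ Icc (0 : ℝ) T, ∀ p : ℝ≥0∞, 1 ≤ p →
    ∀ α, 1 ≤ order α → order α ≤ α₀ - 1 →
    derivNorm α p (S σ t) + derivNorm α p (Er t) ≤
      rate ε t (-3 * (1 - recip p) + delta α₀ (order α))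
  decay_rem_top : ∀ t ∈ Icc (0 : ℝ) T, ∀ m : ℕ, 1 ≤ m → m ≤ α₀ - 1 →
    ∀ α, order α = m + 1 → derivNorm α 2 (Er t) ≤ rate ε t (-3 / 2 + delta α₀ m)
  bound_osc : ∀ σ, ∀ t ∈ Icc (0 : ℝ) T, sobolevNorm α₀ (Eosc σ t) ≤ ENNReal.ofReal ε
  bound_top : ∀ σ, ∀ t ∈ Icc (0 : ℝ) T,
    sobolevNorm (α₀ + 1) (Eosc σ t) + sobolevNorm (α₀ + 1) (Er t) + sobolevNorm α₀ (S σ t) ≤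
      rate ε t (delta α₀ 1)

/-! ### Characteristics -/

/-- `(X_{s,t}(x,v), V_{s,t}(x,v))`, written `X s t x v` and `V s t x v`, are the backward
characteristics on `0 ≤ s ≤ t ≤ T`: `∂_s X = V̂`, `∂_s V = E(s, X)`, and `(X, V) = (x, v)`
at `s = t`. -/
structure IsCharacteristic (T : ℝ) (E : ℝ → R3 → R3) (X V : ℝ → ℝ → R3 → R3 → R3) : Prop where
  pos_init : ∀ t ∈ Icc (0 : ℝ) T, ∀ x v, X t t x v = x
  vel_init : ∀ t ∈ Icc (0 : ℝ) T, ∀ x v, V t t x v = v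
  pos_deriv : ∀ t ∈ Icc (0 : ℝ) T, ∀ x v, ∀ s ∈ Icc (0 : ℝ) t,
    HasDerivWithinAt (fun r => X r t x v) (relVel (V s t x v)) (Icc 0 t) s
  vel_deriv : ∀ t ∈ Icc (0 : ℝ) T, ∀ x v, ∀ s ∈ Icc (0 : ℝ) t,
    HasDerivWithinAt (fun r => V r t x v) (E s (X s t x v)) (Icc 0 t) s

end VKG

end

/-!
# Derivatives of the characteristics of an oscillatory electric field

The oscillatory part of the field decays only like `⟨t⟩^{-3/2}` and loses regularity, so the
characteristics cannot be controlled by integrating it. Instead, its oscillation is used. Let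
`u = v̂` be the free velocity. Along the straight line with velocity `u`, a plane wave of frequency
`k` in the field oscillates at the rate `λ_±(k) + i k·u = ± i (⟨k⟩ ± k·u)`, which is never zero:
`⟨k⟩ ± k·u ≥ (1 - |u|) ⟨k⟩`, because the particles are slower than light (`gap_ge`). Dividing the
symbol of `E^osc` by it gives a potential `Φ`, one derivative smoother than `E^osc`, such that along
a path with velocity `W` the field is the time derivative of `Φ` plus a remainder minus
`(W - u)·∇Φ` (`potential_path`). Here the remainder consists of `E^r` and of a zero order operator
applied to the sources `S_±`, and decays like `⟨t⟩^{-3}`. Along the characteristics this reads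
`V_s - v = Φ_s(X_s) - Φ_t(x) - ∫_s^t (remainder - (V̂_τ - v̂)·∇Φ) dτ` (`momentum_eq`), where the
last product, too, decays like `⟨τ⟩^{-3}` up to small losses.

The operators with symbols `1 / (⟨k⟩ ± k·u)` and `k_i / (⟨k⟩ (⟨k⟩ ± k·u))` are bounded on bounded
functions: their symbols are superpositions of Gaussians, whose kernels have an `L¹` norm that is
independent of translation and dilation of the symbol, by the formulas `1 / ⟨k⟩ = (2/√π) ∫ e^{-ρ²⟨k⟩²} dρ` and
`1 / (⟨k⟩ (⟨k⟩ + p)) = ∫ (⟨k⟩² + 2 y p + y²)^{-3/2} dy` (`norm_fourierInv_resolvent_le`,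
`norm_fourierInv_riesz_le`). This gives the decay of `Φ` and of the remainder. The derivative of
order `n + 1 = α₀` of `Φ` is bounded by the `H^{α₀+1}` norm of `E^osc`, and Landau's inequality
interpolates between the two (`potential_bounds`, `remainder_bounds`).

The characteristics are as smooth as the field is in space. The field is an inverse Fourier
integral with bounded weighted `L²` norm, hence of class `C^n` with jointly continuous derivatives
(`field_regularity`). For smooth dependence on the end point, the differential equation is solved
by the inverse function theorem in the space of continuous functions of time (`contDiff_solution`).

The estimate itself is a bootstrap backwards in time from `s = t`, where both displacements vanish
(`displacement_bounds`). The derivatives of order `m` of the momentum and of the position are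
measured against `⟨s⟩^{-3/2} velWeight` and `⟨s⟩^{-1/2} posWeight`. Both weights are almost geometric
in `m`, so that the chain rule of higher order reproduces them without an analysis of its
individual terms (`norm_iteratedFDeriv_comp_le_weight`). If the bounds hold on `[s, t]`, the normal
form identity returns them with a factor `ε` (`momentum_deriv_le`), and integration of the velocity
passes them on to the position (`position_deriv_le`); the decay that is left over makes all time
integrals converge.
-/

noncomputable section

set_option linter.unusedSectionVars false

namespace VKG

open scoped SchwartzMap LineDeriv Topology
open Filter

/-! ### Fourier transforms in the sense of distributions -/

section FourierPairs

variable {F : Type*} [NormedAddCommGroup F] [InnerProductSpace ℂ F]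

/-- `h` is the Fourier transform of `g` in the sense of tempered distributions. -/
def IsFT (g h : R3 → F) : Prop :=
  ∀ G : 𝓢(R3, ℂ), ∫ x, (𝓕 G) x • g x = ∫ ξ, G ξ • h ξ

theorem IsFT.congr_right {g h h' : R3 → F} (H : IsFT g h) (hh : h =ᵐ[volume] h') : IsFT g h' := by
  intro G
  rw [H G]
  apply integral_congr_ae
  filter_upwards [hh] with x hx
  rw [hx]

theorem isFT_of_integrable [CompleteSpace F] {g : R3 → F} (hg : Integrable g) : IsFT g (𝓕 g) := by
  intro G
  have := VectorFourier.integral_fourierIntegral_smul_eq_flip (e := Real.fourierChar)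
    (μ := (volume : Measure R3)) (ν := (volume : Measure R3)) (L := innerₗ R3)
    (f := (G : R3 → ℂ)) (g := g) Real.continuous_fourierChar continuous_inner G.integrable hg
  simp only [flip_innerₗ] at this
  exact this

theorem isFT_toLp [CompleteSpace F] {g : R3 → F} (hg : MemLp g 2 (volume : Measure R3)) :
    IsFT g ((𝓕 (hg.toLp g) : Lp F 2 (volume : Measure R3)) : R3 → F) := by
  intro G
  have h1 := congrArg (fun f => f G) (Lp.fourier_toTemperedDistribution_eq (hg.toLp g))
  simp only [TemperedDistribution.fourier_apply, Lp.toTemperedDistribution_apply] at h1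
  rw [← h1]
  apply integral_congr_ae
  filter_upwards [hg.coeFn_toLp] with x hx
  rw [hx]

/-- A real test function, as a complex valued Schwartz function. -/
def testSchwartz (φ : R3 → ℝ) (h1 : ContDiff ℝ ∞ φ) (h2 : HasCompactSupport φ) : 𝓢(R3, ℂ) :=
  HasCompactSupport.toSchwartzMap (f := fun x => (φ x : ℂ))
    (h2.comp_left (g := fun r : ℝ => (r : ℂ)) Complex.ofReal_zero)
    (Complex.ofRealCLM.contDiff.comp h1)

@[simp] theorem testSchwartz_apply (φ : R3 → ℝ) (h1 : ContDiff ℝ ∞ φ)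
    (h2 : HasCompactSupport φ) (x : R3) : testSchwartz φ h1 h2 x = (φ x : ℂ) := rfl

/-- A locally integrable Fourier transform is determined almost everywhere. -/
theorem IsFT.unique [CompleteSpace F] {g h h' : R3 → F} (H : IsFT g h) (H' : IsFT g h')
    (hl : LocallyIntegrable h) (hl' : LocallyIntegrable h') : h =ᵐ[volume] h' := by
  apply ae_eq_of_integral_contDiff_smul_eq hl hl'
  intro φ h1 h2
  have := (H (testSchwartz φ h1 h2)).symm.trans (H' (testSchwartz φ h1 h2))
  simpa using this

/-- Fourier inversion: a function whose Fourier transform is integrable has a continuous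
representative, given by the inverse Fourier integral. -/
theorem IsFT.eq_fourierInv [CompleteSpace F] {g h : R3 → F} (H : IsFT g h) (hl : LocallyIntegrable g)
    (hh : Integrable h) : g =ᵐ[volume] 𝓕⁻ h := by
  have hc : Continuous (𝓕⁻ h) := by
    have : Continuous (𝓕 h) :=
      VectorFourier.fourierIntegral_continuous Real.continuous_fourierChar
        (by exact continuous_inner) hh
    rw [Real.fourierInv_eq_fourier_comp_neg]
    have h2 : Continuous (𝓕 (fun x => h (-x))) :=
      VectorFourier.fourierIntegral_continuous Real.continuous_fourierChar
        (by exact continuous_inner) hh.comp_neg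
    exact h2
  apply ae_eq_of_integral_contDiff_smul_eq hl hc.locallyIntegrable
  intro φ h1 h2
  set G : 𝓢(R3, ℂ) := testSchwartz φ h1 h2
  have e1 := H (𝓕⁻ G)
  rw [FourierTransform.fourier_fourierInv_eq] at e1
  have e2 := VectorFourier.integral_fourierIntegral_smul_eq_flip (e := Real.fourierChar)
    (μ := (volume : Measure R3)) (ν := (volume : Measure R3)) (L := -innerₗ R3)
    (f := (G : R3 → ℂ)) (g := h) Real.continuous_fourierChar
    (by exact continuous_inner.neg) G.integrable hh
  have e3 : (-innerₗ R3).flip = -innerₗ R3 := by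
    ext x y
    simp [real_inner_comm]
  rw [e3] at e2
  have e4 : ∫ ξ, (𝓕⁻ G) ξ • h ξ = ∫ x, G x • 𝓕⁻ h x := by
    rw [SchwartzMap.fourierInv_coe]
    exact e2
  rw [e4] at e1
  simpa [G] using e1

theorem integrable_schwartz_smul (ψ : 𝓢(R3, ℂ)) {g : R3 → F}
    (hg : MemLp g 2 (volume : Measure R3)) : Integrable (fun x => ψ x • g x) :=
  memLp_one_iff_integrable.1 (hg.smul (ψ.memLp 2))

theorem norm_smul_integrable_schwartz (ψ : 𝓢(R3, ℂ)) {g : R3 → F}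
    (hg : MemLp g 2 (volume : Measure R3)) : Integrable (fun x => ‖ψ x‖ * ‖g x‖) := by
  simpa [norm_smul] using (integrable_schwartz_smul ψ hg).norm

/-- A fixed smooth cutoff, equal to `1` on the unit ball. -/
def cutoff : ContDiffBump (0 : R3) := ⟨1, 2, one_pos, one_lt_two⟩

/-- Integration by parts against test functions extends to Schwartz functions. -/
theorem schwartz_integral_by_parts [CompleteSpace F] {g g' : R3 → F} (hg : MemLp g 2 (volume : Measure R3))
    (hg' : MemLp g' 2 (volume : Measure R3)) (e : R3)
    (H : ∀ φ : R3 → ℝ, ContDiff ℝ ∞ φ → HasCompactSupport φ →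
      ∫ x, fderiv ℝ φ x e • g x = - ∫ x, φ x • g' x) (ψ : 𝓢(R3, ℂ)) :
    ∫ x, (fderiv ℝ ψ x e) • g x = - ∫ x, ψ x • g' x := by
  have hgl := hg.locallyIntegrable (by norm_num)
  have hgl' := hg'.locallyIntegrable (by norm_num)
  -- complex valued test functions
  have HC : ∀ φ : R3 → ℂ, ContDiff ℝ ∞ φ → HasCompactSupport φ →
      ∫ x, fderiv ℝ φ x e • g x = - ∫ x, φ x • g' x := by
    intro φ h1 h2
    have hre : ContDiff ℝ ∞ (fun x => (φ x).re) := Complex.reCLM.contDiff.comp h1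
    have him : ContDiff ℝ ∞ (fun x => (φ x).im) := Complex.imCLM.contDiff.comp h1
    have cre : HasCompactSupport (fun x => (φ x).re) :=
      h2.comp_left (g := Complex.re) Complex.zero_re
    have cim : HasCompactSupport (fun x => (φ x).im) :=
      h2.comp_left (g := Complex.im) Complex.zero_im
    have d : ∀ x, HasFDerivAt φ (fderiv ℝ φ x) x := fun x =>
      (h1.differentiable (by simp) x).hasFDerivAt
    have dre : ∀ x, fderiv ℝ (fun x => (φ x).re) x e = (fderiv ℝ φ x e).re := fun x => by
      have := (Complex.reCLM.hasFDerivAt (x := φ x)).comp x (d x)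
      rw [show (fun x => (φ x).re) = Complex.reCLM ∘ φ from rfl, this.fderiv]
      rfl
    have dim : ∀ x, fderiv ℝ (fun x => (φ x).im) x e = (fderiv ℝ φ x e).im := fun x => by
      have := (Complex.imCLM.hasFDerivAt (x := φ x)).comp x (d x)
      rw [show (fun x => (φ x).im) = Complex.imCLM ∘ φ from rfl, this.fderiv]
      rfl
    have split : ∀ (z : ℂ) (y : F), z • y = z.re • y + Complex.I • (z.im • y) := by
      intro z y
      conv_lhs => rw [← Complex.re_add_im z]
      rw [add_smul, mul_comm, mul_smul, Complex.coe_smul, Complex.coe_smul]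
    have ci : ∀ {f : R3 → ℝ}, ContDiff ℝ ∞ f → HasCompactSupport f →
        Integrable (fun x => fderiv ℝ f x e • g x) := fun {f} hf hc =>
      hgl.integrable_smul_left_of_hasCompactSupport
        ((hf.continuous_fderiv (by simp)).clm_apply continuous_const) (hc.fderiv_apply ℝ e)
    have ci' : ∀ {f : R3 → ℝ}, ContDiff ℝ ∞ f → HasCompactSupport f →
        Integrable (fun x => f x • g' x) := fun {f} hf hc =>
      hgl'.integrable_smul_left_of_hasCompactSupport hf.continuous hc
    have e1 := H _ hre cre
    have e2 := H _ him cim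
    have i1 := ci hre cre
    have i2 := ci him cim
    simp only [dre] at e1 i1
    simp only [dim] at e2 i2
    calc ∫ x, fderiv ℝ φ x e • g x
        = ∫ x, ((fderiv ℝ φ x e).re • g x + Complex.I • ((fderiv ℝ φ x e).im • g x)) := by
          simp_rw [← split]
      _ = - ∫ x, ((φ x).re • g' x + Complex.I • ((φ x).im • g' x)) := by
          have j2 : Integrable (fun x => Complex.I • ((fderiv ℝ φ x e).im • g x)) := i2.smul _
          have j2' : Integrable (fun x => Complex.I • ((φ x).im • g' x)) := (ci' him cim).smul _
          rw [integral_add i1 j2, integral_smul, e1, e2, integral_add (ci' hre cre) j2',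
            integral_smul]
          rw [smul_neg, neg_add]
      _ = - ∫ x, φ x • g' x := by simp_rw [← split]
  -- cutoffs
  let c : ℕ → ℝ := fun k => ((k : ℝ) + 1)⁻¹
  have hc0 : ∀ k, 0 < c k := fun k => by positivity
  have hc1 : ∀ k, c k ≤ 1 := fun k => inv_le_one_of_one_le₀ (by linarith [Nat.cast_nonneg (α := ℝ) k])
  have hct : Tendsto c atTop (𝓝 0) := by
    simpa [c, one_div] using tendsto_one_div_add_atTop_nhds_zero_nat (𝕜 := ℝ)
  let χ : ℕ → R3 → ℝ := fun k x => cutoff (c k • x)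
  have hχs : ∀ k, ContDiff ℝ ∞ (χ k) := fun k =>
    cutoff.contDiff.comp (contDiff_const_smul (c k))
  have hχc : ∀ k, HasCompactSupport (χ k) := fun k =>
    cutoff.hasCompactSupport.comp_homeomorph (Homeomorph.smulOfNeZero (c k) (hc0 k).ne')
  have hχ1 : ∀ k x, |χ k x| ≤ 1 := fun k x => by
    rw [abs_of_nonneg cutoff.nonneg]; exact cutoff.le_one
  obtain ⟨M, hM⟩ : ∃ M, ∀ x, ‖fderiv ℝ cutoff x‖ ≤ M :=
    (cutoff.hasCompactSupport.fderiv ℝ).exists_bound_of_continuous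
      (cutoff.contDiff.continuous_fderiv (n := 1) (by simp))
  have hM0 : 0 ≤ M := (norm_nonneg _).trans (hM 0)
  have dχ : ∀ k x, HasFDerivAt (χ k) (c k • fderiv ℝ cutoff (c k • x)) x := fun k x => by
    have h1 : HasFDerivAt (fun x : R3 => c k • x) (c k • ContinuousLinearMap.id ℝ R3) x :=
      (hasFDerivAt_id x).const_smul (c k)
    have h2 : HasFDerivAt cutoff (fderiv ℝ cutoff (c k • x)) (c k • x) :=
      ((cutoff.contDiff (n := 1)).differentiable (by simp) _).hasFDerivAt
    have h3 := h2.comp x h1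
    have h4 : (fderiv ℝ cutoff (c k • x)).comp (c k • ContinuousLinearMap.id ℝ R3) =
        c k • fderiv ℝ cutoff (c k • x) := by
      ext v
      simp
    rw [h4] at h3
    exact h3
  have key : ∀ k, ∫ x, ((χ k x : ℂ) * fderiv ℝ ψ x e +
      (c k : ℂ) * ((fderiv ℝ cutoff (c k • x) e : ℝ) : ℂ) * ψ x) • g x
      = - ∫ x, ((χ k x : ℂ) * ψ x) • g' x := by
    intro k
    have hs : ContDiff ℝ ∞ (fun x => (χ k x : ℂ)) := Complex.ofRealCLM.contDiff.comp (hχs k)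
    have := HC (fun x => (χ k x : ℂ) * ψ x) (hs.mul (ψ.smooth ⊤)) (by
      have : HasCompactSupport (fun x => (χ k x : ℂ)) :=
        (hχc k).comp_left (g := fun r : ℝ => (r : ℂ)) Complex.ofReal_zero
      exact this.mul_right)
    rw [← this]
    congr 1
    ext x
    congr 1
    have h1 : HasFDerivAt (fun x => (χ k x : ℂ))
        (Complex.ofRealCLM.comp (c k • fderiv ℝ cutoff (c k • x))) x :=
      Complex.ofRealCLM.hasFDerivAt.comp x (dχ k x)
    have h2 := h1.mul (ψ.differentiable x).hasFDerivAt
    rw [show (fun x => (χ k x : ℂ) * ψ x) = (fun x => (χ k x : ℂ)) * ψ from rfl, h2.fderiv]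
    simp
    ring
  have hχlim : ∀ x, Tendsto (fun k => χ k x) atTop (𝓝 1) := by
    intro x
    have h1 : Tendsto (fun k => c k • x) atTop (𝓝 (0 : R3)) := by
      simpa using hct.smul_const x
    have h2 := (cutoff.continuous.tendsto 0).comp h1
    have h3 : cutoff (0 : R3) = 1 := cutoff.one_of_mem_closedBall (by simp [cutoff])
    rw [h3] at h2
    exact h2
  have l1 : Tendsto (fun k => ∫ x, ((χ k x : ℂ) * fderiv ℝ ψ x e +
      (c k : ℂ) * ((fderiv ℝ cutoff (c k • x) e : ℝ) : ℂ) * ψ x) • g x) atTop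
      (𝓝 (∫ x, fderiv ℝ ψ x e • g x)) := by
    let ψ' : 𝓢(R3, ℂ) := ∂_{e} ψ
    have hψ' : ∀ x, fderiv ℝ ψ x e = ψ' x := fun x =>
      (SchwartzMap.lineDerivOp_apply_eq_fderiv e ψ x).symm
    simp_rw [hψ']
    apply tendsto_integral_of_dominated_convergence
      (fun x => ‖ψ' x‖ * ‖g x‖ + (M * ‖e‖) * (‖ψ x‖ * ‖g x‖))
    · intro k
      apply AEStronglyMeasurable.smul _ hg.1
      apply Continuous.aestronglyMeasurable
      have a1 := (hχs k).continuous
      have a2 : Continuous (fun x : R3 => fderiv ℝ cutoff (c k • x) e) := by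
        have := cutoff.contDiff.continuous_fderiv (n := 1) (by simp)
        fun_prop
      have := ψ.continuous
      have := ψ'.continuous
      fun_prop
    · exact (norm_smul_integrable_schwartz ψ' hg).add
        ((norm_smul_integrable_schwartz ψ hg).const_mul _)
    · intro k
      refine Eventually.of_forall fun x => ?_
      rw [norm_smul]
      have b1 : ‖(χ k x : ℂ) * ψ' x‖ ≤ ‖ψ' x‖ := by
        rw [norm_mul, Complex.norm_real, Real.norm_eq_abs]
        exact mul_le_of_le_one_left (norm_nonneg _) (hχ1 k x)
      have b2 : ‖(c k : ℂ) * ((fderiv ℝ cutoff (c k • x) e : ℝ) : ℂ) * ψ x‖ ≤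
          M * ‖e‖ * ‖ψ x‖ := by
        rw [norm_mul, norm_mul, Complex.norm_real, Complex.norm_real, Real.norm_eq_abs,
          abs_of_pos (hc0 k)]
        have := (fderiv ℝ cutoff (c k • x)).le_opNorm e
        have h4 := hM (c k • x)
        have h5 : ‖fderiv ℝ cutoff (c k • x) e‖ ≤ M * ‖e‖ := this.trans (by gcongr)
        refine mul_le_mul_of_nonneg_right ?_ (norm_nonneg _)
        calc c k * ‖fderiv ℝ cutoff (c k • x) e‖ ≤ 1 * (M * ‖e‖) := by
              gcongr; exact hc1 k
          _ = _ := one_mul _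
      calc _ ≤ (‖ψ' x‖ + M * ‖e‖ * ‖ψ x‖) * ‖g x‖ := by
            gcongr; exact (norm_add_le _ _).trans (add_le_add b1 b2)
        _ = _ := by ring
    · refine Eventually.of_forall fun x => ?_
      have t1 : Tendsto (fun k => (χ k x : ℂ)) atTop (𝓝 1) := by
        exact_mod_cast (Complex.continuous_ofReal.tendsto 1).comp (hχlim x)
      have t2 : Tendsto (fun k => (c k : ℂ) * ((fderiv ℝ cutoff (c k • x) e : ℝ) : ℂ) * ψ x)
          atTop (𝓝 0) := by
        have s1 : Tendsto (fun k => c k • x) atTop (𝓝 (0 : R3)) := by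
          simpa using hct.smul_const x
        have s2 : Continuous (fun y : R3 => ((fderiv ℝ cutoff y e : ℝ) : ℂ)) := by
          have := cutoff.contDiff.continuous_fderiv (n := 1) (by simp)
          fun_prop
        have s3 := (s2.tendsto 0).comp s1
        have s4 : Tendsto (fun k => (c k : ℂ)) atTop (𝓝 0) := by
          exact_mod_cast (Complex.continuous_ofReal.tendsto 0).comp hct
        simpa using (s4.mul s3).mul_const (ψ x)
      simpa using ((t1.mul_const (ψ' x)).add t2).smul_const (g x)
  have l2 : Tendsto (fun k => - ∫ x, ((χ k x : ℂ) * ψ x) • g' x) atTop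
      (𝓝 (- ∫ x, ψ x • g' x)) := by
    apply Tendsto.neg
    apply tendsto_integral_of_dominated_convergence (fun x => ‖ψ x‖ * ‖g' x‖)
    · intro k
      apply AEStronglyMeasurable.smul _ hg'.1
      have a1 := (hχs k).continuous
      have := ψ.continuous
      exact Continuous.aestronglyMeasurable (by fun_prop)
    · exact norm_smul_integrable_schwartz ψ hg'
    · intro k
      refine Eventually.of_forall fun x => ?_
      rw [norm_smul, norm_mul, Complex.norm_real, Real.norm_eq_abs]
      gcongr
      exact mul_le_of_le_one_left (norm_nonneg _) (hχ1 k x)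
    · refine Eventually.of_forall fun x => ?_
      have t1 : Tendsto (fun k => (χ k x : ℂ)) atTop (𝓝 1) := by
        exact_mod_cast (Complex.continuous_ofReal.tendsto 1).comp (hχlim x)
      simpa using (t1.mul_const (ψ x)).smul_const (g' x)
  simp_rw [key] at l1
  exact tendsto_nhds_unique l1 l2

/-- One weak derivative multiplies the Fourier transform by `2πi ⟨ξ, e⟩`. -/
theorem IsFT.deriv [CompleteSpace F] {g g' h : R3 → F} (H : IsFT g h) (hg : MemLp g 2 (volume : Measure R3))
    (hg' : MemLp g' 2 (volume : Measure R3)) (e : R3)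
    (Hd : ∀ φ : R3 → ℝ, ContDiff ℝ ∞ φ → HasCompactSupport φ →
      ∫ x, fderiv ℝ φ x e • g x = - ∫ x, φ x • g' x) :
    IsFT g' (fun ξ => (2 * Real.pi * Complex.I * (inner ℝ ξ e : ℝ)) • h ξ) := by
  intro G
  have h1 := schwartz_integral_by_parts hg hg' e Hd (𝓕 G)
  have h2 : ∀ x, fderiv ℝ (𝓕 G : 𝓢(R3, ℂ)) x e =
      (𝓕 (-(2 * ↑Real.pi * Complex.I) • (SchwartzMap.smulLeftCLM ℂ fun x => inner ℝ x e) G)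
        : 𝓢(R3, ℂ)) x := fun x => by
    rw [← SchwartzMap.lineDerivOp_apply_eq_fderiv, SchwartzMap.lineDerivOp_fourier_eq]
  simp_rw [h2] at h1
  rw [H] at h1
  rw [← neg_inj, ← h1, ← integral_neg]
  congr 1
  ext ξ
  rw [smul_apply, SchwartzMap.smulLeftCLM_apply_apply (by fun_prop),
    smul_smul, ← neg_smul]
  congr 1
  simp
  ring

end FourierPairs

/-! ### Weak derivatives -/

section WeakDerivatives

variable {F : Type*} [NormedAddCommGroup F] [NormedSpace ℝ F]

theorem IsWeakDeriv.ae_eq [CompleteSpace F] {α : Fin 3 → ℕ} {f g g' : R3 → F} (H : IsWeakDeriv α f g)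
    (H' : IsWeakDeriv α f g') : g =ᵐ[volume] g' := by
  apply ae_eq_of_integral_contDiff_smul_eq H.2.1 H'.2.1
  intro φ h1 h2
  have e := (H.2.2 φ h1 h2).symm.trans (H'.2.2 φ h1 h2)
  have hu : ((-1 : ℝ) ^ order α) ≠ 0 := pow_ne_zero _ (by norm_num)
  exact smul_right_injective F hu e

theorem IsWeakDeriv.eLpNorm_eq [CompleteSpace F] {α : Fin 3 → ℕ} {f g : R3 → F} (H : IsWeakDeriv α f g)
    (p : ℝ≥0∞) : eLpNorm g p volume = derivNorm α p f :=
  le_antisymm (le_iInf₂ fun _ H' => (eLpNorm_congr_ae (H.ae_eq H')).le) (iInf₂_le g H)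

theorem exists_isWeakDeriv [CompleteSpace F] {α : Fin 3 → ℕ} {p : ℝ≥0∞} {f : R3 → F}
    (h : derivNorm α p f ≠ ⊤) : ∃ g, IsWeakDeriv α f g ∧ MemLp g p (volume : Measure R3) := by
  by_cases hg : ∃ g, IsWeakDeriv α f g
  · obtain ⟨g, hg⟩ := hg
    exact ⟨g, hg, hg.2.1.aestronglyMeasurable, by rw [hg.eLpNorm_eq]; exact h.lt_top⟩
  · push Not at hg
    exact absurd (by simp [derivNorm, hg]) h

theorem derivNorm_le_sobolevNorm {N : ℕ} {α : Fin 3 → ℕ} (hα : order α ≤ N) (f : R3 → F) :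
    derivNorm α 2 f ≤ sobolevNorm N f := by
  have h1 : derivNorm α 2 f ^ 2 ≤ ∑ m ∈ Finset.range (N + 1),
      ∑ α ∈ Finset.piAntidiag (Finset.univ : Finset (Fin 3)) m, derivNorm α 2 f ^ 2 := by
    calc derivNorm α 2 f ^ 2
        ≤ ∑ β ∈ Finset.piAntidiag (Finset.univ : Finset (Fin 3)) (order α),
          derivNorm β 2 f ^ 2 :=
          Finset.single_le_sum (f := fun β => derivNorm β 2 f ^ 2) (fun _ _ => zero_le)
            (by simp [Finset.mem_piAntidiag, order])
      _ ≤ _ := Finset.single_le_sum (f := fun m => ∑ β ∈ Finset.piAntidiag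
          (Finset.univ : Finset (Fin 3)) m, derivNorm β 2 f ^ 2) (fun _ _ => zero_le)
            (Finset.mem_range.2 (by omega))
  have h2 := ENNReal.rpow_le_rpow h1 (show (0 : ℝ) ≤ 1 / 2 by norm_num)
  calc derivNorm α 2 f = (derivNorm α 2 f ^ 2) ^ (1 / 2 : ℝ) := by
        rw [← ENNReal.rpow_natCast, ← ENNReal.rpow_mul]; norm_num
    _ ≤ _ := h2

end WeakDerivatives

/-- The symbol `(i k)^α` of `∂_x^α`, at `k = 2πξ`. -/
def monoSymbol (α : Fin 3 → ℕ) (ξ : R3) : ℂ := ∏ i, (2 * Real.pi * Complex.I * (ξ i : ℂ)) ^ α i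

theorem continuous_monoSymbol (α : Fin 3 → ℕ) : Continuous (monoSymbol α) := by
  unfold monoSymbol
  fun_prop

/-! ### Weak derivatives on the Fourier side -/

section Symbols

variable {F : Type*} [NormedAddCommGroup F] [InnerProductSpace ℂ F] [CompleteSpace F]

theorem pderiv_contDiff (i : Fin 3) {φ : R3 → ℝ} (h : ContDiff ℝ ∞ φ) :
    ContDiff ℝ ∞ (pderiv i φ) := by
  unfold pderiv
  exact (h.fderiv_right (m := (∞ : WithTop ℕ∞)) (by simp)).clm_apply contDiff_const

theorem pderiv_hasCompactSupport (i : Fin 3) {φ : R3 → ℝ} (h : HasCompactSupport φ) :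
    HasCompactSupport (pderiv i φ) := h.fderiv_apply ℝ _

/-- Passage from `∂^α f` to `∂_i ∂^α f` on the Fourier side. -/
theorem isFT_weakDeriv_step {f g g' h : R3 → F} {α β : Fin 3 → ℕ} (i : Fin 3)
    (hβ : β = α + Pi.single i 1)
    (hm : ∀ φ : R3 → ℝ, multiDeriv β φ = multiDeriv α (pderiv i φ))
    (hg : IsWeakDeriv α f g) (hg' : IsWeakDeriv β f g')
    (h2 : MemLp g 2 (volume : Measure R3)) (h2' : MemLp g' 2 (volume : Measure R3))
    (H : IsFT g (fun ξ => monoSymbol α ξ • h ξ)) :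
    IsFT g' (fun ξ => monoSymbol β ξ • h ξ) := by
  have hord : order β = order α + 1 := by
    subst hβ
    simp [order, Finset.sum_add_distrib]
  have := H.deriv h2 h2' (EuclideanSpace.single i 1) (by
    intro φ k1 k2
    have e1 := hg.2.2 (pderiv i φ) (pderiv_contDiff i k1) (pderiv_hasCompactSupport i k2)
    have e2 := hg'.2.2 φ k1 k2
    rw [hm, e1, hord, pow_succ, mul_smul] at e2
    have hu : ((-1 : ℝ) ^ order α) ≠ 0 := pow_ne_zero _ (by norm_num)
    have e3 := smul_right_injective F hu e2
    simpa [pderiv] using e3)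
  refine this.congr_right (Eventually.of_forall fun ξ => ?_)
  simp only [smul_smul]
  congr 1
  rw [hβ]
  simp only [monoSymbol, Pi.add_apply, pow_add, Finset.prod_mul_distrib]
  rw [mul_comm]
  congr 1
  rw [Finset.prod_eq_single i]
  · simp [EuclideanSpace.inner_single_right]
  · intro j _ hj
    simp [hj]
  · simp

/-- If `f ∈ L²` has weak derivatives in `L²` up to order `N`, their Fourier transforms are
`(ik)^α f̂`. -/
theorem exists_weakDeriv_isFT {f h : R3 → F} {N : ℕ} (hf : MemLp f 2 (volume : Measure R3))
    (H : IsFT f h) (hN : ∀ α, order α ≤ N → derivNorm α 2 f ≠ ⊤) (α : Fin 3 → ℕ)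
    (hα : order α ≤ N) : ∃ g, IsWeakDeriv α f g ∧ MemLp g 2 (volume : Measure R3) ∧
      IsFT g (fun ξ => monoSymbol α ξ • h ξ) := by
  have hfl := hf.locallyIntegrable (by norm_num)
  have base : ∃ g, IsWeakDeriv ![0, 0, 0] f g ∧ MemLp g 2 (volume : Measure R3) ∧
      IsFT g (fun ξ => monoSymbol ![0, 0, 0] ξ • h ξ) := by
    refine ⟨f, ⟨hfl, hfl, ?_⟩, hf, ?_⟩
    · intro φ _ _
      simp [multiDeriv, order, Fin.sum_univ_three]
    · simpa [monoSymbol, Fin.prod_univ_three] using H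
  have step : ∀ (α β : Fin 3 → ℕ) (i : Fin 3), β = α + Pi.single i 1 →
      (∀ φ : R3 → ℝ, multiDeriv β φ = multiDeriv α (pderiv i φ)) → order β ≤ N →
      (∃ g, IsWeakDeriv α f g ∧ MemLp g 2 (volume : Measure R3) ∧
        IsFT g (fun ξ => monoSymbol α ξ • h ξ)) →
      ∃ g, IsWeakDeriv β f g ∧ MemLp g 2 (volume : Measure R3) ∧
        IsFT g (fun ξ => monoSymbol β ξ • h ξ) := by
    rintro α β i hβ hm hord ⟨g, g1, g2, g3⟩
    obtain ⟨g', g1', g2'⟩ := exists_isWeakDeriv (hN β hord)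
    exact ⟨g', g1', g2', isFT_weakDeriv_step i hβ hm g1 g1' g2 g2' g3⟩
  have o3 : ∀ a b c : ℕ, order ![a, b, c] = a + b + c := fun a b c => by
    simp [order, Fin.sum_univ_three]
  have s0 : ∀ a, a ≤ N → ∃ g, IsWeakDeriv ![a, 0, 0] f g ∧ MemLp g 2 (volume : Measure R3) ∧
      IsFT g (fun ξ => monoSymbol ![a, 0, 0] ξ • h ξ) := by
    intro a
    induction a with
    | zero => exact fun _ => base
    | succ a ih =>
      intro ha
      refine step ![a, 0, 0] ![a + 1, 0, 0] 0 ?_ ?_ (by rw [o3]; omega) (ih (by omega))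
      · ext i; fin_cases i <;> simp
      · intro φ; simp [multiDeriv]
  have s1 : ∀ a b, a + b ≤ N → ∃ g, IsWeakDeriv ![a, b, 0] f g ∧
      MemLp g 2 (volume : Measure R3) ∧ IsFT g (fun ξ => monoSymbol ![a, b, 0] ξ • h ξ) := by
    intro a b
    induction b with
    | zero => exact fun h => s0 a (by omega)
    | succ b ih =>
      intro ha
      refine step ![a, b, 0] ![a, b + 1, 0] 1 ?_ ?_ (by rw [o3]; omega) (ih (by omega))
      · ext i; fin_cases i <;> simp
      · intro φ; simp [multiDeriv]
  have s2 : ∀ a b c, a + b + c ≤ N → ∃ g, IsWeakDeriv ![a, b, c] f g ∧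
      MemLp g 2 (volume : Measure R3) ∧ IsFT g (fun ξ => monoSymbol ![a, b, c] ξ • h ξ) := by
    intro a b c
    induction c with
    | zero => exact fun h => s1 a b (by omega)
    | succ c ih =>
      intro ha
      refine step ![a, b, c] ![a, b, c + 1] 2 ?_ ?_ (by rw [o3]; omega) (ih (by omega))
      · ext i; fin_cases i <;> simp
      · intro φ; simp [multiDeriv]
  have hα3 : α = ![α 0, α 1, α 2] := by ext i; fin_cases i <;> rfl
  have := s2 (α 0) (α 1) (α 2) (by rw [← o3, ← hα3]; exact hα)
  rwa [← hα3] at this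

theorem IsFT.eLpNorm_eq {g h : R3 → F} (H : IsFT g h) (hg : MemLp g 2 (volume : Measure R3))
    (hl : LocallyIntegrable h) : eLpNorm h 2 volume = eLpNorm g 2 volume := by
  have h1 := H.unique (isFT_toLp hg) hl
    ((Lp.memLp (𝓕 (hg.toLp g) : Lp F 2 (volume : Measure R3))).locallyIntegrable (by norm_num))
  rw [eLpNorm_congr_ae h1]
  have h2 := Lp.norm_fourier_eq (hg.toLp g)
  rw [Lp.norm_def, Lp.norm_def, ENNReal.toReal_eq_toReal_iff' (Lp.eLpNorm_ne_top _)
    (Lp.eLpNorm_ne_top _), eLpNorm_congr_ae hg.coeFn_toLp] at h2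
  exact h2

theorem freq_pos (ξ : R3) : 0 < freq ξ := by unfold freq bracket; positivity

theorem one_le_freq (ξ : R3) : 1 ≤ freq ξ := by
  unfold freq bracket
  rw [Real.one_le_sqrt]
  nlinarith [sq_nonneg ‖(2 * Real.pi) • ξ‖]

theorem continuous_freq : Continuous freq := by
  unfold freq bracket
  fun_prop

/-- Powers of `⟨k⟩` are dominated by pure powers of the coordinates, so that only pure derivatives
are needed to control a Sobolev weight. -/
theorem freq_pow_le (N : ℕ) (ξ : R3) :
    freq ξ ^ N ≤ 4 ^ N * (1 + ∑ i, |2 * Real.pi * ξ i| ^ N) := by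
  have h1 : freq ξ ≤ 1 + ∑ i, |2 * Real.pi * ξ i| := by
    unfold freq bracket
    rw [Real.sqrt_le_left (by positivity), EuclideanSpace.norm_sq_eq]
    simp only [Fin.sum_univ_three, PiLp.smul_apply, smul_eq_mul, Real.norm_eq_abs]
    nlinarith [abs_nonneg (2 * Real.pi * ξ 0), abs_nonneg (2 * Real.pi * ξ 1),
      abs_nonneg (2 * Real.pi * ξ 2),
      mul_nonneg (abs_nonneg (2 * Real.pi * ξ 0)) (abs_nonneg (2 * Real.pi * ξ 1)),
      mul_nonneg (abs_nonneg (2 * Real.pi * ξ 0)) (abs_nonneg (2 * Real.pi * ξ 2)),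
      mul_nonneg (abs_nonneg (2 * Real.pi * ξ 1)) (abs_nonneg (2 * Real.pi * ξ 2))]
  -- the largest of `1, |k_1|, |k_2|, |k_3|` dominates
  have h2 : ∃ r : ℝ, 0 ≤ r ∧ freq ξ ≤ 4 * r ∧ r ^ N ≤ 1 + ∑ i, |2 * Real.pi * ξ i| ^ N := by
    have hnn : ∀ i, 0 ≤ |2 * Real.pi * ξ i| ^ N := fun i => by positivity
    obtain ⟨j, _, hj⟩ := Finset.exists_max_image Finset.univ (fun i => |2 * Real.pi * ξ i|)
      Finset.univ_nonempty
    have hsum : ∑ i, |2 * Real.pi * ξ i| ≤ 3 * |2 * Real.pi * ξ j| := by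
      calc _ ≤ ∑ _i : Fin 3, |2 * Real.pi * ξ j| := Finset.sum_le_sum hj
        _ = _ := by simp
    by_cases h1' : |2 * Real.pi * ξ j| ≤ 1
    · refine ⟨1, zero_le_one, by linarith, ?_⟩
      rw [one_pow]
      linarith [Finset.sum_nonneg fun i (_ : i ∈ Finset.univ) => hnn i]
    · refine ⟨|2 * Real.pi * ξ j|, abs_nonneg _, by linarith, ?_⟩
      have := Finset.single_le_sum (fun i _ => hnn i) (Finset.mem_univ j)
      linarith
  obtain ⟨r, h0, h3, h4⟩ := h2
  calc freq ξ ^ N ≤ (4 * r) ^ N := pow_le_pow_left₀ (freq_pos ξ).le h3 N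
    _ = 4 ^ N * r ^ N := mul_pow _ _ _
    _ ≤ _ := by gcongr

theorem norm_monoSymbol_single (i : Fin 3) (N : ℕ) (ξ : R3) :
    ‖monoSymbol (Pi.single i N) ξ‖ = |2 * Real.pi * ξ i| ^ N := by
  unfold monoSymbol
  rw [Finset.prod_eq_single i]
  · simp [abs_mul, abs_of_pos Real.pi_pos]
  · intro j _ hj
    simp [hj]
  · simp

theorem order_single (i : Fin 3) (N : ℕ) : order (Pi.single i N) = N := by
  simp [order]

/-- `‖⟨k⟩^N f̂‖_{L²}` is controlled by the `L²` norms of the weak derivatives. -/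
theorem eLpNorm_freq_pow_le {f h : R3 → F} {N : ℕ} {b : ℝ≥0∞} (hb : b ≠ ⊤)
    (hf : MemLp f 2 (volume : Measure R3)) (H : IsFT f h) (hl : LocallyIntegrable h)
    (hN : ∀ α, order α ≤ N → derivNorm α 2 f ≤ b) :
    eLpNorm (fun ξ => freq ξ ^ N • h ξ) 2 volume ≤ ENNReal.ofReal (4 ^ (N + 1)) * b := by
  have hN' : ∀ α, order α ≤ N → derivNorm α 2 f ≠ ⊤ := fun α hα => ne_top_of_le_ne_top hb (hN α hα)
  have hmono : ∀ α, order α ≤ N → eLpNorm (fun ξ => monoSymbol α ξ • h ξ) 2 volume ≤ b := by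
    intro α hα
    obtain ⟨g, g1, g2, g3⟩ := exists_weakDeriv_isFT hf H hN' α hα
    rw [g3.eLpNorm_eq g2 ?_, g1.eLpNorm_eq]
    · exact hN α hα
    · exact hl.continuous_smul (continuous_monoSymbol α)
  have hm := hl.aestronglyMeasurable
  have hms : ∀ α, AEStronglyMeasurable (fun ξ => ‖monoSymbol α ξ • h ξ‖) volume := fun α =>
    ((continuous_monoSymbol α).aestronglyMeasurable.smul hm).norm
  calc eLpNorm (fun ξ => freq ξ ^ N • h ξ) 2 volume
      ≤ eLpNorm (fun ξ => (4 : ℝ) ^ N • (‖monoSymbol 0 ξ • h ξ‖ +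
          ∑ i, ‖monoSymbol (Pi.single i N) ξ • h ξ‖)) 2 volume := by
        apply eLpNorm_mono_real
        intro ξ
        have h1 := freq_pow_le N ξ
        simp only [norm_smul, norm_monoSymbol_single, smul_eq_mul, norm_pow,
          Real.norm_of_nonneg (freq_pos ξ).le, ← Finset.sum_mul]
        have h0 : ‖monoSymbol 0 ξ‖ = 1 := by simp [monoSymbol]
        rw [h0, one_mul]
        calc freq ξ ^ N * ‖h ξ‖ ≤ 4 ^ N * (1 + ∑ i, |2 * Real.pi * ξ i| ^ N) * ‖h ξ‖ := by gcongr
          _ = _ := by ring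
    _ = ENNReal.ofReal (4 ^ N) * eLpNorm (fun ξ => ‖monoSymbol 0 ξ • h ξ‖ +
          ∑ i, ‖monoSymbol (Pi.single i N) ξ • h ξ‖) 2 volume := by
        rw [show (fun ξ => (4 : ℝ) ^ N • (‖monoSymbol 0 ξ • h ξ‖ +
          ∑ i, ‖monoSymbol (Pi.single i N) ξ • h ξ‖)) = (4 : ℝ) ^ N • (fun ξ =>
          ‖monoSymbol 0 ξ • h ξ‖ + ∑ i, ‖monoSymbol (Pi.single i N) ξ • h ξ‖) from rfl,
          eLpNorm_const_smul, Real.enorm_eq_ofReal (by positivity)]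
    _ ≤ ENNReal.ofReal (4 ^ N) * (b + ∑ _i : Fin 3, b) := by
        gcongr
        refine (eLpNorm_add_le (hms 0) (Finset.aestronglyMeasurable_fun_sum _ fun i _ => hms _)
          (by norm_num)).trans ?_
        gcongr
        · rw [eLpNorm_norm]
          exact hmono 0 (by simp [order])
        · rw [show (fun ξ => ∑ i, ‖monoSymbol (Pi.single i N) ξ • h ξ‖) =
            ∑ i, fun ξ => ‖monoSymbol (Pi.single i N) ξ • h ξ‖ by ext; simp]
          refine (eLpNorm_sum_le (fun i _ => hms _) (by norm_num)).trans ?_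
          apply Finset.sum_le_sum
          intro i _
          rw [eLpNorm_norm]
          exact hmono _ (order_single i N).le
    _ = ENNReal.ofReal (4 ^ (N + 1)) * b := by
        rw [pow_succ, ENNReal.ofReal_mul (by positivity), mul_assoc]
        congr 1
        simp
        ring

end Symbols

/-! ### Bounds on bounded functions from Gaussian symbols -/

section GaussianKernels

theorem one_add_pow_mul_exp_neg_sq_le (K : ℕ) {t : ℝ} (ht : 0 ≤ t) :
    (1 + t) ^ K * Real.exp (-t ^ 2) ≤ K.factorial * Real.exp 2 := by
  have h1 := Real.pow_div_factorial_le_exp (1 + t) (by linarith) K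
  rw [div_le_iff₀ (by positivity)] at h1
  calc (1 + t) ^ K * Real.exp (-t ^ 2) ≤ (Real.exp (1 + t) * K.factorial) * Real.exp (-t ^ 2) := by
        gcongr
    _ = K.factorial * Real.exp (1 + t + -t ^ 2) := by rw [Real.exp_add (1 + t)]; ring
    _ ≤ _ := by
        gcongr
        nlinarith [sq_nonneg (t - 1)]

/-- The Gaussian `e^{-|ξ|²}`, as a real Schwartz function. -/
def realGaussian : 𝓢(R3, ℝ) where
  toFun ξ := Real.exp (-‖ξ‖ ^ 2)
  smooth' := Real.contDiff_exp.comp (contDiff_norm_sq ℝ).neg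
  decay' j n := by
    have ht : Function.HasTemperateGrowth (fun x : R3 => -‖x‖ ^ 2) :=
      (Function.hasTemperateGrowth_norm_sq R3).neg
    obtain ⟨k, C, hC, hk⟩ := ht.norm_iteratedFDeriv_le_uniform n
    refine ⟨n.factorial * (1 + C) ^ n * ((j + k * n).factorial * Real.exp 2), fun x => ?_⟩
    have h1 := norm_iteratedFDeriv_comp_le (𝕜 := ℝ) (n := n) (N := ∞) (g := Real.exp)
      (f := fun x : R3 => -‖x‖ ^ 2) Real.contDiff_exp (contDiff_norm_sq ℝ).neg
      (by exact_mod_cast le_top) x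
      (C := Real.exp (-‖x‖ ^ 2)) (D := (1 + C) * (1 + ‖x‖) ^ k)
      (fun i _ => by
        rw [norm_iteratedFDeriv_eq_norm_iteratedDeriv, iteratedDeriv_eq_iterate,
          Real.iter_deriv_exp, Real.norm_of_nonneg (Real.exp_pos _).le])
      (fun i h1 h2 => by
        refine (hk i h2 x).trans ?_
        have a1 : 1 ≤ (1 + C) * (1 + ‖x‖) ^ k :=
          one_le_mul_of_one_le_of_one_le (by linarith)
            (one_le_pow₀ (by linarith [norm_nonneg x]))
        calc C * (1 + ‖x‖) ^ k ≤ ((1 + C) * (1 + ‖x‖) ^ k) ^ 1 := by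
              rw [pow_one]; gcongr; linarith
          _ ≤ _ := pow_le_pow_right₀ a1 h1)
    calc ‖x‖ ^ j * ‖iteratedFDeriv ℝ n (fun ξ : R3 => Real.exp (-‖ξ‖ ^ 2)) x‖
        ≤ (1 + ‖x‖) ^ j * (n.factorial * Real.exp (-‖x‖ ^ 2) * ((1 + C) * (1 + ‖x‖) ^ k) ^ n) := by
          gcongr
          · linarith
          · exact h1
      _ = n.factorial * (1 + C) ^ n * ((1 + ‖x‖) ^ (j + k * n) * Real.exp (-‖x‖ ^ 2)) := by
          rw [mul_pow, ← pow_mul, pow_add]; ring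
      _ ≤ _ := mul_le_mul_of_nonneg_left
          (one_add_pow_mul_exp_neg_sq_le _ (norm_nonneg x)) (by positivity)

/-- The Gaussian `e^{-|ξ|²}`, as a complex Schwartz function. -/
def gaussian : 𝓢(R3, ℂ) := realGaussian.postcompCLM Complex.ofRealCLM

theorem gaussian_apply (ξ : R3) : gaussian ξ = (Real.exp (-‖ξ‖ ^ 2) : ℂ) := rfl

/-- The function `ξ_i e^{-|ξ|²}`. -/
def gaussianMoment (i : Fin 3) : 𝓢(R3, ℂ) :=
  SchwartzMap.smulLeftCLM ℂ (fun ξ : R3 => ((ξ i : ℝ) : ℂ)) gaussian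

theorem gaussianMoment_apply (i : Fin 3) (ξ : R3) :
    gaussianMoment i ξ = (ξ i : ℂ) * (Real.exp (-‖ξ‖ ^ 2) : ℂ) := by
  have : Function.HasTemperateGrowth (fun ξ : R3 => ((ξ i : ℝ) : ℂ)) :=
    (Complex.ofRealCLM.comp (EuclideanSpace.proj (𝕜 := ℝ) i)).hasTemperateGrowth
  rw [gaussianMoment, SchwartzMap.smulLeftCLM_apply_apply this, gaussian_apply, smul_eq_mul]

/-- The `L¹` norm of the kernel with symbol `G`. -/
def kernelMass (G : 𝓢(R3, ℂ)) : ℝ := ∫ y, ‖(𝓕 G : 𝓢(R3, ℂ)) y‖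

theorem kernelMass_nonneg (G : 𝓢(R3, ℂ)) : 0 ≤ kernelMass G :=
  integral_nonneg fun _ => norm_nonneg _

/-- Multiplication of a symbol by a character translates its kernel. -/
theorem exists_modulated (G : 𝓢(R3, ℂ)) (x : R3) : ∃ ψ : 𝓢(R3, ℂ),
    (∀ ξ, ψ ξ = Real.fourierChar (inner ℝ ξ x) • G ξ) ∧ kernelMass ψ = kernelMass G := by
  refine ⟨𝓕⁻ (SchwartzMap.compSubConstCLM ℂ x (𝓕 G)), fun ξ => ?_, ?_⟩
  · have h1 : (𝓕⁻ (𝓕 G)) ξ = G ξ := by rw [FourierTransform.fourierInv_fourier_eq]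
    rw [← h1, SchwartzMap.fourierInv_coe, SchwartzMap.fourierInv_coe, Real.fourierInv_eq,
      Real.fourierInv_eq, ← integral_add_right_eq_self _ x]
    simp only [SchwartzMap.compSubConstCLM_apply, add_sub_cancel_right, inner_add_left,
      AddChar.map_add_eq_mul, mul_smul, real_inner_comm ξ x]
    rw [Circle.smul_def, ← integral_smul]
    congr 1
    ext y
    rw [← Circle.smul_def, smul_comm]
  · unfold kernelMass
    rw [FourierTransform.fourier_fourierInv_eq]
    simp only [SchwartzMap.compSubConstCLM_apply]
    exact integral_sub_right_eq_self (fun y => ‖(𝓕 G : 𝓢(R3, ℂ)) y‖) x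

/-- Translation of a symbol multiplies its kernel by a character. -/
theorem exists_translated (G : 𝓢(R3, ℂ)) (c : R3) : ∃ ψ : 𝓢(R3, ℂ),
    (∀ ξ, ψ ξ = G (ξ + c)) ∧ kernelMass ψ = kernelMass G := by
  refine ⟨SchwartzMap.compSubConstCLM ℂ (-c) G, fun ξ => by simp, ?_⟩
  unfold kernelMass
  congr 1
  ext y
  have h := congrFun (VectorFourier.fourierIntegral_comp_add_right Real.fourierChar
    (volume : Measure R3) (innerₗ R3) (G : R3 → ℂ) c) y
  have e1 : (SchwartzMap.compSubConstCLM ℂ (-c) G : R3 → ℂ) = G ∘ fun v => v + c := by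
    ext v
    simp
  rw [SchwartzMap.fourier_coe, SchwartzMap.fourier_coe, e1]
  refine (congrArg norm h).trans ?_
  rw [Circle.norm_smul]
  rfl

/-- Dilation of a symbol rescales its kernel with the same `L¹` norm. -/
theorem exists_dilated (G : 𝓢(R3, ℂ)) {ρ : ℝ} (hρ : 0 < ρ) : ∃ ψ : 𝓢(R3, ℂ),
    (∀ ξ, ψ ξ = G (ρ • ξ)) ∧ kernelMass ψ = kernelMass G := by
  let L : R3 ≃L[ℝ] R3 := ContinuousLinearEquiv.smulLeft (Units.mk0 ρ hρ.ne')
  refine ⟨SchwartzMap.compCLMOfContinuousLinearEquiv ℂ L G, fun ξ => rfl, ?_⟩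
  have h3 : Module.finrank ℝ R3 = 3 := by simp
  have h1 : ∀ y, (𝓕 (SchwartzMap.compCLMOfContinuousLinearEquiv ℂ L G) : 𝓢(R3, ℂ)) y =
      (ρ ^ 3)⁻¹ • (𝓕 G : 𝓢(R3, ℂ)) (ρ⁻¹ • y) := by
    intro y
    rw [SchwartzMap.fourier_coe, SchwartzMap.fourier_coe, Real.fourier_eq, Real.fourier_eq]
    have := Measure.integral_comp_smul (volume : Measure R3)
      (fun v => Real.fourierChar (-inner ℝ v (ρ⁻¹ • y)) • G v) ρ
    rw [h3, abs_of_pos (by positivity)] at this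
    rw [← this]
    congr 1
    ext v
    rw [inner_smul_left, inner_smul_right]
    simp only [conj_trivial]
    rw [mul_inv_cancel_left₀ hρ.ne']
    rfl
  unfold kernelMass
  simp_rw [h1, norm_smul]
  rw [integral_const_mul, Measure.integral_comp_smul (volume : Measure R3)
      (fun v => ‖(𝓕 G : 𝓢(R3, ℂ)) v‖) ρ⁻¹, h3, Real.norm_of_nonneg (by positivity), smul_eq_mul,
      abs_of_pos (by positivity)]
  field_simp

variable {F : Type*} [NormedAddCommGroup F] [InnerProductSpace ℂ F]

/-- A symbol with integrable kernel maps bounded functions to bounded functions. -/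
theorem IsFT.norm_fourierInv_schwartz_le {g h : R3 → F} (H : IsFT g h) {B : ℝ}
    (hB : ∀ᵐ x ∂(volume : Measure R3), ‖g x‖ ≤ B) (G : 𝓢(R3, ℂ)) (x : R3) :
    ‖𝓕⁻ (fun ξ => G ξ • h ξ) x‖ ≤ kernelMass G * B := by
  obtain ⟨ψ, h1, h2⟩ := exists_modulated G x
  rw [Real.fourierInv_eq]
  have e1 : ∀ ξ, Real.fourierChar (inner ℝ ξ x) • (G ξ • h ξ) = ψ ξ • h ξ := fun ξ => by
    rw [h1, smul_assoc]
  simp_rw [e1]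
  rw [← H ψ, ← h2]
  unfold kernelMass
  rw [← integral_mul_const]
  refine norm_integral_le_of_norm_le ((𝓕 ψ : 𝓢(R3, ℂ)).integrable.norm.mul_const _) ?_
  filter_upwards [hB] with y hy
  rw [norm_smul]
  gcongr

/-- Uniform bound for the dilated and translated symbols `G(ρ ξ + c)`. -/
theorem IsFT.norm_fourierInv_affine_le {g h : R3 → F} (H : IsFT g h) {B : ℝ}
    (hB : ∀ᵐ x ∂(volume : Measure R3), ‖g x‖ ≤ B) (G : 𝓢(R3, ℂ)) {ρ : ℝ} (hρ : 0 < ρ) (c x : R3) :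
    ‖𝓕⁻ (fun ξ => G (ρ • ξ + c) • h ξ) x‖ ≤ kernelMass G * B := by
  obtain ⟨ψ₁, h1, k1⟩ := exists_translated G c
  obtain ⟨ψ₂, h2, k2⟩ := exists_dilated ψ₁ hρ
  have := H.norm_fourierInv_schwartz_le hB ψ₂ x
  rw [k2, k1] at this
  simpa only [h2, h1] using this

/-- Minkowski's inequality for a superposition of symbols. -/
theorem norm_fourierInv_superposition_le [CompleteSpace F] {Ω : Type*} [MeasurableSpace Ω]
    {ν : Measure Ω} [SFinite ν] {h : R3 → F} {m : Ω → R3 → ℂ} {C : Ω → ℝ}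
    (hint : Integrable (fun z : Ω × R3 => m z.1 z.2 • h z.2) (ν.prod volume))
    (hC : Integrable C ν) (x : R3)
    (hm : ∀ᵐ o ∂ν, ‖𝓕⁻ (fun ξ => m o ξ • h ξ) x‖ ≤ C o) :
    ‖𝓕⁻ (fun ξ => (∫ o, m o ξ ∂ν) • h ξ) x‖ ≤ ∫ o, C o ∂ν := by
  have e1 : 𝓕⁻ (fun ξ => (∫ o, m o ξ ∂ν) • h ξ) x =
      ∫ o, 𝓕⁻ (fun ξ => m o ξ • h ξ) x ∂ν := by
    simp_rw [Real.fourierInv_eq]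
    rw [integral_integral_swap]
    · congr 1
      ext ξ
      simp_rw [Circle.smul_def]
      rw [integral_smul, integral_smul_const]
    · refine hint.norm.mono' ?_ (Eventually.of_forall fun z => ?_)
      · have h1 : Continuous fun ξ : R3 => (Real.fourierChar (inner ℝ ξ x) : ℂ) := by
          have := Real.continuous_fourierChar
          fun_prop
        have h2 : AEStronglyMeasurable (fun z : Ω × R3 =>
            (Real.fourierChar (inner ℝ z.2 x) : ℂ)) (ν.prod volume) :=
          (h1.measurable.comp measurable_snd).aestronglyMeasurable
        exact h2.smul hint.1
      · exact (Circle.norm_smul _ _).le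
  rw [e1]
  exact norm_integral_le_of_norm_le hC hm

/-- Superposition of symbols, with the integrability stated through a pointwise bound. -/
theorem norm_fourierInv_superposition_le' [CompleteSpace F] {Ω : Type*} [MeasurableSpace Ω]
    {ν : Measure Ω} [SFinite ν] {h : R3 → F} {m : Ω → R3 → ℂ} {C : Ω → ℝ} {b : R3 → ℝ}
    (hl : AEStronglyMeasurable h volume)
    (hmeas : Measurable (fun z : Ω × R3 => m z.1 z.2))
    (hmi : ∀ ξ, Integrable (fun o => m o ξ) ν)
    (hb : ∀ ξ, ∫ o, ‖m o ξ‖ ∂ν ≤ b ξ) (hbi : Integrable (fun ξ => b ξ * ‖h ξ‖))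
    (hC : Integrable C ν) (x : R3)
    (hm : ∀ᵐ o ∂ν, ‖𝓕⁻ (fun ξ => m o ξ • h ξ) x‖ ≤ C o) :
    ‖𝓕⁻ (fun ξ => (∫ o, m o ξ ∂ν) • h ξ) x‖ ≤ ∫ o, C o ∂ν := by
  refine norm_fourierInv_superposition_le ?_ hC x hm
  have hms : AEStronglyMeasurable (fun z : Ω × R3 => m z.1 z.2 • h z.2) (ν.prod volume) :=
    hmeas.aestronglyMeasurable.smul hl.comp_snd
  rw [integrable_prod_iff' hms]
  refine ⟨Eventually.of_forall fun ξ => (hmi ξ).smul_const (h ξ), ?_⟩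
  refine hbi.mono' hms.norm.prod_swap.integral_prod_right' (Eventually.of_forall fun ξ => ?_)
  simp only [norm_smul]
  rw [integral_mul_const, Real.norm_of_nonneg (by positivity)]
  gcongr
  exact hb ξ

end GaussianKernels

/-! ### Resolvent kernels by subordination to Gaussians -/

section ResolventKernels

theorem kernelMass_smul_add_le (a b : ℝ) (G H : 𝓢(R3, ℂ)) :
    kernelMass ((a : ℂ) • G + (b : ℂ) • H) ≤ |a| * kernelMass G + |b| * kernelMass H := by
  unfold kernelMass
  rw [← integral_const_mul, ← integral_const_mul, ← integral_add]
  · apply integral_mono (SchwartzMap.integrable _).norm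
    · exact ((SchwartzMap.integrable _).norm.const_mul _).add
        ((SchwartzMap.integrable _).norm.const_mul _)
    intro y
    simp only [FourierTransform.fourier_add, FourierTransform.fourier_smul, add_apply, smul_apply]
    refine (norm_add_le _ _).trans ?_
    simp
  · exact (SchwartzMap.integrable _).norm.const_mul _
  · exact (SchwartzMap.integrable _).norm.const_mul _

/-- The phase `k · w` at `k = 2πξ`. -/
def phase (w ξ : R3) : ℝ := inner ℝ w ((2 * Real.pi) • ξ)

theorem norm_le_freq (ξ : R3) : ‖(2 * Real.pi) • ξ‖ ≤ freq ξ := by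
  unfold freq bracket
  apply Real.le_sqrt_of_sq_le
  linarith

theorem freq_sq (ξ : R3) : freq ξ ^ 2 = 1 + ‖(2 * Real.pi) • ξ‖ ^ 2 := by
  unfold freq bracket
  rw [Real.sq_sqrt (by positivity)]

theorem abs_phase_le {w0 : ℝ} {w : R3} (hw : ‖w‖ ≤ w0) (ξ : R3) :
    |phase w ξ| ≤ w0 * freq ξ := by
  have h0 : 0 ≤ w0 := (norm_nonneg w).trans hw
  calc |phase w ξ| ≤ ‖w‖ * ‖(2 * Real.pi) • ξ‖ := abs_real_inner_le_norm _ _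
    _ ≤ w0 * freq ξ := by gcongr; exact norm_le_freq ξ

theorem abs_coord_le_freq (i : Fin 3) (ξ : R3) : |2 * Real.pi * ξ i| ≤ freq ξ := by
  have := PiLp.norm_apply_le ((2 * Real.pi) • ξ) i
  simp only [PiLp.smul_apply, smul_eq_mul, Real.norm_eq_abs] at this
  exact this.trans (norm_le_freq ξ)

theorem continuous_phase (w : R3) : Continuous (phase w) := by
  unfold phase
  fun_prop

/-- The quadratic form `⟨k⟩² + 2 y k·w + y²`. -/
def quadForm (w : R3) (y : ℝ) (ξ : R3) : ℝ := freq ξ ^ 2 + 2 * y * phase w ξ + y ^ 2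

theorem quadForm_eq (w : R3) (y : ℝ) (ξ : R3) :
    quadForm w y ξ = 1 + y ^ 2 * (1 - ‖w‖ ^ 2) + ‖(2 * Real.pi) • ξ + y • w‖ ^ 2 := by
  rw [quadForm, freq_sq, norm_add_sq_real, norm_smul, norm_smul, real_inner_smul_right, phase,
    real_inner_comm w, mul_pow, mul_pow, Real.norm_eq_abs, Real.norm_eq_abs, sq_abs, sq_abs]
  ring

theorem quadForm_ge {w0 : ℝ} (hw1 : w0 < 1) {w : R3} (hw : ‖w‖ ≤ w0) {y : ℝ} (hy : 0 ≤ y)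
    (ξ : R3) : (1 - w0) * freq ξ ^ 2 ≤ quadForm w y ξ := by
  have h0 : 0 ≤ w0 := (norm_nonneg w).trans hw
  have h1 := (abs_le.1 (abs_phase_le hw ξ)).1
  have h2 := freq_pos ξ
  unfold quadForm
  have h3 : -(w0 * (freq ξ ^ 2 + y ^ 2)) ≤ 2 * y * phase w ξ := by
    have : 2 * y * -(w0 * freq ξ) ≤ 2 * y * phase w ξ := by gcongr
    nlinarith [mul_nonneg h0 (sq_nonneg (freq ξ - y))]
  nlinarith [sq_nonneg y]

theorem quadForm_pos {w0 : ℝ} (hw1 : w0 < 1) {w : R3} (hw : ‖w‖ ≤ w0) {y : ℝ} (hy : 0 ≤ y)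
    (ξ : R3) : 0 < quadForm w y ξ := by
  refine lt_of_lt_of_le ?_ (quadForm_ge hw1 hw hy ξ)
  have := freq_pos ξ
  have : 0 < 1 - w0 := by linarith
  positivity

/-- The moment by which `b^{-3/2}` is a superposition of Gaussians. -/
theorem integral_sq_mul_exp {b : ℝ} (hb : 0 < b) :
    ∫ ρ in Ioi (0 : ℝ), ρ ^ 2 * Real.exp (-(ρ ^ 2 * b)) = Real.sqrt Real.pi / 4 * b ^ (-(3 / 2) : ℝ) := by
  have h := integral_rpow_mul_exp_neg_mul_rpow (p := 2) (q := 2) (b := b) (by norm_num)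
    (by norm_num) hb
  have h2 : Real.Gamma ((2 + 1) / 2) = Real.sqrt Real.pi / 2 := by
    rw [show ((2 : ℝ) + 1) / 2 = 1 / 2 + 1 by norm_num, Real.Gamma_add_one (by norm_num),
      Real.Gamma_one_half_eq]
    ring
  rw [h2, show (-(2 + 1) / 2 : ℝ) = -(3 / 2) by norm_num] at h
  calc _ = ∫ x in Ioi (0 : ℝ), x ^ (2 : ℝ) * Real.exp (-b * x ^ (2 : ℝ)) := by
        congr 1; ext x
        rw [Real.rpow_two]; congr 2; ring
    _ = _ := by rw [h]; ring

theorem integral_mul_exp {b : ℝ} (hb : 0 < b) :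
    ∫ ρ in Ioi (0 : ℝ), ρ * Real.exp (-(ρ ^ 2 * b)) = (2 * b)⁻¹ := by
  have h := integral_rpow_mul_exp_neg_mul_rpow (p := 2) (q := 1) (b := b) (by norm_num)
    (by norm_num) hb
  rw [show ((1 : ℝ) + 1) / 2 = 1 by norm_num, Real.Gamma_one,
    show (-(1 + 1) / 2 : ℝ) = -1 by norm_num, Real.rpow_neg_one] at h
  calc _ = ∫ x in Ioi (0 : ℝ), x ^ (1 : ℝ) * Real.exp (-b * x ^ (2 : ℝ)) := by
        congr 1; ext x
        rw [Real.rpow_two, Real.rpow_one]; congr 2; ring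
    _ = _ := by rw [h, mul_inv]; ring

theorem integrableOn_sq_mul_exp {b : ℝ} (hb : 0 < b) :
    IntegrableOn (fun ρ : ℝ => ρ ^ 2 * Real.exp (-(ρ ^ 2 * b))) (Ioi 0) := by
  have h := integrableOn_rpow_mul_exp_neg_mul_rpow (p := 2) (s := 2) (b := b) (by norm_num)
    (by norm_num) hb
  refine h.congr_fun (fun x _ => ?_) measurableSet_Ioi
  simp only [Real.rpow_two]
  congr 2; ring

theorem integrableOn_mul_exp {b : ℝ} (hb : 0 < b) :
    IntegrableOn (fun ρ : ℝ => ρ * Real.exp (-(ρ ^ 2 * b))) (Ioi 0) := by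
  have h := integrableOn_rpow_mul_exp_neg_mul_rpow (p := 2) (s := 1) (b := b) (by norm_num)
    (by norm_num) hb
  refine h.congr_fun (fun x _ => ?_) measurableSet_Ioi
  simp only [Real.rpow_two, Real.rpow_one]
  congr 2; ring

/-- The subordination `∫_0^∞ (⟨k⟩² + 2 y p + y²)^{-3/2} dy = 1 / (⟨k⟩ (⟨k⟩ + p))`. -/
theorem integral_quadForm {a p : ℝ} (ha : 0 < a) (hp : |p| < a) :
    IntegrableOn (fun y : ℝ => (a ^ 2 + 2 * y * p + y ^ 2) ^ (-(3 / 2) : ℝ)) (Ioi 0) ∧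
    ∫ y in Ioi (0 : ℝ), (a ^ 2 + 2 * y * p + y ^ 2) ^ (-(3 / 2) : ℝ) = (a * (a + p))⁻¹ := by
  have hp' := abs_lt.1 hp
  have hD : 0 < a ^ 2 - p ^ 2 := by nlinarith
  have hq : ∀ y : ℝ, 0 < a ^ 2 + 2 * y * p + y ^ 2 := fun y => by
    nlinarith [sq_nonneg (y + p)]
  -- an explicit primitive, with limit `(a² - p²)⁻¹` at infinity
  let f : ℝ → ℝ := fun y => (y + p) / ((a ^ 2 - p ^ 2) * Real.sqrt (a ^ 2 + 2 * y * p + y ^ 2))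
  have hderiv : ∀ y : ℝ, HasDerivAt f ((a ^ 2 + 2 * y * p + y ^ 2) ^ (-(3 / 2) : ℝ)) y := by
    intro y
    have h1 : HasDerivAt (fun y : ℝ => a ^ 2 + 2 * y * p + y ^ 2) (2 * p + 2 * y) y := by
      have e1 : HasDerivAt (fun y : ℝ => 2 * y * p) (2 * p) y := by
        simpa using ((hasDerivAt_id y).const_mul 2).mul_const p
      have e2 : HasDerivAt (fun y : ℝ => y ^ 2) (2 * y) y := by
        simpa using hasDerivAt_pow 2 y
      exact (e1.const_add (a ^ 2)).add e2
    have h2 := h1.sqrt (hq y).ne'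
    have hs : 0 < Real.sqrt (a ^ 2 + 2 * y * p + y ^ 2) := Real.sqrt_pos.2 (hq y)
    have h3 := ((hasDerivAt_id y).add_const p).div (h2.const_mul (a ^ 2 - p ^ 2))
      (by positivity)
    refine HasDerivAt.congr_deriv (f := f) h3 ?_
    have hss := Real.sq_sqrt (hq y).le
    have hr : (a ^ 2 + 2 * y * p + y ^ 2) ^ (-(3 / 2) : ℝ) =
        (Real.sqrt (a ^ 2 + 2 * y * p + y ^ 2) ^ 3)⁻¹ := by
      rw [Real.rpow_neg (hq y).le, Real.sqrt_eq_rpow, ← Real.rpow_mul_natCast (hq y).le]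
      norm_num
    rw [hr]
    set r := Real.sqrt (a ^ 2 + 2 * y * p + y ^ 2)
    simp only [id]
    field_simp
    rw [hss]
    ring
  have hlim : Tendsto f atTop (𝓝 ((a ^ 2 - p ^ 2)⁻¹)) := by
    have h1 : Tendsto (fun y : ℝ => p * y⁻¹) atTop (𝓝 0) := by
      simpa using tendsto_inv_atTop_zero.const_mul p
    have h2 : Tendsto (fun y : ℝ => y⁻¹) atTop (𝓝 (0 : ℝ)) := tendsto_inv_atTop_zero
    have h3 : Tendsto (fun y : ℝ => (1 + p * y⁻¹) /
        ((a ^ 2 - p ^ 2) * Real.sqrt (a ^ 2 * (y⁻¹) ^ 2 + 2 * (p * y⁻¹) + 1))) atTop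
        (𝓝 ((1 + 0) / ((a ^ 2 - p ^ 2) * Real.sqrt (a ^ 2 * 0 ^ 2 + 2 * 0 + 1)))) := by
      apply Tendsto.div (h1.const_add 1)
      · exact (((((h2.pow 2).const_mul _).add (h1.const_mul 2)).add_const 1).sqrt).const_mul _
      · simp [hD.ne']
    simp only [add_zero, ne_eq, OfNat.ofNat_ne_zero, not_false_eq_true, zero_pow, mul_zero,
      zero_add, Real.sqrt_one, mul_one, one_div] at h3
    refine h3.congr' ?_
    filter_upwards [eventually_gt_atTop 0] with y hy
    have e1 : a ^ 2 * (y⁻¹) ^ 2 + 2 * (p * y⁻¹) + 1 = (a ^ 2 + 2 * y * p + y ^ 2) / y ^ 2 := by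
      field_simp
    rw [e1, Real.sqrt_div (hq y).le, Real.sqrt_sq hy.le]
    simp only [f]
    field_simp
  have hint : IntegrableOn (fun y : ℝ => (a ^ 2 + 2 * y * p + y ^ 2) ^ (-(3 / 2) : ℝ)) (Ioi 0) :=
    integrableOn_Ioi_deriv_of_nonneg' (fun y _ => hderiv y)
      (fun y _ => (Real.rpow_pos_of_pos (hq y) _).le) hlim
  refine ⟨hint, ?_⟩
  rw [integral_Ioi_of_hasDerivAt_of_tendsto' (fun y _ => hderiv y) hint hlim]
  simp only [f, zero_add, mul_zero, zero_mul, add_zero]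
  rw [show a ^ 2 + 0 ^ 2 = a ^ 2 by ring, Real.sqrt_sq ha.le]
  have h1 : a + p ≠ 0 := by linarith
  have h2 : a - p ≠ 0 := by linarith
  rw [show a ^ 2 - p ^ 2 = (a - p) * (a + p) by ring]
  field_simp

variable {F : Type*} [NormedAddCommGroup F] [InnerProductSpace ℂ F] [CompleteSpace F]

/-- The operator `⟨D⟩⁻¹` is bounded on bounded functions. -/
theorem norm_fourierInv_inv_freq_le {g h : R3 → F} (H : IsFT g h) {B : ℝ}
    (hB : ∀ᵐ x ∂(volume : Measure R3), ‖g x‖ ≤ B) (hl : AEStronglyMeasurable h volume)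
    (hi : Integrable (fun ξ => (freq ξ)⁻¹ * ‖h ξ‖)) (x : R3) :
    ‖𝓕⁻ (fun ξ => (((freq ξ)⁻¹ : ℝ) : ℂ) • h ξ) x‖ ≤ kernelMass gaussian * B := by
  -- `1 / ⟨k⟩` is a superposition of the Gaussians `e^{-ρ²⟨k⟩²}`, `ρ > 0`
  have hsub : ∀ ξ : R3, ∫ ρ in Ioi (0 : ℝ), 2 / Real.sqrt Real.pi *
      Real.exp (-freq ξ ^ 2 * ρ ^ 2) = (freq ξ)⁻¹ := fun ξ => by
    have hf := freq_pos ξ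
    rw [integral_const_mul, integral_gaussian_Ioi, Real.sqrt_div Real.pi_pos.le,
      Real.sqrt_sq hf.le]
    have : 0 < Real.sqrt Real.pi := Real.sqrt_pos.2 Real.pi_pos
    field_simp
  have hsi : ∀ ξ : R3, IntegrableOn (fun ρ : ℝ => 2 / Real.sqrt Real.pi *
      Real.exp (-freq ξ ^ 2 * ρ ^ 2)) (Ioi 0) := fun ξ =>
    ((integrable_exp_neg_mul_sq (by have := freq_pos ξ; positivity)).const_mul _).integrableOn
  have h1i : IntegrableOn (fun ρ : ℝ => 2 / Real.sqrt Real.pi *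
      Real.exp (-1 * ρ ^ 2)) (Ioi 0) :=
    ((integrable_exp_neg_mul_sq one_pos).const_mul _).integrableOn
  have hm := norm_fourierInv_superposition_le' (ν := volume.restrict (Ioi (0 : ℝ)))
    (h := h) (m := fun ρ ξ => ((2 / Real.sqrt Real.pi * Real.exp (-freq ξ ^ 2 * ρ ^ 2) : ℝ) : ℂ))
    (C := fun ρ => 2 / Real.sqrt Real.pi * Real.exp (-1 * ρ ^ 2) * (kernelMass gaussian * B))
    (b := fun ξ => (freq ξ)⁻¹) hl
    (by
      have := continuous_freq
      exact Continuous.measurable (by fun_prop))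
    (fun ξ => (hsi ξ).ofReal) (fun ξ => by
      rw [← hsub]
      refine le_of_eq (integral_congr_ae (Eventually.of_forall fun ρ => ?_))
      simp only [Complex.norm_real]
      exact Real.norm_of_nonneg (by positivity)) hi
    (h1i.mul_const _) x ?_
  · have e2 : ∫ ρ in Ioi (0 : ℝ), 2 / Real.sqrt Real.pi * Real.exp (-1 * ρ ^ 2) *
        (kernelMass gaussian * B) = kernelMass gaussian * B := by
      rw [integral_mul_const, integral_const_mul, integral_gaussian_Ioi, div_one]
      have : 0 < Real.sqrt Real.pi := Real.sqrt_pos.2 Real.pi_pos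
      field_simp
    rw [e2] at hm
    refine le_trans (le_of_eq ?_) hm
    refine congrArg (fun f : R3 → F => ‖𝓕⁻ f x‖) (funext fun ξ => ?_)
    rw [← hsub, integral_complex_ofReal]
  · refine (ae_restrict_iff' measurableSet_Ioi).2 (Eventually.of_forall fun ρ hρ => ?_)
    have hρ' : (0 : ℝ) < 2 * Real.pi * ρ := by
      have : (0 : ℝ) < ρ := hρ
      positivity
    have key := H.norm_fourierInv_affine_le hB (((2 / Real.sqrt Real.pi *
      Real.exp (-1 * ρ ^ 2) : ℝ) : ℂ) • gaussian) hρ' 0 x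
    have e3 : kernelMass (((2 / Real.sqrt Real.pi * Real.exp (-1 * ρ ^ 2) : ℝ) : ℂ) • gaussian) ≤
        2 / Real.sqrt Real.pi * Real.exp (-1 * ρ ^ 2) * kernelMass gaussian := by
      have := kernelMass_smul_add_le (2 / Real.sqrt Real.pi * Real.exp (-1 * ρ ^ 2)) 0 gaussian 0
      rw [abs_of_nonneg (by positivity)] at this
      simpa using this
    have hB0 : 0 ≤ B := by
      obtain ⟨y, hy⟩ := hB.exists
      exact (norm_nonneg _).trans hy
    refine le_trans (le_of_eq ?_) (key.trans ((mul_le_mul_of_nonneg_right e3 hB0).trans_eq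
      (mul_assoc _ _ _)))
    refine congrArg (fun f : R3 → F => ‖𝓕⁻ f x‖) (funext fun ξ => ?_)
    congr 1
    rw [smul_apply, gaussian_apply, add_zero, norm_smul, mul_pow, smul_eq_mul,
      Real.norm_of_nonneg hρ'.le, freq_sq]
    rw [← Complex.ofReal_mul, mul_assoc, ← Real.exp_add, norm_smul, mul_pow,
      Real.norm_of_nonneg (by positivity)]
    congr 3
    ring

/-- The bound for the kernels of `k_i (⟨k⟩² + 2 y k·w + y²)^{-3/2}`. -/
theorem norm_fourierInv_quadForm_le {g h : R3 → F} (H : IsFT g h) {B : ℝ}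
    (hB : ∀ᵐ x ∂(volume : Measure R3), ‖g x‖ ≤ B) (hl : AEStronglyMeasurable h volume)
    (hi : Integrable (fun ξ => (freq ξ)⁻¹ * ‖h ξ‖)) {w0 : ℝ} (hw1 : w0 < 1) {w : R3}
    (hw : ‖w‖ ≤ w0) (i : Fin 3) {y : ℝ} (hy : 0 ≤ y) (x : R3) :
    ‖𝓕⁻ (fun ξ => ((2 * Real.pi * ξ i * quadForm w y ξ ^ (-(3 / 2) : ℝ) : ℝ) : ℂ) • h ξ) x‖ ≤
      (2 / Real.sqrt Real.pi * kernelMass (gaussianMoment i) + kernelMass gaussian /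
        Real.sqrt (1 - w0 ^ 2)) * (1 - w0 ^ 2)⁻¹ * (1 + y ^ 2)⁻¹ * B := by
  have hw0 : 0 ≤ w0 := (norm_nonneg w).trans hw
  have hB0 : 0 ≤ B := by
    obtain ⟨y, hy⟩ := hB.exists
    exact (norm_nonneg _).trans hy
  have hγ : 0 < 1 - w0 ^ 2 := by nlinarith
  have hγ' : 1 - w0 ^ 2 ≤ 1 - ‖w‖ ^ 2 := by nlinarith [norm_nonneg w]
  have hpi : 0 < Real.sqrt Real.pi := Real.sqrt_pos.2 Real.pi_pos
  -- completing the square, the quadratic form is `|k + y w|² + β`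
  set β : ℝ := 1 + y ^ 2 * (1 - ‖w‖ ^ 2) with hβ
  have hβ1 : (1 - w0 ^ 2) * (1 + y ^ 2) ≤ β := by nlinarith [sq_nonneg y, sq_nonneg w0]
  have hβ0 : 0 < β := lt_of_lt_of_le (by positivity) hβ1
  have hq := quadForm_pos hw1 hw hy
  -- its power `-3/2` is a superposition of the shifted Gaussians `e^{-ρ²(|k + y w|² + β)}`
  have hsub : ∀ ξ : R3, ∫ ρ in Ioi (0 : ℝ), 4 / Real.sqrt Real.pi * (2 * Real.pi * ξ i) *
      (ρ ^ 2 * Real.exp (-(ρ ^ 2 * quadForm w y ξ))) =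
      2 * Real.pi * ξ i * quadForm w y ξ ^ (-(3 / 2) : ℝ) := fun ξ => by
    rw [integral_const_mul, integral_sq_mul_exp (hq ξ)]
    field_simp
  have hsi : ∀ ξ : R3, IntegrableOn (fun ρ : ℝ => 4 / Real.sqrt Real.pi * (2 * Real.pi * ξ i) *
      (ρ ^ 2 * Real.exp (-(ρ ^ 2 * quadForm w y ξ)))) (Ioi 0) := fun ξ =>
    (integrableOn_sq_mul_exp (hq ξ)).const_mul _
  set M1 := kernelMass (gaussianMoment i)
  set M0 := kernelMass gaussian
  have hM1 : 0 ≤ M1 := kernelMass_nonneg _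
  have hM0 : 0 ≤ M0 := kernelMass_nonneg _
  have hm := norm_fourierInv_superposition_le' (ν := volume.restrict (Ioi (0 : ℝ)))
    (h := h) (m := fun ρ ξ => ((4 / Real.sqrt Real.pi * (2 * Real.pi * ξ i) *
      (ρ ^ 2 * Real.exp (-(ρ ^ 2 * quadForm w y ξ))) : ℝ) : ℂ))
    (C := fun ρ => (4 / Real.sqrt Real.pi * M1 * (ρ * Real.exp (-(ρ ^ 2 * β))) +
      4 / Real.sqrt Real.pi * (y * M0) * (ρ ^ 2 * Real.exp (-(ρ ^ 2 * β)))) * B)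
    (b := fun ξ => (1 - w0)⁻¹ ^ (3 / 2 : ℝ) * (freq ξ)⁻¹) hl
    (by
      have := continuous_freq
      have := continuous_phase w
      unfold quadForm
      exact Continuous.measurable (by fun_prop))
    (fun ξ => (hsi ξ).ofReal) (fun ξ => by
      have hf := freq_pos ξ
      have e1 : ∫ ρ in Ioi (0 : ℝ), ‖((4 / Real.sqrt Real.pi * (2 * Real.pi * ξ i) *
        (ρ ^ 2 * Real.exp (-(ρ ^ 2 * quadForm w y ξ))) : ℝ) : ℂ)‖ =
          |2 * Real.pi * ξ i| * quadForm w y ξ ^ (-(3 / 2) : ℝ) := by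
        have : ∀ ρ : ℝ, ‖((4 / Real.sqrt Real.pi * (2 * Real.pi * ξ i) *
          (ρ ^ 2 * Real.exp (-(ρ ^ 2 * quadForm w y ξ))) : ℝ) : ℂ)‖ =
          4 / Real.sqrt Real.pi * |2 * Real.pi * ξ i| *
          (ρ ^ 2 * Real.exp (-(ρ ^ 2 * quadForm w y ξ))) := fun ρ => by
          rw [Complex.norm_real, Real.norm_eq_abs, abs_mul, abs_mul,
            abs_of_nonneg (show 0 ≤ 4 / Real.sqrt Real.pi by positivity),
            abs_of_nonneg (show 0 ≤ ρ ^ 2 * Real.exp (-(ρ ^ 2 * quadForm w y ξ)) by positivity)]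
        simp_rw [this]
        rw [integral_const_mul, integral_sq_mul_exp (hq ξ)]
        field_simp
      rw [e1]
      have e2 : quadForm w y ξ ^ (-(3 / 2) : ℝ) ≤ (1 - w0)⁻¹ ^ (3 / 2 : ℝ) * (freq ξ ^ 3)⁻¹ := by
        have h10 : 0 < 1 - w0 := by linarith
        calc quadForm w y ξ ^ (-(3 / 2) : ℝ) ≤ ((1 - w0) * freq ξ ^ 2) ^ (-(3 / 2) : ℝ) :=
              Real.rpow_le_rpow_of_nonpos (by positivity) (quadForm_ge hw1 hw hy ξ) (by norm_num)
          _ = _ := by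
              rw [Real.mul_rpow h10.le (by positivity), Real.rpow_neg h10.le,
                ← Real.inv_rpow h10.le, Real.rpow_neg (by positivity), ← Real.rpow_natCast,
                ← Real.rpow_mul hf.le]
              norm_num
      calc |2 * Real.pi * ξ i| * quadForm w y ξ ^ (-(3 / 2) : ℝ)
          ≤ freq ξ * ((1 - w0)⁻¹ ^ (3 / 2 : ℝ) * (freq ξ ^ 3)⁻¹) := by
            exact mul_le_mul (abs_coord_le_freq i ξ) e2 (Real.rpow_nonneg (hq ξ).le _) hf.le
        _ = (1 - w0)⁻¹ ^ (3 / 2 : ℝ) * (freq ξ ^ 2)⁻¹ := by field_simp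
        _ ≤ (1 - w0)⁻¹ ^ (3 / 2 : ℝ) * (freq ξ)⁻¹ := by
            have : (0 : ℝ) ≤ (1 - w0)⁻¹ ^ (3 / 2 : ℝ) :=
              Real.rpow_nonneg (inv_nonneg.2 (by linarith)) _
            gcongr
            nlinarith [one_le_freq ξ])
    (by simpa only [mul_assoc] using hi.const_mul ((1 - w0)⁻¹ ^ (3 / 2 : ℝ)))
    ((((integrableOn_mul_exp hβ0).const_mul _).add
      ((integrableOn_sq_mul_exp hβ0).const_mul _)).mul_const _) x ?_
  · refine le_trans (le_of_eq ?_) (hm.trans ?_)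
    · refine congrArg (fun f : R3 → F => ‖𝓕⁻ f x‖) (funext fun ξ => ?_)
      rw [← hsub, integral_complex_ofReal]
    · rw [integral_mul_const]
      refine mul_le_mul_of_nonneg_right ?_ hB0
      rw [integral_add ((integrableOn_mul_exp hβ0).const_mul _)
        ((integrableOn_sq_mul_exp hβ0).const_mul _), integral_const_mul, integral_const_mul,
        integral_sq_mul_exp hβ0, integral_mul_exp hβ0]
      have b1 : β⁻¹ ≤ (1 - w0 ^ 2)⁻¹ * (1 + y ^ 2)⁻¹ := by
        rw [← mul_inv]
        gcongr
      have b2 : y * β ^ (-(3 / 2) : ℝ) ≤ (Real.sqrt (1 - w0 ^ 2))⁻¹ * β⁻¹ := by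
        have hs : y * Real.sqrt (1 - w0 ^ 2) ≤ Real.sqrt β := by
          rw [← Real.sqrt_sq hy, ← Real.sqrt_mul (sq_nonneg y)]
          apply Real.sqrt_le_sqrt
          nlinarith [sq_nonneg y]
        have e3 : β ^ (-(3 / 2) : ℝ) = β⁻¹ * (Real.sqrt β)⁻¹ := by
          rw [Real.sqrt_eq_rpow, ← Real.rpow_neg_one, ← Real.rpow_neg hβ0.le,
            ← Real.rpow_add hβ0]
          norm_num
        rw [e3]
        have hsβ : 0 < Real.sqrt β := Real.sqrt_pos.2 hβ0
        have hsγ : 0 < Real.sqrt (1 - w0 ^ 2) := Real.sqrt_pos.2 hγ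
        rw [show y * (β⁻¹ * (Real.sqrt β)⁻¹) = (y * (Real.sqrt β)⁻¹) * β⁻¹ by ring]
        gcongr
        rw [← div_eq_mul_inv, div_le_iff₀ hsβ, ← div_eq_inv_mul, le_div_iff₀ hsγ]
        exact hs
      calc 4 / Real.sqrt Real.pi * M1 * (2 * β)⁻¹ + 4 / Real.sqrt Real.pi * (y * M0) *
            (Real.sqrt Real.pi / 4 * β ^ (-(3 / 2) : ℝ))
          = 2 / Real.sqrt Real.pi * M1 * β⁻¹ + M0 * (y * β ^ (-(3 / 2) : ℝ)) := by
            field_simp; ring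
        _ ≤ 2 / Real.sqrt Real.pi * M1 * β⁻¹ + M0 * ((Real.sqrt (1 - w0 ^ 2))⁻¹ * β⁻¹) := by
            gcongr
        _ = (2 / Real.sqrt Real.pi * M1 + M0 / Real.sqrt (1 - w0 ^ 2)) * β⁻¹ := by ring
        _ ≤ (2 / Real.sqrt Real.pi * M1 + M0 / Real.sqrt (1 - w0 ^ 2)) *
            ((1 - w0 ^ 2)⁻¹ * (1 + y ^ 2)⁻¹) := by gcongr
        _ = _ := by ring
  · refine (ae_restrict_iff' measurableSet_Ioi).2 (Eventually.of_forall fun ρ hρ0 => ?_)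
    have hρ : (0 : ℝ) < ρ := hρ0
    have hρ' : (0 : ℝ) < 2 * Real.pi * ρ := by positivity
    set a : ℝ := 4 / Real.sqrt Real.pi * (ρ * Real.exp (-(ρ ^ 2 * β)))
    set b : ℝ := -(4 / Real.sqrt Real.pi * (y * w i) * (ρ ^ 2 * Real.exp (-(ρ ^ 2 * β))))
    have key := H.norm_fourierInv_affine_le hB ((a : ℂ) • gaussianMoment i + (b : ℂ) • gaussian)
      hρ' ((ρ * y) • w) x
    have e3 := kernelMass_smul_add_le a b (gaussianMoment i) gaussian
    have hwi : |w i| ≤ 1 := by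
      have := PiLp.norm_apply_le w i
      rw [Real.norm_eq_abs] at this
      linarith
    have e4 : |b| ≤ 4 / Real.sqrt Real.pi * y * (ρ ^ 2 * Real.exp (-(ρ ^ 2 * β))) := by
      rw [abs_neg, abs_mul, abs_mul, abs_mul, abs_of_nonneg hy,
        abs_of_nonneg (show 0 ≤ 4 / Real.sqrt Real.pi by positivity),
        abs_of_nonneg (show 0 ≤ ρ ^ 2 * Real.exp (-(ρ ^ 2 * β)) by positivity)]
      gcongr
      exact mul_le_of_le_one_right hy hwi
    rw [abs_of_nonneg (show 0 ≤ a by positivity)] at e3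
    refine le_trans (le_of_eq ?_) (key.trans (mul_le_mul_of_nonneg_right (e3.trans ?_) hB0))
    · refine congrArg (fun f : R3 → F => ‖𝓕⁻ f x‖) (funext fun ξ => ?_)
      congr 1
      have hexp : Real.exp (-(ρ ^ 2 * quadForm w y ξ)) = Real.exp (-(ρ ^ 2 * β)) *
          Real.exp (-‖(2 * Real.pi * ρ) • ξ + (ρ * y) • w‖ ^ 2) := by
        rw [← Real.exp_add, quadForm_eq, show (2 * Real.pi * ρ) • ξ + (ρ * y) • w =
          ρ • ((2 * Real.pi) • ξ + y • w) by rw [smul_add, smul_smul, smul_smul]; congr 2; ring,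
          norm_smul, mul_pow, Real.norm_eq_abs, sq_abs]
        congr 1
        ring
      rw [add_apply, smul_apply, smul_apply, gaussian_apply, gaussianMoment_apply, hexp]
      simp only [PiLp.add_apply, PiLp.smul_apply, smul_eq_mul, a, b]
      push_cast
      ring
    · calc _ ≤ a * M1 + 4 / Real.sqrt Real.pi * y * (ρ ^ 2 * Real.exp (-(ρ ^ 2 * β))) * M0 := by
            gcongr
        _ = _ := by simp only [a]; ring

/-- The resonance gap: for velocities below the speed of light, `⟨k⟩ + k·w` is comparable to
`⟨k⟩`. -/
theorem freq_add_phase_ge {w0 : ℝ} {w : R3} (hw : ‖w‖ ≤ w0) (ξ : R3) :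
    (1 - w0) * freq ξ ≤ freq ξ + phase w ξ := by
  linarith [(abs_le.1 (abs_phase_le hw ξ)).1]

/-- The constant in the bound for `k_i / (⟨k⟩ (⟨k⟩ + k·w))`. -/
def rieszConst (w0 : ℝ) (i : Fin 3) : ℝ :=
  (2 / Real.sqrt Real.pi * kernelMass (gaussianMoment i) + kernelMass gaussian /
        Real.sqrt (1 - w0 ^ 2)) * (1 - w0 ^ 2)⁻¹ * (Real.pi / 2)

/-- The operator with symbol `k_i / (⟨k⟩ (⟨k⟩ + k·w))` is bounded on bounded functions. -/
theorem norm_fourierInv_riesz_le {g h : R3 → F} (H : IsFT g h) {B : ℝ}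
    (hB : ∀ᵐ x ∂(volume : Measure R3), ‖g x‖ ≤ B) (hl : AEStronglyMeasurable h volume)
    (hi : Integrable (fun ξ => (freq ξ)⁻¹ * ‖h ξ‖)) {w0 : ℝ} (hw1 : w0 < 1) {w : R3}
    (hw : ‖w‖ ≤ w0) (i : Fin 3) (x : R3) :
    ‖𝓕⁻ (fun ξ => ((2 * Real.pi * ξ i * (freq ξ * (freq ξ + phase w ξ))⁻¹ : ℝ) : ℂ) • h ξ) x‖ ≤
      rieszConst w0 i * B := by
  have hq := fun y (hy : 0 ≤ y) => quadForm_pos hw1 hw (y := y) hy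
  have hlt : ∀ ξ, |phase w ξ| < freq ξ := fun ξ => by
    have := abs_phase_le hw ξ
    have := freq_pos ξ
    nlinarith
  have hI := fun ξ => integral_quadForm (freq_pos ξ) (hlt ξ)
  set K : ℝ := (2 / Real.sqrt Real.pi * kernelMass (gaussianMoment i) + kernelMass gaussian /
        Real.sqrt (1 - w0 ^ 2)) * (1 - w0 ^ 2)⁻¹ with hK
  have hm := norm_fourierInv_superposition_le' (ν := volume.restrict (Ioi (0 : ℝ)))
    (h := h) (m := fun y ξ => ((2 * Real.pi * ξ i * quadForm w y ξ ^ (-(3 / 2) : ℝ) : ℝ) : ℂ))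
    (C := fun y => K * (1 + y ^ 2)⁻¹ * B)
    (b := fun ξ => (1 - w0)⁻¹ * (freq ξ)⁻¹) hl
    (by
      have h1 : Continuous fun z : ℝ × R3 => quadForm w z.1 z.2 := by
        have := continuous_freq
        have := continuous_phase w
        unfold quadForm
        fun_prop
      have h2 : Continuous fun z : ℝ × R3 => 2 * Real.pi * z.2 i := by fun_prop
      exact Complex.measurable_ofReal.comp (h2.measurable.mul (h1.measurable.pow_const _)))
    (fun ξ => ((hI ξ).1.const_mul (2 * Real.pi * ξ i)).ofReal) (fun ξ => by
      have e1 : ∫ y in Ioi (0 : ℝ), ‖((2 * Real.pi * ξ i * quadForm w y ξ ^ (-(3 / 2) : ℝ) : ℝ)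
          : ℂ)‖ = ∫ y in Ioi (0 : ℝ), |2 * Real.pi * ξ i| * quadForm w y ξ ^ (-(3 / 2) : ℝ) := by
        refine setIntegral_congr_fun measurableSet_Ioi fun y hy => ?_
        simp only [Complex.norm_real, Real.norm_eq_abs]
        rw [abs_mul, abs_of_nonneg (Real.rpow_nonneg (hq y (le_of_lt hy) ξ).le _)]
      have e2 : ∫ y in Ioi (0 : ℝ), quadForm w y ξ ^ (-(3 / 2) : ℝ) =
        (freq ξ * (freq ξ + phase w ξ))⁻¹ := (hI ξ).2
      rw [e1, integral_const_mul, e2, mul_inv]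
      have f0 := freq_pos ξ
      have h10 : 0 < 1 - w0 := by linarith
      calc |2 * Real.pi * ξ i| * ((freq ξ)⁻¹ * (freq ξ + phase w ξ)⁻¹)
          ≤ freq ξ * ((freq ξ)⁻¹ * ((1 - w0) * freq ξ)⁻¹) := by
            gcongr
            · have := freq_add_phase_ge hw ξ
              have : 0 < freq ξ + phase w ξ := lt_of_lt_of_le (by positivity) this
              positivity
            · exact abs_coord_le_freq i ξ
            · exact freq_add_phase_ge hw ξ
        _ = _ := by field_simp)
    (by simpa only [mul_assoc] using hi.const_mul (1 - w0)⁻¹)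
    (((integrable_inv_one_add_sq.integrableOn).const_mul K).mul_const B) x ?_
  · refine le_trans (le_of_eq ?_) (hm.trans_eq ?_)
    · refine congrArg (fun f : R3 → F => ‖𝓕⁻ f x‖) (funext fun ξ => ?_)
      have e2 : ∫ y in Ioi (0 : ℝ), quadForm w y ξ ^ (-(3 / 2) : ℝ) =
        (freq ξ * (freq ξ + phase w ξ))⁻¹ := (hI ξ).2
      rw [← e2, integral_complex_ofReal, integral_const_mul]
    · rw [integral_mul_const, integral_const_mul, integral_Ioi_inv_one_add_sq]
      simp [rieszConst, hK]
  · refine (ae_restrict_iff' measurableSet_Ioi).2 (Eventually.of_forall fun y hy => ?_)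
    exact norm_fourierInv_quadForm_le H hB hl hi hw1 hw i (le_of_lt hy) x

/-- The constant in the bound for `1 / (⟨k⟩ + k·w)`. -/
def resolventConst (w0 : ℝ) : ℝ := kernelMass gaussian + ∑ i, |rieszConst w0 i|

/-- The operator with symbol `1 / (⟨k⟩ + k·w)` is bounded on bounded functions, since
`1 / (⟨k⟩ + k·w) = 1 / ⟨k⟩ - w · k / (⟨k⟩ (⟨k⟩ + k·w))`. -/
theorem norm_fourierInv_resolvent_le {g h : R3 → F} (H : IsFT g h) {B : ℝ}
    (hB : ∀ᵐ x ∂(volume : Measure R3), ‖g x‖ ≤ B) (hl : AEStronglyMeasurable h volume)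
    (hi : Integrable (fun ξ => (freq ξ)⁻¹ * ‖h ξ‖)) {w0 : ℝ} (hw1 : w0 < 1) {w : R3}
    (hw : ‖w‖ ≤ w0) (x : R3) :
    ‖𝓕⁻ (fun ξ => (((freq ξ + phase w ξ)⁻¹ : ℝ) : ℂ) • h ξ) x‖ ≤ resolventConst w0 * B := by
  have hB0 : 0 ≤ B := by
    obtain ⟨y, hy⟩ := hB.exists
    exact (norm_nonneg _).trans hy
  have h10 : 0 < 1 - w0 := by linarith
  have hpos : ∀ ξ, 0 < freq ξ + phase w ξ := fun ξ =>
    lt_of_lt_of_le (mul_pos h10 (freq_pos ξ)) (freq_add_phase_ge hw ξ)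
  have hph : ∀ ξ, phase w ξ = ∑ i, w i * (2 * Real.pi * ξ i) := fun ξ => by
    simp [phase, PiLp.inner_apply, mul_comm]
  let A : R3 → F := fun ξ => (((freq ξ)⁻¹ : ℝ) : ℂ) • h ξ
  let R : Fin 3 → R3 → F := fun i ξ =>
    ((2 * Real.pi * ξ i * (freq ξ * (freq ξ + phase w ξ))⁻¹ : ℝ) : ℂ) • h ξ
  have hdec : (fun ξ => (((freq ξ + phase w ξ)⁻¹ : ℝ) : ℂ) • h ξ) =
      fun ξ => A ξ - ∑ i, (w i : ℂ) • R i ξ := by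
    ext1 ξ
    simp only [A, R, smul_smul, ← Finset.sum_smul, ← sub_smul]
    congr 1
    norm_cast
    simp_rw [← mul_assoc (w _), ← Finset.sum_mul]
    simp_rw [mul_assoc (w _)]
    rw [← hph]
    have := hpos ξ
    have := freq_pos ξ
    field_simp
    ring
  have hAi : Integrable A := hi.mono' ((Complex.measurable_ofReal.comp
      (continuous_freq.measurable.inv)).aestronglyMeasurable.smul hl)
      (Eventually.of_forall fun ξ => by
        simp only [A]
        rw [norm_smul, Complex.norm_real, Real.norm_of_nonneg (inv_nonneg.2 (freq_pos ξ).le)])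
  have hRi : ∀ i, Integrable (R i) := fun i => by
    refine (hi.const_mul (1 - w0)⁻¹).mono' ?_ (Eventually.of_forall fun ξ => ?_)
    · refine AEStronglyMeasurable.smul ?_ hl
      have := continuous_freq
      have := continuous_phase w
      refine Continuous.aestronglyMeasurable (Complex.continuous_ofReal.comp ?_)
      refine Continuous.mul (by fun_prop) (Continuous.inv₀ (by fun_prop) fun ξ => ?_)
      exact (mul_pos (freq_pos ξ) (hpos ξ)).ne'
    · have f0 := freq_pos ξ
      have := hpos ξ
      simp only [R]
      rw [norm_smul, Complex.norm_real, Real.norm_eq_abs, abs_mul,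
        abs_of_pos (show 0 < (freq ξ * (freq ξ + phase w ξ))⁻¹ by positivity), ← mul_assoc]
      refine mul_le_mul_of_nonneg_right ?_ (norm_nonneg _)
      calc |2 * Real.pi * ξ i| * (freq ξ * (freq ξ + phase w ξ))⁻¹
          ≤ freq ξ * (freq ξ * ((1 - w0) * freq ξ))⁻¹ := by
            gcongr
            · exact abs_coord_le_freq i ξ
            · exact freq_add_phase_ge hw ξ
        _ = _ := by field_simp
  have hlin : 𝓕⁻ (fun ξ => A ξ - ∑ i, (w i : ℂ) • R i ξ) x =
      𝓕⁻ A x - ∑ i, (w i : ℂ) • 𝓕⁻ (R i) x := by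
    have hc : ∀ {f : R3 → F}, Integrable f →
        Integrable fun ξ => Real.fourierChar (inner ℝ ξ x) • f ξ := fun {f} hf => by
      have := (Real.fourierIntegral_convergent_iff (f := f) (μ := volume) (-x)).2 hf
      simpa [inner_neg_right] using this
    have hcs : ∀ i, Integrable fun ξ =>
        (w i : ℂ) • (Real.fourierChar (inner ℝ ξ x) • R i ξ) := fun i => (hc (hRi i)).smul (w i : ℂ)
    simp_rw [Real.fourierInv_eq, ← integral_smul]
    rw [← integral_finsetSum _ (fun i _ => hcs i), ← integral_sub (hc hAi)
      (integrable_finsetSum _ (fun i _ => hcs i))]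
    congr 1
    ext1 ξ
    rw [smul_sub, Finset.smul_sum]
    congr 2
    ext1 i
    rw [smul_comm]
  rw [hdec, hlin]
  have b1 := norm_fourierInv_inv_freq_le H hB hl hi x
  have b2 := fun i => norm_fourierInv_riesz_le H hB hl hi hw1 hw i x
  calc _ ≤ ‖𝓕⁻ A x‖ + ∑ i, ‖(w i : ℂ) • 𝓕⁻ (R i) x‖ :=
        (norm_sub_le _ _).trans (by gcongr; exact norm_sum_le _ _)
    _ ≤ kernelMass gaussian * B + ∑ i, |rieszConst w0 i| * B := by
        refine add_le_add b1 (Finset.sum_le_sum fun i _ => ?_)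
        · rw [norm_smul]
          have hwi : ‖(w i : ℂ)‖ ≤ 1 := by
            rw [Complex.norm_real]
            exact (PiLp.norm_apply_le w i).trans (by linarith)
          calc _ ≤ 1 * (rieszConst w0 i * B) := by gcongr; exact b2 i
            _ ≤ _ := by rw [one_mul]; gcongr; exact le_abs_self _
    _ = _ := by rw [resolventConst, ← Finset.sum_mul, add_mul]

end ResolventKernels

/-! ### Derivatives of Fourier integrals -/

section FourierCalculus

variable {F : Type*} [NormedAddCommGroup F] [InnerProductSpace ℂ F] [CompleteSpace F]

theorem fourierInv_eq_vectorFourier (h : R3 → F) :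
    𝓕⁻ h = VectorFourier.fourierIntegral Real.fourierChar volume
      (-(innerSL ℝ : R3 →L[ℝ] R3 →L[ℝ] ℝ)).toLinearMap₁₂ h := by
  funext x
  rw [Real.fourierInv_eq]
  simp [VectorFourier.fourierIntegral]

theorem norm_two_pi_le_freq (ξ : R3) : 2 * Real.pi * ‖ξ‖ ≤ freq ξ := by
  have := norm_le_freq ξ
  rw [norm_smul, Real.norm_of_nonneg (by positivity)] at this
  exact this

theorem integrable_norm_pow_mul {h : R3 → F} {N : ℕ} (hm : AEStronglyMeasurable h)
    (hi : Integrable fun ξ => freq ξ ^ N * ‖h ξ‖) {j : ℕ} (hj : j ≤ N) :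
    Integrable fun ξ => ‖ξ‖ ^ j * ‖h ξ‖ := by
  refine hi.mono' ((continuous_norm.pow j).aestronglyMeasurable.mul hm.norm) ?_
  filter_upwards with ξ
  rw [Real.norm_of_nonneg (by positivity)]
  have h1 := one_le_freq ξ
  have h2 := norm_two_pi_le_freq ξ
  have h3 : ‖ξ‖ ≤ freq ξ := by nlinarith [Real.pi_gt_three, norm_nonneg ξ]
  gcongr
  calc ‖ξ‖ ^ j ≤ freq ξ ^ j := by gcongr
    _ ≤ _ := pow_le_pow_right₀ h1 hj

theorem integrable_freq_pow_mul {h : R3 → F} {N : ℕ} (hm : AEStronglyMeasurable h)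
    (hi : Integrable fun ξ => freq ξ ^ N * ‖h ξ‖) {j : ℕ} (hj : j ≤ N) :
    Integrable fun ξ => freq ξ ^ j * ‖h ξ‖ := by
  refine hi.mono' ((continuous_freq.pow j).aestronglyMeasurable.mul hm.norm) ?_
  filter_upwards with ξ
  have h1 := one_le_freq ξ
  rw [Real.norm_of_nonneg (by positivity)]
  gcongr

theorem integrable_of_freq_pow {h : R3 → F} {N : ℕ} (hm : AEStronglyMeasurable h)
    (hi : Integrable fun ξ => freq ξ ^ N * ‖h ξ‖) : Integrable h := by
  refine hi.mono' hm ?_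
  filter_upwards with ξ
  exact le_mul_of_one_le_left (norm_nonneg _) (one_le_pow₀ (one_le_freq ξ))

theorem contDiff_fourierInv {h : R3 → F} {N : ℕ} (hm : AEStronglyMeasurable h)
    (hi : Integrable fun ξ => freq ξ ^ N * ‖h ξ‖) : ContDiff ℝ N (𝓕⁻ h) := by
  rw [fourierInv_eq_vectorFourier]
  exact VectorFourier.contDiff_fourierIntegral (N := (N : ℕ∞)) _
    (fun n hn => integrable_norm_pow_mul hm hi (by exact_mod_cast hn))

theorem iteratedFDeriv_fourierInv {h : R3 → F} {N : ℕ} (hm : AEStronglyMeasurable h)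
    (hi : Integrable fun ξ => freq ξ ^ N * ‖h ξ‖) {j : ℕ} (hj : j ≤ N) :
    iteratedFDeriv ℝ j (𝓕⁻ h) = VectorFourier.fourierIntegral Real.fourierChar volume
      (-(innerSL ℝ : R3 →L[ℝ] R3 →L[ℝ] ℝ)).toLinearMap₁₂ (fun ξ =>
        VectorFourier.fourierPowSMulRight (-(innerSL ℝ : R3 →L[ℝ] R3 →L[ℝ] ℝ)) h ξ j) := by
  rw [fourierInv_eq_vectorFourier]
  exact VectorFourier.iteratedFDeriv_fourierIntegral (N := (N : ℕ∞)) _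
    (fun n hn => integrable_norm_pow_mul hm hi (by exact_mod_cast hn)) hm (by exact_mod_cast hj)

theorem norm_powSMulRight_le (h : R3 → F) (ξ : R3) (j : ℕ) :
    ‖VectorFourier.fourierPowSMulRight (-(innerSL ℝ : R3 →L[ℝ] R3 →L[ℝ] ℝ)) h ξ j‖ ≤
      freq ξ ^ j * ‖h ξ‖ := by
  refine (VectorFourier.norm_fourierPowSMulRight_le _ h ξ j).trans ?_
  have h0 : ‖-(innerSL ℝ : R3 →L[ℝ] R3 →L[ℝ] ℝ)‖ ≤ 1 :=
    (norm_neg (innerSL ℝ : R3 →L[ℝ] R3 →L[ℝ] ℝ)).trans_le (norm_innerSL_le ℝ)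
  rw [← mul_pow]
  have h2 := norm_two_pi_le_freq ξ
  gcongr
  calc 2 * Real.pi * ‖-(innerSL ℝ : R3 →L[ℝ] R3 →L[ℝ] ℝ)‖ * ‖ξ‖ ≤ 2 * Real.pi * 1 * ‖ξ‖ := by gcongr
    _ ≤ _ := by linarith

theorem integrable_powSMulRight {h : R3 → F} {N : ℕ} (hm : AEStronglyMeasurable h)
    (hi : Integrable fun ξ => freq ξ ^ N * ‖h ξ‖) {j : ℕ} (hj : j ≤ N) :
    Integrable fun ξ =>
      VectorFourier.fourierPowSMulRight (-(innerSL ℝ : R3 →L[ℝ] R3 →L[ℝ] ℝ)) h ξ j :=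
  VectorFourier.integrable_fourierPowSMulRight _ (integrable_norm_pow_mul hm hi hj) hm

/-- Derivatives of an inverse Fourier integral are bounded by moments of the symbol. -/
theorem norm_iteratedFDeriv_fourierInv_le {h : R3 → F} {N : ℕ} (hm : AEStronglyMeasurable h)
    (hi : Integrable fun ξ => freq ξ ^ N * ‖h ξ‖) {j : ℕ} (hj : j ≤ N) (x : R3) :
    ‖iteratedFDeriv ℝ j (𝓕⁻ h) x‖ ≤ ∫ ξ, freq ξ ^ j * ‖h ξ‖ := by
  rw [iteratedFDeriv_fourierInv hm hi hj]
  refine (VectorFourier.norm_fourierIntegral_le_integral_norm _ _ _ _ _).trans ?_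
  exact integral_mono (integrable_powSMulRight hm hi hj).norm (integrable_freq_pow_mul hm hi hj)
    fun ξ => norm_powSMulRight_le h ξ j

theorem iteratedFDeriv_fourierInv_apply {h : R3 → F} {N : ℕ} (hm : AEStronglyMeasurable h)
    (hi : Integrable fun ξ => freq ξ ^ N * ‖h ξ‖) {j : ℕ} (hj : j ≤ N) (x : R3)
    (m : Fin j → R3) :
    iteratedFDeriv ℝ j (𝓕⁻ h) x m =
      𝓕⁻ (fun ξ => (∏ i, (2 * Real.pi * Complex.I * ((inner ℝ ξ (m i) : ℝ) : ℂ))) • h ξ) x := by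
  rw [iteratedFDeriv_fourierInv hm hi hj, fourierInv_eq_vectorFourier,
    Real.fourierIntegral_continuousMultilinearMap_apply'
      (integrable_powSMulRight hm hi hj)]
  refine congrArg (fun f : R3 → F => VectorFourier.fourierIntegral Real.fourierChar volume
      (-(innerSL ℝ : R3 →L[ℝ] R3 →L[ℝ] ℝ)).toLinearMap₁₂ f x) (funext fun ξ => ?_)
  rw [VectorFourier.fourierPowSMulRight_apply, Finset.prod_mul_distrib, Finset.prod_const,
    Finset.card_univ, Fintype.card_fin]
  have : (∏ i, (-(innerSL ℝ : R3 →L[ℝ] R3 →L[ℝ] ℝ)) ξ (m i)) =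
      (-1) ^ j * ∏ i, (inner ℝ ξ (m i) : ℝ) := by
    simp [Finset.prod_neg]
  rw [this, ← Complex.coe_smul, smul_smul]
  congr 1
  push_cast
  rw [← mul_assoc, ← mul_pow]
  ring

/-- Characters are Hölder continuous of exponent `1/4`, with constant `⟨k⟩^{1/4}`; this exponent is
what the weight in `integrable_freq_rpow_of_eLpNorm` leaves over. -/
theorem norm_fourierChar_sub_le (ξ x y : R3) :
    ‖((Real.fourierChar (inner ℝ ξ x) : Circle) : ℂ) - (Real.fourierChar (inner ℝ ξ y) : Circle)‖ ≤
      2 * ((freq ξ) ^ (1 / 4 : ℝ) * ‖x - y‖ ^ (1 / 4 : ℝ)) := by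
  set a : ℝ := freq ξ * ‖x - y‖ with ha
  have ha0 : 0 ≤ a := mul_nonneg (freq_pos ξ).le (norm_nonneg _)
  rw [← Real.mul_rpow (freq_pos ξ).le (norm_nonneg _), ← ha]
  by_cases h1 : a ≤ 1
  · have h2 : ‖((Real.fourierChar (inner ℝ ξ x) : Circle) : ℂ) -
        (Real.fourierChar (inner ℝ ξ y) : Circle)‖ ≤ a := by
      have e : ((Real.fourierChar (inner ℝ ξ x) : Circle) : ℂ) - (Real.fourierChar (inner ℝ ξ y) : Circle)
          = (Real.fourierChar (inner ℝ ξ y) : Circle) *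
            (Complex.exp (Complex.I * ((2 * Real.pi * inner ℝ ξ (x - y) : ℝ) : ℂ)) - 1) := by
        have : (inner ℝ ξ x : ℝ) = inner ℝ ξ y + inner ℝ ξ (x - y) := by
          rw [← inner_add_right]; congr 1; abel
        rw [this, AddChar.map_add_eq_mul, Circle.coe_mul, mul_sub, mul_one]
        congr 2
        rw [Real.fourierChar_apply]
        congr 1
        push_cast; ring
      rw [e, norm_mul, Circle.norm_coe, one_mul]
      refine (Real.norm_exp_I_mul_ofReal_sub_one_le).trans ?_
      rw [Real.norm_eq_abs, abs_mul, abs_of_nonneg (by positivity)]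
      have := abs_real_inner_le_norm ξ (x - y)
      calc _ ≤ 2 * Real.pi * (‖ξ‖ * ‖x - y‖) := by gcongr
        _ = 2 * Real.pi * ‖ξ‖ * ‖x - y‖ := by ring
        _ ≤ a := by rw [ha]; gcongr; exact norm_two_pi_le_freq ξ
    have h3 : a ≤ a ^ (1 / 4 : ℝ) := by
      calc a = a ^ (1 : ℝ) := (Real.rpow_one a).symm
        _ ≤ a ^ (1 / 4 : ℝ) := Real.rpow_le_rpow_of_exponent_ge_of_imp ha0 h1 (by norm_num)
            (by intro _ h; norm_num at h)
    have : 0 ≤ a ^ (1 / 4 : ℝ) := by positivity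
    linarith
  · push Not at h1
    have h3 : 1 ≤ a ^ (1 / 4 : ℝ) := Real.one_le_rpow h1.le (by norm_num)
    refine (norm_sub_le _ _).trans ?_
    rw [Circle.norm_coe, Circle.norm_coe]
    linarith

/-- The derivatives of top order are Hölder continuous if a further quarter of a moment is
available. -/
theorem norm_iteratedFDeriv_fourierInv_sub_le {h : R3 → F} {N : ℕ} (hm : AEStronglyMeasurable h)
    (hi : Integrable fun ξ => freq ξ ^ N * ‖h ξ‖)
    (hi' : Integrable fun ξ => freq ξ ^ (1 / 4 : ℝ) * (freq ξ ^ N * ‖h ξ‖)) (x y : R3) :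
    ‖iteratedFDeriv ℝ N (𝓕⁻ h) x - iteratedFDeriv ℝ N (𝓕⁻ h) y‖ ≤
      2 * ‖x - y‖ ^ (1 / 4 : ℝ) * ∫ ξ, freq ξ ^ (1 / 4 : ℝ) * (freq ξ ^ N * ‖h ξ‖) := by
  rw [iteratedFDeriv_fourierInv hm hi le_rfl]
  set H := fun ξ => VectorFourier.fourierPowSMulRight (-(innerSL ℝ : R3 →L[ℝ] R3 →L[ℝ] ℝ)) h ξ N
    with hH
  have hHi : Integrable H := integrable_powSMulRight hm hi le_rfl
  have hc : ∀ z : R3, Integrable fun ξ => Real.fourierChar (inner ℝ ξ z) • H ξ := fun z => by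
    refine hHi.norm.mono' ?_ (Eventually.of_forall fun ξ => by
      rw [Circle.smul_def, norm_smul, Circle.norm_coe, one_mul])
    have : Continuous fun ξ : R3 => Real.fourierChar (inner ℝ ξ z) :=
      Real.continuous_fourierChar.comp (continuous_id.inner continuous_const)
    exact this.aestronglyMeasurable.smul hHi.1
  have e : ∀ z : R3, VectorFourier.fourierIntegral Real.fourierChar volume
      (-(innerSL ℝ : R3 →L[ℝ] R3 →L[ℝ] ℝ)).toLinearMap₁₂ H z =
      ∫ ξ, Real.fourierChar (inner ℝ ξ z) • H ξ := fun z => by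
    simp [VectorFourier.fourierIntegral]
  rw [e, e, ← integral_sub (hc x) (hc y), ← integral_const_mul]
  refine norm_integral_le_of_norm_le (hi'.const_mul _) (Eventually.of_forall fun ξ => ?_)
  rw [Circle.smul_def, Circle.smul_def, ← sub_smul, norm_smul]
  calc _ ≤ 2 * ((freq ξ) ^ (1 / 4 : ℝ) * ‖x - y‖ ^ (1 / 4 : ℝ)) * (freq ξ ^ N * ‖h ξ‖) := by
        gcongr
        · have := (freq_pos ξ).le
          positivity
        · exact norm_fourierChar_sub_le ξ x y
        · exact norm_powSMulRight_le h ξ N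
    _ = _ := by ring

/-- A multilinear map on `ℝ³` is controlled by its values on tuples of basis vectors. -/
theorem norm_multilinear_le_sum_basis {G : Type*} [NormedAddCommGroup G] [NormedSpace ℝ G] {n : ℕ}
    (M : ContinuousMultilinearMap ℝ (fun _ : Fin n => R3) G) :
    ‖M‖ ≤ ∑ c : Fin n → Fin 3, ‖M fun i => EuclideanSpace.single (c i) (1 : ℝ)‖ := by
  refine M.opNorm_le_bound (Finset.sum_nonneg fun _ _ => norm_nonneg _) fun m => ?_
  have hm : m = fun i => ∑ c : Fin 3, (m i) c • EuclideanSpace.single c (1 : ℝ) := by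
    funext i
    have := (EuclideanSpace.basisFun (Fin 3) ℝ).sum_repr (m i)
    simpa using this.symm
  have h1 : M m = ∑ c : Fin n → Fin 3, (∏ i, (m i) (c i)) •
      M fun i => EuclideanSpace.single (c i) (1 : ℝ) := by
    conv_lhs => rw [hm]
    rw [ContinuousMultilinearMap.map_sum]
    refine Finset.sum_congr rfl fun c _ => ?_
    exact M.map_smul_univ (fun i => (m i) (c i)) _
  rw [h1, Finset.sum_mul]
  refine (norm_sum_le _ _).trans (Finset.sum_le_sum fun c _ => ?_)
  rw [norm_smul, mul_comm, norm_prod]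
  gcongr with i
  exact PiLp.norm_apply_le (m i) (c i)

/-- On basis vectors, the symbol of the total derivative is the symbol of a partial derivative. -/
theorem prod_basis_eq_monoSymbol {n : ℕ} (c : Fin n → Fin 3) :
    ∃ α : Fin 3 → ℕ, order α = n ∧ ∀ ξ : R3,
      ∏ i, (2 * Real.pi * Complex.I *
        ((inner ℝ ξ (EuclideanSpace.single (c i) (1 : ℝ)) : ℝ) : ℂ)) = monoSymbol α ξ := by
  refine ⟨fun k => (Finset.univ.filter fun i => c i = k).card, ?_, fun ξ => ?_⟩
  · unfold order
    rw [← Finset.card_eq_sum_card_fiberwise (f := c) (fun _ _ => Finset.mem_coe.2 (Finset.mem_univ _))]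
    simp
  · unfold monoSymbol
    rw [← Finset.prod_fiberwise_of_maps_to (g := c) (fun _ _ => Finset.mem_univ _)]
    refine Finset.prod_congr rfl fun k _ => ?_
    rw [← Finset.prod_const]
    refine Finset.prod_congr rfl fun i hi => ?_
    rw [(Finset.mem_filter.1 hi).2]
    have : (inner ℝ ξ (EuclideanSpace.single k (1 : ℝ)) : ℝ) = ξ k := by
      simpa using EuclideanSpace.inner_single_right k (1 : ℝ) ξ
    rw [this]

/-- The total derivative is controlled by the partial derivatives of the same order, each of which
is an inverse Fourier integral. -/
theorem norm_iteratedFDeriv_fourierInv_le_of_monoSymbol {h : R3 → F} {N : ℕ} {B : ℝ}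
    (hm : AEStronglyMeasurable h)
    (hi : Integrable fun ξ => freq ξ ^ N * ‖h ξ‖) (x : R3)
    (hB : ∀ α, order α = N → ‖𝓕⁻ (fun ξ => monoSymbol α ξ • h ξ) x‖ ≤ B) :
    ‖iteratedFDeriv ℝ N (𝓕⁻ h) x‖ ≤ 3 ^ N * B := by
  refine (norm_multilinear_le_sum_basis _).trans ?_
  have : ∀ c ∈ (Finset.univ : Finset (Fin N → Fin 3)),
      ‖iteratedFDeriv ℝ N (𝓕⁻ h) x fun i => EuclideanSpace.single (c i) (1 : ℝ)‖ ≤ B := by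
    intro c _
    obtain ⟨α, hα, he⟩ := prod_basis_eq_monoSymbol c
    rw [iteratedFDeriv_fourierInv_apply hm hi le_rfl]
    simp_rw [he]
    exact hB α hα
  refine (Finset.sum_le_card_nsmul _ _ _ this).trans ?_
  simp

end FourierCalculus

/-! ### Interpolation between derivatives -/

section Interpolation

variable {E G : Type*} [NormedAddCommGroup E] [NormedSpace ℝ E] [Nontrivial E]
  [NormedAddCommGroup G] [NormedSpace ℝ G]

/-- Landau's inequality for three consecutive derivatives. -/
theorem norm_iteratedFDeriv_succ_sq_le {f : E → G} {j : ℕ} (hf : ContDiff ℝ (j + 2 : ℕ) f)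
    {M₀ M₂ : ℝ} (h0 : ∀ x, ‖iteratedFDeriv ℝ j f x‖ ≤ M₀)
    (h2 : ∀ x, ‖iteratedFDeriv ℝ (j + 2) f x‖ ≤ M₂) (x : E) :
    ‖iteratedFDeriv ℝ (j + 1) f x‖ ^ 2 ≤ 8 * M₀ * M₂ := by
  have hM0 : 0 ≤ M₀ := (norm_nonneg _).trans (h0 x)
  have hM2 : 0 ≤ M₂ := (norm_nonneg _).trans (h2 x)
  have hd1 : Differentiable ℝ (iteratedFDeriv ℝ j f) :=
    hf.differentiable_iteratedFDeriv (by exact_mod_cast (by omega))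
  have hd2 : Differentiable ℝ (iteratedFDeriv ℝ (j + 1) f) :=
    hf.differentiable_iteratedFDeriv (by exact_mod_cast (by omega))
  have hlip : ∀ y z, ‖fderiv ℝ (iteratedFDeriv ℝ j f) y - fderiv ℝ (iteratedFDeriv ℝ j f) z‖ ≤
      M₂ * ‖y - z‖ := by
    intro y z
    rw [fderiv_iteratedFDeriv, Function.comp_apply, Function.comp_apply]
    refine (dist_eq_norm _ _).symm.trans_le
      (((LinearIsometryEquiv.isometry _).dist_eq _ _).trans_le ?_)
    rw [dist_eq_norm]
    exact convex_univ.norm_image_sub_le_of_norm_fderiv_le (𝕜 := ℝ) (fun w _ => hd2 w)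
      (fun w _ => (norm_fderiv_iteratedFDeriv (𝕜 := ℝ)).trans_le (h2 w)) (mem_univ z) (mem_univ y)
  -- first-order Taylor expansion with step of length `r`
  have key : ∀ r : ℝ, 0 < r → r * ‖iteratedFDeriv ℝ (j + 1) f x‖ ≤ 2 * M₀ + M₂ * r * r := by
    intro r hr
    rw [← norm_fderiv_iteratedFDeriv]
    suffices h : ‖fderiv ℝ (iteratedFDeriv ℝ j f) x‖ ≤ (2 * M₀ + M₂ * r * r) / r by
      rw [le_div_iff₀ hr] at h; linarith
    refine ContinuousLinearMap.opNorm_le_of_unit_norm (by positivity) fun u hu => ?_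
    have ht := (convex_closedBall x r).norm_image_sub_le_of_norm_fderiv_le' (𝕜 := ℝ)
      (f := iteratedFDeriv ℝ j f) (φ := fderiv ℝ (iteratedFDeriv ℝ j f) x) (C := M₂ * r)
      (fun w _ => hd1 w) (fun w hw => (hlip w x).trans (by
        rw [mem_closedBall_iff_norm] at hw; gcongr))
      (Metric.mem_closedBall_self hr.le) (y := x + r • u) (by
        rw [mem_closedBall_iff_norm, add_sub_cancel_left, norm_smul, hu, mul_one,
          Real.norm_of_nonneg hr.le])
    rw [add_sub_cancel_left, map_smul, norm_smul r u, hu, mul_one, Real.norm_of_nonneg hr.le] at ht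
    rw [le_div_iff₀ hr]
    have : r * ‖fderiv ℝ (iteratedFDeriv ℝ j f) x u‖ =
        ‖r • fderiv ℝ (iteratedFDeriv ℝ j f) x u‖ := by
      rw [norm_smul, Real.norm_of_nonneg hr.le]
    rw [mul_comm, this]
    have e : r • fderiv ℝ (iteratedFDeriv ℝ j f) x u =
      (iteratedFDeriv ℝ j f (x + r • u) - iteratedFDeriv ℝ j f x) -
      (iteratedFDeriv ℝ j f (x + r • u) - iteratedFDeriv ℝ j f x -
        r • fderiv ℝ (iteratedFDeriv ℝ j f) x u) := by abel
    rw [e]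
    refine (norm_sub_le _ _).trans ?_
    have := (norm_sub_le (iteratedFDeriv ℝ j f (x + r • u)) (iteratedFDeriv ℝ j f x)).trans
      (add_le_add (h0 _) (h0 _))
    linarith
  set m := ‖iteratedFDeriv ℝ (j + 1) f x‖ with hm
  have hm0 : 0 ≤ m := norm_nonneg _
  rcases hm0.eq_or_lt with hz | hpos
  · have : 0 ≤ 8 * M₀ * M₂ := by positivity
    rw [← hz]; simpa using this
  -- if `M₂ = 0`, a long step gives a contradiction; otherwise `m / (2 M₂)` is the optimal step
  rcases hM2.eq_or_lt with hz | hpos2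
  · exfalso
    have := key ((2 * M₀ + 1) / m) (by positivity)
    rw [← hz, div_mul_cancel₀ _ hpos.ne'] at this
    linarith
  · have := key (m / (2 * M₂)) (by positivity)
    have e1 : m / (2 * M₂) * m = m ^ 2 / (2 * M₂) := by ring
    have e2 : M₂ * (m / (2 * M₂)) * (m / (2 * M₂)) = m ^ 2 / (4 * M₂) := by
      field_simp; ring
    rw [e1, e2] at this
    have e3 : m ^ 2 / (2 * M₂) - m ^ 2 / (4 * M₂) = m ^ 2 / (4 * M₂) := by field_simp; ring
    have h4 : m ^ 2 / (4 * M₂) ≤ 2 * M₀ := by linarith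
    rw [div_le_iff₀ (by positivity)] at h4
    nlinarith

/-- Interpolation between `f` and its `n`-th derivative. -/
theorem norm_iteratedFDeriv_le_of_interpolation {f : E → G} {n : ℕ} (hf : ContDiff ℝ n f)
    {A B : ℝ} (hA : 0 < A) (hB : 0 < B) (h0 : ∀ x, ‖f x‖ ≤ A)
    (hn : ∀ x, ‖iteratedFDeriv ℝ n f x‖ ≤ A * B ^ n)
    (hb : ∀ j ≤ n, ∃ M, ∀ x, ‖iteratedFDeriv ℝ j f x‖ ≤ M) {j : ℕ} (hj : j ≤ n) (x : E) :
    ‖iteratedFDeriv ℝ j f x‖ ≤ 3 ^ (j * (n - j)) * (A * B ^ j) := by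
  have hbd : ∀ j ≤ n, BddAbove (range fun x => ‖iteratedFDeriv ℝ j f x‖) := fun j hj => by
    obtain ⟨M, hM⟩ := hb j hj
    exact ⟨M, by rintro _ ⟨x, rfl⟩; exact hM x⟩
  set M : ℕ → ℝ := fun j => ⨆ x, ‖iteratedFDeriv ℝ j f x‖ with hMdef
  have hM : ∀ j ≤ n, ∀ x, ‖iteratedFDeriv ℝ j f x‖ ≤ M j := fun j hj x => le_ciSup (hbd j hj) x
  have hMnn : ∀ j, 0 ≤ M j := fun j => Real.iSup_nonneg fun x => norm_nonneg _
  set c : ℕ → ℝ := fun j => 3 ^ (j * (n - j)) * (A * B ^ j) with hc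
  have hcpos : ∀ j, 0 < c j := fun j => by positivity
  -- an order `k` for which the ratio of the supremum to the claimed bound is maximal
  obtain ⟨k, hk, hmax⟩ := Finset.exists_max_image (Finset.range (n + 1)) (fun j => M j / c j)
    ⟨0, by simp⟩
  have hkn : k ≤ n := by simpa [Nat.lt_succ_iff] using hk
  set K := M k / c k with hK
  have hKnn : 0 ≤ K := div_nonneg (hMnn k) (hcpos k).le
  have hMK : ∀ j ≤ n, M j ≤ K * c j := fun j hj => by
    have := hmax j (by simp; omega)
    rwa [div_le_iff₀ (hcpos j)] at this
  suffices hK1 : K ≤ 1 by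
    calc _ ≤ M j := hM j hj x
      _ ≤ K * c j := hMK j hj
      _ ≤ 1 * c j := by gcongr
      _ = _ := one_mul _
  rcases Nat.eq_zero_or_pos k with hk0 | hk0
  · rw [hK, hk0, div_le_one (hcpos 0)]
    refine ciSup_le fun x => ?_
    rw [norm_iteratedFDeriv_zero]
    simpa [hc] using h0 x
  rcases hkn.eq_or_lt with hkn' | hkn'
  · rw [hK, hkn', div_le_one (hcpos n)]
    refine ciSup_le fun x => ?_
    simpa [hc] using hn x
  · obtain ⟨l, rfl⟩ : ∃ l, k = l + 1 := ⟨k - 1, by omega⟩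
    have hsq : ∀ x, ‖iteratedFDeriv ℝ (l + 1) f x‖ ^ 2 ≤ 8 * M l * M (l + 2) :=
      norm_iteratedFDeriv_succ_sq_le (hf.of_le (by exact_mod_cast hkn')) (hM l (by omega))
        (hM (l + 2) (by omega))
    have h1 : M (l + 1) ≤ Real.sqrt (8 * M l * M (l + 2)) :=
      ciSup_le fun x => Real.le_sqrt_of_sq_le (hsq x)
    have h2 : M (l + 1) ^ 2 ≤ 8 * M l * M (l + 2) := by
      have := pow_le_pow_left₀ (hMnn _) h1 2
      rwa [Real.sq_sqrt (by have := hMnn l; have := hMnn (l + 2); positivity)] at this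
    -- the claimed bounds are log-concave with factor `9`, and Landau's inequality has `8 < 9`: the
    -- maximal ratio cannot be attained at an intermediate order unless it vanishes
    have h3 : 9 * (c l * c (l + 2)) = c (l + 1) ^ 2 := by
      obtain ⟨r, rfl⟩ : ∃ r, n = l + 2 + r := ⟨n - (l + 2), by omega⟩
      simp only [hc]
      have e1 : l + 2 + r - l = r + 2 := by omega
      have e2 : l + 2 + r - (l + 2) = r := by omega
      have e3 : l + 2 + r - (l + 1) = r + 1 := by omega
      rw [e1, e2, e3]
      have : (3 : ℝ) ^ (l * (r + 2)) * 3 ^ ((l + 2) * r) * 9 = (3 ^ ((l + 1) * (r + 1))) ^ 2 := by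
        rw [show (9 : ℝ) = 3 ^ 2 by norm_num, ← pow_add, ← pow_add, ← pow_mul]
        congr 1; ring
      calc _ = ((3 : ℝ) ^ (l * (r + 2)) * 3 ^ ((l + 2) * r) * 9) * (A ^ 2 * (B ^ l * B ^ (l + 2))) := by ring
        _ = _ := by rw [this]; ring
    have h4 : M (l + 1) = K * c (l + 1) := by rw [hK, div_mul_cancel₀ _ (hcpos _).ne']
    have h5 : 8 * M l * M (l + 2) ≤ 8 * (K * c l) * (K * c (l + 2)) := by
      gcongr
      · exact hMnn _
      · exact hMK l (by omega)
      · exact hMK (l + 2) (by omega)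
    rw [h4] at h2
    have h6 : K ^ 2 * c (l + 1) ^ 2 ≤ 8 / 9 * (K ^ 2 * c (l + 1) ^ 2) := by
      rw [mul_pow] at h2
      rw [← h3] at h2 ⊢
      nlinarith
    have h7 : 0 < c (l + 1) ^ 2 := pow_pos (hcpos _) 2
    have h8 : K ^ 2 ≤ 0 := by nlinarith
    nlinarith

end Interpolation

/-! ### Product rule for Lipschitz primitives -/

section DuhamelProduct

/-- Product rule in integrated form, when one factor is only a Lipschitz primitive. -/
theorem mul_primitive_sub_eq_integral {s t : ℝ} (hst : s ≤ t) {A A' g : ℝ → ℂ}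
    (hA : ∀ τ ∈ Icc s t, HasDerivWithinAt A (A' τ) (Icc s t) τ) (hA' : ContinuousOn A' (Icc s t))
    (hg : IntervalIntegrable g volume s t) {M : ℝ} (hM : ∀ τ ∈ Icc s t, ‖g τ‖ ≤ M) (c₀ : ℂ) :
    A t * (c₀ + ∫ r in s..t, g r) - A s * c₀ =
      ∫ τ in s..t, (A' τ * (c₀ + ∫ r in s..τ, g r) + A τ * g τ) := by
  have hu : uIcc s t = Icc s t := uIcc_of_le hst
  have hM0 : 0 ≤ M := (norm_nonneg _).trans (hM s ⟨le_rfl, hst⟩)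
  have hAc : ContinuousOn A (Icc s t) := fun τ hτ => (hA τ hτ).continuousWithinAt
  set c : ℝ → ℂ := fun τ => c₀ + ∫ r in s..τ, g r with hc
  have hsub : ∀ x ∈ Icc s t, ∀ y ∈ Icc s t, uIcc x y ⊆ uIcc s t := fun x hx y hy => by
    rw [← hu] at hx hy
    exact uIcc_subset_uIcc hx hy
  have hlipI : ∀ (f : ℝ → ℂ) (L : ℝ), IntervalIntegrable f volume s t →
      (∀ τ ∈ Icc s t, ‖f τ‖ ≤ L) →
      LipschitzOnWith (Real.toNNReal L) (fun τ => ∫ r in s..τ, f r) (Icc s t) := by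
    intro f L hf hL
    refine LipschitzOnWith.of_dist_le_mul fun x hx y hy => ?_
    have hL0 : 0 ≤ L := (norm_nonneg _).trans (hL s ⟨le_rfl, hst⟩)
    rw [dist_eq_norm, Real.coe_toNNReal _ hL0,
      intervalIntegral.integral_interval_sub_left
        (hf.mono_set (hsub _ ⟨le_rfl, hst⟩ _ hx)) (hf.mono_set (hsub _ ⟨le_rfl, hst⟩ _ hy)),
      dist_comm, dist_comm, Real.dist_eq]
    refine intervalIntegral.norm_integral_le_of_norm_le_const fun r hr => hL r ?_
    rw [← hu]
    exact hsub _ hy _ hx (uIoc_subset_uIcc hr)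
  have hclip : LipschitzOnWith (Real.toNNReal M) c (Icc s t) := by
    refine LipschitzOnWith.of_dist_le_mul fun x hx y hy => ?_
    have := (hlipI g M hg hM).dist_le_mul x hx y hy
    simpa [hc] using this
  obtain ⟨MA, hMA⟩ := isCompact_Icc.exists_bound_of_continuousOn hA'
  have hAlip : LipschitzOnWith (Real.toNNReal MA) A (Icc s t) := by
    refine (convex_Icc s t).lipschitzOnWith_of_nnnorm_hasDerivWithin_le hA fun τ hτ => ?_
    rw [← NNReal.coe_le_coe, Real.coe_toNNReal _ ((norm_nonneg _).trans (hMA τ hτ))]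
    exact hMA τ hτ
  have hcc : ContinuousOn c (Icc s t) := hclip.continuousOn
  set f : ℝ → ℂ := fun τ => A' τ * c τ + A τ * g τ with hf
  have hfi : IntervalIntegrable f volume s t := by
    refine ((hA'.mul hcc).intervalIntegrable_of_Icc hst).add ?_
    exact hg.continuousOn_mul (by rwa [hu])
  have hfM : ∃ L, ∀ τ ∈ Icc s t, ‖f τ‖ ≤ L := by
    obtain ⟨L1, h1⟩ := isCompact_Icc.exists_bound_of_continuousOn (hA'.mul hcc)
    obtain ⟨L2, h2⟩ := isCompact_Icc.exists_bound_of_continuousOn hAc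
    refine ⟨L1 + L2 * M, fun τ hτ => (norm_add_le _ _).trans (add_le_add (h1 τ hτ) ?_)⟩
    rw [norm_mul]
    have := (norm_nonneg _).trans (h2 τ hτ)
    gcongr
    exacts [h2 τ hτ, hM τ hτ]
  obtain ⟨L, hL⟩ := hfM
  have e3 : c s = c₀ := by simp [hc]
  have e4 : ∀ τ, c₀ + ∫ r in s..τ, g r = c τ := fun τ => rfl
  have hcd : ∀ x, HasDerivAt (fun τ => ∫ r in s..τ, g r) (g x) x → HasDerivAt c (g x) x :=
    fun x h => h.const_add c₀
  have e5 : ∀ τ, A' τ * c τ + A τ * g τ = f τ := fun τ => rfl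
  change A t * c t - A s * c₀ = ∫ τ in s..t, f τ
  clear_value c f
  -- an absolutely continuous function whose derivative vanishes almost everywhere is constant
  have hac : AbsolutelyContinuousOnInterval (fun τ => A τ • c τ - ∫ r in s..τ, f r) s t := by
    refine AbsolutelyContinuousOnInterval.sub ?_ ?_
    · exact AbsolutelyContinuousOnInterval.fun_smul (f := A) (g := c)
        (hu ▸ hAlip : LipschitzOnWith _ A (uIcc s t)).absolutelyContinuousOnInterval
        (hu ▸ hclip : LipschitzOnWith _ c (uIcc s t)).absolutelyContinuousOnInterval
    · have := hlipI f L hfi hL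
      rw [← hu] at this
      exact this.absolutelyContinuousOnInterval
  have hd : ∀ᵐ x, x ∈ uIcc s t →
      HasDerivAt (fun τ => A τ • c τ - ∫ r in s..τ, f r) 0 x := by
    have n1 : ∀ᵐ x : ℝ, x ≠ s := by simp [ae_iff, measure_singleton]
    have n2 : ∀ᵐ x : ℝ, x ≠ t := by simp [ae_iff, measure_singleton]
    filter_upwards [hg.ae_hasDerivAt_integral, hfi.ae_hasDerivAt_integral, n1, n2]
      with x h1 h2 h3 h4 hx
    have hs : s ∈ uIcc s t := left_mem_uIcc
    have d1 := hcd x (h1 hx s hs)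
    have d2 := h2 hx s hs
    rw [hu] at hx
    have d3 : HasDerivAt A (A' x) x := (hA x hx).hasDerivAt
      (Icc_mem_nhds (lt_of_le_of_ne hx.1 (Ne.symm h3)) (lt_of_le_of_ne hx.2 h4))
    refine ((d3.mul d1).sub d2).congr_deriv ?_
    rw [← e5, sub_self]
  obtain ⟨C, hC⟩ := hac.const_of_ae_hasDerivAt_zero hd
  have e1 := hC s left_mem_uIcc
  have e2 := hC t right_mem_uIcc
  simp only [intervalIntegral.integral_same, sub_zero, smul_eq_mul] at e1 e2
  rw [e3] at e1
  rw [← e1] at e2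
  linear_combination e2

end DuhamelProduct

/-! ### Measurability of the symbols in time and frequency -/

section Measurability

variable {F : Type*} [NormedAddCommGroup F] [InnerProductSpace ℂ F] [CompleteSpace F]

/-- The inverse Fourier integral of a jointly measurable family is jointly measurable. No
integrability is needed, because the Bochner integral of a non-integrable function is `0`. -/
theorem stronglyMeasurable_fourierInv {Ω : Type*} [MeasurableSpace Ω] {h : Ω → R3 → F}
    (hh : StronglyMeasurable fun z : Ω × R3 => h z.1 z.2) :
    StronglyMeasurable fun z : Ω × R3 => 𝓕⁻ (h z.1) z.2 := by
  simp_rw [Real.fourierInv_eq, Circle.smul_def]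
  refine StronglyMeasurable.integral_prod_right' (ν := volume)
    (f := fun p : (Ω × R3) × R3 => ((Real.fourierChar (inner ℝ p.2 p.1.2) : Circle) : ℂ) • h p.1.1 p.2) ?_
  have h1 : StronglyMeasurable fun p : (Ω × R3) × R3 =>
      ((Real.fourierChar (inner ℝ p.2 p.1.2) : Circle) : ℂ) := by
    have : Continuous fun q : R3 × R3 => ((Real.fourierChar (inner ℝ q.2 q.1) : Circle) : ℂ) :=
      continuous_subtype_val.comp (Real.continuous_fourierChar.comp
        (continuous_snd.inner continuous_fst))
    have hm : Measurable fun p : (Ω × R3) × R3 => ((p.1.2, p.2) : R3 × R3) :=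
      (measurable_snd.comp measurable_fst).prodMk measurable_snd
    have h4 := this.measurable.comp hm
    exact h4.stronglyMeasurable
  have h2 : StronglyMeasurable fun p : (Ω × R3) × R3 => h p.1.1 p.2 :=
    hh.comp_measurable ((measurable_fst.comp measurable_fst).prodMk measurable_snd)
  have h3 := (continuous_smul (M := ℂ) (X := F)).comp_stronglyMeasurable (h1.prodMk h2)
  exact h3

theorem stronglyMeasurable_fourier {Ω : Type*} [MeasurableSpace Ω] {h : Ω → R3 → F}
    (hh : StronglyMeasurable fun z : Ω × R3 => h z.1 z.2) :
    StronglyMeasurable fun z : Ω × R3 => 𝓕 (h z.1) z.2 := by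
  have := (stronglyMeasurable_fourierInv hh).comp_measurable
    (measurable_fst.prodMk measurable_snd.neg : Measurable fun z : Ω × R3 => (z.1, -z.2))
  simpa [Function.comp_def, Real.fourierInv_eq_fourier_neg] using this

theorem measurable_freq : Measurable freq := continuous_freq.measurable

theorem measurable_lam (σ : ℤˣ) : Measurable (lam σ) := by
  unfold lam
  exact measurable_const.mul (Complex.measurable_ofReal.comp measurable_freq)

theorem measurable_amp (σ : ℤˣ) : Measurable (amp σ) := by
  unfold amp
  exact measurable_const.mul (Complex.measurable_ofReal.comp measurable_freq).inv

/-- The interaction picture amplitude `Ŝ₀ + ∫_0^t e^{-λ s} Ŝ(s) ds`. -/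
def profile (σ : ℤˣ) (S₀ : Lp ℂ 2 (volume : Measure R3)) (S : ℝ → R3 → ℂ) (t : ℝ) (ξ : R3) : ℂ :=
  (𝓕 S₀ : Lp ℂ 2 (volume : Measure R3)) ξ +
    ∫ s in (0 : ℝ)..t, Complex.exp (-(lam σ ξ * s)) * 𝓕 (S s) ξ

theorem measurable_profile (σ : ℤˣ) (S₀ : Lp ℂ 2 (volume : Measure R3)) {S : ℝ → R3 → ℂ}
    (hS : Measurable fun z : ℝ × R3 => S z.1 z.2) :
    Measurable fun z : ℝ × R3 => profile σ S₀ S z.1 z.2 := by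
  have h0 : Measurable fun z : ℝ × R3 => ((𝓕 S₀ : Lp ℂ 2 (volume : Measure R3)) : R3 → ℂ) z.2 :=
    (Lp.stronglyMeasurable _).measurable.comp measurable_snd
  have hŜ : Measurable fun z : ℝ × R3 => 𝓕 (S z.1) z.2 :=
    (stronglyMeasurable_fourier hS.stronglyMeasurable).measurable
  have hint : Measurable fun p : (ℝ × R3) × ℝ =>
      Complex.exp (-(lam σ p.1.2 * p.2)) * 𝓕 (S p.2) p.1.2 := by
    refine Measurable.mul ?_ (hŜ.comp (measurable_snd.prodMk (measurable_snd.comp measurable_fst)))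
    exact (((measurable_lam σ).comp (measurable_snd.comp measurable_fst)).mul
      (Complex.measurable_ofReal.comp measurable_snd)).neg.cexp
  refine h0.add ?_
  have hhalf : ∀ a b : ℝ × R3 → ℝ, Measurable a → Measurable b →
      Measurable fun z : ℝ × R3 => ∫ s in Ioc (a z) (b z),
        Complex.exp (-(lam σ z.2 * s)) * 𝓕 (S s) z.2 := by
    intro a b ha hb
    simp_rw [← integral_indicator measurableSet_Ioc]
    have hset : MeasurableSet {p : (ℝ × R3) × ℝ | a p.1 < p.2 ∧ p.2 ≤ b p.1} :=
      (measurableSet_lt (ha.comp measurable_fst) measurable_snd).inter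
        (measurableSet_le measurable_snd (hb.comp measurable_fst))
    have := (hint.indicator hset).stronglyMeasurable.integral_prod_right' (ν := volume)
    exact this.measurable
  simp only [intervalIntegral]
  exact (hhalf _ _ measurable_const measurable_fst).sub (hhalf _ _ measurable_fst measurable_const)

theorem oscSymbol_eq_profile (σ : ℤˣ) (S₀ : Lp ℂ 2 (volume : Measure R3)) (S : ℝ → R3 → ℂ)
    (t : ℝ) (ξ : R3) (i : Fin 3) : oscSymbol σ S₀ S t ξ i =
      Complex.exp (lam σ ξ * t) * amp σ ξ * (2 * Real.pi * Complex.I * (ξ i : ℂ)) *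
        profile σ S₀ S t ξ := rfl

theorem stronglyMeasurable_C3 {Ω : Type*} [MeasurableSpace Ω] {f : Ω → C3}
    (h : ∀ i, Measurable fun z => f z i) : StronglyMeasurable f := by
  have : f = fun z => WithLp.toLp 2 fun i => f z i := rfl
  rw [this]
  exact ((PiLp.continuous_toLp 2 _).measurable.comp (measurable_pi_iff.2 h)).stronglyMeasurable

theorem stronglyMeasurable_oscSymbol (σ : ℤˣ) (S₀ : Lp ℂ 2 (volume : Measure R3)) {S : ℝ → R3 → ℂ}
    (hS : Measurable fun z : ℝ × R3 => S z.1 z.2) :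
    StronglyMeasurable fun z : ℝ × R3 => oscSymbol σ S₀ S z.1 z.2 := by
  refine stronglyMeasurable_C3 fun i => ?_
  simp_rw [oscSymbol_eq_profile]
  have hc : Measurable fun z : ℝ × R3 => ((z.2 i : ℝ) : ℂ) :=
    Complex.measurable_ofReal.comp ((by fun_prop : Measurable fun x : R3 => x i).comp measurable_snd)
  refine (Measurable.mul (Measurable.mul ?_ ((measurable_amp σ).comp measurable_snd)) ?_).mul
    (measurable_profile σ S₀ hS)
  · exact (((measurable_lam σ).comp measurable_snd).mul
      (Complex.measurable_ofReal.comp measurable_fst)).cexp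
  · exact measurable_const.mul hc

end Measurability

/-! ### Weighted integrability of symbols -/

section CauchySchwarz

/-- The weight `⟨k⟩^{-7/4}` is square integrable in dimension three, as `2 · 7/4 > 3`. -/
theorem memLp_freq_rpow : MemLp (fun ξ : R3 => freq ξ ^ (-(7 / 4) : ℝ)) 2 volume := by
  have hm : Measurable fun ξ : R3 => freq ξ ^ (-(7 / 4) : ℝ) := measurable_freq.pow_const _
  rw [memLp_two_iff_integrable_sq hm.aestronglyMeasurable]
  have h := integrable_rpow_neg_one_add_norm_sq (E := R3) (μ := volume) (r := 7 / 2) (by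
    simp; norm_num)
  refine h.mono' (hm.pow_const 2).aestronglyMeasurable (Eventually.of_forall fun ξ => ?_)
  have hf := freq_pos ξ
  rw [Real.norm_of_nonneg (by positivity), ← Real.rpow_natCast, ← Real.rpow_mul hf.le]
  have e : freq ξ = (1 + ‖(2 * Real.pi) • ξ‖ ^ 2) ^ (1 / 2 : ℝ) := by
    unfold freq bracket; rw [Real.sqrt_eq_rpow]
  rw [e, ← Real.rpow_mul (by positivity)]
  have e2 : (1 / 2 : ℝ) * (-(7 / 4) * (2 : ℕ)) = -(7 / 2) / 2 := by norm_num
  rw [e2]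
  refine Real.rpow_le_rpow_of_nonpos (by positivity) ?_ (by norm_num)
  rw [norm_smul, Real.norm_of_nonneg (by positivity)]
  have : ‖ξ‖ ≤ 2 * Real.pi * ‖ξ‖ := by nlinarith [Real.pi_gt_three, norm_nonneg ξ]
  gcongr

/-- The constant in the Cauchy–Schwarz bound of an `L¹` norm by a weighted `L²` norm. -/
def weightConst : ℝ := (eLpNorm (fun ξ : R3 => freq ξ ^ (-(7 / 4) : ℝ)) 2 volume).toReal

variable {F : Type*} [NormedAddCommGroup F] [InnerProductSpace ℂ F] [CompleteSpace F]

/-- Sobolev embedding with a Hölder exponent: by Cauchy–Schwarz against `⟨k⟩^{-7/4}`, two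
derivatives in `L²` control a quarter of a moment in `L¹`. -/
theorem integrable_freq_rpow_of_eLpNorm {h : R3 → F} {N : ℕ} {b : ℝ} (hb : 0 ≤ b)
    (hm : AEStronglyMeasurable h)
    (hN : eLpNorm (fun ξ => freq ξ ^ (N + 2) • h ξ) 2 volume ≤ ENNReal.ofReal b) :
    Integrable (fun ξ => freq ξ ^ (1 / 4 : ℝ) * (freq ξ ^ N * ‖h ξ‖)) ∧
      ∫ ξ, freq ξ ^ (1 / 4 : ℝ) * (freq ξ ^ N * ‖h ξ‖) ≤ weightConst * b := by
  have hm2 : AEStronglyMeasurable (fun ξ => freq ξ ^ (N + 2) • h ξ) :=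
    (continuous_freq.pow (N + 2)).aestronglyMeasurable.smul hm
  have e : (fun ξ => freq ξ ^ (1 / 4 : ℝ) * (freq ξ ^ N * ‖h ξ‖)) =
      fun ξ => freq ξ ^ (-(7 / 4) : ℝ) • ‖freq ξ ^ (N + 2) • h ξ‖ := by
    funext ξ
    have hf := freq_pos ξ
    rw [norm_smul, Real.norm_of_nonneg (by positivity), smul_eq_mul]
    have : freq ξ ^ (1 / 4 : ℝ) * freq ξ ^ N = freq ξ ^ (-(7 / 4) : ℝ) * freq ξ ^ (N + 2) := by
      rw [← Real.rpow_natCast, ← Real.rpow_natCast, ← Real.rpow_add hf, ← Real.rpow_add hf]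
      congr 1; push_cast; ring
    rw [← mul_assoc, ← mul_assoc, this]
  have hL2 : MemLp (fun ξ => freq ξ ^ (N + 2) • h ξ) 2 volume :=
    ⟨hm2, hN.trans_lt ENNReal.ofReal_lt_top⟩
  have hcs := eLpNorm_smul_le_mul_eLpNorm (p := 2) (q := 2) (r := 1)
    (μ := (volume : Measure R3)) hL2.norm.1 memLp_freq_rpow.1
  have hl1 : MemLp (fun ξ => freq ξ ^ (-(7 / 4) : ℝ) • ‖freq ξ ^ (N + 2) • h ξ‖) 1 volume :=
    hL2.norm.smul memLp_freq_rpow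
  rw [e]
  have hi := memLp_one_iff_integrable.1 hl1
  refine ⟨hi, ?_⟩
  have h1 : ENNReal.ofReal (∫ ξ, freq ξ ^ (-(7 / 4) : ℝ) • ‖freq ξ ^ (N + 2) • h ξ‖) ≤
      ENNReal.ofReal (weightConst * b) := by
    rw [ofReal_integral_eq_lintegral_ofReal hi (Eventually.of_forall fun ξ => by
      have := freq_pos ξ; simp only [Pi.zero_apply, smul_eq_mul]; positivity)]
    calc _ = eLpNorm (fun ξ => freq ξ ^ (-(7 / 4) : ℝ) • ‖freq ξ ^ (N + 2) • h ξ‖) 1 volume := by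
          rw [eLpNorm_one_eq_lintegral_enorm]
          refine lintegral_congr fun ξ => ?_
          rw [Real.enorm_of_nonneg]
          have := freq_pos ξ; simp only [smul_eq_mul]; positivity
      _ ≤ _ := hcs
      _ ≤ ENNReal.ofReal weightConst * ENNReal.ofReal b := by
          rw [eLpNorm_norm]
          refine mul_le_mul' ?_ hN
          rw [weightConst, ENNReal.ofReal_toReal memLp_freq_rpow.2.ne]
      _ = _ := (ENNReal.ofReal_mul ENNReal.toReal_nonneg).symm
  exact (ENNReal.ofReal_le_ofReal_iff (mul_nonneg ENNReal.toReal_nonneg hb)).1 h1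

theorem integrable_freq_pow_of_eLpNorm {h : R3 → F} {N : ℕ} {b : ℝ} (hb : 0 ≤ b)
    (hm : AEStronglyMeasurable h)
    (hN : eLpNorm (fun ξ => freq ξ ^ (N + 2) • h ξ) 2 volume ≤ ENNReal.ofReal b) :
    Integrable (fun ξ => freq ξ ^ N * ‖h ξ‖) ∧ ∫ ξ, freq ξ ^ N * ‖h ξ‖ ≤ weightConst * b := by
  obtain ⟨h1, h2⟩ := integrable_freq_rpow_of_eLpNorm hb hm hN
  have hle : ∀ ξ, freq ξ ^ N * ‖h ξ‖ ≤ freq ξ ^ (1 / 4 : ℝ) * (freq ξ ^ N * ‖h ξ‖) := fun ξ => by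
    have := (freq_pos ξ).le
    exact le_mul_of_one_le_left (by positivity) (Real.one_le_rpow (one_le_freq ξ) (by norm_num))
  have hi : Integrable (fun ξ => freq ξ ^ N * ‖h ξ‖) := by
    refine h1.mono' ((continuous_freq.pow N).aestronglyMeasurable.mul hm.norm)
      (Eventually.of_forall fun ξ => ?_)
    have := (freq_pos ξ).le
    rw [Real.norm_of_nonneg (by positivity)]
    exact hle ξ
  exact ⟨hi, (integral_mono hi h1 hle).trans h2⟩

end CauchySchwarz

/-! ### Brackets, exponents and inverse Fourier integrals -/

section Basics

theorem one_le_bracket {F : Type*} [NormedAddCommGroup F] (y : F) : 1 ≤ bracket y := by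
  unfold bracket
  rw [Real.one_le_sqrt]
  nlinarith [sq_nonneg ‖y‖]

theorem bracket_pos {F : Type*} [NormedAddCommGroup F] (y : F) : 0 < bracket y :=
  one_pos.trans_le (one_le_bracket y)

theorem delta_succ (n m : ℕ) : delta (n + 1) m = m / n := by
  unfold delta
  push_cast
  rw [add_sub_cancel_right]

theorem recip_top : recip ⊤ = 0 := by simp [recip]

theorem recip_one : recip 1 = 1 := by simp [recip]

theorem rate_ne_top (ε t r : ℝ) : rate ε t r ≠ ⊤ := ENNReal.ofReal_ne_top

theorem ae_norm_le_of_eLpNorm_top {F : Type*} [NormedAddCommGroup F] {f : R3 → F} {B : ℝ}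
    (hB : 0 ≤ B) (h : eLpNorm f ⊤ volume ≤ ENNReal.ofReal B) :
    ∀ᵐ x ∂(volume : Measure R3), ‖f x‖ ≤ B := by
  rw [eLpNorm_exponent_top] at h
  filter_upwards [ae_le_eLpNormEssSup (f := f) (μ := volume)] with x hx
  have := hx.trans h
  rw [← ofReal_norm] at this
  exact (ENNReal.ofReal_le_ofReal_iff hB).1 this

variable {F : Type*} [NormedAddCommGroup F] [InnerProductSpace ℂ F] [CompleteSpace F]

theorem continuous_fourierInv {h : R3 → F} (hh : Integrable h) : Continuous (𝓕⁻ h) := by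
  rw [fourierInv_eq_vectorFourier]
  exact VectorFourier.fourierIntegral_continuous Real.continuous_fourierChar
    (by exact (-(innerSL ℝ : R3 →L[ℝ] R3 →L[ℝ] ℝ)).continuous₂) hh

/-- An essential bound on a function is a pointwise bound on its continuous representative. -/
theorem IsFT.norm_fourierInv_le {g h : R3 → F} (H : IsFT g h) (hl : LocallyIntegrable g)
    (hh : Integrable h) {B : ℝ} (hB : ∀ᵐ x ∂(volume : Measure R3), ‖g x‖ ≤ B) (x : R3) :
    ‖𝓕⁻ h x‖ ≤ B := by
  have h1 : ∀ᵐ x ∂(volume : Measure R3), ‖𝓕⁻ h x‖ ≤ B := by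
    filter_upwards [H.eq_fourierInv hl hh, hB] with y h1 h2
    rwa [← h1]
  have h2 : Dense {x : R3 | ‖𝓕⁻ h x‖ ≤ B} := Measure.dense_of_ae h1
  have h3 : IsClosed {x : R3 | ‖𝓕⁻ h x‖ ≤ B} :=
    isClosed_le (continuous_fourierInv hh).norm continuous_const
  have := h2.closure_eq
  rw [h3.closure_eq] at this
  exact (this.symm ▸ mem_univ x : x ∈ {x : R3 | ‖𝓕⁻ h x‖ ≤ B})

theorem fourierInv_const_smul (c : ℂ) (h : R3 → F) (x : R3) :
    𝓕⁻ (fun ξ => c • h ξ) x = c • 𝓕⁻ h x := by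
  rw [Real.fourierInv_eq, Real.fourierInv_eq, ← integral_smul]
  refine integral_congr_ae (Eventually.of_forall fun ξ => ?_)
  exact smul_comm _ _ _

theorem integrable_char_smul {h : R3 → F} (hh : Integrable h) (x : R3) :
    Integrable fun ξ => Real.fourierChar (inner ℝ ξ x) • h ξ := by
  have := (Real.fourierIntegral_convergent_iff (f := h) (μ := volume) (-x)).2 hh
  simpa [inner_neg_right] using this

theorem fourierInv_apply_C3 {h : R3 → C3} (hh : Integrable h) (x : R3) (i : Fin 3) :
    𝓕⁻ h x i = 𝓕⁻ (fun ξ => h ξ i) x := by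
  rw [Real.fourierInv_eq, Real.fourierInv_eq]
  have := (PiLp.proj 2 (𝕜 := ℂ) (fun _ : Fin 3 => ℂ) i).integral_comp_comm (integrable_char_smul hh x)
  exact this.symm

theorem norm_C3_le (y : C3) : ‖y‖ ≤ ∑ i, ‖y i‖ := by
  rw [EuclideanSpace.norm_eq, Real.sqrt_le_left (Finset.sum_nonneg fun _ _ => norm_nonneg _)]
  exact Finset.sum_sq_le_sq_sum_of_nonneg fun _ _ => norm_nonneg _

/-- The embedding of `ℝ³` into `ℂ³`. -/
def complexify : R3 →L[ℝ] C3 :=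
  LinearMap.toContinuousLinearMap
    { toFun := fun x => WithLp.toLp 2 fun i => ((x i : ℝ) : ℂ)
      map_add' := fun x y => by
        refine PiLp.ext fun i => ?_
        simp
      map_smul' := fun c x => by
        refine PiLp.ext fun i => ?_
        simp }

theorem complexify_apply (x : R3) (i : Fin 3) : complexify x i = ((x i : ℝ) : ℂ) := rfl

theorem norm_complexify (x : R3) : ‖complexify x‖ = ‖x‖ := by
  rw [EuclideanSpace.norm_eq, EuclideanSpace.norm_eq]
  simp [complexify_apply]

end Basics

/-! ### The assumptions on the field on the Fourier side -/

namespace IsOscillatoryElectricField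

variable {n : ℕ} {ε T : ℝ} {S₀ : ℤˣ → Lp ℂ 2 (volume : Measure R3)} {S : ℤˣ → ℝ → R3 → ℂ}
  {Eosc : ℤˣ → ℝ → R3 → C3} {Er : ℝ → R3 → C3} {E : ℝ → R3 → R3}

theorem isFT_osc (H : IsOscillatoryElectricField (n + 1) ε T S₀ S Eosc Er E) (σ : ℤˣ) {t : ℝ}
    (ht : t ∈ Icc 0 T) : MemLp (Eosc σ t) 2 (volume : Measure R3) ∧
      IsFT (Eosc σ t) (oscSymbol σ (S₀ σ) (S σ) t) ∧
      MemLp (oscSymbol σ (S₀ σ) (S σ) t) 2 (volume : Measure R3) := by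
  obtain ⟨h, hh⟩ := H.osc σ t ht
  exact ⟨h, (isFT_toLp h).congr_right hh, (memLp_congr_ae hh).1 (Lp.memLp _)⟩

/-- The `H^{α₀+1}` bound of the oscillatory field, as a weighted `L²` bound of its symbol. -/
theorem osc_weight (H : IsOscillatoryElectricField (n + 1) ε T S₀ S Eosc Er E) (σ : ℤˣ) {t : ℝ}
    (ht : t ∈ Icc 0 T) :
    eLpNorm (fun ξ => freq ξ ^ (n + 2) • oscSymbol σ (S₀ σ) (S σ) t ξ) 2 volume ≤
      ENNReal.ofReal (4 ^ (n + 3) * (ε * bracket t ^ (1 / n : ℝ))) := by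
  obtain ⟨h1, h2, h3⟩ := H.isFT_osc σ ht
  have h4 : ∀ α, order α ≤ n + 2 → derivNorm α 2 (Eosc σ t) ≤ rate ε t (delta (n + 1) 1) :=
    fun α hα => (derivNorm_le_sobolevNorm hα _).trans
      (le_self_add.trans (le_self_add.trans (H.bound_top σ t ht)))
  have := eLpNorm_freq_pow_le (rate_ne_top _ _ _) h1 h2 (h3.locallyIntegrable (by norm_num)) h4
  rw [rate, ← ENNReal.ofReal_mul (by positivity), delta_succ] at this
  simpa using this

/-- The pointwise decay of the oscillatory field. -/
theorem osc_bound (H : IsOscillatoryElectricField (n + 1) ε T S₀ S Eosc Er E) (hε : 0 ≤ ε)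
    (σ : ℤˣ) {t : ℝ} (ht : t ∈ Icc 0 T) :
    ∀ᵐ x ∂(volume : Measure R3), ‖Eosc σ t x‖ ≤ ε * bracket t ^ (-(3 / 2) : ℝ) := by
  have h := H.decay_osc σ t ht ⊤ le_top
  rw [rate, recip_top] at h
  have := ae_norm_le_of_eLpNorm_top
    (mul_nonneg hε (Real.rpow_nonneg (bracket_pos t).le _)) h
  norm_num at this ⊢
  exact this

theorem source_memLp (H : IsOscillatoryElectricField (n + 1) ε T S₀ S Eosc Er E) (σ : ℤˣ) {t : ℝ}
    (ht : t ∈ Icc 0 T) (p : ℝ≥0∞) (hp : 1 ≤ p) : MemLp (S σ t) p (volume : Measure R3) := by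
  have hm : Measurable (S σ t) := (H.measurable_source σ).comp (measurable_const.prodMk measurable_id)
  refine ⟨hm.aestronglyMeasurable, ?_⟩
  exact (le_self_add.trans (H.decay_source σ t ht p hp (Pi.single 0 1) (order_single 0 1))).trans_lt
    ENNReal.ofReal_lt_top

theorem source_integrable (H : IsOscillatoryElectricField (n + 1) ε T S₀ S Eosc Er E) (σ : ℤˣ)
    {t : ℝ} (ht : t ∈ Icc 0 T) : Integrable (S σ t) :=
  memLp_one_iff_integrable.1 (H.source_memLp σ ht 1 le_rfl)

theorem norm_fourier_source_le (H : IsOscillatoryElectricField (n + 1) ε T S₀ S Eosc Er E)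
    (hε : 0 ≤ ε) (σ : ℤˣ) {t : ℝ} (ht : t ∈ Icc 0 T) (ξ : R3) : ‖𝓕 (S σ t) ξ‖ ≤ ε := by
  have h1 : ‖𝓕 (S σ t) ξ‖ ≤ ∫ x, ‖S σ t x‖ :=
    VectorFourier.norm_fourierIntegral_le_integral_norm _ _ _ _ _
  refine h1.trans ?_
  have h := le_self_add.trans
    (H.decay_source σ t ht 1 le_rfl (Pi.single 0 1) (order_single 0 1))
  rw [rate, recip_one, sub_self, mul_zero, Real.rpow_zero, mul_one, eLpNorm_one_eq_lintegral_enorm]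
    at h
  rw [integral_norm_eq_lintegral_enorm (H.source_integrable σ ht).1]
  exact ENNReal.toReal_le_of_le_ofReal hε h

theorem source_bound (H : IsOscillatoryElectricField (n + 1) ε T S₀ S Eosc Er E) (hε : 0 ≤ ε)
    (σ : ℤˣ) {t : ℝ} (ht : t ∈ Icc 0 T) :
    ∀ᵐ x ∂(volume : Measure R3), ‖S σ t x‖ ≤ ε * bracket t ^ (-3 : ℝ) := by
  have h := le_self_add.trans
    (H.decay_source σ t ht ⊤ le_top (Pi.single 0 1) (order_single 0 1))
  rw [rate, recip_top] at h
  have := ae_norm_le_of_eLpNorm_top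
    (mul_nonneg hε (Real.rpow_nonneg (bracket_pos t).le _)) h
  norm_num at this ⊢
  exact this

theorem isFT_source (H : IsOscillatoryElectricField (n + 1) ε T S₀ S Eosc Er E) (σ : ℤˣ)
    {t : ℝ} (ht : t ∈ Icc 0 T) : IsFT (S σ t) (𝓕 (S σ t)) ∧ Continuous (𝓕 (S σ t)) :=
  ⟨isFT_of_integrable (H.source_integrable σ ht),
    VectorFourier.fourierIntegral_continuous Real.continuous_fourierChar continuous_inner
      (H.source_integrable σ ht)⟩

theorem source_derivNorm_le (H : IsOscillatoryElectricField (n + 1) ε T S₀ S Eosc Er E) (σ : ℤˣ)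
    {t : ℝ} (ht : t ∈ Icc 0 T) : ∀ α, order α ≤ n + 1 →
      derivNorm α 2 (S σ t) ≤ rate ε t (delta (n + 1) 1) := fun _ hα =>
  (derivNorm_le_sobolevNorm hα _).trans (le_add_self.trans (H.bound_top σ t ht))

/-- The `H^{α₀}` bound of the source, as a weighted `L²` bound of its Fourier transform. -/
theorem source_weight (H : IsOscillatoryElectricField (n + 1) ε T S₀ S Eosc Er E) (σ : ℤˣ) {t : ℝ}
    (ht : t ∈ Icc 0 T) :
    eLpNorm (fun ξ => freq ξ ^ (n + 1) • 𝓕 (S σ t) ξ) 2 volume ≤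
      ENNReal.ofReal (4 ^ (n + 2) * (ε * bracket t ^ (1 / n : ℝ))) := by
  have := eLpNorm_freq_pow_le (rate_ne_top _ _ _) (H.source_memLp σ ht 2 (by norm_num))
    (H.isFT_source σ ht).1 (H.isFT_source σ ht).2.locallyIntegrable (H.source_derivNorm_le σ ht)
  rw [rate, ← ENNReal.ofReal_mul (by positivity), delta_succ] at this
  simpa using this

/-- The weak derivatives of the source have the expected Fourier transforms and decay pointwise. -/
theorem source_deriv (H : IsOscillatoryElectricField (n + 1) ε T S₀ S Eosc Er E) (hε : 0 ≤ ε)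
    (σ : ℤˣ) {t : ℝ} (ht : t ∈ Icc 0 T) (α : Fin 3 → ℕ) (h1 : 1 ≤ order α) (h2 : order α ≤ n) :
    ∃ g : R3 → ℂ, IsFT g (fun ξ => monoSymbol α ξ • 𝓕 (S σ t) ξ) ∧ LocallyIntegrable g ∧
      ∀ᵐ x ∂(volume : Measure R3), ‖g x‖ ≤ ε * bracket t ^ (-3 + order α / n : ℝ) := by
  obtain ⟨g, g1, g2, g3⟩ := exists_weakDeriv_isFT (N := n + 1) (H.source_memLp σ ht 2 (by norm_num))
    (H.isFT_source σ ht).1 (fun α hα => ne_top_of_le_ne_top (rate_ne_top _ _ _)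
      (H.source_derivNorm_le σ ht α hα)) α (h2.trans (Nat.le_succ _))
  refine ⟨g, g3, g1.2.1, ?_⟩
  have h := le_self_add.trans (H.decay_deriv σ t ht ⊤ le_top α h1 (by simpa using h2))
  rw [← g1.eLpNorm_eq, rate, recip_top, delta_succ] at h
  have := ae_norm_le_of_eLpNorm_top
    (mul_nonneg hε (Real.rpow_nonneg (bracket_pos t).le _)) h
  simpa using this

/-- The Fourier transform of the regular field, with all the bounds on that field that the normal
form uses. -/
theorem exists_rem_symbol (H : IsOscillatoryElectricField (n + 1) ε T S₀ S Eosc Er E) (hε : 0 ≤ ε)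
    {t : ℝ} (ht : t ∈ Icc 0 T) : ∃ r : R3 → C3, IsFT (Er t) r ∧ LocallyIntegrable (Er t) ∧
      MemLp r 2 (volume : Measure R3) ∧
      eLpNorm (fun ξ => freq ξ ^ (n + 2) • r ξ) 2 volume ≤
        ENNReal.ofReal (4 ^ (n + 3) * (ε * bracket t ^ (1 / n : ℝ))) ∧
      (∀ᵐ x ∂(volume : Measure R3), ‖Er t x‖ ≤ ε * bracket t ^ (-3 : ℝ)) ∧
      ∀ α : Fin 3 → ℕ, 1 ≤ order α → order α ≤ n →
        ∃ g : R3 → C3, IsFT g (fun ξ => monoSymbol α ξ • r ξ) ∧ LocallyIntegrable g ∧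
          ∀ᵐ x ∂(volume : Measure R3), ‖g x‖ ≤ ε * bracket t ^ (-3 + order α / n : ℝ) := by
  have h4 : ∀ α, order α ≤ n + 2 → derivNorm α 2 (Er t) ≤ rate ε t (delta (n + 1) 1) :=
    fun α hα => (derivNorm_le_sobolevNorm hα _).trans
      (le_add_self.trans (le_self_add.trans (H.bound_top 1 t ht)))
  have h5 : ∀ α, order α ≤ n + 2 → derivNorm α 2 (Er t) ≠ ⊤ := fun α hα =>
    ne_top_of_le_ne_top (rate_ne_top _ _ _) (h4 α hα)
  obtain ⟨g, hg, -⟩ := exists_isWeakDeriv (h5 0 (by simp [order]))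
  have hloc := hg.1
  have hm : MemLp (Er t) 2 (volume : Measure R3) := ⟨hloc.aestronglyMeasurable,
    (H.decay_rem t ht 2 (by norm_num)).trans_lt ENNReal.ofReal_lt_top⟩
  have hr := Lp.memLp (𝓕 (hm.toLp (Er t)) : Lp C3 2 (volume : Measure R3))
  refine ⟨_, isFT_toLp hm, hloc, hr, ?_, ?_, fun α h1 h2 => ?_⟩
  · have := eLpNorm_freq_pow_le (rate_ne_top _ _ _) hm (isFT_toLp hm)
      (hr.locallyIntegrable (by norm_num)) h4
    rw [rate, ← ENNReal.ofReal_mul (by positivity), delta_succ] at this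
    simpa using this
  · have h := H.decay_rem t ht ⊤ le_top
    rw [rate, recip_top] at h
    have := ae_norm_le_of_eLpNorm_top
      (mul_nonneg hε (Real.rpow_nonneg (bracket_pos t).le _)) h
    norm_num at this ⊢
    exact this
  · obtain ⟨g, g1, g2, g3⟩ := exists_weakDeriv_isFT (N := n + 2) hm (isFT_toLp hm) h5 α
      (h2.trans (by omega))
    refine ⟨g, g3, g1.2.1, ?_⟩
    have h := le_add_self.trans (H.decay_deriv 1 t ht ⊤ le_top α h1 (by simpa using h2))
    rw [← g1.eLpNorm_eq, rate, recip_top, delta_succ] at h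
    have := ae_norm_le_of_eLpNorm_top
      (mul_nonneg hε (Real.rpow_nonneg (bracket_pos t).le _)) h
    simpa using this

end IsOscillatoryElectricField

/-! ### Symbols of the normal form -/

section NormalFormSymbols

variable {F : Type*} [NormedAddCommGroup F] [InnerProductSpace ℂ F] [CompleteSpace F]

/-- Interpolation for inverse Fourier integrals, whose derivatives are bounded a priori. -/
theorem norm_iteratedFDeriv_fourierInv_interpolation {h : R3 → F} {N : ℕ}
    (hm : AEStronglyMeasurable h) (hi : Integrable fun ξ => freq ξ ^ N * ‖h ξ‖) {A B : ℝ}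
    (hA : 0 < A) (hB : 0 < B) (h0 : ∀ x, ‖𝓕⁻ h x‖ ≤ A)
    (hN : ∀ x, ‖iteratedFDeriv ℝ N (𝓕⁻ h) x‖ ≤ A * B ^ N) {j : ℕ} (hj : j ≤ N) (x : R3) :
    ‖iteratedFDeriv ℝ j (𝓕⁻ h) x‖ ≤ 3 ^ (N * N) * (A * B ^ j) := by
  refine (norm_iteratedFDeriv_le_of_interpolation (contDiff_fourierInv hm hi) hA hB h0 hN
    (fun k hk => ⟨_, fun x => norm_iteratedFDeriv_fourierInv_le hm hi hk x⟩) hj x).trans ?_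
  have : (3 : ℝ) ^ (j * (N - j)) ≤ 3 ^ (N * N) :=
    pow_le_pow_right₀ (by norm_num) (Nat.mul_le_mul hj (Nat.sub_le _ _))
  gcongr

/-- A sign, as a real number. -/
def sgn (σ : ℤˣ) : ℝ := ((σ : ℤ) : ℝ)

theorem sgn_mul_self (σ : ℤˣ) : sgn σ * sgn σ = 1 := by
  unfold sgn
  rcases Int.units_eq_one_or σ with h | h <;> simp [h]

theorem abs_sgn (σ : ℤˣ) : |sgn σ| = 1 := by
  unfold sgn
  rcases Int.units_eq_one_or σ with h | h <;> simp [h]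

theorem norm_sgn (σ : ℤˣ) : ‖(sgn σ : ℂ)‖ = 1 := by
  rw [Complex.norm_real, Real.norm_eq_abs, abs_sgn]

/-- The size `⟨k⟩ ± k·u` of the resonance function `λ_± + i k·u = ± i (⟨k⟩ ± k·u)`. -/
def gap (u : R3) (σ : ℤˣ) (ξ : R3) : ℝ := freq ξ + phase (sgn σ • u) ξ

theorem norm_sgn_smul (u : R3) (σ : ℤˣ) : ‖sgn σ • u‖ = ‖u‖ := by
  rw [norm_smul, Real.norm_eq_abs, abs_sgn, one_mul]

/-- The resonance function never vanishes, uniformly for velocities bounded away from the speed of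
light. -/
theorem gap_ge {w0 : ℝ} {u : R3} (hu : ‖u‖ ≤ w0) (σ : ℤˣ) (ξ : R3) :
    (1 - w0) * freq ξ ≤ gap u σ ξ :=
  freq_add_phase_ge (by rwa [norm_sgn_smul]) ξ

theorem gap_pos {u : R3} (hu : ‖u‖ < 1) (σ : ℤˣ) (ξ : R3) : 0 < gap u σ ξ :=
  (mul_pos (by linarith) (freq_pos ξ)).trans_le (gap_ge le_rfl σ ξ)

theorem gap_inv_le {w0 : ℝ} (hw : w0 < 1) {u : R3} (hu : ‖u‖ ≤ w0) (σ : ℤˣ) (ξ : R3) :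
    (gap u σ ξ)⁻¹ ≤ (1 - w0)⁻¹ * (freq ξ)⁻¹ := by
  rw [← mul_inv]
  exact inv_anti₀ (mul_pos (by linarith) (freq_pos ξ)) (gap_ge hu σ ξ)

theorem continuous_gap (u : R3) (σ : ℤˣ) : Continuous (gap u σ) :=
  continuous_freq.add (continuous_phase _)

/-- The resonance function `λ_± + i k·u` in terms of the gap. -/
theorem lam_add_phase (u : R3) (σ : ℤˣ) (ξ : R3) :
    lam σ ξ + Complex.I * (phase u ξ : ℂ) = Complex.I * sgn σ * (gap u σ ξ : ℂ) := by
  have h : phase (sgn σ • u) ξ = sgn σ * phase u ξ := by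
    unfold phase
    rw [real_inner_smul_left]
  have h2 : ((sgn σ : ℝ) : ℂ) * sgn σ = 1 := by rw [← Complex.ofReal_mul, sgn_mul_self]; simp
  unfold lam gap
  rw [h]
  have h3 : (((σ : ℤ)) : ℂ) = (sgn σ : ℂ) := by simp [sgn]
  rw [h3]
  push_cast
  linear_combination (-(Complex.I * phase u ξ)) * h2

/-- The symbol `h / (λ_± + i k·u)`. -/
def potSymbol (u : R3) (σ : ℤˣ) (h : R3 → F) (ξ : R3) : F :=
  (-(Complex.I * sgn σ)) • ((((gap u σ ξ)⁻¹ : ℝ) : ℂ) • h ξ)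

/-- The symbol `a_± i k h / (λ_± + i k·u)`. -/
def srcSymbol (u : R3) (σ : ℤˣ) (h : R3 → ℂ) (ξ : R3) : C3 :=
  WithLp.toLp 2 fun i => -(Complex.I / 2) •
    (((2 * Real.pi * ξ i * (freq ξ * gap u σ ξ)⁻¹ : ℝ) : ℂ) • h ξ)

theorem norm_potSymbol (u : R3) (hu : ‖u‖ < 1) (σ : ℤˣ) (h : R3 → F) (ξ : R3) :
    ‖potSymbol u σ h ξ‖ = (gap u σ ξ)⁻¹ * ‖h ξ‖ := by
  unfold potSymbol
  rw [norm_smul, norm_smul, norm_neg, norm_mul, Complex.norm_I, norm_sgn, Complex.norm_real,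
    Real.norm_of_nonneg (inv_nonneg.2 (gap_pos hu σ ξ).le)]
  ring

theorem norm_srcSymbol_le {w0 : ℝ} (hw : w0 < 1) {u : R3} (hu : ‖u‖ ≤ w0) (σ : ℤˣ) (h : R3 → ℂ)
    (ξ : R3) : ‖srcSymbol u σ h ξ‖ ≤ 2 * (1 - w0)⁻¹ * ((freq ξ)⁻¹ * ‖h ξ‖) := by
  have h1 : 0 < 1 - w0 := by linarith
  have hf := freq_pos ξ
  have hg := gap_pos (hu.trans_lt hw) σ ξ
  have hi : ∀ i : Fin 3, ‖srcSymbol u σ h ξ i‖ ≤ 1 / 2 * (1 - w0)⁻¹ * ((freq ξ)⁻¹ * ‖h ξ‖) := by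
    intro i
    change ‖-(Complex.I / 2) • (((2 * Real.pi * ξ i * (freq ξ * gap u σ ξ)⁻¹ : ℝ) : ℂ) • h ξ)‖ ≤ _
    rw [norm_smul, norm_smul, norm_neg, norm_div, Complex.norm_I, Complex.norm_real, norm_mul,
      mul_inv, norm_mul (freq ξ)⁻¹, Real.norm_of_nonneg (inv_nonneg.2 hf.le),
      Real.norm_of_nonneg (inv_nonneg.2 hg.le)]
    have h2 : ‖2 * Real.pi * ξ i‖ ≤ freq ξ := by
      refine le_trans ?_ (norm_two_pi_le_freq ξ)
      rw [norm_mul, Real.norm_of_nonneg (by positivity : (0 : ℝ) ≤ 2 * Real.pi)]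
      gcongr
      exact PiLp.norm_apply_le ξ i
    have h3 := gap_inv_le hw hu σ ξ
    calc 1 / ‖(2 : ℂ)‖ * (‖2 * Real.pi * ξ i‖ * ((freq ξ)⁻¹ * (gap u σ ξ)⁻¹) * ‖h ξ‖)
        ≤ 1 / ‖(2 : ℂ)‖ * (freq ξ * ((freq ξ)⁻¹ * ((1 - w0)⁻¹ * (freq ξ)⁻¹)) * ‖h ξ‖) := by gcongr
      _ = _ := by
        rw [mul_inv_cancel_left₀ hf.ne']
        norm_num
        ring
  refine (norm_C3_le _).trans ((Finset.sum_le_sum fun i _ => hi i).trans ?_)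
  rw [Finset.sum_const, Finset.card_univ, Fintype.card_fin, nsmul_eq_mul]
  have : 0 ≤ (1 - w0)⁻¹ * ((freq ξ)⁻¹ * ‖h ξ‖) := by positivity
  push_cast
  nlinarith

theorem aestronglyMeasurable_potSymbol (u : R3) (hu : ‖u‖ < 1) (σ : ℤˣ) {h : R3 → F}
    (hm : AEStronglyMeasurable h) : AEStronglyMeasurable (potSymbol u σ h) := by
  have hc : Continuous fun ξ => (((gap u σ ξ)⁻¹ : ℝ) : ℂ) :=
    Complex.continuous_ofReal.comp ((continuous_gap u σ).inv₀ fun ξ => (gap_pos hu σ ξ).ne')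
  exact (hc.aestronglyMeasurable.smul hm).const_smul (-(Complex.I * sgn σ))

theorem aestronglyMeasurable_srcSymbol (u : R3) (hu : ‖u‖ < 1) (σ : ℤˣ) {h : R3 → ℂ}
    (hm : AEStronglyMeasurable h) : AEStronglyMeasurable (srcSymbol u σ h) := by
  refine (PiLp.continuous_toLp 2 _).comp_aestronglyMeasurable ?_
  refine AEMeasurable.aestronglyMeasurable (aemeasurable_pi_iff.2 fun i => ?_)
  have hc : Continuous fun ξ : R3 => ((2 * Real.pi * ξ i * (freq ξ * gap u σ ξ)⁻¹ : ℝ) : ℂ) := by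
    refine Complex.continuous_ofReal.comp (Continuous.mul (by fun_prop) ?_)
    exact (continuous_freq.mul (continuous_gap u σ)).inv₀ fun ξ =>
      (mul_pos (freq_pos ξ) (gap_pos hu σ ξ)).ne'
  exact ((hc.aestronglyMeasurable.smul hm).const_smul (-(Complex.I / 2))).aemeasurable

/-- The kernel with symbol `a_± i k / (λ_± + i k·u)` is bounded on `L^∞`. -/
theorem norm_fourierInv_srcSymbol_le {g h : R3 → ℂ} (H : IsFT g h) {B : ℝ}
    (hB : ∀ᵐ x ∂(volume : Measure R3), ‖g x‖ ≤ B) (hl : AEStronglyMeasurable h volume)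
    (hi : Integrable (fun ξ => (freq ξ)⁻¹ * ‖h ξ‖)) {w0 : ℝ} (hw : w0 < 1) {u : R3}
    (hu : ‖u‖ ≤ w0) (σ : ℤˣ) (x : R3) :
    ‖𝓕⁻ (srcSymbol u σ h) x‖ ≤ (∑ i, |rieszConst w0 i|) * B := by
  have hB0 : 0 ≤ B := by
    obtain ⟨y, hy⟩ := hB.exists
    exact (norm_nonneg _).trans hy
  have hint : Integrable (srcSymbol u σ h) :=
    (hi.const_mul (2 * (1 - w0)⁻¹)).mono' (aestronglyMeasurable_srcSymbol u (hu.trans_lt hw) σ hl)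
      (Eventually.of_forall fun ξ => norm_srcSymbol_le hw hu σ h ξ)
  refine (norm_C3_le _).trans ?_
  rw [Finset.sum_mul]
  refine Finset.sum_le_sum fun i _ => ?_
  rw [fourierInv_apply_C3 hint]
  change ‖𝓕⁻ (fun ξ => -(Complex.I / 2) •
    (((2 * Real.pi * ξ i * (freq ξ * gap u σ ξ)⁻¹ : ℝ) : ℂ) • h ξ)) x‖ ≤ _
  rw [fourierInv_const_smul, norm_smul]
  have h1 := norm_fourierInv_riesz_le H hB hl hi hw (w := sgn σ • u) (by rwa [norm_sgn_smul]) i x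
  have h2 : ‖-(Complex.I / 2)‖ ≤ 1 := by
    rw [norm_neg, norm_div, Complex.norm_I]; norm_num
  calc _ ≤ 1 * (rieszConst w0 i * B) := by
        gcongr
        exact h1
    _ ≤ _ := by
        rw [one_mul]; gcongr; exact le_abs_self _

/-- Division by the resonance function is bounded on bounded functions. -/
theorem norm_fourierInv_potSymbol_le {g h : R3 → F} (H : IsFT g h) {B : ℝ}
    (hB : ∀ᵐ x ∂(volume : Measure R3), ‖g x‖ ≤ B) (hl : AEStronglyMeasurable h volume)
    (hi : Integrable (fun ξ => (freq ξ)⁻¹ * ‖h ξ‖)) {w0 : ℝ} (hw : w0 < 1) {u : R3}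
    (hu : ‖u‖ ≤ w0) (σ : ℤˣ) (x : R3) :
    ‖𝓕⁻ (potSymbol u σ h) x‖ ≤ |resolventConst w0| * B := by
  have hB0 : 0 ≤ B := by
    obtain ⟨y, hy⟩ := hB.exists
    exact (norm_nonneg _).trans hy
  change ‖𝓕⁻ (fun ξ => (-(Complex.I * sgn σ)) • ((((gap u σ ξ)⁻¹ : ℝ) : ℂ) • h ξ)) x‖ ≤ _
  rw [fourierInv_const_smul, norm_smul, norm_neg, norm_mul, Complex.norm_I, norm_sgn, one_mul,
    one_mul]
  refine (norm_fourierInv_resolvent_le H hB hl hi hw (w := sgn σ • u)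
    (by rwa [norm_sgn_smul]) x).trans ?_
  gcongr
  exact le_abs_self _

theorem monoSymbol_smul_srcSymbol (α : Fin 3 → ℕ) (u : R3) (σ : ℤˣ) (h : R3 → ℂ) (ξ : R3) :
    monoSymbol α ξ • srcSymbol u σ h ξ = srcSymbol u σ (fun ξ => monoSymbol α ξ • h ξ) ξ := by
  refine PiLp.ext fun i => ?_
  simp only [srcSymbol, PiLp.smul_apply, smul_eq_mul]
  ring

theorem norm_monoSymbol_le (α : Fin 3 → ℕ) (ξ : R3) : ‖monoSymbol α ξ‖ ≤ freq ξ ^ order α := by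
  unfold monoSymbol order
  rw [norm_prod, ← Finset.prod_pow_eq_pow_sum]
  refine Finset.prod_le_prod (fun i _ => norm_nonneg _) fun i _ => ?_
  rw [norm_pow]
  refine pow_le_pow_left₀ (norm_nonneg _) (le_trans ?_ (norm_two_pi_le_freq ξ)) _
  simp only [norm_mul, Complex.norm_I, Complex.norm_real, mul_one, Complex.norm_ofNat,
    Real.norm_of_nonneg Real.pi_pos.le]
  have := PiLp.norm_apply_le ξ i
  gcongr

end NormalFormSymbols

/-! ### Potential and remainder of the normal form -/

section NormalForm

/-- The potential `Φ = ∑_± φ_±` of the normal form, `φ̂_± = Ê_±^{osc} / (λ_± + i k·u)`. -/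
def potential (u : R3) (S₀ : ℤˣ → Lp ℂ 2 (volume : Measure R3)) (S : ℤˣ → ℝ → R3 → ℂ)
    (t : ℝ) (x : R3) : C3 :=
  ∑ σ, 𝓕⁻ (potSymbol u σ (oscSymbol σ (S₀ σ) (S σ) t)) x

/-- The continuous representative of the oscillatory field. -/
def oscRep (S₀ : ℤˣ → Lp ℂ 2 (volume : Measure R3)) (S : ℤˣ → ℝ → R3 → ℂ)
    (t : ℝ) (x : R3) : C3 :=
  ∑ σ, 𝓕⁻ (oscSymbol σ (S₀ σ) (S σ) t) x

/-- The source term of the normal form: the part of the time derivative of the potential that comes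
from the source `S` of the oscillatory field. -/
def srcTerm (u : R3) (S : ℤˣ → ℝ → R3 → ℂ) (t : ℝ) (x : R3) : C3 :=
  ∑ σ, 𝓕⁻ (srcSymbol u σ (𝓕 (S σ t))) x

/-- The part of the field that is not absorbed by the potential: the regular field minus the
source term. -/
def remainder (u : R3) (S₀ : ℤˣ → Lp ℂ 2 (volume : Measure R3)) (S : ℤˣ → ℝ → R3 → ℂ)
    (E : ℝ → R3 → R3) (t : ℝ) (x : R3) : C3 :=
  complexify (E t x) - oscRep S₀ S t x - srcTerm u S t x

/-- The growth exponent per derivative of the potential: `n + 1` derivatives lead from the decay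
`⟨t⟩^{-3/2}` of the potential to the growth `⟨t⟩^{1/n}` of its top derivative. -/
def growthExp (n : ℕ) : ℝ := (3 / 2 + 1 / n) / (n + 1)

/-- The constant in the bounds of the potential and of the remainder. -/
def normalFormConst (w0 : ℝ) (n : ℕ) : ℝ :=
  6 * 3 ^ ((n + 1) * (n + 1)) * (1 + |resolventConst w0| + (∑ i, |rieszConst w0 i|) * 3 ^ n +
    3 ^ n + (1 + (1 - w0)⁻¹) * weightConst * 4 ^ (n + 3))

theorem weightConst_nonneg : 0 ≤ weightConst := ENNReal.toReal_nonneg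

namespace IsOscillatoryElectricField

variable {n : ℕ} {ε T : ℝ} {S₀ : ℤˣ → Lp ℂ 2 (volume : Measure R3)} {S : ℤˣ → ℝ → R3 → ℂ}
  {Eosc : ℤˣ → ℝ → R3 → C3} {Er : ℝ → R3 → C3} {E : ℝ → R3 → R3}

theorem osc_integrable (H : IsOscillatoryElectricField (n + 1) ε T S₀ S Eosc Er E) (hε : 0 ≤ ε)
    (σ : ℤˣ) {t : ℝ} (ht : t ∈ Icc 0 T) :
    Integrable (fun ξ => freq ξ ^ n * ‖oscSymbol σ (S₀ σ) (S σ) t ξ‖) ∧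
      ∫ ξ, freq ξ ^ n * ‖oscSymbol σ (S₀ σ) (S σ) t ξ‖ ≤
        weightConst * (4 ^ (n + 3) * (ε * bracket t ^ (1 / n : ℝ))) :=
  integrable_freq_pow_of_eLpNorm
    (mul_nonneg (by positivity) (mul_nonneg hε (Real.rpow_nonneg (bracket_pos t).le _)))
    (H.isFT_osc σ ht).2.2.1 (H.osc_weight σ ht)

theorem integrable_inv_freq {F : Type*} [NormedAddCommGroup F] [InnerProductSpace ℂ F]
    {h : R3 → F} (hh : Integrable h) : Integrable fun ξ => (freq ξ)⁻¹ * ‖h ξ‖ := by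
  have hc : Continuous fun ξ => (freq ξ)⁻¹ := continuous_freq.inv₀ fun ξ => (freq_pos ξ).ne'
  refine hh.norm.mono' (hc.aestronglyMeasurable.mul hh.1.norm) (Eventually.of_forall fun ξ => ?_)
  have := freq_pos ξ
  rw [Real.norm_of_nonneg (by positivity)]
  exact mul_le_of_le_one_left (norm_nonneg _) (inv_le_one_of_one_le₀ (one_le_freq ξ))

/-- Division by the resonance function gains one derivative over `osc_integrable`. -/
theorem potSymbol_integrable (H : IsOscillatoryElectricField (n + 1) ε T S₀ S Eosc Er E)
    (hε : 0 ≤ ε) (σ : ℤˣ) {t : ℝ} (ht : t ∈ Icc 0 T) {w0 : ℝ} (hw : w0 < 1) {u : R3}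
    (hu : ‖u‖ ≤ w0) :
    AEStronglyMeasurable (potSymbol u σ (oscSymbol σ (S₀ σ) (S σ) t)) ∧
    Integrable (fun ξ => freq ξ ^ (n + 1) * ‖potSymbol u σ (oscSymbol σ (S₀ σ) (S σ) t) ξ‖) ∧
      ∫ ξ, freq ξ ^ (n + 1) * ‖potSymbol u σ (oscSymbol σ (S₀ σ) (S σ) t) ξ‖ ≤
        (1 - w0)⁻¹ * (weightConst * (4 ^ (n + 3) * (ε * bracket t ^ (1 / n : ℝ)))) := by
  have hm := aestronglyMeasurable_potSymbol u (hu.trans_lt hw) σ (H.isFT_osc σ ht).2.2.1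
  obtain ⟨h1, h2⟩ := H.osc_integrable hε σ ht
  have hle : ∀ ξ, freq ξ ^ (n + 1) * ‖potSymbol u σ (oscSymbol σ (S₀ σ) (S σ) t) ξ‖ ≤
      (1 - w0)⁻¹ * (freq ξ ^ n * ‖oscSymbol σ (S₀ σ) (S σ) t ξ‖) := fun ξ => by
    have hf := freq_pos ξ
    rw [norm_potSymbol u (hu.trans_lt hw)]
    calc _ ≤ freq ξ ^ (n + 1) * ((1 - w0)⁻¹ * (freq ξ)⁻¹ * ‖oscSymbol σ (S₀ σ) (S σ) t ξ‖) := by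
          gcongr; exact gap_inv_le hw hu σ ξ
      _ = _ := by field_simp; ring
  have hi : Integrable
      (fun ξ => freq ξ ^ (n + 1) * ‖potSymbol u σ (oscSymbol σ (S₀ σ) (S σ) t) ξ‖) := by
    refine (h1.const_mul (1 - w0)⁻¹).mono'
      ((continuous_freq.pow _).aestronglyMeasurable.mul hm.norm) (Eventually.of_forall fun ξ => ?_)
    have := freq_pos ξ
    rw [Real.norm_of_nonneg (by positivity)]
    exact hle ξ
  refine ⟨hm, hi, (integral_mono hi (h1.const_mul _) hle).trans ?_⟩
  rw [integral_const_mul]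
  have : 0 ≤ (1 - w0)⁻¹ := inv_nonneg.2 (by linarith)
  gcongr

theorem srcSymbol_integrable (hn : 1 ≤ n)
    (H : IsOscillatoryElectricField (n + 1) ε T S₀ S Eosc Er E)
    (hε : 0 ≤ ε) (σ : ℤˣ) {t : ℝ} (ht : t ∈ Icc 0 T) {w0 : ℝ} (hw : w0 < 1) {u : R3}
    (hu : ‖u‖ ≤ w0) :
    AEStronglyMeasurable (srcSymbol u σ (𝓕 (S σ t))) ∧
    Integrable (fun ξ => freq ξ ^ n * ‖srcSymbol u σ (𝓕 (S σ t)) ξ‖) ∧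
    Integrable (fun ξ => freq ξ ^ (n - 1) * ‖𝓕 (S σ t) ξ‖) ∧
    ∫ ξ, freq ξ ^ n * ‖srcSymbol u σ (𝓕 (S σ t)) ξ‖ ≤
      2 * (1 - w0)⁻¹ * (weightConst * (4 ^ (n + 2) * (ε * bracket t ^ (1 / n : ℝ)))) := by
  obtain ⟨m, rfl⟩ : ∃ m, n = m + 1 := ⟨n - 1, by omega⟩
  have hc := (H.isFT_source σ ht).2.aestronglyMeasurable (μ := (volume : Measure R3))
  have hm := aestronglyMeasurable_srcSymbol u (hu.trans_lt hw) σ hc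
  obtain ⟨h1, h2⟩ := integrable_freq_pow_of_eLpNorm (N := m)
    (mul_nonneg (by positivity) (mul_nonneg hε (Real.rpow_nonneg (bracket_pos t).le _)))
    hc (H.source_weight σ ht)
  have hle : ∀ ξ, freq ξ ^ (m + 1) * ‖srcSymbol u σ (𝓕 (S σ t)) ξ‖ ≤
      2 * (1 - w0)⁻¹ * (freq ξ ^ m * ‖𝓕 (S σ t) ξ‖) := fun ξ => by
    have hf := freq_pos ξ
    calc _ ≤ freq ξ ^ (m + 1) * (2 * (1 - w0)⁻¹ * ((freq ξ)⁻¹ * ‖𝓕 (S σ t) ξ‖)) := by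
          gcongr; exact norm_srcSymbol_le hw hu σ _ ξ
      _ = _ := by field_simp; ring
  have hi : Integrable (fun ξ => freq ξ ^ (m + 1) * ‖srcSymbol u σ (𝓕 (S σ t)) ξ‖) := by
    refine (h1.const_mul (2 * (1 - w0)⁻¹)).mono'
      ((continuous_freq.pow _).aestronglyMeasurable.mul hm.norm) (Eventually.of_forall fun ξ => ?_)
    have := freq_pos ξ
    rw [Real.norm_of_nonneg (by positivity)]
    exact hle ξ
  refine ⟨hm, hi, h1, (integral_mono hi (h1.const_mul _) hle).trans ?_⟩
  rw [integral_const_mul]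
  have : 0 ≤ (1 - w0)⁻¹ := inv_nonneg.2 (by linarith)
  gcongr

/-- The field minus the continuous representative of its oscillatory part is the continuous
representative of the regular field, and has its symbol. -/
theorem exists_rem (H : IsOscillatoryElectricField (n + 1) ε T S₀ S Eosc Er E) (hε : 0 ≤ ε)
    {t : ℝ} (ht : t ∈ Icc 0 T) : ∃ r : R3 → C3,
      (∀ x, complexify (E t x) - oscRep S₀ S t x = 𝓕⁻ r x) ∧ AEStronglyMeasurable r ∧
      eLpNorm (fun ξ => freq ξ ^ (n + 2) • r ξ) 2 volume ≤
        ENNReal.ofReal (4 ^ (n + 3) * (ε * bracket t ^ (1 / n : ℝ))) ∧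
      Integrable (fun ξ => freq ξ ^ n * ‖r ξ‖) ∧
      (∀ x, ‖𝓕⁻ r x‖ ≤ ε * bracket t ^ (-3 : ℝ)) ∧
      ∀ α : Fin 3 → ℕ, 1 ≤ order α → order α ≤ n → ∀ x,
        ‖𝓕⁻ (fun ξ => monoSymbol α ξ • r ξ) x‖ ≤ ε * bracket t ^ (-3 + order α / n : ℝ) := by
  obtain ⟨r, h1, h2, h3, h4, h5, h6⟩ := H.exists_rem_symbol hε ht
  obtain ⟨hi, -⟩ := integrable_freq_pow_of_eLpNorm (N := n)
    (mul_nonneg (by positivity) (mul_nonneg hε (Real.rpow_nonneg (bracket_pos t).le _))) h3.1 h4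
  have hr : Integrable r := integrable_of_freq_pow h3.1 hi
  refine ⟨r, ?_, h3.1, h4, hi, h1.norm_fourierInv_le h2 hr h5, fun α ha hb => ?_⟩
  · have hEc : Continuous fun x => E t x := by
      have := H.continuous_field.comp (f := fun x : R3 => (t, x))
        (continuous_const.prodMk continuous_id).continuousOn (s := univ)
        (fun x _ => ⟨ht, mem_univ x⟩)
      exact continuousOn_univ.1 this
    have hoi : ∀ σ, Integrable (oscSymbol σ (S₀ σ) (S σ) t) := fun σ =>
      integrable_of_freq_pow (H.isFT_osc σ ht).2.2.1 (H.osc_integrable hε σ ht).1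
    have hoc : Continuous (oscRep S₀ S t) :=
      continuous_finsetSum _ fun σ _ => continuous_fourierInv (hoi σ)
    have hcl : Continuous fun x => complexify (E t x) - oscRep S₀ S t x :=
      (complexify.continuous.comp hEc).sub hoc
    have hae : (fun x => complexify (E t x) - oscRep S₀ S t x) =ᵐ[volume] 𝓕⁻ r := by
      have e1 := h1.eq_fourierInv h2 hr
      have e2 : ∀ σ, Eosc σ t =ᵐ[volume] 𝓕⁻ (oscSymbol σ (S₀ σ) (S σ) t) := fun σ =>
        (H.isFT_osc σ ht).2.1.eq_fourierInv ((H.isFT_osc σ ht).1.locallyIntegrable (by norm_num))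
          (hoi σ)
      have e3 := ae_all_iff.2 e2
      filter_upwards [e1, e3] with x hx1 hx2
      have : complexify (E t x) = oscRep S₀ S t x + 𝓕⁻ r x := by
        refine PiLp.ext fun i => ?_
        rw [complexify_apply, H.decomposition t ht x i, hx1]
        unfold oscRep
        rw [PiLp.add_apply]
        congr 1
        rw [WithLp.ofLp_sum, Finset.sum_apply]
        exact Finset.sum_congr rfl fun σ _ => by rw [hx2 σ]
      rw [this, add_sub_cancel_left]
    exact fun x => congrFun (hcl.ae_eq_iff_eq volume (continuous_fourierInv hr) |>.1 hae) x
  · obtain ⟨g, g1, g2, g3⟩ := h6 α ha hb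
    refine g1.norm_fourierInv_le g2 ?_ g3
    refine (integrable_freq_pow_mul h3.1 hi hb).mono'
      ((continuous_monoSymbol α).aestronglyMeasurable.smul h3.1) (Eventually.of_forall fun ξ => ?_)
    rw [norm_smul]
    gcongr
    exact norm_monoSymbol_le α ξ

/-- The potential decays like `⟨t⟩^{-3/2}`, its derivative of order `n + 1` is controlled by the
`H^{α₀+1}` norm of the field with growth `⟨t⟩^{1/n}`, and the orders in between are interpolated. -/
theorem potential_bounds (H : IsOscillatoryElectricField (n + 1) ε T S₀ S Eosc Er E)
    (hε : 0 < ε) {t : ℝ} (ht : t ∈ Icc 0 T) {w0 : ℝ} (hw : w0 < 1) {u : R3} (hu : ‖u‖ ≤ w0) :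
    ContDiff ℝ (n + 1 : ℕ) (potential u S₀ S t) ∧ ∀ j ≤ n + 1, ∀ x,
      ‖iteratedFDeriv ℝ j (potential u S₀ S t) x‖ ≤
        normalFormConst w0 n * ε * bracket t ^ (-(3 / 2) + j * growthExp n : ℝ) := by
  have hb := bracket_pos t
  have h10 : 0 < 1 - w0 := by linarith
  have hwc := weightConst_nonneg
  set K : ℝ := 1 + |resolventConst w0| + (1 - w0)⁻¹ * weightConst * 4 ^ (n + 3) with hK
  have hKpos : 0 < K := by positivity
  have hmu : (n + 1 : ℝ) * growthExp n = 3 / 2 + 1 / n := by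
    unfold growthExp; field_simp
  set A : ℝ := K * (ε * bracket t ^ (-(3 / 2) : ℝ)) with hA
  -- `B` is chosen such that `A * B ^ (n + 1)` grows like `⟨t⟩^{1/n}`
  set B : ℝ := bracket t ^ growthExp n with hB
  have hBj : ∀ j : ℕ, A * B ^ j = K * ε * bracket t ^ (-(3 / 2) + j * growthExp n : ℝ) := fun j => by
    rw [hA, hB, ← Real.rpow_natCast, ← Real.rpow_mul hb.le, Real.rpow_add hb, mul_comm (j : ℝ)]
    ring
  have hone : ∀ σ, ContDiff ℝ (n + 1 : ℕ) (𝓕⁻ (potSymbol u σ (oscSymbol σ (S₀ σ) (S σ) t))) ∧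
      ∀ j ≤ n + 1, ∀ x,
        ‖iteratedFDeriv ℝ j (𝓕⁻ (potSymbol u σ (oscSymbol σ (S₀ σ) (S σ) t))) x‖ ≤
          3 ^ ((n + 1) * (n + 1)) * (A * B ^ j) := fun σ => by
    obtain ⟨hm, hi, hle⟩ := H.potSymbol_integrable hε.le σ ht hw hu
    have hoi := integrable_of_freq_pow (H.isFT_osc σ ht).2.2.1 (H.osc_integrable hε.le σ ht).1
    refine ⟨contDiff_fourierInv hm hi, fun j hj x => ?_⟩
    refine norm_iteratedFDeriv_fourierInv_interpolation hm hi (by positivity) (by positivity)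
      (fun y => ?_) (fun y => ?_) hj x
    · refine (norm_fourierInv_potSymbol_le (H.isFT_osc σ ht).2.1 (H.osc_bound hε.le σ ht)
        (H.isFT_osc σ ht).2.2.1 (integrable_inv_freq hoi) hw hu σ y).trans ?_
      rw [hA]
      gcongr
      rw [hK]
      have : 0 ≤ (1 - w0)⁻¹ * weightConst * 4 ^ (n + 3) := by positivity
      linarith
    · refine (norm_iteratedFDeriv_fourierInv_le hm hi le_rfl y).trans (hle.trans ?_)
      rw [hBj]
      push_cast
      rw [hmu, show -(3 / 2) + (3 / 2 + 1 / (n : ℝ)) = 1 / n by ring]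
      calc (1 - w0)⁻¹ * (weightConst * (4 ^ (n + 3) * (ε * bracket t ^ (1 / n : ℝ))))
          = ((1 - w0)⁻¹ * weightConst * 4 ^ (n + 3)) * ε * bracket t ^ (1 / n : ℝ) := by ring
        _ ≤ _ := by
          gcongr
          rw [hK]
          have := abs_nonneg (resolventConst w0)
          linarith
  refine ⟨ContDiff.sum fun σ _ => (hone σ).1, fun j hj x => ?_⟩
  have hsum : iteratedFDeriv ℝ j (potential u S₀ S t) x =
      ∑ σ, iteratedFDeriv ℝ j (𝓕⁻ (potSymbol u σ (oscSymbol σ (S₀ σ) (S σ) t))) x :=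
    iteratedFDeriv_fun_sum_apply fun σ _ =>
      ((hone σ).1.of_le (by exact_mod_cast hj)).contDiffAt
  rw [hsum]
  refine (norm_sum_le _ _).trans ((Finset.sum_le_sum fun σ _ => (hone σ).2 j hj x).trans ?_)
  rw [hBj, Finset.sum_const, Finset.card_univ, Fintype.card_units_int, nsmul_eq_mul]
  have hKN : ((2 : ℕ) : ℝ) * 3 ^ ((n + 1) * (n + 1)) * K ≤ normalFormConst w0 n := by
    unfold normalFormConst
    have h1 : 0 ≤ (∑ i, |rieszConst w0 i|) * 3 ^ n :=
      mul_nonneg (Finset.sum_nonneg fun _ _ => abs_nonneg _) (by positivity)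
    have h2 : (0 : ℝ) ≤ 3 ^ n := by positivity
    have h3 : 0 ≤ weightConst * 4 ^ (n + 3) := by positivity
    have : K ≤ 1 + |resolventConst w0| + (∑ i, |rieszConst w0 i|) * 3 ^ n +
        3 ^ n + (1 + (1 - w0)⁻¹) * weightConst * 4 ^ (n + 3) := by rw [hK]; nlinarith
    calc _ ≤ 6 * 3 ^ ((n + 1) * (n + 1)) * K := by
          push_cast
          gcongr
          norm_num
      _ ≤ _ := by gcongr
  calc _ = ((2 : ℕ) : ℝ) * 3 ^ ((n + 1) * (n + 1)) * K * ε *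
        bracket t ^ (-(3 / 2) + j * growthExp n : ℝ) := by ring
    _ ≤ _ := by gcongr

/-- The remainder decays like `⟨t⟩^{-3}`, which is integrable, and loses `⟨t⟩^{1/n}` with each
derivative. -/
theorem remainder_bounds (hn : 1 ≤ n)
    (H : IsOscillatoryElectricField (n + 1) ε T S₀ S Eosc Er E)
    (hε : 0 < ε) {t : ℝ} (ht : t ∈ Icc 0 T) {w0 : ℝ} (hw : w0 < 1) {u : R3} (hu : ‖u‖ ≤ w0) :
    ContDiff ℝ n (remainder u S₀ S E t) ∧ ∀ j ≤ n, ∀ x,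
      ‖iteratedFDeriv ℝ j (remainder u S₀ S E t) x‖ ≤
        normalFormConst w0 n * ε * bracket t ^ (-3 + j * (1 / n) : ℝ) := by
  have hb := bracket_pos t
  have hn0 : (0 : ℝ) < n := by exact_mod_cast hn
  have hrz : 0 ≤ ∑ i, |rieszConst w0 i| := Finset.sum_nonneg fun _ _ => abs_nonneg _
  set K : ℝ := 1 + (∑ i, |rieszConst w0 i|) * 3 ^ n + 3 ^ n with hK
  have hKpos : 0 < K := by positivity
  set A : ℝ := K * (ε * bracket t ^ (-3 : ℝ)) with hA
  set B : ℝ := bracket t ^ (1 / n : ℝ) with hB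
  have hBj : ∀ j : ℕ, A * B ^ j = K * ε * bracket t ^ (-3 + j * (1 / n) : ℝ) := fun j => by
    rw [hA, hB, ← Real.rpow_natCast, ← Real.rpow_mul hb.le, Real.rpow_add hb, mul_comm (j : ℝ)]
    ring
  have hone3 : (1 : ℝ) ≤ 3 ^ n := one_le_pow₀ (by norm_num)
  have hpow : (-3 + (n : ℝ) * (1 / n)) = -3 + (n : ℝ) / n := by field_simp
  have hsrc : ∀ σ, ContDiff ℝ n (𝓕⁻ (srcSymbol u σ (𝓕 (S σ t)))) ∧ ∀ j ≤ n, ∀ x,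
        ‖iteratedFDeriv ℝ j (𝓕⁻ (srcSymbol u σ (𝓕 (S σ t)))) x‖ ≤
          3 ^ (n * n) * (A * B ^ j) := fun σ => by
    obtain ⟨hm, hi, hi2, -⟩ := H.srcSymbol_integrable hn hε.le σ ht hw hu
    have hc := (H.isFT_source σ ht).2.aestronglyMeasurable (μ := (volume : Measure R3))
    have hSi : Integrable (𝓕 (S σ t)) := integrable_of_freq_pow hc hi2
    refine ⟨contDiff_fourierInv hm hi, fun j hj x => ?_⟩
    refine norm_iteratedFDeriv_fourierInv_interpolation hm hi (by positivity) (by positivity)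
      (fun y => ?_) (fun y => ?_) hj x
    · refine (norm_fourierInv_srcSymbol_le (H.isFT_source σ ht).1 (H.source_bound hε.le σ ht)
        hc (integrable_inv_freq hSi) hw hu σ y).trans ?_
      rw [hA]
      gcongr
      rw [hK]
      nlinarith
    · refine (norm_iteratedFDeriv_fourierInv_le_of_monoSymbol hm hi y
        (B := (∑ i, |rieszConst w0 i|) * (ε * bracket t ^ (-3 + (n : ℝ) / n))) fun α hα => ?_).trans ?_
      · obtain ⟨g, g1, g2, g3⟩ := H.source_deriv hε.le σ ht α (by omega) (by omega)
        simp_rw [monoSymbol_smul_srcSymbol]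
        rw [hα] at g3
        refine norm_fourierInv_srcSymbol_le g1 g3
          ((continuous_monoSymbol α).aestronglyMeasurable.smul hc) ?_ hw hu σ y
        refine hi2.mono' ?_ (Eventually.of_forall fun ξ => ?_)
        · have hcf : Continuous fun ξ => (freq ξ)⁻¹ :=
            continuous_freq.inv₀ fun ξ => (freq_pos ξ).ne'
          exact hcf.aestronglyMeasurable.mul
            ((continuous_monoSymbol α).aestronglyMeasurable.smul hc).norm
        · have hf := freq_pos ξ
          rw [Real.norm_of_nonneg (by positivity), norm_smul]
          obtain ⟨m, rfl⟩ : ∃ m, n = m + 1 := ⟨n - 1, by omega⟩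
          calc _ ≤ (freq ξ)⁻¹ * (freq ξ ^ (m + 1) * ‖𝓕 (S σ t) ξ‖) := by
                gcongr; rw [← hα]; exact norm_monoSymbol_le α ξ
            _ = _ := by rw [Nat.add_sub_cancel, pow_succ]; field_simp
      · rw [hBj, hpow]
        calc _ = ((∑ i, |rieszConst w0 i|) * 3 ^ n) * ε * bracket t ^ (-3 + (n : ℝ) / n) := by ring
          _ ≤ _ := by
            gcongr
            rw [hK]
            linarith
  obtain ⟨r, r1, r2, r3, r4, r5, r6⟩ := H.exists_rem hε.le ht
  have hrem : ContDiff ℝ n (𝓕⁻ r) ∧ ∀ j ≤ n, ∀ x,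
      ‖iteratedFDeriv ℝ j (𝓕⁻ r) x‖ ≤ 3 ^ (n * n) * (A * B ^ j) := by
    refine ⟨contDiff_fourierInv r2 r4, fun j hj x => ?_⟩
    refine norm_iteratedFDeriv_fourierInv_interpolation r2 r4 (by positivity) (by positivity)
      (fun y => ?_) (fun y => ?_) hj x
    · refine (r5 y).trans ?_
      rw [hA]
      refine le_mul_of_one_le_left (by positivity) ?_
      rw [hK]
      nlinarith
    · refine (norm_iteratedFDeriv_fourierInv_le_of_monoSymbol r2 r4 y fun α hα =>
        (r6 α (by omega) (by omega) y).trans_eq (by rw [hα])).trans ?_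
      rw [hBj, hpow]
      calc _ = 3 ^ n * ε * bracket t ^ (-3 + (n : ℝ) / n) := by ring
        _ ≤ _ := by
          gcongr
          rw [hK]
          nlinarith
  have hfun : remainder u S₀ S E t = fun x => 𝓕⁻ r x - srcTerm u S t x := by
    funext x
    rw [remainder, r1]
  have hsc : ContDiff ℝ n (srcTerm u S t) := ContDiff.sum fun σ _ => (hsrc σ).1
  rw [hfun]
  refine ⟨hrem.1.sub hsc, fun j hj x => ?_⟩
  have hj' : ((j : ℕ) : WithTop ℕ∞) ≤ n := by exact_mod_cast hj
  have hsum : iteratedFDeriv ℝ j (srcTerm u S t) x =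
      ∑ σ, iteratedFDeriv ℝ j (𝓕⁻ (srcSymbol u σ (𝓕 (S σ t)))) x :=
    iteratedFDeriv_fun_sum_apply fun σ _ => ((hsrc σ).1.of_le hj').contDiffAt
  have hsub : iteratedFDeriv ℝ j (fun x => 𝓕⁻ r x - srcTerm u S t x) x =
      iteratedFDeriv ℝ j (𝓕⁻ r) x - iteratedFDeriv ℝ j (srcTerm u S t) x :=
    iteratedFDeriv_sub_apply (hrem.1.of_le hj').contDiffAt (hsc.of_le hj').contDiffAt
  rw [hsub, hsum]
  have h2 : ‖∑ σ, iteratedFDeriv ℝ j (𝓕⁻ (srcSymbol u σ (𝓕 (S σ t)))) x‖ ≤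
      2 * (3 ^ (n * n) * (A * B ^ j)) := by
    refine (norm_sum_le _ _).trans ((Finset.sum_le_sum fun σ _ => (hsrc σ).2 j hj x).trans ?_)
    rw [Finset.sum_const, Finset.card_univ, Fintype.card_units_int, nsmul_eq_mul]
    norm_num
  refine (norm_sub_le _ _).trans ((add_le_add (hrem.2 j hj x) h2).trans ?_)
  rw [hBj]
  have hKN : 3 * 3 ^ (n * n) * K ≤ normalFormConst w0 n := by
    unfold normalFormConst
    have h3 : 0 ≤ weightConst * 4 ^ (n + 3) := mul_nonneg weightConst_nonneg (by positivity)
    have h4 : 0 ≤ (1 + (1 - w0)⁻¹) * (weightConst * 4 ^ (n + 3)) :=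
      mul_nonneg (by have : 0 ≤ (1 - w0)⁻¹ := inv_nonneg.2 (by linarith)
                     linarith) h3
    have h5 := abs_nonneg (resolventConst w0)
    have : K ≤ 1 + |resolventConst w0| + (∑ i, |rieszConst w0 i|) * 3 ^ n +
        3 ^ n + (1 + (1 - w0)⁻¹) * weightConst * 4 ^ (n + 3) := by rw [hK]; linarith
    have h6 : (3 : ℝ) ^ (n * n) ≤ 3 ^ ((n + 1) * (n + 1)) :=
      pow_le_pow_right₀ (by norm_num) (by nlinarith)
    calc _ ≤ 6 * 3 ^ ((n + 1) * (n + 1)) * K := by gcongr; norm_num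
      _ ≤ _ := by gcongr
  calc _ = 3 * 3 ^ (n * n) * K * ε * bracket t ^ (-3 + j * (1 / n) : ℝ) := by ring
    _ ≤ _ := by gcongr

end IsOscillatoryElectricField
end NormalForm

/-! ### The normal form identity at a fixed frequency -/

section NormalFormIdentity

/-- The vector `a_± i k / (λ_± + i k·u)`. -/
def kernelVec (u : R3) (σ : ℤˣ) (ξ : R3) : C3 :=
  WithLp.toLp 2 fun i => -(Complex.I / 2) * ((2 * Real.pi * ξ i * (freq ξ * gap u σ ξ)⁻¹ : ℝ) : ℂ)

theorem srcSymbol_eq (u : R3) (σ : ℤˣ) (h : R3 → ℂ) (ξ : R3) :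
    srcSymbol u σ h ξ = h ξ • kernelVec u σ ξ := by
  refine PiLp.ext fun i => ?_
  simp only [srcSymbol, kernelVec, PiLp.smul_apply, smul_eq_mul]
  ring

theorem sgn_coe (σ : ℤˣ) : (((σ : ℤ)) : ℂ) = (sgn σ : ℂ) := by simp [sgn]

theorem sgn_coe_mul_self (σ : ℤˣ) : ((sgn σ : ℝ) : ℂ) * sgn σ = 1 := by
  rw [← Complex.ofReal_mul, sgn_mul_self]; simp

/-- The symbol of the oscillatory field contains the resonance function as a factor. -/
theorem oscSymbol_eq {u : R3} (hu : ‖u‖ < 1) (σ : ℤˣ) (S₀ : Lp ℂ 2 (volume : Measure R3))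
    (S : ℝ → R3 → ℂ) (t : ℝ) (ξ : R3) :
    oscSymbol σ S₀ S t ξ = ((lam σ ξ + Complex.I * (phase u ξ : ℂ)) *
      (Complex.exp (lam σ ξ * t) * profile σ S₀ S t ξ)) • kernelVec u σ ξ := by
  have hg : (gap u σ ξ : ℂ) ≠ 0 := by exact_mod_cast (gap_pos hu σ ξ).ne'
  have hf : (freq ξ : ℂ) ≠ 0 := by exact_mod_cast (freq_pos ξ).ne'
  rw [lam_add_phase]
  refine PiLp.ext fun i => ?_
  rw [oscSymbol_eq_profile]
  simp only [kernelVec, PiLp.smul_apply, smul_eq_mul, amp, sgn_coe]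
  push_cast
  field_simp

/-- The symbol of the potential: a phase times the interaction picture amplitude, times a vector
that is constant in time. -/
theorem potSymbol_osc_eq {u : R3} (hu : ‖u‖ < 1) (σ : ℤˣ) (S₀ : Lp ℂ 2 (volume : Measure R3))
    (S : ℝ → R3 → ℂ) (t : ℝ) (ξ : R3) :
    potSymbol u σ (oscSymbol σ S₀ S t) ξ =
      (Complex.exp (lam σ ξ * t) * profile σ S₀ S t ξ) • kernelVec u σ ξ := by
  have hg : (gap u σ ξ : ℂ) ≠ 0 := by exact_mod_cast (gap_pos hu σ ξ).ne'
  rw [potSymbol, oscSymbol_eq hu, smul_smul, smul_smul, lam_add_phase]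
  congr 1
  push_cast
  have := sgn_coe_mul_self σ
  field_simp
  linear_combination (-Complex.I ^ 2 * profile σ S₀ S t ξ) * this +
    (-profile σ S₀ S t ξ) * Complex.I_sq

/-- The integrand, in frequency, of the time derivative of the potential along a path. -/
def pathSymbol (u : R3) (σ : ℤˣ) (S₀ : Lp ℂ 2 (volume : Measure R3)) (S : ℝ → R3 → ℂ)
    (t : ℝ) (w : R3) (ξ : R3) : C3 :=
  oscSymbol σ S₀ S t ξ + srcSymbol u σ (𝓕 (S t)) ξ +
    (2 * Real.pi * Complex.I * ((inner ℝ ξ (w - u) : ℝ) : ℂ)) •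
      potSymbol u σ (oscSymbol σ S₀ S t) ξ

theorem coe_fourierChar (r : ℝ) :
    ((Real.fourierChar r : Circle) : ℂ) = Complex.exp (2 * Real.pi * Complex.I * r) := by
  rw [Real.fourierChar_apply]
  congr 1
  push_cast; ring

theorem stronglyMeasurable_srcSymbol {Ω : Type*} [MeasurableSpace Ω] (u : R3) (σ : ℤˣ)
    {h : Ω → R3 → ℂ} (hh : Measurable fun z : Ω × R3 => h z.1 z.2) :
    StronglyMeasurable fun z : Ω × R3 => srcSymbol u σ (h z.1) z.2 := by
  refine stronglyMeasurable_C3 fun i => ?_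
  have hc : Measurable fun ξ : R3 => ((2 * Real.pi * ξ i * (freq ξ * gap u σ ξ)⁻¹ : ℝ) : ℂ) := by
    refine Complex.measurable_ofReal.comp (Measurable.mul (by fun_prop) ?_)
    exact (measurable_freq.mul (continuous_gap u σ).measurable).inv
  exact ((hc.comp measurable_snd).smul hh).const_smul (-(Complex.I / 2))

theorem stronglyMeasurable_pathSymbol {u : R3} (hu : ‖u‖ < 1) (σ : ℤˣ)
    (S₀ : Lp ℂ 2 (volume : Measure R3))
    {S : ℝ → R3 → ℂ} (hS : Measurable fun z : ℝ × R3 => S z.1 z.2) {W : ℝ → R3}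
    (hW : Continuous W) :
    StronglyMeasurable fun z : ℝ × R3 => pathSymbol u σ S₀ S z.1 (W z.1) z.2 := by
  have h1 := stronglyMeasurable_oscSymbol σ S₀ hS
  have hŜ : Measurable fun z : ℝ × R3 => 𝓕 (S z.1) z.2 :=
    (stronglyMeasurable_fourier hS.stronglyMeasurable).measurable
  have h2 := stronglyMeasurable_srcSymbol u σ (h := fun t => 𝓕 (S t)) hŜ
  have h3 : StronglyMeasurable fun z : ℝ × R3 => potSymbol u σ (oscSymbol σ S₀ S z.1) z.2 := by
    have hc : Continuous fun ξ => (((gap u σ ξ)⁻¹ : ℝ) : ℂ) :=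
      Complex.continuous_ofReal.comp ((continuous_gap u σ).inv₀ fun ξ => (gap_pos hu σ ξ).ne')
    have h4 : StronglyMeasurable fun z : ℝ × R3 => (((gap u σ z.2)⁻¹ : ℝ) : ℂ) :=
      (hc.measurable.comp measurable_snd).stronglyMeasurable
    exact (h4.smul h1).const_smul (-(Complex.I * sgn σ))
  have h5 : StronglyMeasurable fun z : ℝ × R3 =>
      (2 * Real.pi * Complex.I * ((inner ℝ z.2 (W z.1 - u) : ℝ) : ℂ)) := by
    have : Continuous fun z : ℝ × R3 => (inner ℝ z.2 (W z.1 - u) : ℝ) :=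
      continuous_snd.inner ((hW.comp continuous_fst).sub continuous_const)
    exact (continuous_const.mul (Complex.continuous_ofReal.comp this)).stronglyMeasurable
  exact (h1.add h2).add (h5.smul h3)

namespace IsOscillatoryElectricField

variable {n : ℕ} {ε T : ℝ} {S₀ : ℤˣ → Lp ℂ 2 (volume : Measure R3)} {S : ℤˣ → ℝ → R3 → ℂ}
  {Eosc : ℤˣ → ℝ → R3 → C3} {Er : ℝ → R3 → C3} {E : ℝ → R3 → R3}

theorem norm_exp_neg_lam_mul (σ : ℤˣ) (ξ : R3) (τ : ℝ) : ‖Complex.exp (-(lam σ ξ * τ))‖ = 1 := by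
  rw [show -(lam σ ξ * τ) = ((-(sgn σ * freq ξ * τ) : ℝ) : ℂ) * Complex.I by
    unfold lam; rw [sgn_coe]; push_cast; ring]
  exact Complex.norm_exp_ofReal_mul_I _

theorem measurable_fourier_source (H : IsOscillatoryElectricField (n + 1) ε T S₀ S Eosc Er E)
    (σ : ℤˣ) (ξ : R3) : Measurable fun r : ℝ => 𝓕 (S σ r) ξ := by
  have hŜ : Measurable fun z : ℝ × R3 => 𝓕 (S σ z.1) z.2 :=
    (stronglyMeasurable_fourier (h := S σ) (H.measurable_source σ).stronglyMeasurable).measurable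
  exact Measurable.of_uncurry_right (f := fun r ξ => 𝓕 (S σ r) ξ) hŜ

theorem fourier_source_norm (H : IsOscillatoryElectricField (n + 1) ε T S₀ S Eosc Er E)
    (hε : 0 ≤ ε) (σ : ℤˣ) (ξ : R3) {τ : ℝ} (hτ : τ ∈ Icc 0 T) :
    ‖Complex.exp (-(lam σ ξ * τ)) * 𝓕 (S σ τ) ξ‖ ≤ ε := by
  rw [norm_mul, norm_exp_neg_lam_mul, one_mul]
  exact H.norm_fourier_source_le hε σ hτ ξ

theorem fourier_source_intervalIntegrable
    (H : IsOscillatoryElectricField (n + 1) ε T S₀ S Eosc Er E)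
    (hε : 0 ≤ ε) (σ : ℤˣ) {s t : ℝ} (hs : 0 ≤ s) (hst : s ≤ t) (htT : t ≤ T) (ξ : R3) :
    IntervalIntegrable (fun r : ℝ => Complex.exp (-(lam σ ξ * r)) * 𝓕 (S σ r) ξ) volume s t := by
  have hexp : Measurable fun r : ℝ => Complex.exp (-(lam σ ξ * r)) := by fun_prop
  have hm : Measurable fun r : ℝ => Complex.exp (-(lam σ ξ * r)) * 𝓕 (S σ r) ξ :=
    hexp.mul (H.measurable_fourier_source σ ξ)
  rw [intervalIntegrable_iff_integrableOn_Ioc_of_le hst]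
  have hae : ∀ᵐ τ ∂(volume.restrict (Ioc s t)),
      ‖Complex.exp (-(lam σ ξ * (τ : ℝ))) * 𝓕 (S σ τ) ξ‖ ≤ ε := by
    filter_upwards [ae_restrict_mem measurableSet_Ioc] with τ hτ
    exact H.fourier_source_norm hε σ ξ ⟨hs.trans hτ.1.le, hτ.2.trans htT⟩
  exact Integrable.mono' (g := fun _ => ε) (integrable_const _) hm.aestronglyMeasurable hae

/-- Along a path, a plane wave of frequency `λ` has a derivative that is proportional to the wave
itself. -/
theorem hasDerivWithinAt_phaseFactor {s t : ℝ} {γ W : ℝ → R3}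
    (hγ : ∀ τ ∈ Icc s t, HasDerivWithinAt γ (W τ) (Icc s t) τ) (l : ℂ) (ξ : R3) :
    ∀ τ ∈ Icc s t, HasDerivWithinAt
      (fun τ : ℝ => Complex.exp (2 * Real.pi * Complex.I * ((inner ℝ ξ (γ τ) : ℝ) : ℂ) + l * τ))
      ((2 * Real.pi * Complex.I * ((inner ℝ ξ (W τ) : ℝ) : ℂ) + l) *
        Complex.exp (2 * Real.pi * Complex.I * ((inner ℝ ξ (γ τ) : ℝ) : ℂ) + l * τ))
      (Icc s t) τ := by
  intro τ hτ
  have h1 : HasDerivWithinAt (fun τ => (inner ℝ ξ (γ τ) : ℝ)) (inner ℝ ξ (W τ)) (Icc s t) τ :=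
    ((innerSL ℝ ξ).hasFDerivAt.comp_hasDerivWithinAt τ (hγ τ hτ))
  have h2 := h1.ofReal_comp.const_mul (2 * Real.pi * Complex.I)
  have h3 : HasDerivWithinAt (fun τ : ℝ => l * (τ : ℂ)) l (Icc s t) τ := by
    have := ((hasDerivAt_id τ).ofReal_comp.const_mul l).hasDerivWithinAt (s := Icc s t)
    simpa using this
  refine ((h2.add h3).cexp).congr_deriv ?_
  simp only [Pi.add_apply]
  rw [mul_comm]

/-- The fundamental theorem of calculus for the symbol of the potential along a path, at a fixed
frequency. The amplitude is only Lipschitz in time, as the source is merely measurable. -/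
theorem pathSymbol_integral (H : IsOscillatoryElectricField (n + 1) ε T S₀ S Eosc Er E)
    (hε : 0 ≤ ε) (σ : ℤˣ) {u : R3} (hu : ‖u‖ < 1) {s t : ℝ} (hs : 0 ≤ s) (hst : s ≤ t)
    (htT : t ≤ T) {γ W : ℝ → R3}
    (hγ : ∀ τ ∈ Icc s t, HasDerivWithinAt γ (W τ) (Icc s t) τ) (hW : ContinuousOn W (Icc s t))
    (ξ : R3) :
    Real.fourierChar (inner ℝ ξ (γ t)) • potSymbol u σ (oscSymbol σ (S₀ σ) (S σ) t) ξ -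
      Real.fourierChar (inner ℝ ξ (γ s)) • potSymbol u σ (oscSymbol σ (S₀ σ) (S σ) s) ξ =
    ∫ τ in s..t, Real.fourierChar (inner ℝ ξ (γ τ)) •
      pathSymbol u σ (S₀ σ) (S σ) τ (W τ) ξ := by
  have hgi := H.fourier_source_intervalIntegrable hε σ hs hst htT ξ
  have hgb : ∀ τ ∈ Icc s t, ‖Complex.exp (-(lam σ ξ * (τ : ℝ))) * 𝓕 (S σ τ) ξ‖ ≤ ε := fun τ hτ =>
    H.fourier_source_norm hε σ ξ ⟨hs.trans hτ.1, hτ.2.trans htT⟩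
  have hgi0 := fun (τ : ℝ) (h0 : 0 ≤ τ) (hτ : τ ≤ T) =>
    H.fourier_source_intervalIntegrable hε σ le_rfl h0 hτ ξ
  set l := lam σ ξ with hl
  set A : ℝ → ℂ := fun τ =>
    Complex.exp (2 * Real.pi * Complex.I * ((inner ℝ ξ (γ τ) : ℝ) : ℂ) + l * τ) with hA
  set A' : ℝ → ℂ := fun τ => (2 * Real.pi * Complex.I * ((inner ℝ ξ (W τ) : ℝ) : ℂ) + l) * A τ
    with hA'
  have hd : ∀ τ ∈ Icc s t, HasDerivWithinAt A (A' τ) (Icc s t) τ :=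
    hasDerivWithinAt_phaseFactor hγ l ξ
  have hAc : ContinuousOn A (Icc s t) := fun τ hτ => (hd τ hτ).continuousWithinAt
  have hA'c : ContinuousOn A' (Icc s t) := by
    refine ContinuousOn.mul (ContinuousOn.add (continuousOn_const.mul ?_) continuousOn_const) hAc
    exact Complex.continuous_ofReal.comp_continuousOn (continuousOn_const.inner hW)
  set g : ℝ → ℂ := fun r => Complex.exp (-(l * r)) * 𝓕 (S σ r) ξ with hg
  -- product rule for the phase `A` and the amplitude, which is a primitive of `g`
  have key := mul_primitive_sub_eq_integral hst hd hA'c hgi hgb (profile σ (S₀ σ) (S σ) s ξ)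
  have hprof : ∀ τ ∈ Icc s t, profile σ (S₀ σ) (S σ) s ξ + ∫ r in s..τ, g r =
      profile σ (S₀ σ) (S σ) τ ξ := fun τ hτ => by
    unfold profile
    rw [add_assoc]
    congr 1
    exact intervalIntegral.integral_add_adjacent_intervals (hgi0 s hs (hst.trans htT))
      (hgi.mono_set (by rw [uIcc_of_le hst, uIcc_of_le hτ.1]; exact Icc_subset_Icc le_rfl hτ.2))
  have hsplit : ∀ τ : ℝ, A τ = ((Real.fourierChar (inner ℝ ξ (γ τ)) : Circle) : ℂ) *
      Complex.exp (l * τ) := fun τ => by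
    rw [hA, coe_fourierChar]
    exact Complex.exp_add _ _
  rw [potSymbol_osc_eq hu, potSymbol_osc_eq hu, Circle.smul_def, Circle.smul_def, smul_smul,
    smul_smul, ← sub_smul]
  have e1 : ∀ τ : ℝ, ((Real.fourierChar (inner ℝ ξ (γ τ)) : Circle) : ℂ) *
      (Complex.exp (lam σ ξ * τ) * profile σ (S₀ σ) (S σ) τ ξ) =
      A τ * profile σ (S₀ σ) (S σ) τ ξ := fun τ => by rw [hsplit, mul_assoc]
  rw [e1, e1]
  have e2 : ∫ τ in s..t, Real.fourierChar (inner ℝ ξ (γ τ)) •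
      pathSymbol u σ (S₀ σ) (S σ) τ (W τ) ξ =
      ∫ τ in s..t, (A' τ * (profile σ (S₀ σ) (S σ) s ξ + ∫ r in s..τ, g r) + A τ * g τ) •
        kernelVec u σ ξ := by
    refine intervalIntegral.integral_congr fun τ hτ => ?_
    rw [uIcc_of_le hst] at hτ
    rw [hprof τ hτ, pathSymbol, srcSymbol_eq, oscSymbol_eq hu, potSymbol_osc_eq hu, smul_smul,
      ← add_smul, ← add_smul, Circle.smul_def, smul_smul]
    congr 1
    rw [hA', hg]
    simp only
    rw [hsplit, inner_sub_right]
    have hexp : Complex.exp (l * τ) * Complex.exp (-(l * τ)) = 1 := by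
      rw [← Complex.exp_add, add_neg_cancel, Complex.exp_zero]
    have hph : (phase u ξ : ℂ) = 2 * Real.pi * ((inner ℝ ξ u : ℝ) : ℂ) := by
      unfold phase
      rw [real_inner_smul_right, real_inner_comm]
      push_cast; ring
    rw [hph, ← hl]
    push_cast
    linear_combination (-((Real.fourierChar (inner ℝ ξ (γ τ)) : Circle) : ℂ) * 𝓕 (S σ τ) ξ) * hexp
  rw [e2, intervalIntegral.integral_smul_const, ← key, hprof t ⟨hst, le_rfl⟩]

end IsOscillatoryElectricField
end NormalFormIdentity

/-! ### The normal form identity along a path -/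

section PathIdentity

variable {F : Type*} [NormedAddCommGroup F] [InnerProductSpace ℂ F] [CompleteSpace F]

theorem fourierInv_add {f g : R3 → F} (hf : Integrable f) (hg : Integrable g) (x : R3) :
    𝓕⁻ (fun ξ => f ξ + g ξ) x = 𝓕⁻ f x + 𝓕⁻ g x := by
  rw [Real.fourierInv_eq, Real.fourierInv_eq, Real.fourierInv_eq,
    ← integral_add (integrable_char_smul hf x) (integrable_char_smul hg x)]
  refine integral_congr_ae (Eventually.of_forall fun ξ => ?_)
  exact smul_add _ _ _

theorem fderiv_fourierInv {h : R3 → F} (hm : AEStronglyMeasurable h)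
    (hi : Integrable fun ξ => freq ξ ^ 1 * ‖h ξ‖) (x y : R3) :
    fderiv ℝ (𝓕⁻ h) x y =
      𝓕⁻ (fun ξ => (2 * Real.pi * Complex.I * ((inner ℝ ξ y : ℝ) : ℂ)) • h ξ) x := by
  have := iteratedFDeriv_fourierInv_apply hm hi le_rfl x (fun _ => y)
  rw [iteratedFDeriv_one_apply] at this
  simpa using this

theorem norm_two_pi_I_inner_le (ξ y : R3) :
    ‖2 * Real.pi * Complex.I * ((inner ℝ ξ y : ℝ) : ℂ)‖ ≤ freq ξ * ‖y‖ := by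
  simp only [norm_mul, Complex.norm_I, Complex.norm_real, mul_one, Complex.norm_ofNat,
    Real.norm_of_nonneg Real.pi_pos.le]
  have h1 := norm_inner_le_norm (𝕜 := ℝ) ξ y
  calc 2 * Real.pi * ‖(inner ℝ ξ y : ℝ)‖ ≤ 2 * Real.pi * (‖ξ‖ * ‖y‖) := by gcongr
    _ = (2 * Real.pi * ‖ξ‖) * ‖y‖ := by ring
    _ ≤ _ := by gcongr; exact norm_two_pi_le_freq ξ

theorem bracket_mono {a b : ℝ} (ha : 0 ≤ a) (hab : a ≤ b) : bracket a ≤ bracket b := by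
  unfold bracket
  apply Real.sqrt_le_sqrt
  rw [Real.norm_of_nonneg ha, Real.norm_of_nonneg (ha.trans hab)]
  gcongr

namespace IsOscillatoryElectricField

variable {n : ℕ} {ε T : ℝ} {S₀ : ℤˣ → Lp ℂ 2 (volume : Measure R3)} {S : ℤˣ → ℝ → R3 → ℂ}
  {Eosc : ℤˣ → ℝ → R3 → C3} {Er : ℝ → R3 → C3} {E : ℝ → R3 → R3}

/-- The symbol of the time derivative of the potential is integrable, uniformly in time, and its
inverse Fourier integral consists of the oscillatory field, the source term and a directional
derivative of the potential. -/
theorem pathSymbol_bound (hn : 1 ≤ n) (H : IsOscillatoryElectricField (n + 1) ε T S₀ S Eosc Er E)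
    (hε : 0 ≤ ε) (σ : ℤˣ) {u : R3} (hu : ‖u‖ < 1) {M : ℝ} (hM : 0 ≤ M) : ∃ C : ℝ,
    ∀ τ ∈ Icc 0 T, ∀ w : R3, ‖w - u‖ ≤ M →
      Integrable (pathSymbol u σ (S₀ σ) (S σ) τ w) ∧
      ∫ ξ, ‖pathSymbol u σ (S₀ σ) (S σ) τ w ξ‖ ≤ C ∧
      ∀ x, 𝓕⁻ (pathSymbol u σ (S₀ σ) (S σ) τ w) x =
        𝓕⁻ (oscSymbol σ (S₀ σ) (S σ) τ) x + 𝓕⁻ (srcSymbol u σ (𝓕 (S σ τ))) x +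
          fderiv ℝ (𝓕⁻ (potSymbol u σ (oscSymbol σ (S₀ σ) (S σ) τ))) x (w - u) := by
  have h10 : 0 ≤ (1 - ‖u‖)⁻¹ := inv_nonneg.2 (by linarith)
  have hwc := weightConst_nonneg
  refine ⟨weightConst * (4 ^ (n + 3) * (ε * bracket T ^ (1 / n : ℝ))) +
    2 * (1 - ‖u‖)⁻¹ * (weightConst * (4 ^ (n + 2) * (ε * bracket T ^ (1 / n : ℝ)))) +
    M * ((1 - ‖u‖)⁻¹ * (weightConst * (4 ^ (n + 3) * (ε * bracket T ^ (1 / n : ℝ))))),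
    fun τ hτ w hw => ?_⟩
  have hbr : bracket τ ^ (1 / n : ℝ) ≤ bracket T ^ (1 / n : ℝ) :=
    Real.rpow_le_rpow (bracket_pos τ).le (bracket_mono hτ.1 hτ.2) (by positivity)
  obtain ⟨o1, o2⟩ := H.osc_integrable hε σ hτ
  obtain ⟨s1, s2, -, s3⟩ := H.srcSymbol_integrable hn hε σ hτ hu le_rfl
  obtain ⟨p1, p2, p3⟩ := H.potSymbol_integrable hε σ hτ hu le_rfl
  have om := (H.isFT_osc σ hτ).2.2.1
  have oi := integrable_of_freq_pow om o1
  have si := integrable_of_freq_pow s1 s2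
  have p4 := integrable_freq_pow_mul p1 p2 (show 1 ≤ n + 1 by omega)
  set G := fun ξ : R3 => (2 * Real.pi * Complex.I * ((inner ℝ ξ (w - u) : ℝ) : ℂ)) •
      potSymbol u σ (oscSymbol σ (S₀ σ) (S σ) τ) ξ with hG
  have hGle : ∀ ξ, ‖G ξ‖ ≤
      M * (freq ξ ^ (n + 1) * ‖potSymbol u σ (oscSymbol σ (S₀ σ) (S σ) τ) ξ‖) := fun ξ => by
    have hf := freq_pos ξ
    rw [hG, norm_smul]
    have h1 : freq ξ ≤ freq ξ ^ (n + 1) := by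
      rw [pow_succ]
      exact le_mul_of_one_le_left hf.le (one_le_pow₀ (one_le_freq ξ))
    calc _ ≤ (freq ξ * ‖w - u‖) * ‖potSymbol u σ (oscSymbol σ (S₀ σ) (S σ) τ) ξ‖ := by
          gcongr; exact norm_two_pi_I_inner_le ξ _
      _ ≤ (freq ξ ^ (n + 1) * M) * ‖potSymbol u σ (oscSymbol σ (S₀ σ) (S σ) τ) ξ‖ := by gcongr
      _ = _ := by ring
  have hGm : AEStronglyMeasurable G := by
    have hc : Continuous fun ξ : R3 => 2 * Real.pi * Complex.I * ((inner ℝ ξ (w - u) : ℝ) : ℂ) :=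
      continuous_const.mul (Complex.continuous_ofReal.comp (continuous_id.inner continuous_const))
    exact hc.aestronglyMeasurable.smul p1
  have hGi : Integrable G := (p2.const_mul M).mono' hGm (Eventually.of_forall hGle)
  have hpi : Integrable (pathSymbol u σ (S₀ σ) (S σ) τ w) := (oi.add si).add hGi
  have bo : ∀ {F' : Type} [NormedAddCommGroup F'] (h : R3 → F') (N : ℕ) (ξ : R3),
      ‖h ξ‖ ≤ freq ξ ^ N * ‖h ξ‖ := fun h N ξ =>
    le_mul_of_one_le_left (norm_nonneg _) (one_le_pow₀ (one_le_freq ξ))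
  refine ⟨hpi, ?_, fun x => ?_⟩
  · have hle : ∀ ξ, ‖pathSymbol u σ (S₀ σ) (S σ) τ w ξ‖ ≤
        freq ξ ^ n * ‖oscSymbol σ (S₀ σ) (S σ) τ ξ‖ +
        freq ξ ^ n * ‖srcSymbol u σ (𝓕 (S σ τ)) ξ‖ +
        M * (freq ξ ^ (n + 1) * ‖potSymbol u σ (oscSymbol σ (S₀ σ) (S σ) τ) ξ‖) := fun ξ =>
      (norm_add_le _ _).trans (add_le_add ((norm_add_le _ _).trans
        (add_le_add (bo _ n ξ) (bo _ n ξ))) (hGle ξ))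
    refine (integral_mono hpi.norm ((o1.add s2).add (p2.const_mul M)) hle).trans ?_
    have e : ∫ ξ, (freq ξ ^ n * ‖oscSymbol σ (S₀ σ) (S σ) τ ξ‖ +
        freq ξ ^ n * ‖srcSymbol u σ (𝓕 (S σ τ)) ξ‖ +
        M * (freq ξ ^ (n + 1) * ‖potSymbol u σ (oscSymbol σ (S₀ σ) (S σ) τ) ξ‖)) =
        (∫ ξ, freq ξ ^ n * ‖oscSymbol σ (S₀ σ) (S σ) τ ξ‖) +
        (∫ ξ, freq ξ ^ n * ‖srcSymbol u σ (𝓕 (S σ τ)) ξ‖) +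
        M * ∫ ξ, freq ξ ^ (n + 1) * ‖potSymbol u σ (oscSymbol σ (S₀ σ) (S σ) τ) ξ‖ := by
      rw [← integral_const_mul, ← integral_add o1 s2]
      exact integral_add (o1.add s2) (p2.const_mul M)
    refine e.trans_le (add_le_add (add_le_add (o2.trans ?_) (s3.trans ?_))
      (mul_le_mul_of_nonneg_left (p3.trans ?_) hM)) <;> gcongr
  · have e1 := fourierInv_add (oi.add si) hGi x
    have e2 := fourierInv_add oi si x
    rw [fderiv_fourierInv p1 p4]
    exact e1.trans (congrArg (· + 𝓕⁻ G x) e2)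

/-- Normal form identity for one sign along a path with continuous velocity. -/
theorem potential_path_one (hn : 1 ≤ n) (H : IsOscillatoryElectricField (n + 1) ε T S₀ S Eosc Er E)
    (hε : 0 ≤ ε) (σ : ℤˣ) {u : R3} (hu : ‖u‖ < 1) {s t : ℝ} (hs : 0 ≤ s) (hst : s ≤ t)
    (htT : t ≤ T) {γ W : ℝ → R3}
    (hγ : ∀ τ ∈ Icc s t, HasDerivWithinAt γ (W τ) (Icc s t) τ) (hγc : Continuous γ)
    (hW : Continuous W) :
    IntervalIntegrable (fun τ => 𝓕⁻ (pathSymbol u σ (S₀ σ) (S σ) τ (W τ)) (γ τ)) volume s t ∧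
    𝓕⁻ (potSymbol u σ (oscSymbol σ (S₀ σ) (S σ) t)) (γ t) -
      𝓕⁻ (potSymbol u σ (oscSymbol σ (S₀ σ) (S σ) s)) (γ s) =
    ∫ τ in s..t, 𝓕⁻ (pathSymbol u σ (S₀ σ) (S σ) τ (W τ)) (γ τ) := by
  obtain ⟨M, hM⟩ := isCompact_Icc.exists_bound_of_continuousOn
    ((hW.sub continuous_const).continuousOn (s := Icc s t) : ContinuousOn (fun τ => W τ - u) _)
  have hM0 : 0 ≤ M := (norm_nonneg _).trans (hM s ⟨le_rfl, hst⟩)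
  obtain ⟨C, hC⟩ := H.pathSymbol_bound hn hε σ hu hM0
  have hmem : ∀ τ ∈ Icc s t, τ ∈ Icc 0 T := fun τ hτ => ⟨hs.trans hτ.1, hτ.2.trans htT⟩
  set ψ : ℝ × R3 → C3 := fun z => Real.fourierChar (inner ℝ z.2 (γ z.1)) •
    pathSymbol u σ (S₀ σ) (S σ) z.1 (W z.1) z.2 with hψ
  have hψm : StronglyMeasurable ψ := by
    have h1 := stronglyMeasurable_pathSymbol hu σ (S₀ σ) (H.measurable_source σ) hW
    have h2 : Continuous fun z : ℝ × R3 =>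
        ((Real.fourierChar (inner ℝ z.2 (γ z.1)) : Circle) : ℂ) :=
      continuous_subtype_val.comp (Real.continuous_fourierChar.comp
        (continuous_snd.inner (hγc.comp continuous_fst)))
    exact h2.stronglyMeasurable.smul h1
  have hψn : ∀ z, ‖ψ z‖ = ‖pathSymbol u σ (S₀ σ) (S σ) z.1 (W z.1) z.2‖ := fun z => by
    rw [hψ]
    simp only
    rw [Circle.smul_def, norm_smul, Circle.norm_coe, one_mul]
  -- by Fubini, the identity can be integrated in frequency
  have hint : Integrable ψ ((volume.restrict (Ioc s t)).prod volume) := by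
    rw [integrable_prod_iff hψm.aestronglyMeasurable]
    constructor
    · filter_upwards [ae_restrict_mem measurableSet_Ioc] with τ hτ
      exact integrable_char_smul
        (hC τ (hmem τ (Ioc_subset_Icc_self hτ)) (W τ) (hM τ (Ioc_subset_Icc_self hτ))).1 (γ τ)
    · refine Integrable.mono' (g := fun _ => C) (integrable_const _)
        (hψm.norm.integral_prod_right' (ν := volume)).aestronglyMeasurable ?_
      filter_upwards [ae_restrict_mem measurableSet_Ioc] with τ hτ
      rw [Real.norm_of_nonneg (integral_nonneg fun _ => norm_nonneg _)]
      simp_rw [hψn]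
      exact (hC τ (hmem τ (Ioc_subset_Icc_self hτ)) (W τ) (hM τ (Ioc_subset_Icc_self hτ))).2.1
  have hinv : ∀ τ, 𝓕⁻ (pathSymbol u σ (S₀ σ) (S σ) τ (W τ)) (γ τ) = ∫ ξ, ψ (τ, ξ) := fun τ => by
    rw [Real.fourierInv_eq]
  simp_rw [hinv]
  refine ⟨?_, ?_⟩
  · rw [intervalIntegrable_iff_integrableOn_Ioc_of_le hst]
    exact hint.integral_prod_left
  · have hpi : ∀ τ ∈ Icc s t, Integrable (potSymbol u σ (oscSymbol σ (S₀ σ) (S σ) τ)) :=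
      fun τ hτ => by
        obtain ⟨p1, p2, -⟩ := H.potSymbol_integrable hε σ (hmem τ hτ) hu le_rfl
        exact integrable_of_freq_pow p1 p2
    rw [Real.fourierInv_eq, Real.fourierInv_eq,
      ← integral_sub (integrable_char_smul (hpi t ⟨hst, le_rfl⟩) _)
        (integrable_char_smul (hpi s ⟨le_rfl, hst⟩) _),
      intervalIntegral.integral_of_le hst, integral_integral_swap hint]
    refine integral_congr_ae (Eventually.of_forall fun ξ => ?_)
    simp only
    rw [H.pathSymbol_integral hε σ hu hs hst htT hγ hW.continuousOn ξ,
      intervalIntegral.integral_of_le hst]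

/-- Normal form identity: along a path with velocity `W`, the field is the time derivative of the
potential up to the remainder and a term that is linear in `W - u`. -/
theorem potential_path (hn : 1 ≤ n) (H : IsOscillatoryElectricField (n + 1) ε T S₀ S Eosc Er E)
    (hε : 0 ≤ ε) {u : R3} (hu : ‖u‖ < 1) {s t : ℝ} (hs : 0 ≤ s) (hst : s ≤ t)
    (htT : t ≤ T) {γ W : ℝ → R3}
    (hγ : ∀ τ ∈ Icc s t, HasDerivWithinAt γ (W τ) (Icc s t) τ) (hW : ContinuousOn W (Icc s t)) :
    IntervalIntegrable (fun τ => remainder u S₀ S E τ (γ τ) -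
      fderiv ℝ (potential u S₀ S τ) (γ τ) (W τ - u)) volume s t ∧
    potential u S₀ S t (γ t) - potential u S₀ S s (γ s) =
      ∫ τ in s..t, (complexify (E τ (γ τ)) - (remainder u S₀ S E τ (γ τ) -
      fderiv ℝ (potential u S₀ S τ) (γ τ) (W τ - u))) := by
  have hmem : ∀ τ ∈ Icc s t, τ ∈ Icc 0 T := fun τ hτ => ⟨hs.trans hτ.1, hτ.2.trans htT⟩
  have hγc0 : ContinuousOn γ (Icc s t) := fun τ hτ => (hγ τ hτ).continuousWithinAt
  -- continuous extensions of the path and of its velocity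
  set γ' := IccExtend hst ((Icc s t).domRestrict γ) with hγ'
  set W' := IccExtend hst ((Icc s t).domRestrict W) with hW'
  have eγ : ∀ τ ∈ Icc s t, γ' τ = γ τ := fun τ hτ => by rw [hγ', IccExtend_of_mem hst _ hτ]; rfl
  have eW : ∀ τ ∈ Icc s t, W' τ = W τ := fun τ hτ => by rw [hW', IccExtend_of_mem hst _ hτ]; rfl
  have cγ : Continuous γ' := (continuousOn_iff_continuous_domRestrict.1 hγc0).Icc_extend'
  have cW : Continuous W' := (continuousOn_iff_continuous_domRestrict.1 hW).Icc_extend'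
  have hγd : ∀ τ ∈ Icc s t, HasDerivWithinAt γ' (W' τ) (Icc s t) τ := fun τ hτ => by
    rw [eW τ hτ]
    exact (hγ τ hτ).congr_of_mem eγ hτ
  have key := fun σ => H.potential_path_one hn hε σ hu hs hst htT hγd cγ cW
  obtain ⟨M, hM⟩ := isCompact_Icc.exists_bound_of_continuousOn
    (hW.sub continuousOn_const : ContinuousOn (fun τ => W τ - u) (Icc s t))
  have hM0 : 0 ≤ M := (norm_nonneg _).trans (hM s ⟨le_rfl, hst⟩)
  have hval : ∀ τ ∈ Icc s t, complexify (E τ (γ τ)) - (remainder u S₀ S E τ (γ τ) -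
      fderiv ℝ (potential u S₀ S τ) (γ τ) (W τ - u)) =
      ∑ σ, 𝓕⁻ (pathSymbol u σ (S₀ σ) (S σ) τ (W' τ)) (γ' τ) := fun τ hτ => by
    rw [eγ τ hτ, eW τ hτ]
    have h1 : ∀ σ, 𝓕⁻ (pathSymbol u σ (S₀ σ) (S σ) τ (W τ)) (γ τ) =
        𝓕⁻ (oscSymbol σ (S₀ σ) (S σ) τ) (γ τ) + 𝓕⁻ (srcSymbol u σ (𝓕 (S σ τ))) (γ τ) +
          fderiv ℝ (𝓕⁻ (potSymbol u σ (oscSymbol σ (S₀ σ) (S σ) τ))) (γ τ) (W τ - u) := fun σ => by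
      obtain ⟨C, hC⟩ := H.pathSymbol_bound hn hε σ hu hM0
      exact (hC τ (hmem τ hτ) (W τ) (hM τ hτ)).2.2 (γ τ)
    have h2 : fderiv ℝ (potential u S₀ S τ) (γ τ) =
        ∑ σ, fderiv ℝ (𝓕⁻ (potSymbol u σ (oscSymbol σ (S₀ σ) (S σ) τ))) (γ τ) := by
      refine fderiv_fun_sum fun σ _ => ?_
      obtain ⟨p1, p2, -⟩ := H.potSymbol_integrable hε σ (hmem τ hτ) hu le_rfl
      exact ((contDiff_fourierInv p1 p2).differentiable (by simp)).differentiableAt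
    simp_rw [h1]
    rw [Finset.sum_add_distrib, Finset.sum_add_distrib, h2, _root_.sum_apply,
      remainder, oscRep, srcTerm]
    abel
  have hsumi : IntervalIntegrable
      (fun τ => ∑ σ, 𝓕⁻ (pathSymbol u σ (S₀ σ) (S σ) τ (W' τ)) (γ' τ)) volume s t := by
    have := IntervalIntegrable.sum Finset.univ (fun σ _ => (key σ).1)
    refine this.congr_ae (Eventually.of_forall fun τ => ?_)
    simp
  have hEc : ContinuousOn (fun τ => complexify (E τ (γ τ))) (Icc s t) :=
    complexify.continuous.comp_continuousOn (H.continuous_field.comp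
      (continuousOn_id.prodMk hγc0) fun τ hτ => ⟨hmem τ hτ, mem_univ _⟩)
  have hu' : uIcc s t = Icc s t := uIcc_of_le hst
  refine ⟨?_, ?_⟩
  · refine ((hEc.intervalIntegrable_of_Icc hst).sub hsumi).congr_ae ?_
    refine (ae_restrict_mem measurableSet_uIoc).mono fun τ hτ => ?_
    rw [uIoc_of_le hst] at hτ
    simp only
    rw [← hval τ (Ioc_subset_Icc_self hτ)]
    abel
  · rw [intervalIntegral.integral_congr (g := fun τ =>
      ∑ σ, 𝓕⁻ (pathSymbol u σ (S₀ σ) (S σ) τ (W' τ)) (γ' τ)) fun τ hτ => hval τ (hu' ▸ hτ),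
      intervalIntegral.integral_finsetSum fun σ _ => (key σ).1]
    simp_rw [← (key _).2]
    rw [Finset.sum_sub_distrib, eγ t ⟨hst, le_rfl⟩, eγ s ⟨le_rfl, hst⟩]
    rfl

end IsOscillatoryElectricField
end PathIdentity

/-! ### Smooth dependence of solutions of differential equations -/

section SmoothDependence

universe v

variable {I : Type} [TopologicalSpace I] [CompactSpace I] [LocallyCompactSpace I]

/-- The superposition operator `y ↦ F(·, y(·))` on continuous functions. -/
def superposition {Y Z : Type v} [NormedAddCommGroup Y] [NormedAddCommGroup Z] (F : C(I × Y, Z))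
    (y : C(I, Y)) : C(I, Z) :=
  F.comp ((ContinuousMap.id I).prodMk y)

theorem continuous_superposition {Y Z : Type v} [NormedAddCommGroup Y] [NormedAddCommGroup Z]
    (F : C(I × Y, Z)) : Continuous (superposition F) := by
  refine ContinuousMap.continuous_of_continuous_uncurry _ ?_
  change Continuous fun p : C(I, Y) × I => F (p.2, p.1 p.2)
  exact F.continuous.comp (continuous_snd.prodMk (continuous_fst.eval continuous_snd))

/-- Pointwise application of a continuous family of continuous linear maps. -/
def pointwiseApply (Y Z : Type v) [NormedAddCommGroup Y] [NormedSpace ℝ Y] [NormedAddCommGroup Z]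
    [NormedSpace ℝ Z] : C(I, Y →L[ℝ] Z) →L[ℝ] C(I, Y) →L[ℝ] C(I, Z) :=
  LinearMap.mkContinuous₂
    (LinearMap.mk₂ ℝ (fun (A : C(I, Y →L[ℝ] Z)) (z : C(I, Y)) =>
        (⟨fun τ => A τ (z τ), A.continuous.clm_apply z.continuous⟩ : C(I, Z)))
      (fun A B z => by ext; simp) (fun c A z => by ext; simp) (fun A z w => by ext; simp)
      (fun c A z => by ext; simp)) 1 fun A z => by
    rw [one_mul, ContinuousMap.norm_le _ (by positivity)]
    intro τ
    exact ((A τ).le_opNorm _).trans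
      (by gcongr; exacts [A.norm_coe_le_norm τ, z.norm_coe_le_norm τ])

theorem pointwiseApply_apply {Y Z : Type v} [NormedAddCommGroup Y] [NormedSpace ℝ Y]
    [NormedAddCommGroup Z] [NormedSpace ℝ Z] (A : C(I, Y →L[ℝ] Z)) (z : C(I, Y)) (τ : I) :
    pointwiseApply Y Z A z τ = A τ (z τ) := rfl

/-- The superposition operator is differentiable, with derivative the pointwise application of the
derivative in space. -/
theorem hasFDerivAt_superposition {Y Z : Type v} [NormedAddCommGroup Y] [NormedSpace ℝ Y]
    [NormedAddCommGroup Z] [NormedSpace ℝ Z] (F : C(I × Y, Z)) (F' : C(I × Y, Y →L[ℝ] Z))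
    (hF : ∀ τ w, HasFDerivAt (fun w => F (τ, w)) (F' (τ, w)) w) (y : C(I, Y)) :
    HasFDerivAt (superposition F) (pointwiseApply Y Z (superposition F' y)) y := by
  rw [hasFDerivAt_iff_isLittleO, Asymptotics.isLittleO_iff]
  intro c hc
  obtain ⟨δ, hδ, hδ'⟩ := Metric.continuous_iff.1 (continuous_superposition F') y c hc
  filter_upwards [Metric.ball_mem_nhds y hδ] with z hz
  rw [ContinuousMap.norm_le _ (by positivity)]
  intro τ
  have hzτ : z τ ∈ Metric.ball (y τ) δ :=
    lt_of_le_of_lt (ContinuousMap.dist_apply_le_dist τ) hz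
  have hmv := (convex_ball (y τ) δ).norm_image_sub_le_of_norm_hasFDerivWithin_le' (𝕜 := ℝ)
    (f := fun w => F (τ, w)) (f' := fun w => F' (τ, w)) (φ := F' (τ, y τ)) (C := c)
    (fun w _ => (hF τ w).hasFDerivWithinAt) (fun w hw => by
      have h1 : dist (y + ContinuousMap.const I (w - y τ)) y < δ := by
        rw [dist_eq_norm, add_sub_cancel_left]
        refine lt_of_le_of_lt ((ContinuousMap.norm_le _ (norm_nonneg (w - y τ))).2 fun _ => le_rfl) ?_
        rwa [← dist_eq_norm]
      have h2 := (ContinuousMap.dist_apply_le_dist τ).trans_lt (hδ' _ h1)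
      rw [dist_eq_norm] at h2
      have h3 : (y + ContinuousMap.const I (w - y τ)) τ = w := by simp
      change ‖F' (τ, (y + ContinuousMap.const I (w - y τ)) τ) - F' (τ, y τ)‖ < c at h2
      rw [h3] at h2
      exact h2.le)
    (Metric.mem_ball_self hδ) hzτ
  refine hmv.trans ?_
  gcongr
  exact (z - y).norm_coe_le_norm τ

/-- The superposition operator is as smooth as the function that defines it is in space. -/
theorem contDiff_superposition {Y : Type v} [NormedAddCommGroup Y] [NormedSpace ℝ Y] (k : ℕ) :
    ∀ {Z : Type v} [NormedAddCommGroup Z] [NormedSpace ℝ Z] (F : C(I × Y, Z)),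
      (∀ τ, ContDiff ℝ k fun w => F (τ, w)) →
      (∀ j ≤ k, Continuous fun q : I × Y => iteratedFDeriv ℝ j (fun w => F (q.1, w)) q.2) →
      ContDiff ℝ k (superposition F) := by
  induction k with
  | zero =>
    intro Z _ _ F _ _
    exact contDiff_zero.2 (continuous_superposition F)
  | succ k ih =>
    intro Z _ _ F h1 h2
    have hcomm : ∀ (j : ℕ) (q : I × Y),
        iteratedFDeriv ℝ j (fun w => fderiv ℝ (fun w => F (q.1, w)) w) q.2 =
        (continuousMultilinearCurryRightEquiv' ℝ j Y Z)
          (iteratedFDeriv ℝ (j + 1) (fun w => F (q.1, w)) q.2) := fun j q => by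
      rw [iteratedFDeriv_succ_eq_comp_right, Function.comp_apply, LinearIsometryEquiv.apply_symm_apply]
    have hcont : ∀ j ≤ k, Continuous fun q : I × Y =>
        iteratedFDeriv ℝ j (fun w => fderiv ℝ (fun w => F (q.1, w)) w) q.2 := fun j hj => by
      simp_rw [hcomm]
      exact (LinearIsometryEquiv.continuous _).comp (h2 (j + 1) (by omega))
    have hF'c : Continuous fun q : I × Y => fderiv ℝ (fun w => F (q.1, w)) q.2 := by
      have := hcont 0 (Nat.zero_le _)
      have h3 := (continuousMultilinearCurryFin0 ℝ Y (Y →L[ℝ] Z)).continuous.comp this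
      refine h3.congr fun q => ?_
      simp [Function.comp]
    set F' : C(I × Y, Y →L[ℝ] Z) := ⟨fun q => fderiv ℝ (fun w => F (q.1, w)) q.2, hF'c⟩ with hF'
    have hd : ∀ τ w, HasFDerivAt (fun w => F (τ, w)) (F' (τ, w)) w := fun τ w =>
      ((h1 τ).differentiable (by simp)).differentiableAt.hasFDerivAt
    push_cast
    rw [contDiff_succ_iff_hasFDerivAt]
    refine ⟨fun y => pointwiseApply Y Z (superposition F' y), ?_,
      fun y => hasFDerivAt_superposition F F' hd y⟩
    refine (pointwiseApply Y Z).contDiff.comp (ih F' (fun τ => ?_) hcont)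
    exact (h1 τ).fderiv_right (by simp)

variable {Y : Type} [NormedAddCommGroup Y] [NormedSpace ℝ Y]

/-- The Volterra operator `z ↦ ∫_0^r z` on `C([0, R], Y)`. -/
def volterra [CompleteSpace Y] {R : ℝ} (hR : 0 ≤ R) : C(Icc 0 R, Y) →L[ℝ] C(Icc 0 R, Y) :=
  have hc : ∀ z : C(Icc 0 R, Y), Continuous fun τ : ℝ => z (projIcc 0 R hR τ) := fun z =>
    z.continuous.comp continuous_projIcc
  LinearMap.mkContinuous
    { toFun := fun z => ⟨fun r => ∫ τ in (0 : ℝ)..r, z (projIcc 0 R hR τ),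
        (intervalIntegral.continuous_primitive (fun a b => (hc z).intervalIntegrable a b) 0).comp
          continuous_subtype_val⟩
      map_add' := fun z w => by
        ext r
        exact intervalIntegral.integral_add ((hc z).intervalIntegrable _ _)
          ((hc w).intervalIntegrable _ _)
      map_smul' := fun c z => by
        ext r
        exact intervalIntegral.integral_smul c _ } R fun z => by
    rw [ContinuousMap.norm_le _ (by positivity)]
    intro r
    have := intervalIntegral.norm_integral_le_of_norm_le_const (a := 0) (b := (r : ℝ))
      (f := fun τ => z (projIcc 0 R hR τ)) (C := ‖z‖) fun τ _ => z.norm_coe_le_norm _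
    refine this.trans ?_
    rw [sub_zero, abs_of_nonneg r.2.1, mul_comm]
    gcongr
    exact r.2.2

theorem volterra_apply [CompleteSpace Y] {R : ℝ} (hR : 0 ≤ R) (z : C(Icc 0 R, Y)) (r : Icc 0 R) :
    volterra hR z r = ∫ τ in (0 : ℝ)..r, z (projIcc 0 R hR τ) := rfl

/-- Multiplication by `e^{l τ}` on `C([0, R], Y)`. -/
def expWeight (Y : Type) [NormedAddCommGroup Y] [NormedSpace ℝ Y] (R l : ℝ) :
    C(Icc 0 R, Y) →L[ℝ] C(Icc 0 R, Y) :=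
  pointwiseApply Y Y ⟨fun τ => Real.exp (l * τ) • ContinuousLinearMap.id ℝ Y, by fun_prop⟩

theorem expWeight_apply (R l : ℝ) (z : C(Icc 0 R, Y)) (τ : Icc 0 R) :
    expWeight Y R l z τ = Real.exp (l * τ) • z τ := rfl

theorem expWeight_mul (R l : ℝ) : expWeight Y R l * expWeight Y R (-l) = 1 := by
  ext z τ
  change expWeight Y R l (expWeight Y R (-l) z) τ = z τ
  rw [expWeight_apply, expWeight_apply, smul_smul, ← Real.exp_add]
  simp

theorem isUnit_expWeight (R l : ℝ) : IsUnit (expWeight Y R l) :=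
  ⟨⟨expWeight Y R l, expWeight Y R (-l), expWeight_mul R l, by
    have := expWeight_mul (Y := Y) R (-l)
    rwa [neg_neg] at this⟩, rfl⟩

/-- A linear Volterra equation of the second kind is uniquely solvable: in an exponentially
weighted norm, the integral operator is a contraction. -/
theorem isUnit_one_sub_volterra [CompleteSpace Y] {R : ℝ} (hR : 0 ≤ R)
    (A : C(Icc 0 R, Y →L[ℝ] Y)) :
    IsUnit (1 - (volterra hR).comp (pointwiseApply Y Y A) :
      C(Icc 0 R, Y) →L[ℝ] C(Icc 0 R, Y)) := by
  set l : ℝ := ‖A‖ + 1 with hl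
  have hl0 : 0 < l := by positivity
  set B : C(Icc 0 R, Y) →L[ℝ] C(Icc 0 R, Y) := (volterra hR).comp (pointwiseApply Y Y A) with hB
  -- conjugation by `e^{lτ}` amounts to the exponentially weighted norm
  set B' := expWeight Y R (-l) * B * expWeight Y R l with hB'
  have hnorm : ‖B'‖ < 1 := by
    refine lt_of_le_of_lt (ContinuousLinearMap.opNorm_le_bound _ (M := ‖A‖ / l) (by positivity)
      fun z => ?_) ((div_lt_one hl0).2 (by rw [hl]; linarith))
    rw [ContinuousMap.norm_le _ (by positivity)]
    intro r
    change ‖expWeight Y R (-l) (volterra hR (pointwiseApply Y Y A (expWeight Y R l z))) r‖ ≤ _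
    rw [expWeight_apply, volterra_apply, norm_smul, Real.norm_of_nonneg (Real.exp_pos _).le]
    have hle : ‖∫ τ in (0 : ℝ)..r,
        (pointwiseApply Y Y A (expWeight Y R l z)) (projIcc 0 R hR τ)‖ ≤
        ∫ τ in (0 : ℝ)..r, ‖A‖ * ‖z‖ * Real.exp (l * τ) := by
      refine intervalIntegral.norm_integral_le_of_norm_le r.2.1
        (Eventually.of_forall fun τ hτ => ?_)
        (Continuous.intervalIntegrable (by fun_prop) _ _)
      have hp : ((projIcc 0 R hR τ : Icc 0 R) : ℝ) = τ := by
        rw [projIcc_of_mem hR ⟨hτ.1.le, hτ.2.trans r.2.2⟩]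
      rw [pointwiseApply_apply, expWeight_apply, hp]
      refine ((A _).le_opNorm _).trans ?_
      rw [norm_smul, Real.norm_of_nonneg (Real.exp_pos _).le]
      calc _ ≤ ‖A‖ * (Real.exp (l * τ) * ‖z‖) := by
            gcongr
            exacts [A.norm_coe_le_norm _, z.norm_coe_le_norm _]
        _ = _ := by ring
    have hint : ∫ τ in (0 : ℝ)..r, ‖A‖ * ‖z‖ * Real.exp (l * τ) =
        ‖A‖ * ‖z‖ * ((Real.exp (l * r) - 1) / l) := by
      rw [intervalIntegral.integral_const_mul, intervalIntegral.integral_comp_mul_left _ hl0.ne',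
        integral_exp]
      simp [div_eq_inv_mul]
    rw [hint] at hle
    calc _ ≤ Real.exp (-l * r) * (‖A‖ * ‖z‖ * ((Real.exp (l * r) - 1) / l)) := by gcongr
      _ = ‖A‖ / l * ‖z‖ * (Real.exp (-l * r) * Real.exp (l * r) - Real.exp (-l * r)) := by ring
      _ ≤ ‖A‖ / l * ‖z‖ * 1 := by
          gcongr
          rw [← Real.exp_add]
          have := Real.exp_pos (-l * r)
          simp only [neg_mul, neg_add_cancel, Real.exp_zero]
          linarith [Real.exp_pos (-(l * r))]
      _ = _ := mul_one _
  have hu : IsUnit (1 - B') := by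
    have := isUnit_one_sub_of_norm_lt_one (R := C(Icc 0 R, Y) →L[ℝ] C(Icc 0 R, Y)) hnorm
    exact this
  have h1 := expWeight_mul (Y := Y) R l
  have e : 1 - B = expWeight Y R l * (1 - B') * expWeight Y R (-l) := by
    rw [hB', mul_sub, sub_mul, mul_one, h1]
    congr 1
    calc B = 1 * B * 1 := by rw [one_mul, mul_one]
      _ = (expWeight Y R l * expWeight Y R (-l)) * B * (expWeight Y R l * expWeight Y R (-l)) := by
          rw [h1]
      _ = _ := by simp only [mul_assoc]
  rw [e]
  exact ((isUnit_expWeight R l).mul hu).mul (isUnit_expWeight R (-l))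

/-- Constant functions. -/
def constCLM (I Y : Type) [TopologicalSpace I] [CompactSpace I] [NormedAddCommGroup Y]
    [NormedSpace ℝ Y] : Y →L[ℝ] C(I, Y) :=
  LinearMap.mkContinuous
    { toFun := fun p => ContinuousMap.const I p
      map_add' := fun _ _ => rfl
      map_smul' := fun _ _ => rfl } 1 fun p => by
    rw [one_mul]
    exact (ContinuousMap.norm_le _ (norm_nonneg p)).2 fun _ => le_rfl

/-- Smooth dependence on initial data: the solution map `p ↦ z p` of an ordinary differential
equation is of class `C^n` with values in the continuous functions of time, if the right hand side
is of class `C^n` in space, with derivatives that are jointly continuous. -/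
theorem contDiff_solution [CompleteSpace Y] {R : ℝ} (hR : 0 ≤ R) {n : ℕ} (hn : 1 ≤ n)
    (F : C(Icc 0 R × Y, Y)) (hF : ∀ τ, ContDiff ℝ n fun w => F (τ, w))
    (hF' : ∀ j ≤ n, Continuous fun q : Icc 0 R × Y => iteratedFDeriv ℝ j (fun w => F (q.1, w)) q.2)
    {L : NNReal} (hL : ∀ τ, LipschitzWith L fun w => F (τ, w))
    (Z : Y → C(Icc 0 R, Y)) (hZ0 : ∀ p, Z p ⟨0, le_rfl, hR⟩ = p)
    (hZ : ∀ p, ∀ r : Icc 0 R, HasDerivWithinAt (fun τ : ℝ => Z p (projIcc 0 R hR τ)) (F (r, Z p r))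
      (Icc 0 R) r) :
    ContDiff ℝ n Z := by
  have hproj : ∀ r : Icc 0 R, projIcc 0 R hR (r : ℝ) = r := fun r => projIcc_val hR r
  have hcZ : ∀ p, Continuous fun τ : ℝ => Z p (projIcc 0 R hR τ) := fun p =>
    (Z p).continuous.comp continuous_projIcc
  -- the solution map is continuous
  have hZc : Continuous Z := by
    have hlip : LipschitzWith (Real.toNNReal (Real.exp (L * R))) Z := by
      refine LipschitzWith.of_dist_le_mul fun p q => ?_
      rw [Real.coe_toNNReal _ (Real.exp_pos _).le, ContinuousMap.dist_le (by positivity)]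
      intro r
      have hd : ∀ p, ∀ τ ∈ Ico (0 : ℝ) R, HasDerivWithinAt (fun τ : ℝ => Z p (projIcc 0 R hR τ))
          ((fun (τ : ℝ) w => F (projIcc 0 R hR τ, w)) τ (Z p (projIcc 0 R hR τ))) (Ici τ) τ :=
        fun p τ hτ => by
          have h1 := hZ p (projIcc 0 R hR τ)
          have h2 : ((projIcc 0 R hR τ : Icc 0 R) : ℝ) = τ := by
            rw [projIcc_of_mem hR (Ico_subset_Icc_self hτ)]
          rw [h2] at h1
          refine h1.mono_of_mem_nhdsWithin ?_
          exact mem_of_superset (Icc_mem_nhdsGE hτ.2) (Icc_subset_Icc hτ.1 le_rfl)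
      have := dist_le_of_trajectories_ODE (v := fun (τ : ℝ) w => F (projIcc 0 R hR τ, w)) (K := L)
        (a := 0) (b := R) (δ := dist p q) (fun τ => hL _) (hcZ p).continuousOn (hd p)
        (hcZ q).continuousOn (hd q) (by
          have e : projIcc 0 R hR 0 = ⟨0, le_rfl, hR⟩ := projIcc_left hR
          simp only [e, hZ0]
          exact le_rfl) r r.2
      simp only [hproj] at this
      refine this.trans ?_
      rw [mul_comm, sub_zero]
      gcongr
      exact r.2.2
    exact hlip.continuous
  -- the solution with initial value `p` is the inverse image under `G` of the constant `p`, and `G` is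
  -- locally invertible by the inverse function theorem
  set G : C(Icc 0 R, Y) → C(Icc 0 R, Y) := fun y => y - volterra hR (superposition F y) with hG
  have hGZ : ∀ p, G (Z p) = constCLM (Icc 0 R) Y p := fun p => by
    ext r
    change Z p r - volterra hR (superposition F (Z p)) r = p
    rw [volterra_apply]
    have hF0 : Continuous fun τ : ℝ => F (projIcc 0 R hR τ, Z p (projIcc 0 R hR τ)) :=
      F.continuous.comp (continuous_projIcc.prodMk (hcZ p))
    have hftc := intervalIntegral.integral_eq_sub_of_hasDerivAt_of_le (a := 0) (b := (r : ℝ))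
      (f := fun τ : ℝ => Z p (projIcc 0 R hR τ))
      (f' := fun τ : ℝ => F (projIcc 0 R hR τ, Z p (projIcc 0 R hR τ))) r.2.1 (hcZ p).continuousOn
      (fun τ hτ => by
        have hτR : τ < R := hτ.2.trans_le r.2.2
        have h1 := hZ p (projIcc 0 R hR τ)
        have h2 : ((projIcc 0 R hR τ : Icc 0 R) : ℝ) = τ := by
          rw [projIcc_of_mem hR ⟨hτ.1.le, hτR.le⟩]
        rw [h2] at h1
        exact h1.hasDerivAt (Icc_mem_nhds hτ.1 hτR)) (hF0.intervalIntegrable _ _)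
    change Z p r - ∫ τ in (0 : ℝ)..r, F (projIcc 0 R hR τ, Z p (projIcc 0 R hR τ)) = p
    have e : projIcc 0 R hR 0 = ⟨0, le_rfl, hR⟩ := projIcc_left hR
    rw [hftc, hproj, e, hZ0]
    abel
  have hvol : ContDiff ℝ n (volterra (Y := Y) hR) := (volterra (Y := Y) hR).contDiff
  have hGd : ContDiff ℝ n G := contDiff_id.sub (hvol.comp (contDiff_superposition n F hF hF'))
  have hn' : ((n : ℕ) : WithTop ℕ∞) ≠ 0 := by
    simp only [ne_eq, Nat.cast_eq_zero]; omega
  have hFc : Continuous fun q : Icc 0 R × Y => fderiv ℝ (fun w => F (q.1, w)) q.2 := by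
    have h3 := (continuousMultilinearCurryFin1 ℝ Y Y).continuous.comp (hF' 1 hn)
    refine h3.congr fun q => ?_
    ext v
    simp [Function.comp, iteratedFDeriv_one_apply]
  set F' : C(Icc 0 R × Y, Y →L[ℝ] Y) := ⟨_, hFc⟩ with hF'def
  have hFd : ∀ τ w, HasFDerivAt (fun w => F (τ, w)) (F' (τ, w)) w := fun τ w =>
    ((hF τ).differentiable hn').differentiableAt.hasFDerivAt
  rw [contDiff_iff_contDiffAt]
  intro p₀
  obtain ⟨U, hU⟩ := isUnit_one_sub_volterra hR (superposition F' (Z p₀))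
  have hder : HasFDerivAt G ((ContinuousLinearEquiv.unitsEquiv ℝ _ U :
      C(Icc 0 R, Y) ≃L[ℝ] C(Icc 0 R, Y)) : C(Icc 0 R, Y) →L[ℝ] C(Icc 0 R, Y)) (Z p₀) := by
    have h1 := (hasFDerivAt_id (𝕜 := ℝ) (Z p₀)).sub ((volterra hR).hasFDerivAt.comp (Z p₀)
      (hasFDerivAt_superposition F F' hFd (Z p₀)))
    refine h1.congr_fderiv ?_
    rw [← ContinuousLinearMap.one_def, ← hU]
    rfl
  have hinv := (hGd.contDiffAt (x := Z p₀)).to_localInverse hder hn'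
  have hleft := ((hGd.contDiffAt (x := Z p₀)).hasStrictFDerivAt' hder hn').eventually_left_inverse
  rw [hGZ] at hinv
  refine (hinv.comp p₀ (constCLM (Icc 0 R) Y).contDiff.contDiffAt).congr_of_eventuallyEq ?_
  filter_upwards [hZc.continuousAt.eventually hleft] with p hp
  rw [Function.comp_apply, ← hGZ]
  exact hp.symm

end SmoothDependence

/-! ### Joint continuity of derivatives -/

section JointContinuity

variable {G : Type*} [NormedAddCommGroup G] [NormedSpace ℝ G]

/-- The derivative of a jointly continuous family is jointly continuous if it is Hölder continuous
in space, uniformly in the parameter. -/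
theorem continuousOn_fderiv_of_holder {f : ℝ → R3 → G} {s : Set ℝ} {L : ℝ} (hL : 0 ≤ L)
    (hc : ContinuousOn (fun z : ℝ × R3 => f z.1 z.2) (s ×ˢ univ))
    (hd : ∀ τ ∈ s, Differentiable ℝ (f τ))
    (hh : ∀ τ ∈ s, ∀ x y, ‖x - y‖ ≤ 1 →
      ‖fderiv ℝ (f τ) x - fderiv ℝ (f τ) y‖ ≤ L * ‖x - y‖ ^ (1 / 4 : ℝ)) :
    ContinuousOn (fun z : ℝ × R3 => fderiv ℝ (f z.1) z.2) (s ×ˢ univ) := by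
  rw [continuousOn_clm_apply]
  intro h
  refine continuousOn_of_uniform_approx_of_continuousOn fun u hu => ?_
  obtain ⟨c, hc0, hcu⟩ := Metric.mem_uniformity_dist.1 hu
  -- a difference quotient with small step `r` approximates the derivative uniformly
  have hlim : Tendsto (fun r : ℝ => L * (r * ‖h‖) ^ (1 / 4 : ℝ) * ‖h‖) (𝓝 0)
      (𝓝 (L * (0 * ‖h‖) ^ (1 / 4 : ℝ) * ‖h‖)) := by
    have : Continuous fun r : ℝ => L * (r * ‖h‖) ^ (1 / 4 : ℝ) * ‖h‖ :=
      (continuous_const.mul ((continuous_id.mul continuous_const).rpow_const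
        fun _ => Or.inr (by norm_num))).mul continuous_const
    exact this.tendsto 0
  have hlim2 : Tendsto (fun r : ℝ => r * ‖h‖) (𝓝 0) (𝓝 (0 * ‖h‖)) :=
    (continuous_id.mul continuous_const).tendsto 0
  have e0 : L * (0 * ‖h‖) ^ (1 / 4 : ℝ) * ‖h‖ = 0 := by
    rw [zero_mul, Real.zero_rpow (by norm_num)]; ring
  rw [e0] at hlim
  rw [zero_mul] at hlim2
  have hev := ((hlim.eventually (gt_mem_nhds hc0)).and
    (hlim2.eventually (gt_mem_nhds one_pos))).filter_mono (nhdsWithin_le_nhds (s := Ioi 0))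
  obtain ⟨r, ⟨hr1, hr2⟩, hr0⟩ := (hev.and self_mem_nhdsWithin).exists
  have hr0 : 0 < r := hr0
  refine ⟨fun z => r⁻¹ • (f z.1 (z.2 + r • h) - f z.1 z.2), ?_, fun z hz => hcu ?_⟩
  · refine ContinuousOn.const_smul (ContinuousOn.sub ?_ hc) _
    exact hc.comp (f := fun z : ℝ × R3 => (z.1, z.2 + r • h)) (by fun_prop)
      fun z hz => ⟨hz.1, mem_univ _⟩
  · obtain ⟨τ, x⟩ := z
    have hτ : τ ∈ s := hz.1
    have hmv := (convex_closedBall x (r * ‖h‖)).norm_image_sub_le_of_norm_fderiv_le' (𝕜 := ℝ)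
      (f := f τ) (φ := fderiv ℝ (f τ) x) (C := L * (r * ‖h‖) ^ (1 / 4 : ℝ))
      (fun w _ => hd τ hτ w) (fun w hw => by
        rw [mem_closedBall_iff_norm] at hw
        refine (hh τ hτ w x (hw.trans hr2.le)).trans ?_
        gcongr) (Metric.mem_closedBall_self (by positivity)) (y := x + r • h) (by
        rw [mem_closedBall_iff_norm, add_sub_cancel_left, norm_smul, Real.norm_of_nonneg hr0.le])
    rw [add_sub_cancel_left, map_smul, norm_smul r h, Real.norm_of_nonneg hr0.le] at hmv
    rw [dist_comm, dist_eq_norm]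
    have e1 : r⁻¹ • (f τ (x + r • h) - f τ x) - fderiv ℝ (f τ) x h =
        r⁻¹ • (f τ (x + r • h) - f τ x - r • fderiv ℝ (f τ) x h) := by
      rw [smul_sub _ _ (r • fderiv ℝ (f τ) x h), smul_smul, inv_mul_cancel₀ hr0.ne', one_smul]
    change ‖r⁻¹ • (f τ (x + r • h) - f τ x) - fderiv ℝ (f τ) x h‖ < c
    rw [e1, norm_smul, Real.norm_of_nonneg (inv_nonneg.2 hr0.le)]
    refine lt_of_le_of_lt ?_ hr1
    calc _ ≤ r⁻¹ * (L * (r * ‖h‖) ^ (1 / 4 : ℝ) * (r * ‖h‖)) := by gcongr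
      _ = _ := by field_simp

theorem norm_fderiv_iteratedFDeriv_sub {f : R3 → G} (j : ℕ) (x y : R3) :
    ‖fderiv ℝ (iteratedFDeriv ℝ j f) x - fderiv ℝ (iteratedFDeriv ℝ j f) y‖ =
      ‖iteratedFDeriv ℝ (j + 1) f x - iteratedFDeriv ℝ (j + 1) f y‖ := by
  rw [fderiv_iteratedFDeriv, Function.comp_apply, Function.comp_apply]
  refine (dist_eq_norm _ _).symm.trans
    (((LinearIsometryEquiv.isometry _).dist_eq _ _).trans (dist_eq_norm _ _))

theorem le_rpow_quarter {a : ℝ} (h0 : 0 ≤ a) (h1 : a ≤ 1) : a ≤ a ^ (1 / 4 : ℝ) := by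
  calc a = a ^ (1 : ℝ) := (Real.rpow_one a).symm
    _ ≤ a ^ (1 / 4 : ℝ) := Real.rpow_le_rpow_of_exponent_ge_of_imp h0 h1 (by norm_num)
        (by intro _ h; norm_num at h)

/-- All derivatives of a jointly continuous family are jointly continuous if they are bounded and
the last one is Hölder continuous, uniformly in the parameter. -/
theorem continuousOn_iteratedFDeriv_of_holder {f : ℝ → R3 → G} {s : Set ℝ} {L : ℝ} (hL : 0 ≤ L)
    {n : ℕ} (hc : ContinuousOn (fun z : ℝ × R3 => f z.1 z.2) (s ×ˢ univ))
    (hd : ∀ τ ∈ s, ContDiff ℝ n (f τ))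
    (hb : ∀ τ ∈ s, ∀ j ≤ n, ∀ x, ‖iteratedFDeriv ℝ j (f τ) x‖ ≤ L)
    (hh : ∀ τ ∈ s, ∀ x y, ‖iteratedFDeriv ℝ n (f τ) x - iteratedFDeriv ℝ n (f τ) y‖ ≤
      L * ‖x - y‖ ^ (1 / 4 : ℝ)) :
    ∀ j ≤ n, ContinuousOn (fun z : ℝ × R3 => iteratedFDeriv ℝ j (f z.1) z.2) (s ×ˢ univ) := by
  intro j
  induction j with
  | zero =>
    intro _
    refine ((continuousMultilinearCurryFin0 ℝ R3 G).symm.continuous.comp_continuousOn hc).congr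
      fun z _ => ?_
    rw [iteratedFDeriv_zero_eq_comp]
    rfl
  | succ j ih =>
    intro hj
    have hstep := continuousOn_fderiv_of_holder (f := fun τ => iteratedFDeriv ℝ j (f τ)) hL
      (ih (by omega)) (fun τ hτ => (hd τ hτ).differentiable_iteratedFDeriv
        (by exact_mod_cast (by omega))) (fun τ hτ x y hxy => by
        rw [norm_fderiv_iteratedFDeriv_sub]
        rcases (show j + 1 = n ∨ j + 1 < n by omega) with h | h
        · rw [h]; exact hh τ hτ x y
        · have hd2 : Differentiable ℝ (iteratedFDeriv ℝ (j + 1) (f τ)) :=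
            (hd τ hτ).differentiable_iteratedFDeriv (by exact_mod_cast h)
          refine (convex_univ.norm_image_sub_le_of_norm_fderiv_le (𝕜 := ℝ) (fun w _ => hd2 w)
            (fun w _ => (norm_fderiv_iteratedFDeriv (𝕜 := ℝ)).trans_le
              (hb τ hτ (j + 1 + 1) (by omega) w)) (mem_univ y) (mem_univ x)).trans ?_
          gcongr
          exact le_rpow_quarter (norm_nonneg _) hxy)
    refine ((continuousMultilinearCurryLeftEquiv ℝ (fun _ : Fin (j + 1) => R3) G).symm.continuous.comp_continuousOn
      hstep).congr fun z _ => ?_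
    rw [iteratedFDeriv_succ_eq_comp_left]
    rfl

end JointContinuity

/-! ### Regularity of the electric field -/

section FieldRegularity

/-- The real part `ℂ³ → ℝ³`. -/
def realPart : C3 →L[ℝ] R3 :=
  LinearMap.toContinuousLinearMap
    { toFun := fun x => WithLp.toLp 2 fun i => (x i).re
      map_add' := fun x y => by
        refine PiLp.ext fun i => ?_
        simp
      map_smul' := fun c x => by
        refine PiLp.ext fun i => ?_
        simp }

theorem realPart_complexify (x : R3) : realPart (complexify x) = x := by
  refine PiLp.ext fun i => ?_
  change ((complexify x) i).re = x i
  rw [complexify_apply, Complex.ofReal_re]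

namespace IsOscillatoryElectricField

variable {n : ℕ} {ε T : ℝ} {S₀ : ℤˣ → Lp ℂ 2 (volume : Measure R3)} {S : ℤˣ → ℝ → R3 → ℂ}
  {Eosc : ℤˣ → ℝ → R3 → C3} {Er : ℝ → R3 → C3} {E : ℝ → R3 → R3}

/-- The electric field is the inverse Fourier integral of a symbol with a bounded weighted `L²`
norm. -/
theorem exists_field_symbol (H : IsOscillatoryElectricField (n + 1) ε T S₀ S Eosc Er E)
    (hε : 0 ≤ ε) {t : ℝ} (ht : t ∈ Icc 0 T) : ∃ e : R3 → C3,
      AEStronglyMeasurable e ∧ (∀ x, complexify (E t x) = 𝓕⁻ e x) ∧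
      eLpNorm (fun ξ => freq ξ ^ (n + 2) • e ξ) 2 volume ≤
        ENNReal.ofReal (3 * (4 ^ (n + 3) * (ε * bracket T ^ (1 / n : ℝ)))) := by
  obtain ⟨r, r1, r2, r3, r4, -⟩ := H.exists_rem hε ht
  have hbr : bracket t ^ (1 / n : ℝ) ≤ bracket T ^ (1 / n : ℝ) :=
    Real.rpow_le_rpow (bracket_pos t).le (bracket_mono ht.1 ht.2) (by positivity)
  have hm := fun σ => (H.isFT_osc σ ht).2.2.1
  have hi := fun σ => integrable_of_freq_pow (hm σ) (H.osc_integrable hε σ ht).1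
  have hri := integrable_of_freq_pow r2 r4
  set b : ℝ := 4 ^ (n + 3) * (ε * bracket T ^ (1 / n : ℝ)) with hb
  have hb0 : 0 ≤ b := mul_nonneg (by positivity)
    (mul_nonneg hε (Real.rpow_nonneg (bracket_pos T).le _))
  have hle : ENNReal.ofReal (4 ^ (n + 3) * (ε * bracket t ^ (1 / n : ℝ))) ≤ ENNReal.ofReal b := by
    apply ENNReal.ofReal_le_ofReal
    rw [hb]
    gcongr
  refine ⟨fun ξ => oscSymbol 1 (S₀ 1) (S 1) t ξ + oscSymbol (-1) (S₀ (-1)) (S (-1)) t ξ + r ξ,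
    ((hm 1).add (hm (-1))).add r2, fun x => ?_, ?_⟩
  · have e1 := fourierInv_add ((hi 1).add (hi (-1))) hri x
    have e2 := fourierInv_add (hi 1) (hi (-1)) x
    have e3 : complexify (E t x) = oscRep S₀ S t x + 𝓕⁻ r x := by rw [← r1 x]; abel
    rw [e3]
    refine Eq.trans ?_ (e1.trans (congrArg (· + 𝓕⁻ r x) e2)).symm
    refine congrArg (· + 𝓕⁻ r x) ?_
    unfold oscRep
    rw [show (Finset.univ : Finset ℤˣ) = {1, -1} from rfl, Finset.sum_pair (by decide)]
  · have hp := continuous_freq.pow (n + 2)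
    have e : (fun ξ => freq ξ ^ (n + 2) • (oscSymbol 1 (S₀ 1) (S 1) t ξ +
        oscSymbol (-1) (S₀ (-1)) (S (-1)) t ξ + r ξ)) =
        ((fun ξ => freq ξ ^ (n + 2) • oscSymbol 1 (S₀ 1) (S 1) t ξ) +
        (fun ξ => freq ξ ^ (n + 2) • oscSymbol (-1) (S₀ (-1)) (S (-1)) t ξ)) +
        (fun ξ => freq ξ ^ (n + 2) • r ξ) := by
      funext ξ
      simp only [Pi.add_apply, smul_add]
    have m1 := hp.aestronglyMeasurable (μ := (volume : Measure R3)) |>.smul (hm 1)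
    have m2 := hp.aestronglyMeasurable (μ := (volume : Measure R3)) |>.smul (hm (-1))
    have m3 := hp.aestronglyMeasurable (μ := (volume : Measure R3)) |>.smul r2
    rw [e]
    refine (eLpNorm_add_le (m1.add m2) m3 (by norm_num)).trans ?_
    calc _ ≤ ENNReal.ofReal b + ENNReal.ofReal b + ENNReal.ofReal b :=
          add_le_add ((eLpNorm_add_le m1 m2 (by norm_num)).trans
            (add_le_add ((H.osc_weight 1 ht).trans hle) ((H.osc_weight (-1) ht).trans hle)))
            (r3.trans hle)
      _ = _ := by
        rw [← ENNReal.ofReal_add hb0 hb0, ← ENNReal.ofReal_add (by positivity) hb0]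
        congr 1; ring

/-- The electric field is of class `C^n` in space, with bounded derivatives that are jointly
continuous. -/
theorem field_regularity (H : IsOscillatoryElectricField (n + 1) ε T S₀ S Eosc Er E)
    (hε : 0 ≤ ε) : ∃ L : ℝ, 0 ≤ L ∧ (∀ t ∈ Icc 0 T, ContDiff ℝ n (E t)) ∧
      (∀ t ∈ Icc 0 T, ∀ j ≤ n, ∀ x, ‖iteratedFDeriv ℝ j (E t) x‖ ≤ L) ∧
      ∀ j ≤ n, ContinuousOn (fun z : ℝ × R3 => iteratedFDeriv ℝ j (E z.1) z.2)
        (Icc 0 T ×ˢ univ) := by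
  set b : ℝ := 3 * (4 ^ (n + 3) * (ε * bracket T ^ (1 / n : ℝ))) with hb
  have hb0 : 0 ≤ b := mul_nonneg (by norm_num) (mul_nonneg (by positivity)
    (mul_nonneg hε (Real.rpow_nonneg (bracket_pos T).le _)))
  have hw := weightConst_nonneg
  set L : ℝ := ‖realPart‖ * (2 * (weightConst * b)) with hL
  have hL0 : 0 ≤ L := by positivity
  have main : ∀ t ∈ Icc 0 T, ContDiff ℝ n (E t) ∧
      (∀ j ≤ n, ∀ x, ‖iteratedFDeriv ℝ j (E t) x‖ ≤ L) ∧
      ∀ x y, ‖iteratedFDeriv ℝ n (E t) x - iteratedFDeriv ℝ n (E t) y‖ ≤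
        L * ‖x - y‖ ^ (1 / 4 : ℝ) := by
    intro t ht
    obtain ⟨e, em, e1, e2⟩ := H.exists_field_symbol hε ht
    obtain ⟨i1, i2⟩ := integrable_freq_pow_of_eLpNorm hb0 em e2
    obtain ⟨i3, i4⟩ := integrable_freq_rpow_of_eLpNorm hb0 em e2
    have hcd : ContDiff ℝ n (𝓕⁻ e) := contDiff_fourierInv em i1
    have hE : E t = realPart ∘ 𝓕⁻ e := by
      funext x
      rw [Function.comp_apply, ← e1, realPart_complexify]
    have hit : ∀ j ≤ n, ∀ x, iteratedFDeriv ℝ j (E t) x =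
        realPart.compContinuousMultilinearMap (iteratedFDeriv ℝ j (𝓕⁻ e) x) := fun j hj x => by
      rw [hE]
      exact realPart.iteratedFDeriv_comp_left hcd.contDiffAt (by exact_mod_cast hj)
    refine ⟨hE ▸ realPart.contDiff.comp hcd, fun j hj x => ?_, fun x y => ?_⟩
    · rw [hit j hj]
      refine (realPart.norm_compContinuousMultilinearMap_le _).trans ?_
      rw [hL]
      gcongr
      refine (norm_iteratedFDeriv_fourierInv_le em i1 hj x).trans ?_
      have : ∫ ξ, freq ξ ^ j * ‖e ξ‖ ≤ ∫ ξ, freq ξ ^ n * ‖e ξ‖ :=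
        integral_mono (integrable_freq_pow_mul em i1 hj) i1 fun ξ => by
          have := pow_le_pow_right₀ (one_le_freq ξ) hj
          simp only
          gcongr
      have h0 : 0 ≤ weightConst * b := by positivity
      linarith
    · rw [hit n le_rfl, hit n le_rfl]
      have e3 : realPart.compContinuousMultilinearMap (iteratedFDeriv ℝ n (𝓕⁻ e) x) -
          realPart.compContinuousMultilinearMap (iteratedFDeriv ℝ n (𝓕⁻ e) y) =
          realPart.compContinuousMultilinearMap
            (iteratedFDeriv ℝ n (𝓕⁻ e) x - iteratedFDeriv ℝ n (𝓕⁻ e) y) := by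
        ext1 m
        exact (map_sub realPart _ _).symm
      rw [e3]
      refine (realPart.norm_compContinuousMultilinearMap_le _).trans ?_
      have h1 := norm_iteratedFDeriv_fourierInv_sub_le em i1 i3 x y
      calc _ ≤ ‖realPart‖ * (2 * ‖x - y‖ ^ (1 / 4 : ℝ) * (weightConst * b)) := by
            gcongr
            refine h1.trans ?_
            gcongr
        _ = _ := by rw [hL]; ring
  exact ⟨L, hL0, fun t ht => (main t ht).1, fun t ht => (main t ht).2.1,
    continuousOn_iteratedFDeriv_of_holder hL0 H.continuous_field (fun t ht => (main t ht).1)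
      (fun t ht => (main t ht).2.1) fun t ht => (main t ht).2.2⟩

end IsOscillatoryElectricField
end FieldRegularity

/-! ### Smoothness of the characteristics -/

section Flow

theorem contDiff_bracket {n : WithTop ℕ∞} : ContDiff ℝ n (bracket : R3 → ℝ) :=
  (contDiff_const.add (contDiff_norm_sq ℝ)).sqrt fun v => by positivity

theorem contDiff_relVel {n : WithTop ℕ∞} : ContDiff ℝ n relVel :=
  (contDiff_bracket.inv fun v => (bracket_pos v).ne').smul contDiff_id

theorem abs_bracket_sub_le (a b : R3) : |bracket a - bracket b| ≤ ‖a - b‖ := by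
  have key : ∀ a b : R3, bracket a ≤ bracket b + ‖a - b‖ := fun a b => by
    unfold bracket
    have h1 : ‖b‖ ≤ √(1 + ‖b‖ ^ 2) := Real.le_sqrt_of_sq_le (by linarith)
    have h2 := Real.sq_sqrt (show 0 ≤ 1 + ‖b‖ ^ 2 by positivity)
    have h3 : ‖a‖ ≤ ‖b‖ + ‖a - b‖ := by
      have := norm_add_le b (a - b)
      rwa [add_sub_cancel] at this
    refine Real.sqrt_le_iff.2 ⟨by positivity, ?_⟩
    nlinarith [norm_nonneg (a - b), norm_nonneg a, norm_nonneg b]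
  rw [abs_le]
  have h1 := key a b
  have h2 := key b a
  rw [norm_sub_rev] at h2
  constructor <;> linarith

theorem norm_le_bracket (a : R3) : ‖a‖ ≤ bracket a :=
  Real.le_sqrt_of_sq_le (by linarith)

theorem norm_relVel_sub_le (a b : R3) : ‖relVel a - relVel b‖ ≤ 2 * ‖a - b‖ := by
  have ha := bracket_pos a
  have hb := bracket_pos b
  have e : relVel a - relVel b =
      (bracket a)⁻¹ • (a - b) + ((bracket a)⁻¹ * (bracket b)⁻¹ * (bracket b - bracket a)) • b := by
    unfold relVel
    rw [smul_sub, sub_add, ← sub_smul]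
    congr 2
    field_simp
    ring
  rw [e]
  refine (norm_add_le _ _).trans ?_
  rw [norm_smul, norm_smul, norm_mul, norm_mul, Real.norm_eq_abs, Real.norm_eq_abs,
    Real.norm_eq_abs, abs_inv, abs_inv, abs_of_pos ha, abs_of_pos hb]
  have h1 : (bracket a)⁻¹ ≤ 1 := inv_le_one_of_one_le₀ (one_le_bracket a)
  have h2 : (bracket b)⁻¹ * ‖b‖ ≤ 1 := by
    rw [inv_mul_le_iff₀ hb, mul_one]; exact norm_le_bracket b
  have h3 : |bracket b - bracket a| ≤ ‖a - b‖ := by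
    rw [norm_sub_rev]; exact abs_bracket_sub_le b a
  have h0 := norm_nonneg (a - b)
  calc _ = (bracket a)⁻¹ * ‖a - b‖ +
        (bracket a)⁻¹ * (((bracket b)⁻¹ * ‖b‖) * |bracket b - bracket a|) := by ring
    _ ≤ 1 * ‖a - b‖ + 1 * (1 * ‖a - b‖) := by gcongr
    _ = _ := by ring

theorem lipschitzWith_relVel : LipschitzWith 2 relVel :=
  LipschitzWith.of_dist_le_mul fun a b => by
    rw [dist_eq_norm, dist_eq_norm]; exact norm_relVel_sub_le a b

/-- The derivatives in phase space of the right hand side of the characteristic system. -/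
theorem iteratedFDeriv_phaseField {f g : R3 → R3} {n j : ℕ} (hf : ContDiff ℝ n f)
    (hg : ContDiff ℝ n g) (hj : j ≤ n) (w : R3 × R3) :
    iteratedFDeriv ℝ j (fun w : R3 × R3 => (-g w.2, -f w.1)) w =
      (-ContinuousLinearMap.inl ℝ R3 R3).compContinuousMultilinearMap
        ((iteratedFDeriv ℝ j g w.2).compContinuousLinearMap
          fun _ => ContinuousLinearMap.snd ℝ R3 R3) +
      (-ContinuousLinearMap.inr ℝ R3 R3).compContinuousMultilinearMap
        ((iteratedFDeriv ℝ j f w.1).compContinuousLinearMap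
          fun _ => ContinuousLinearMap.fst ℝ R3 R3) := by
  have hj' : (j : WithTop ℕ∞) ≤ (n : WithTop ℕ∞) := by exact_mod_cast hj
  have e : (fun w : R3 × R3 => (-g w.2, -f w.1)) =
      (-ContinuousLinearMap.inl ℝ R3 R3) ∘ (g ∘ ContinuousLinearMap.snd ℝ R3 R3) +
      (-ContinuousLinearMap.inr ℝ R3 R3) ∘ (f ∘ ContinuousLinearMap.fst ℝ R3 R3) := by
    funext w
    simp
  have c1 : ContDiff ℝ n (g ∘ ContinuousLinearMap.snd ℝ R3 R3) :=
    hg.comp (ContinuousLinearMap.snd ℝ R3 R3).contDiff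
  have c2 : ContDiff ℝ n (f ∘ ContinuousLinearMap.fst ℝ R3 R3) :=
    hf.comp (ContinuousLinearMap.fst ℝ R3 R3).contDiff
  rw [e, iteratedFDeriv_add_apply
      (((ContinuousLinearMap.contDiff _).comp c1).contDiffAt.of_le hj')
      (((ContinuousLinearMap.contDiff _).comp c2).contDiffAt.of_le hj'),
    ContinuousLinearMap.iteratedFDeriv_comp_left _ c1.contDiffAt hj',
    ContinuousLinearMap.iteratedFDeriv_comp_left _ c2.contDiffAt hj',
    ContinuousLinearMap.iteratedFDeriv_comp_right _ hg _ hj',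
    ContinuousLinearMap.iteratedFDeriv_comp_right _ hf _ hj']
  rfl

variable {n : ℕ} {T : ℝ} {E : ℝ → R3 → R3} {X V : ℝ → ℝ → R3 → R3 → R3}

/-- The characteristics depend on their end point in a `C^n` fashion, uniformly in time. Time
is reversed, so that the prescribed values are initial values. -/
theorem IsCharacteristic.exists_contDiff (hn : 1 ≤ n) (HC : IsCharacteristic T E X V) {L : ℝ}
    (hL0 : 0 ≤ L) (hcd : ∀ t ∈ Icc 0 T, ContDiff ℝ n (E t))
    (hL : ∀ t ∈ Icc 0 T, ∀ j ≤ n, ∀ x, ‖iteratedFDeriv ℝ j (E t) x‖ ≤ L)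
    (hc0 : ContinuousOn (fun z : ℝ × R3 => E z.1 z.2) (Icc 0 T ×ˢ univ))
    (hc : ∀ j ≤ n, ContinuousOn (fun z : ℝ × R3 => iteratedFDeriv ℝ j (E z.1) z.2)
      (Icc 0 T ×ˢ univ)) {t : ℝ} (ht : t ∈ Icc 0 T) (v : R3) :
    ∃ Z : R3 → C(Icc 0 t, R3 × R3), ContDiff ℝ n Z ∧
      ∀ x (r : Icc 0 t), Z x r = (X (t - r) t x v - x, V (t - r) t x v - v) := by
  have hrev : ∀ r : Icc 0 t, t - (r : ℝ) ∈ Icc 0 t := fun r =>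
    ⟨by linarith [r.2.2], by linarith [r.2.1]⟩
  have hrevT : ∀ r : Icc 0 t, t - (r : ℝ) ∈ Icc 0 T := fun r =>
    ⟨(hrev r).1, (hrev r).2.trans ht.2⟩
  have hpair : ∀ q : Icc 0 t × (R3 × R3), ((t - (q.1 : ℝ), q.2.1) : ℝ × R3) ∈
      Icc 0 T ×ˢ (univ : Set R3) := fun q => ⟨hrevT q.1, mem_univ _⟩
  have hpc : Continuous fun q : Icc 0 t × (R3 × R3) => ((t - (q.1 : ℝ), q.2.1) : ℝ × R3) := by
    fun_prop
  have hEc : Continuous fun q : Icc 0 t × (R3 × R3) => E (t - q.1) q.2.1 :=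
    hc0.comp_continuous hpc hpair
  let F : C(Icc 0 t × (R3 × R3), R3 × R3) :=
    ⟨fun q => (-relVel q.2.2, -E (t - q.1) q.2.1),
      ((contDiff_relVel (n := 0)).continuous.comp (by fun_prop)).neg.prodMk hEc.neg⟩
  have hXc : ∀ x v, ContinuousOn (fun r => X r t x v) (Icc 0 t) := fun x v r hr =>
    (HC.pos_deriv t ht x v r hr).continuousWithinAt
  have hVc : ∀ x v, ContinuousOn (fun r => V r t x v) (Icc 0 t) := fun x v r hr =>
    (HC.vel_deriv t ht x v r hr).continuousWithinAt
  have hrc : Continuous fun r : Icc 0 t => t - (r : ℝ) := by fun_prop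
  let Z : R3 × R3 → C(Icc 0 t, R3 × R3) := fun p =>
    ⟨fun r => (X (t - r) t p.1 p.2, V (t - r) t p.1 p.2),
      ((hXc p.1 p.2).comp_continuous hrc hrev).prodMk ((hVc p.1 p.2).comp_continuous hrc hrev)⟩
  have hF : ∀ τ, ContDiff ℝ n fun w => F (τ, w) := fun τ =>
    (contDiff_relVel.comp contDiff_snd).neg.prodMk ((hcd _ (hrevT τ)).comp contDiff_fst).neg
  have hF' : ∀ j ≤ n, Continuous fun q : Icc 0 t × (R3 × R3) =>
      iteratedFDeriv ℝ j (fun w => F (q.1, w)) q.2 := by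
    intro j hj
    have e : (fun q : Icc 0 t × (R3 × R3) => iteratedFDeriv ℝ j (fun w => F (q.1, w)) q.2) =
        fun q => ContinuousLinearMap.compContinuousMultilinearMapL ℝ (fun _ : Fin j => R3 × R3)
            R3 (R3 × R3) (-ContinuousLinearMap.inl ℝ R3 R3)
            (ContinuousMultilinearMap.compContinuousLinearMapL
              (fun _ : Fin j => ContinuousLinearMap.snd ℝ R3 R3)
              (iteratedFDeriv ℝ j relVel q.2.2)) +
          ContinuousLinearMap.compContinuousMultilinearMapL ℝ (fun _ : Fin j => R3 × R3)
            R3 (R3 × R3) (-ContinuousLinearMap.inr ℝ R3 R3)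
            (ContinuousMultilinearMap.compContinuousLinearMapL
              (fun _ : Fin j => ContinuousLinearMap.fst ℝ R3 R3)
              (iteratedFDeriv ℝ j (E (t - q.1)) q.2.1)) := by
      funext q
      exact iteratedFDeriv_phaseField (hcd _ (hrevT q.1)) contDiff_relVel hj q.2
    rw [e]
    have h1 : Continuous fun q : Icc 0 t × (R3 × R3) => iteratedFDeriv ℝ j relVel q.2.2 :=
      ((contDiff_relVel (n := n)).continuous_iteratedFDeriv (by exact_mod_cast hj)).comp
        (by fun_prop)
    have h2 : Continuous fun q : Icc 0 t × (R3 × R3) =>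
        iteratedFDeriv ℝ j (E (t - q.1)) q.2.1 := (hc j hj).comp_continuous hpc hpair
    exact ((ContinuousLinearMap.continuous _).comp
        ((ContinuousLinearMap.continuous _).comp h1)).add
      ((ContinuousLinearMap.continuous _).comp ((ContinuousLinearMap.continuous _).comp h2))
  have hlipE : ∀ τ ∈ Icc 0 T, LipschitzWith L.toNNReal (E τ) := fun τ hτ =>
    lipschitzWith_of_nnnorm_fderiv_le ((hcd τ hτ).differentiable (by
      exact_mod_cast (Nat.one_le_iff_ne_zero.1 hn))) fun x => by
        rw [← NNReal.coe_le_coe, coe_nnnorm, Real.coe_toNNReal _ hL0, ← norm_iteratedFDeriv_one]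
        exact hL τ hτ 1 hn x
  have hlip : ∀ τ, LipschitzWith (max 2 L.toNNReal) fun w => F (τ, w) := fun τ => by
    have h1 : LipschitzWith 2 fun w : R3 × R3 => -relVel w.2 := by
      have := (lipschitzWith_relVel.comp (LipschitzWith.prod_snd (α := R3))).neg
      rwa [mul_one] at this
    have h2 : LipschitzWith L.toNNReal fun w : R3 × R3 => -E (t - τ) w.1 := by
      have := ((hlipE _ (hrevT τ)).comp (LipschitzWith.prod_fst (β := R3))).neg
      rwa [mul_one] at this
    exact h1.prodMk h2
  have hZ0 : ∀ p, Z p ⟨0, le_rfl, ht.1⟩ = p := fun p => by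
    change (X (t - 0) t p.1 p.2, V (t - 0) t p.1 p.2) = p
    rw [sub_zero, HC.pos_init t ht, HC.vel_init t ht]
  have hZ : ∀ p, ∀ r : Icc 0 t, HasDerivWithinAt
      (fun τ : ℝ => Z p (projIcc 0 t ht.1 τ)) (F (r, Z p r)) (Icc 0 t) r := by
    intro p r
    have hs : HasDerivWithinAt (fun τ : ℝ => t - τ) (-1) (Icc 0 t) r := by
      simpa using ((hasDerivAt_id (r : ℝ)).const_sub t).hasDerivWithinAt
    have hm : MapsTo (fun τ : ℝ => t - τ) (Icc 0 t) (Icc 0 t) := fun τ hτ =>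
      hrev ⟨τ, hτ⟩
    have h1 := (HC.pos_deriv t ht p.1 p.2 _ (hrev r)).scomp (r : ℝ) hs hm
    have h2 := (HC.vel_deriv t ht p.1 p.2 _ (hrev r)).scomp (r : ℝ) hs hm
    have h3 := h1.prodMk h2
    rw [neg_one_smul, neg_one_smul] at h3
    refine h3.congr_of_mem (fun τ hτ => ?_) r.2
    rw [projIcc_of_mem ht.1 hτ]
    rfl
  have hmain := contDiff_solution ht.1 hn F hF hF' hlip Z hZ0 hZ
  have hcst : ContDiff ℝ n fun x : R3 => constCLM (Icc 0 t) (R3 × R3) (x, v) :=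
    (ContinuousLinearMap.contDiff _).comp (contDiff_id.prodMk contDiff_const)
  refine ⟨fun x => Z (x, v) - constCLM (Icc 0 t) (R3 × R3) (x, v),
    (hmain.comp (contDiff_id.prodMk contDiff_const)).sub hcst, fun x r => ?_⟩
  rfl

/-- The evaluation of a multilinear map with values in continuous functions is continuous in the
operator norm. -/
theorem continuous_eval_compContinuousMultilinearMap {I Y G : Type} [TopologicalSpace I]
    [CompactSpace I] [NormedAddCommGroup Y] [NormedSpace ℝ Y] [NormedAddCommGroup G]
    [NormedSpace ℝ G] (p : Y →L[ℝ] G) {j : ℕ}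
    (M : ContinuousMultilinearMap ℝ (fun _ : Fin j => R3) C(I, Y)) :
    Continuous fun r : I =>
      (p ∘L ContinuousMap.evalCLM ℝ r).compContinuousMultilinearMap M := by
  rw [continuous_iff_continuousAt]
  intro r
  rw [ContinuousAt, tendsto_iff_norm_sub_tendsto_zero]
  refine squeeze_zero (fun _ => norm_nonneg _)
    (fun r' => norm_multilinear_le_sum_basis _) ?_
  rw [← Finset.sum_const_zero (s := (Finset.univ : Finset (Fin j → Fin 3)))]
  refine tendsto_finsetSum _ fun c _ => ?_
  have h : Continuous fun r' : I => p ((M fun i => EuclideanSpace.single (c i) 1) r') :=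
    p.continuous.comp (map_continuous _)
  exact tendsto_iff_norm_sub_tendsto_zero.1 h.continuousAt

end Flow

/-! ### Families of smooth functions -/

section SmoothFamilies

variable {G G' : Type} [NormedAddCommGroup G] [NormedSpace ℝ G] [NormedAddCommGroup G']
  [NormedSpace ℝ G']

/-- The functions `f τ`, `τ ∈ I`, are of class `C^n`, and their derivatives up to order `n`
are locally bounded in space, uniformly in `τ ∈ I`. -/
structure SmoothFamily (n : ℕ) (I : Set ℝ) (f : ℝ → R3 → G) : Prop where
  contDiff : ∀ τ ∈ I, ContDiff ℝ n (f τ)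
  bounded : ∀ x, ∃ C : ℝ, ∃ r > 0, ∀ τ ∈ I, ∀ y ∈ Metric.ball x r, ∀ j ≤ n,
    ‖iteratedFDeriv ℝ j (f τ) y‖ ≤ C

variable {n : ℕ} {I : Set ℝ} {f : ℝ → R3 → G}

theorem SmoothFamily.mono {J : Set ℝ} (hf : SmoothFamily n I f) (hJ : J ⊆ I) :
    SmoothFamily n J f :=
  ⟨fun τ hτ => hf.contDiff τ (hJ hτ), fun x => by
    obtain ⟨C, r, hr, h⟩ := hf.bounded x
    exact ⟨C, r, hr, fun τ hτ => h τ (hJ hτ)⟩⟩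

theorem smoothFamily_const (n : ℕ) (I : Set ℝ) {h : R3 → G} (hh : ContDiff ℝ n h) :
    SmoothFamily n I fun _ => h := by
  refine ⟨fun _ _ => hh, fun x => ?_⟩
  have hc : Continuous fun y => ∑ j ∈ Finset.range (n + 1), ‖iteratedFDeriv ℝ j h y‖ :=
    continuous_finsetSum _ fun j hj => (hh.continuous_iteratedFDeriv (by
      have : j ≤ n := by simpa [Nat.lt_succ_iff] using hj
      exact_mod_cast this)).norm
  obtain ⟨r, hr, hb⟩ := Metric.eventually_nhds_iff_ball.1
    (hc.continuousAt.eventually_lt continuousAt_const (lt_add_one _))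
  exact ⟨_, r, hr, fun τ _ y hy j hj => (Finset.single_le_sum
    (f := fun j => ‖iteratedFDeriv ℝ j h y‖) (fun _ _ => norm_nonneg _)
    (Finset.mem_range.2 (Nat.lt_succ_of_le hj))).trans (hb y hy).le⟩

theorem SmoothFamily.neg (hf : SmoothFamily n I f) : SmoothFamily n I fun τ x => -f τ x := by
  refine ⟨fun τ hτ => (hf.contDiff τ hτ).neg, fun x => ?_⟩
  obtain ⟨C, r, hr, h⟩ := hf.bounded x
  refine ⟨C, r, hr, fun τ hτ y hy j hj => ?_⟩
  have e : iteratedFDeriv ℝ j (fun x => -f τ x) y = -iteratedFDeriv ℝ j (f τ) y :=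
    iteratedFDeriv_neg_apply
  rw [e, norm_neg]
  exact h τ hτ y hy j hj

theorem SmoothFamily.sub {g : ℝ → R3 → G} (hf : SmoothFamily n I f) (hg : SmoothFamily n I g) :
    SmoothFamily n I fun τ x => f τ x - g τ x := by
  refine ⟨fun τ hτ => (hf.contDiff τ hτ).sub (hg.contDiff τ hτ), fun x => ?_⟩
  obtain ⟨C, r, hr, h⟩ := hf.bounded x
  obtain ⟨C', r', hr', h'⟩ := hg.bounded x
  refine ⟨C + C', min r r', lt_min hr hr', fun τ hτ y hy j hj => ?_⟩
  have hj' : (j : WithTop ℕ∞) ≤ (n : WithTop ℕ∞) := by exact_mod_cast hj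
  have e : iteratedFDeriv ℝ j (fun x => f τ x - g τ x) y =
      iteratedFDeriv ℝ j (f τ) y - iteratedFDeriv ℝ j (g τ) y :=
    iteratedFDeriv_sub_apply ((hf.contDiff τ hτ).contDiffAt.of_le hj')
      ((hg.contDiff τ hτ).contDiffAt.of_le hj')
  rw [e]
  exact (norm_sub_le _ _).trans (add_le_add
    (h τ hτ y (Metric.ball_subset_ball (min_le_left _ _) hy) j hj)
    (h' τ hτ y (Metric.ball_subset_ball (min_le_right _ _) hy) j hj))

theorem SmoothFamily.add {g : ℝ → R3 → G} (hf : SmoothFamily n I f) (hg : SmoothFamily n I g) :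
    SmoothFamily n I fun τ x => f τ x + g τ x := by
  simpa only [sub_neg_eq_add] using hf.sub hg.neg

/-- Composition from the left with functions whose derivatives are bounded on bounded sets. -/
theorem SmoothFamily.comp {f : ℝ → R3 → R3} (hf : SmoothFamily n I f) {g : ℝ → R3 → G}
    (hg : ∀ τ ∈ I, ContDiff ℝ n (g τ))
    (hgb : ∀ ρ : ℝ, ∃ A, ∀ τ ∈ I, ∀ z, ‖z‖ ≤ ρ → ∀ j ≤ n, ‖iteratedFDeriv ℝ j (g τ) z‖ ≤ A) :
    SmoothFamily n I fun τ x => g τ (f τ x) := by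
  refine ⟨fun τ hτ => (hg τ hτ).comp (hf.contDiff τ hτ), fun x => ?_⟩
  obtain ⟨C, r, hr, h⟩ := hf.bounded x
  obtain ⟨A, hA⟩ := hgb C
  refine ⟨n.factorial * max A 0 * (max C 1) ^ n, r, hr, fun τ hτ y hy j hj => ?_⟩
  have hfy : ‖f τ y‖ ≤ C := by
    have := h τ hτ y hy 0 (Nat.zero_le _)
    rwa [norm_iteratedFDeriv_zero] at this
  have h1 := norm_iteratedFDeriv_comp_le (𝕜 := ℝ) (n := j) (N := n) (hg τ hτ) (hf.contDiff τ hτ)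
    (by exact_mod_cast hj) y (C := max A 0) (D := max C 1)
    (fun i hi => (hA τ hτ _ hfy i (hi.trans hj)).trans (le_max_left _ _))
    (fun i hi1 hi => ((h τ hτ y hy i (hi.trans hj)).trans (le_max_left _ _)).trans
      (le_self_pow₀ (le_max_right _ _) (by omega)))
  refine h1.trans ?_
  have h2 : (j.factorial : ℝ) ≤ n.factorial := by exact_mod_cast Nat.factorial_le hj
  have h3 : max C 1 ^ j ≤ max C 1 ^ n := pow_le_pow_right₀ (le_max_right _ _) hj
  gcongr

/-- The Leibniz rule for smooth families. -/
theorem SmoothFamily.clm_apply {f : ℝ → R3 → G →L[ℝ] G'} {g : ℝ → R3 → G}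
    (hf : SmoothFamily n I f) (hg : SmoothFamily n I g) :
    SmoothFamily n I fun τ x => f τ x (g τ x) := by
  refine ⟨fun τ hτ => (hf.contDiff τ hτ).clm_apply (hg.contDiff τ hτ), fun x => ?_⟩
  obtain ⟨C, r, hr, h⟩ := hf.bounded x
  obtain ⟨C', r', hr', h'⟩ := hg.bounded x
  refine ⟨2 ^ n * (max C 0 * max C' 0), min r r', lt_min hr hr', fun τ hτ y hy j hj => ?_⟩
  have h1 := norm_iteratedFDeriv_clm_apply (𝕜 := ℝ) (n := j) (N := n) (hf.contDiff τ hτ)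
    (hg.contDiff τ hτ) y (by exact_mod_cast hj)
  refine h1.trans ?_
  calc _ ≤ ∑ i ∈ Finset.range (j + 1), (j.choose i : ℝ) * (max C 0 * max C' 0) := by
        refine Finset.sum_le_sum fun i hi => ?_
        have hi' : i ≤ j := by simpa [Nat.lt_succ_iff] using hi
        rw [mul_assoc]
        gcongr
        · exact (h τ hτ y (Metric.ball_subset_ball (min_le_left _ _) hy) i (hi'.trans hj)).trans
            (le_max_left _ _)
        · exact (h' τ hτ y (Metric.ball_subset_ball (min_le_right _ _) hy) (j - i)
            ((Nat.sub_le _ _).trans hj)).trans (le_max_left _ _)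
    _ = 2 ^ j * (max C 0 * max C' 0) := by
        rw [← Finset.sum_mul]
        congr 1
        exact_mod_cast Nat.sum_range_choose j
    _ ≤ _ := by
        gcongr
        · norm_num
        
theorem SmoothFamily.fderiv (hf : SmoothFamily (n + 1) I f) :
    SmoothFamily n I fun τ => _root_.fderiv ℝ (f τ) := by
  refine ⟨fun τ hτ => (hf.contDiff τ hτ).fderiv_right (by norm_cast), fun x => ?_⟩
  obtain ⟨C, r, hr, h⟩ := hf.bounded x
  refine ⟨C, r, hr, fun τ hτ y hy j hj => ?_⟩
  rw [norm_iteratedFDeriv_fderiv]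
  exact h τ hτ y hy (j + 1) (by omega)

/-- The derivative is a measurable function of the parameter, as a limit of difference
quotients. -/
theorem aestronglyMeasurable_fderiv {μ : Measure ℝ} {f : ℝ → R3 → G}
    (hm : ∀ x, AEStronglyMeasurable (fun τ => f τ x) μ)
    (hd : ∀ᵐ τ ∂μ, Differentiable ℝ (f τ)) (x : R3) :
    AEStronglyMeasurable (fun τ => fderiv ℝ (f τ) x) μ := by
  have h1 : ∀ i : Fin 3, AEStronglyMeasurable
      (fun τ => fderiv ℝ (f τ) x (EuclideanSpace.single i 1)) μ := fun i => by
    refine aestronglyMeasurable_of_tendsto_ae atTop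
      (f := fun (k : ℕ) τ => ((k : ℝ) + 1) •
        (f τ (x + ((k : ℝ) + 1)⁻¹ • EuclideanSpace.single i 1) - f τ x))
      (fun k => ((hm _).sub (hm _)).const_smul _) ?_
    filter_upwards [hd] with τ hτ
    have h := (hτ x).hasFDerivAt.lim_real (EuclideanSpace.single i 1)
    exact h.comp (tendsto_natCast_atTop_atTop.atTop_add tendsto_const_nhds)
  have e : (fun τ => fderiv ℝ (f τ) x) = fun τ => ∑ i : Fin 3,
      (ContinuousLinearMap.smulRightL ℝ R3 G (EuclideanSpace.proj i))
        (fderiv ℝ (f τ) x (EuclideanSpace.single i 1)) := by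
    funext τ
    refine ContinuousLinearMap.ext fun y => ?_
    rw [sum_apply]
    conv_lhs => rw [← (EuclideanSpace.basisFun (Fin 3) ℝ).sum_repr y, map_sum]
    refine Finset.sum_congr rfl fun i _ => ?_
    rw [map_smul]
    simp
  rw [e]
  exact Finset.aestronglyMeasurable_fun_sum _ fun i _ =>
    (ContinuousLinearMap.continuous _).comp_aestronglyMeasurable (h1 i)

end SmoothFamilies

/-! ### Differentiation under the integral -/

section Differentiation

/-- Differentiation under an integral over a bounded interval. -/
theorem contDiff_setIntegral (a b : ℝ) (n : ℕ) {G : Type} [NormedAddCommGroup G] [NormedSpace ℝ G]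
    [CompleteSpace G] {f : ℝ → R3 → G} (hf : SmoothFamily n (Ioc a b) f)
    (hm : ∀ x, AEStronglyMeasurable (fun τ => f τ x) (volume.restrict (Ioc a b))) :
    ContDiff ℝ n (fun x => ∫ τ in Ioc a b, f τ x) ∧
      ∀ j ≤ n, ∀ x, ∀ B : ℝ → ℝ, IntegrableOn B (Ioc a b) →
        (∀ τ ∈ Ioc a b, ‖iteratedFDeriv ℝ j (f τ) x‖ ≤ B τ) →
        ‖iteratedFDeriv ℝ j (fun x => ∫ τ in Ioc a b, f τ x) x‖ ≤ ∫ τ in Ioc a b, B τ := by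
  have hzero : ∀ x, ∀ B : ℝ → ℝ, IntegrableOn B (Ioc a b) →
        (∀ τ ∈ Ioc a b, ‖iteratedFDeriv ℝ 0 (f τ) x‖ ≤ B τ) →
        ‖iteratedFDeriv ℝ 0 (fun x => ∫ τ in Ioc a b, f τ x) x‖ ≤ ∫ τ in Ioc a b, B τ := by
    intro x B hB hle
    rw [norm_iteratedFDeriv_zero]
    refine norm_integral_le_of_norm_le hB ?_
    filter_upwards [ae_restrict_mem measurableSet_Ioc] with τ hτ
    rw [← norm_iteratedFDeriv_zero (𝕜 := ℝ)]
    exact hle τ hτ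
  induction n generalizing G with
  | zero =>
    refine ⟨?_, fun j hj => ?_⟩
    · rw [Nat.cast_zero, contDiff_zero, continuous_iff_continuousAt]
      intro x
      obtain ⟨C, r, hr, h⟩ := hf.bounded x
      refine continuousAt_of_dominated (bound := fun _ => C) (Eventually.of_forall hm) ?_
        (integrable_const C) ?_
      · filter_upwards [Metric.ball_mem_nhds x hr] with y hy
        filter_upwards [ae_restrict_mem measurableSet_Ioc] with τ hτ
        rw [← norm_iteratedFDeriv_zero (𝕜 := ℝ)]
        exact h τ hτ y hy 0 le_rfl
      · filter_upwards [ae_restrict_mem measurableSet_Ioc] with τ hτ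
        exact (hf.contDiff τ hτ).continuous.continuousAt
    · obtain rfl : j = 0 := by omega
      exact hzero
  | succ n ih =>
    have hd : ∀ τ ∈ Ioc a b, Differentiable ℝ (f τ) := fun τ hτ =>
      (hf.contDiff τ hτ).differentiable (by norm_cast)
    have hm' := aestronglyMeasurable_fderiv hm
      ((ae_restrict_mem measurableSet_Ioc).mono hd)
    have hD : ∀ x, HasFDerivAt (fun x => ∫ τ in Ioc a b, f τ x)
        (∫ τ in Ioc a b, fderiv ℝ (f τ) x) x := by
      intro x
      obtain ⟨C, r, hr, h⟩ := hf.bounded x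
      refine hasFDerivAt_integral_of_dominated_of_fderiv_le (F := fun x τ => f τ x)
        (F' := fun x τ => fderiv ℝ (f τ) x) (Metric.ball_mem_nhds x hr)
        (Eventually.of_forall hm) ?_ (hm' x) (bound := fun _ => C) ?_ (integrable_const C) ?_
      · refine Integrable.mono' (integrable_const C) (hm x) ?_
        filter_upwards [ae_restrict_mem measurableSet_Ioc] with τ hτ
        rw [← norm_iteratedFDeriv_zero (𝕜 := ℝ)]
        exact h τ hτ x (Metric.mem_ball_self hr) 0 (Nat.zero_le _)
      · filter_upwards [ae_restrict_mem measurableSet_Ioc] with τ hτ y hy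
        rw [← norm_iteratedFDeriv_one]
        exact h τ hτ y hy 1 (by omega)
      · filter_upwards [ae_restrict_mem measurableSet_Ioc] with τ hτ y hy
        exact (hd τ hτ y).hasFDerivAt
    have hfd : fderiv ℝ (fun x => ∫ τ in Ioc a b, f τ x) =
        fun x => ∫ τ in Ioc a b, fderiv ℝ (f τ) x := funext fun x => (hD x).fderiv
    have hz : ∀ x, ∀ B : ℝ → ℝ, IntegrableOn B (Ioc a b) →
        (∀ τ ∈ Ioc a b, ‖iteratedFDeriv ℝ 0 (fderiv ℝ (f τ)) x‖ ≤ B τ) →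
        ‖iteratedFDeriv ℝ 0 (fun x => ∫ τ in Ioc a b, fderiv ℝ (f τ) x) x‖ ≤
          ∫ τ in Ioc a b, B τ := by
      intro x B hB hle
      rw [norm_iteratedFDeriv_zero]
      refine norm_integral_le_of_norm_le hB ?_
      filter_upwards [ae_restrict_mem measurableSet_Ioc] with τ hτ
      rw [← norm_iteratedFDeriv_zero (𝕜 := ℝ)]
      exact hle τ hτ
    obtain ⟨ih1, ih2⟩ := ih hf.fderiv hm' hz
    refine ⟨?_, fun j hj x B hB hle => ?_⟩
    · have : ((n + 1 : ℕ) : WithTop ℕ∞) = (n : WithTop ℕ∞) + 1 := by norm_cast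
      rw [this, contDiff_succ_iff_fderiv]
      exact ⟨fun x => (hD x).differentiableAt, by simp, hfd ▸ ih1⟩
    · rcases j with _ | j
      · exact hzero x B hB hle
      · rw [← norm_iteratedFDeriv_fderiv, hfd]
        refine ih2 j (by omega) x B hB fun τ hτ => ?_
        rw [norm_iteratedFDeriv_fderiv]
        exact hle τ hτ

end Differentiation

/-! ### Families given by a curve of functions -/

section Displacement

variable {n : ℕ} {T : ℝ}

/-- A family of functions that is given by a `C^n` function with values in the continuous functions
of time is a smooth family, with derivatives that are continuous in time. -/
theorem smoothFamily_of_contDiff {Y G : Type} [NormedAddCommGroup Y] [NormedSpace ℝ Y]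
    [NormedAddCommGroup G] [NormedSpace ℝ G] {t : ℝ} (p : Y →L[ℝ] G)
    {Z : R3 → C(Icc 0 t, Y)} (hZ : ContDiff ℝ n Z) {f : ℝ → R3 → G}
    (hf : ∀ τ x, (hτ : τ ∈ Icc 0 t) → f τ x = p (Z x ⟨t - τ, by
      constructor <;> linarith [hτ.1, hτ.2]⟩)) :
    SmoothFamily n (Icc 0 t) f ∧
      ∀ j ≤ n, ∀ x, ContinuousOn (fun τ => iteratedFDeriv ℝ j (f τ) x) (Icc 0 t) := by
  have hrev : ∀ τ ∈ Icc 0 t, t - τ ∈ Icc 0 t := fun τ hτ =>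
    ⟨by linarith [hτ.2], by linarith [hτ.1]⟩
  have e : ∀ τ (hτ : τ ∈ Icc 0 t), f τ =
      (p ∘L ContinuousMap.evalCLM ℝ (⟨t - τ, hrev τ hτ⟩ : Icc 0 t)) ∘ Z := fun τ hτ =>
    funext fun x => hf τ x hτ
  have hit : ∀ τ (hτ : τ ∈ Icc 0 t), ∀ j ≤ n, ∀ x, iteratedFDeriv ℝ j (f τ) x =
      (p ∘L ContinuousMap.evalCLM ℝ (⟨t - τ, hrev τ hτ⟩ : Icc 0 t)).compContinuousMultilinearMap
        (iteratedFDeriv ℝ j Z x) := fun τ hτ j hj x => by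
    rw [e τ hτ]
    exact ContinuousLinearMap.iteratedFDeriv_comp_left _ hZ.contDiffAt (by exact_mod_cast hj)
  have hnorm : ∀ r : Icc 0 t, ‖p ∘L ContinuousMap.evalCLM ℝ r‖ ≤ ‖p‖ := fun r => by
    refine ContinuousLinearMap.opNorm_le_bound _ (norm_nonneg _) fun z => ?_
    exact (p.le_opNorm _).trans (by gcongr; exact z.norm_coe_le_norm r)
  refine ⟨⟨fun τ hτ => ?_, fun x => ?_⟩, fun j hj x => ?_⟩
  · rw [e τ hτ]
    exact (ContinuousLinearMap.contDiff _).comp hZ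
  · set B : ℝ := ∑ j ∈ Finset.range (n + 1), ‖iteratedFDeriv ℝ j Z x‖ + 1 with hB
    have hev : ∀ᶠ y in 𝓝 x, ∑ j ∈ Finset.range (n + 1), ‖iteratedFDeriv ℝ j Z y‖ < B := by
      have hc : Continuous fun y => ∑ j ∈ Finset.range (n + 1), ‖iteratedFDeriv ℝ j Z y‖ :=
        continuous_finsetSum _ fun j hj => (hZ.continuous_iteratedFDeriv (by
          have : j ≤ n := by simpa [Nat.lt_succ_iff] using hj
          exact_mod_cast this)).norm
      exact hc.continuousAt.eventually_lt continuousAt_const (by rw [hB]; linarith)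
    obtain ⟨r, hr, h⟩ := Metric.eventually_nhds_iff_ball.1 hev
    refine ⟨‖p‖ * B, r, hr, fun τ hτ y hy j hj => ?_⟩
    rw [hit τ hτ j hj]
    refine (ContinuousLinearMap.norm_compContinuousMultilinearMap_le _ _).trans ?_
    have h1 : ‖iteratedFDeriv ℝ j Z y‖ ≤ B :=
      (Finset.single_le_sum (f := fun j => ‖iteratedFDeriv ℝ j Z y‖)
        (fun _ _ => norm_nonneg _) (Finset.mem_range.2 (by omega))).trans (h y hy).le
    have h2 := hnorm ⟨t - τ, hrev τ hτ⟩
    gcongr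
  · rw [continuousOn_iff_continuous_domRestrict]
    have h1 := (continuous_eval_compContinuousMultilinearMap p (iteratedFDeriv ℝ j Z x)).comp
      (f := fun τ : Icc 0 t => (⟨t - τ, hrev τ τ.2⟩ : Icc 0 t)) (by fun_prop)
    refine h1.congr fun τ => ?_
    exact (hit τ τ.2 j hj x).symm

end Displacement

/-! ### Weights in time -/

section Weights

/-- The growth `⟨s⟩^{δ_m / 2} ⟨t⟩^{δ_m}` of the derivatives of order `m` of the position
`X_{s,t}`, relative to the decay `⟨s⟩^{-1/2}`; here `δ_m = m / n`. -/
def posWeight (n m : ℕ) (s t : ℝ) : ℝ := bracket s ^ (m / (2 * n) : ℝ) * bracket t ^ (m / n : ℝ)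

/-- The growth of the derivatives of order `m` of the velocity `V_{s,t}`, relative to the decay
`⟨s⟩^{-3/2}`: the first term comes from the derivatives of the potential, the second from those
of the position. -/
def velWeight (n m : ℕ) (s t : ℝ) : ℝ :=
  bracket s ^ (m * growthExp n) + bracket s ^ (growthExp n - 1 / 2) * posWeight n m s t

/-- An exponent small enough for the decay that is left after all the losses to be
integrable at the rate `⟨s⟩^{-1 - decayExp n}`. -/
def decayExp (n : ℕ) : ℝ := 1 / (8 * (n + 1))

variable {n : ℕ}

theorem decayExp_pos : 0 < decayExp n := by unfold decayExp; positivity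

theorem decayExp_le (hn : 3 ≤ n) : decayExp n ≤ 1 / 32 := by
  have : (3 : ℝ) ≤ n := by exact_mod_cast hn
  unfold decayExp
  rw [div_le_div_iff₀ (by positivity) (by norm_num)]
  linarith

theorem growthExp_nonneg : 0 ≤ growthExp n := by unfold growthExp; positivity

theorem growthExp_le (hn : 3 ≤ n) : growthExp n ≤ 11 / 24 := by
  have h3 : (3 : ℝ) ≤ n := by exact_mod_cast hn
  unfold growthExp
  rw [div_le_iff₀ (by positivity)]
  have : (1 / n : ℝ) ≤ 1 / 3 := by gcongr
  linarith

theorem one_div_le_growthExp (hn : 3 ≤ n) : (1 / n : ℝ) ≤ growthExp n := by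
  have h3 : (3 : ℝ) ≤ n := by exact_mod_cast hn
  unfold growthExp
  rw [le_div_iff₀ (by positivity)]
  have : (1 / n : ℝ) * (n + 1) = 1 + 1 / n := by field_simp
  rw [this]; linarith

theorem succ_mul_growthExp (hn : 3 ≤ n) {m : ℕ} (hm : m ≤ n) :
    m * growthExp n + growthExp n ≤ 11 / 6 := by
  have h3 : (3 : ℝ) ≤ n := by exact_mod_cast hn
  have hm' : (m : ℝ) ≤ n := by exact_mod_cast hm
  have e : (n + 1) * growthExp n = 3 / 2 + 1 / n := by unfold growthExp; field_simp
  have : (1 / n : ℝ) ≤ 1 / 3 := by gcongr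
  have := growthExp_nonneg (n := n)
  nlinarith

/-- The potential loses less per derivative than the weight of the position allows; the difference
is what makes the velocity integrable in time. -/
theorem mul_growthExp_sub_le (hn : 3 ≤ n) (m : ℕ) :
    m * growthExp n - m / n ≤ m / (2 * n) - m / n * (4 * decayExp n) := by
  have h3 : (3 : ℝ) ≤ n := by exact_mod_cast hn
  have e : m * growthExp n - m / n = m / (2 * n) - m / n * (4 * decayExp n) := by
    unfold growthExp decayExp
    field_simp
    ring
  exact e.le

theorem mul_growthExp_le (hn : 3 ≤ n) (m : ℕ) :
    m * growthExp n ≤ m / (2 * n) + m / n := by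
  have := mul_growthExp_sub_le hn m
  have h : (0 : ℝ) ≤ m / n * (4 * decayExp n) :=
    mul_nonneg (by positivity) (mul_nonneg (by norm_num) decayExp_pos.le)
  linarith

theorem bracket_rpow_pos (s p : ℝ) : 0 < bracket s ^ p := Real.rpow_pos_of_pos (bracket_pos s) p

theorem bracket_rpow_mono (s : ℝ) {p q : ℝ} (h : p ≤ q) : bracket s ^ p ≤ bracket s ^ q :=
  Real.rpow_le_rpow_of_exponent_le (one_le_bracket s) h

theorem one_le_bracket_rpow (s : ℝ) {p : ℝ} (h : 0 ≤ p) : 1 ≤ bracket s ^ p :=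
  Real.one_le_rpow (one_le_bracket s) h

theorem bracket_rpow_add (s p q : ℝ) : bracket s ^ (p + q) = bracket s ^ p * bracket s ^ q :=
  Real.rpow_add (bracket_pos s) p q

theorem bracket_rpow_anti {s τ p : ℝ} (hs : 0 ≤ s) (h : s ≤ τ) (hp : p ≤ 0) :
    bracket τ ^ p ≤ bracket s ^ p :=
  Real.rpow_le_rpow_of_nonpos (bracket_pos s) (bracket_mono hs h) hp

theorem posWeight_pos (n m : ℕ) (s t : ℝ) : 0 < posWeight n m s t :=
  mul_pos (bracket_rpow_pos _ _) (bracket_rpow_pos _ _)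

theorem one_le_velWeight (n m : ℕ) (s t : ℝ) : 1 ≤ velWeight n m s t := by
  have h1 := one_le_bracket_rpow s (mul_nonneg (Nat.cast_nonneg m) (growthExp_nonneg (n := n)))
  have h2 := mul_pos (bracket_rpow_pos s (growthExp n - 1 / 2)) (posWeight_pos n m s t)
  unfold velWeight
  linarith

theorem rpow_le_velWeight (n m : ℕ) (s t : ℝ) :
    bracket s ^ (m * growthExp n) ≤ velWeight n m s t :=
  le_add_of_nonneg_right (mul_pos (bracket_rpow_pos _ _) (posWeight_pos n m s t)).le

theorem mul_posWeight_le_velWeight (n m : ℕ) (s t : ℝ) :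
    bracket s ^ growthExp n * (bracket s ^ (-(1 / 2) : ℝ) * posWeight n m s t) ≤
      velWeight n m s t := by
  rw [← mul_assoc, ← bracket_rpow_add]
  exact le_add_of_nonneg_left (bracket_rpow_pos _ _).le

theorem posWeight_rpow {m a : ℕ} (hm : m ≠ 0) (s t : ℝ) :
    posWeight n m s t ^ (a / m : ℝ) = posWeight n a s t := by
  have hm' : (m : ℝ) ≠ 0 := by exact_mod_cast hm
  unfold posWeight
  rw [Real.mul_rpow (bracket_rpow_pos _ _).le (bracket_rpow_pos _ _).le,
    ← Real.rpow_mul (bracket_pos s).le, ← Real.rpow_mul (bracket_pos t).le]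
  congr 2 <;> field_simp

/-- The weights are almost geometric in the order of differentiation. -/
theorem velWeight_le_rpow (hn : 3 ≤ n) {m a : ℕ} (hm : m ≠ 0) (ha : a ≤ m) (s t : ℝ) :
    velWeight n a s t ≤ 2 * velWeight n m s t ^ (a / m : ℝ) := by
  have hm' : (m : ℝ) ≠ 0 := by exact_mod_cast hm
  have hp : (0 : ℝ) ≤ a / m := by positivity
  have hp1 : (a / m : ℝ) ≤ 1 := div_le_one_of_le₀ (by exact_mod_cast ha) (by positivity)
  have hk := growthExp_le hn
  have h1 : bracket s ^ (a * growthExp n) ≤ velWeight n m s t ^ (a / m : ℝ) := by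
    refine le_of_eq_of_le ?_ (Real.rpow_le_rpow (bracket_rpow_pos _ _).le
      (rpow_le_velWeight n m s t) hp)
    rw [← Real.rpow_mul (bracket_pos s).le]
    congr 1
    field_simp
  have h2 : bracket s ^ (growthExp n - 1 / 2) * posWeight n a s t ≤
      velWeight n m s t ^ (a / m : ℝ) := by
    have h3 : bracket s ^ (growthExp n - 1 / 2) * posWeight n m s t ≤ velWeight n m s t :=
      le_add_of_nonneg_left (bracket_rpow_pos _ _).le
    refine le_trans ?_ (Real.rpow_le_rpow
      (mul_pos (bracket_rpow_pos _ _) (posWeight_pos n m s t)).le h3 hp)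
    rw [Real.mul_rpow (bracket_rpow_pos _ _).le (posWeight_pos n m s t).le, posWeight_rpow hm,
      ← Real.rpow_mul (bracket_pos s).le]
    refine mul_le_mul_of_nonneg_right (bracket_rpow_mono s ?_) (posWeight_pos n a s t).le
    nlinarith
  unfold velWeight at *
  linarith

/-- The weights are almost multiplicative, as the Leibniz rule requires. -/
theorem velWeight_mul_le (hn : 3 ≤ n) {m i : ℕ} (hi : i ≤ m) (s t : ℝ) :
    velWeight n i s t * velWeight n (m - i) s t ≤ 4 * velWeight n m s t := by
  have hpos : ∀ k, 0 < velWeight n k s t := fun k =>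
    zero_lt_one.trans_le (one_le_velWeight n k s t)
  rcases eq_or_ne m 0 with rfl | hm
  · obtain rfl : i = 0 := by omega
    have h : velWeight n 0 s t ≤ 2 := by
      have := velWeight_le_rpow hn one_ne_zero (Nat.zero_le 1) s t
      simpa using this
    have := hpos 0
    simp only [Nat.sub_self]
    nlinarith
  · have h1 := velWeight_le_rpow hn hm hi s t
    have h2 := velWeight_le_rpow hn hm (Nat.sub_le m i) s t
    have e : velWeight n m s t ^ (i / m : ℝ) * velWeight n m s t ^ ((m - i : ℕ) / m : ℝ) =
        velWeight n m s t := by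
      rw [← Real.rpow_add (hpos m), ← add_div, Nat.cast_sub hi, add_sub_cancel,
        div_self (by exact_mod_cast hm), Real.rpow_one]
    calc _ ≤ (2 * velWeight n m s t ^ (i / m : ℝ)) *
          (2 * velWeight n m s t ^ ((m - i : ℕ) / m : ℝ)) :=
          mul_le_mul h1 h2 (hpos _).le (mul_nonneg zero_le_two (Real.rpow_nonneg (hpos m).le _))
      _ = 4 * (velWeight n m s t ^ (i / m : ℝ) * velWeight n m s t ^ ((m - i : ℕ) / m : ℝ)) := by
          ring
      _ = _ := by rw [e]

/-- Integrability in time of the remainder of the normal form along the characteristics. -/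
theorem rpow_mul_velWeight_le (hn : 3 ≤ n) {m : ℕ} (hm : m ≤ n) {s τ t : ℝ} (hs : 0 ≤ s)
    (hsτ : s ≤ τ) :
    bracket τ ^ (-3 + growthExp n) * velWeight n m τ t ≤
      bracket τ ^ (-1 - decayExp n) *
        (bracket s ^ decayExp n * (bracket s ^ (-(3 / 2) : ℝ) * velWeight n m s t)) := by
  have h1 := succ_mul_growthExp hn hm
  have h2 := growthExp_le hn
  have h3 := decayExp_le hn
  have hm2 : (m / (2 * n) : ℝ) ≤ 1 / 2 := by
    have h3 : (3 : ℝ) ≤ n := by exact_mod_cast hn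
    have : (m : ℝ) ≤ n := by exact_mod_cast hm
    rw [div_le_div_iff₀ (by positivity) (by norm_num)]
    linarith
  unfold velWeight posWeight
  have e1 : bracket τ ^ (-3 + growthExp n) * bracket τ ^ (m * growthExp n) ≤
      bracket τ ^ (-1 - decayExp n) * (bracket s ^ decayExp n *
        (bracket s ^ (-(3 / 2) : ℝ) * bracket s ^ (m * growthExp n))) := by
    rw [← bracket_rpow_add, ← bracket_rpow_add, ← bracket_rpow_add,
      show -3 + growthExp n + m * growthExp n =
        (-1 - decayExp n) + (-2 + decayExp n + growthExp n + m * growthExp n) by ring,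
      bracket_rpow_add τ (-1 - decayExp n)]
    refine mul_le_mul_of_nonneg_left ?_ (bracket_rpow_pos _ _).le
    exact (bracket_rpow_anti hs hsτ (by linarith)).trans (bracket_rpow_mono s (by linarith))
  have e2 : bracket τ ^ (-3 + growthExp n) * (bracket τ ^ (growthExp n - 1 / 2) *
        bracket τ ^ (m / (2 * n) : ℝ)) ≤
      bracket τ ^ (-1 - decayExp n) * (bracket s ^ decayExp n *
        (bracket s ^ (-(3 / 2) : ℝ) * (bracket s ^ (growthExp n - 1 / 2) *
          bracket s ^ (m / (2 * n) : ℝ)))) := by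
    rw [← bracket_rpow_add, ← bracket_rpow_add, ← bracket_rpow_add, ← bracket_rpow_add,
      ← bracket_rpow_add,
      show -3 + growthExp n + (growthExp n - 1 / 2 + m / (2 * n)) = (-1 - decayExp n) +
        (-2 + decayExp n + growthExp n + (growthExp n - 1 / 2 + m / (2 * n))) by ring,
      bracket_rpow_add τ (-1 - decayExp n)]
    refine mul_le_mul_of_nonneg_left ?_ (bracket_rpow_pos _ _).le
    exact (bracket_rpow_anti hs hsτ (by linarith)).trans (bracket_rpow_mono s (by linarith))
  have e3 := mul_le_mul_of_nonneg_right e2 (bracket_rpow_pos t (m / n : ℝ)).le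
  calc _ = bracket τ ^ (-3 + growthExp n) * bracket τ ^ (m * growthExp n) +
        bracket τ ^ (-3 + growthExp n) * (bracket τ ^ (growthExp n - 1 / 2) *
        bracket τ ^ (m / (2 * n) : ℝ)) * bracket t ^ (m / n : ℝ) := by ring
    _ ≤ _ := add_le_add e1 e3
    _ = _ := by ring

/-- Integrability in time of the velocity, at the cost of one power of decay. -/
theorem rpow_mul_velWeight_le_posWeight (hn : 3 ≤ n) {m : ℕ} (hm : m ≤ n) (hm1 : 1 ≤ m)
    {s τ t : ℝ} (hs : 0 ≤ s) (hsτ : s ≤ τ) (hτt : τ ≤ t) :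
    bracket τ ^ (-(3 / 2) : ℝ) * velWeight n m τ t ≤
      2 * (bracket τ ^ (-1 - decayExp n) *
        (bracket s ^ decayExp n * (bracket s ^ (-(1 / 2) : ℝ) * posWeight n m s t))) := by
  have hn3 : (3 : ℝ) ≤ n := by exact_mod_cast hn
  have hmn : (m / n : ℝ) ≤ 1 := div_le_one_of_le₀ (by exact_mod_cast hm) (by positivity)
  have hmn1 : (1 / n : ℝ) ≤ m / n := by
    have : (1 : ℝ) ≤ m := by exact_mod_cast hm1
    gcongr
  have hm2 : (m / (2 * n) : ℝ) = 1 / 2 * (m / n) := by field_simp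
  have h1 := mul_growthExp_sub_le hn m
  have h2 := growthExp_le hn
  have h3 := decayExp_le hn
  have h4 := decayExp_pos (n := n)
  unfold velWeight posWeight
  rw [hm2] at h1 ⊢
  have ht : bracket τ ^ (m / n : ℝ) ≤ bracket t ^ (m / n : ℝ) :=
    Real.rpow_le_rpow (bracket_pos τ).le (bracket_mono (hs.trans hsτ) hτt) (by positivity)
  have e1 : bracket τ ^ (-(3 / 2) : ℝ) * bracket τ ^ (m * growthExp n) ≤
      bracket τ ^ (-1 - decayExp n) * (bracket s ^ decayExp n *
        (bracket s ^ (-(1 / 2) : ℝ) * bracket s ^ (1 / 2 * (m / n) : ℝ))) *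
        bracket t ^ (m / n : ℝ) := by
    rw [← bracket_rpow_add, ← bracket_rpow_add, ← bracket_rpow_add,
      show -(3 / 2) + m * growthExp n = ((-1 - decayExp n) +
        (-(1 / 2) + decayExp n + (m * growthExp n - m / n))) + m / n by ring,
      bracket_rpow_add τ _ (m / n), bracket_rpow_add τ (-1 - decayExp n)]
    refine mul_le_mul ?_ ht (bracket_rpow_pos _ _).le
      (mul_pos (bracket_rpow_pos _ _) (bracket_rpow_pos _ _)).le
    refine mul_le_mul_of_nonneg_left ?_ (bracket_rpow_pos _ _).le
    refine (bracket_rpow_anti hs hsτ ?_).trans (bracket_rpow_mono s ?_) <;>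
      nlinarith [mul_nonneg (show (0 : ℝ) ≤ m / n by positivity) h4.le]
  have e2 : bracket τ ^ (-(3 / 2) : ℝ) * (bracket τ ^ (growthExp n - 1 / 2) *
        bracket τ ^ (1 / 2 * (m / n) : ℝ)) * bracket t ^ (m / n : ℝ) ≤
      bracket τ ^ (-1 - decayExp n) * (bracket s ^ decayExp n *
        (bracket s ^ (-(1 / 2) : ℝ) * bracket s ^ (1 / 2 * (m / n) : ℝ))) *
        bracket t ^ (m / n : ℝ) := by
    refine mul_le_mul_of_nonneg_right ?_ (bracket_rpow_pos _ _).le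
    rw [← bracket_rpow_add, ← bracket_rpow_add, ← bracket_rpow_add, ← bracket_rpow_add,
      show -(3 / 2) + (growthExp n - 1 / 2 + 1 / 2 * (m / n)) = (-1 - decayExp n) +
        (-1 + decayExp n + growthExp n + 1 / 2 * (m / n)) by ring,
      bracket_rpow_add τ (-1 - decayExp n)]
    refine mul_le_mul_of_nonneg_left ?_ (bracket_rpow_pos _ _).le
    exact (bracket_rpow_anti hs hsτ (by linarith)).trans (bracket_rpow_mono s (by linarith))
  calc _ = bracket τ ^ (-(3 / 2) : ℝ) * bracket τ ^ (m * growthExp n) +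
        bracket τ ^ (-(3 / 2) : ℝ) * (bracket τ ^ (growthExp n - 1 / 2) *
        bracket τ ^ (1 / 2 * (m / n) : ℝ)) * bracket t ^ (m / n : ℝ) := by ring
    _ ≤ _ := add_le_add e1 e2
    _ = _ := by ring

/-- The weight of the velocity is dominated by the rate of the final estimate. -/
theorem velWeight_le (hn : 3 ≤ n) (m : ℕ) (s t : ℝ) :
    bracket s ^ (-(3 / 2) : ℝ) * velWeight n m s t ≤
      2 * (bracket s ^ (-(3 / 2) * (1 - m / n) : ℝ) * bracket t ^ (m / n : ℝ)) := by
  have h1 := mul_growthExp_le hn m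
  have h2 := growthExp_le hn
  have hn3 : (3 : ℝ) ≤ n := by exact_mod_cast hn
  have hm0 : (0 : ℝ) ≤ m / n := by positivity
  have hm2 : (m / (2 * n) : ℝ) = 1 / 2 * (m / n) := by field_simp
  unfold velWeight posWeight
  rw [hm2] at h1 ⊢
  have e1 : bracket s ^ (-(3 / 2) : ℝ) * bracket s ^ (m * growthExp n) ≤
      bracket s ^ (-(3 / 2) * (1 - m / n) : ℝ) * bracket t ^ (m / n : ℝ) := by
    rw [← bracket_rpow_add]
    exact (bracket_rpow_mono s (by linarith)).trans
      (le_mul_of_one_le_right (bracket_rpow_pos _ _).le (one_le_bracket_rpow t hm0))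
  have e2 : bracket s ^ (-(3 / 2) : ℝ) * (bracket s ^ (growthExp n - 1 / 2) *
      bracket s ^ (1 / 2 * (m / n) : ℝ)) * bracket t ^ (m / n : ℝ) ≤
      bracket s ^ (-(3 / 2) * (1 - m / n) : ℝ) * bracket t ^ (m / n : ℝ) := by
    refine mul_le_mul_of_nonneg_right ?_ (bracket_rpow_pos _ _).le
    rw [← bracket_rpow_add, ← bracket_rpow_add]
    exact bracket_rpow_mono s (by linarith)
  linarith

/-- The weight of the position is the rate of the final estimate. -/
theorem rpow_mul_posWeight (hn : 3 ≤ n) (m : ℕ) (s t : ℝ) :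
    bracket s ^ (-(1 / 2) : ℝ) * posWeight n m s t =
      bracket s ^ (-(1 / 2) * (1 - m / n) : ℝ) * bracket t ^ (m / n : ℝ) := by
  have hn3 : (3 : ℝ) ≤ n := by exact_mod_cast hn
  unfold posWeight
  rw [← mul_assoc, ← bracket_rpow_add]
  congr 2
  field_simp
  ring

/-- The potential at the terminal time `t` obeys the bound required at time `s`. -/
theorem rpow_terminal_le (hn : 3 ≤ n) {m : ℕ} (hm : m ≤ n) {s t : ℝ} (hs : 0 ≤ s) (hst : s ≤ t) :
    bracket t ^ (-(3 / 2) + m * growthExp n : ℝ) ≤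
      bracket s ^ (-(3 / 2) : ℝ) * velWeight n m s t := by
  have h1 := mul_growthExp_le hn m
  have hn3 : (3 : ℝ) ≤ n := by exact_mod_cast hn
  have hmn : (m / n : ℝ) ≤ 1 := div_le_one_of_le₀ (by exact_mod_cast hm) (by positivity)
  have hm2 : (m / (2 * n) : ℝ) = 1 / 2 * (m / n) := by field_simp
  refine (bracket_rpow_anti hs hst (by linarith)).trans ?_
  rw [bracket_rpow_add]
  exact mul_le_mul_of_nonneg_left (rpow_le_velWeight n m s t) (bracket_rpow_pos _ _).le

theorem continuous_bracket_rpow (p : ℝ) : Continuous fun s : ℝ => bracket s ^ p := by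
  have h : Continuous fun s : ℝ => bracket s := by unfold bracket; fun_prop
  exact h.rpow_const fun s => Or.inl (bracket_pos s).ne'

theorem continuous_posWeight (n m : ℕ) (t : ℝ) : Continuous fun s => posWeight n m s t :=
  (continuous_bracket_rpow _).mul continuous_const

theorem continuous_velWeight (n m : ℕ) (t : ℝ) : Continuous fun s => velWeight n m s t :=
  (continuous_bracket_rpow _).add
    ((continuous_bracket_rpow _).mul (continuous_posWeight n m t))

theorem integral_bracket_rpow_le {θ : ℝ} (hθ : 0 < θ) (hθ1 : θ ≤ 1) {s t : ℝ} (hs : 0 ≤ s)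
    (hst : s ≤ t) : ∫ τ in Ioc s t, bracket τ ^ (-1 - θ) ≤ 4 / θ * bracket s ^ (-θ) := by
  have hbr : ∀ τ : ℝ, 0 ≤ τ → bracket τ ≤ 1 + τ ∧ (1 + τ) / 2 ≤ bracket τ := fun τ hτ => by
    unfold bracket
    rw [Real.norm_eq_abs, sq_abs]
    exact ⟨Real.sqrt_le_iff.2 ⟨by linarith, by nlinarith⟩,
      Real.le_sqrt_of_sq_le (by nlinarith [sq_nonneg (1 - τ)])⟩
  have hpt : ∀ τ ∈ Icc s t, bracket τ ^ (-1 - θ) ≤ 4 * (τ + 1) ^ (-1 - θ) := fun τ hτ => by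
    have h0 : 0 ≤ τ := hs.trans hτ.1
    refine (Real.rpow_le_rpow_of_nonpos (by linarith) (hbr τ h0).2 (by linarith)).trans ?_
    rw [div_eq_inv_mul, Real.mul_rpow (by norm_num) (by linarith), add_comm τ]
    refine mul_le_mul_of_nonneg_right ?_ (Real.rpow_nonneg (by linarith) _)
    rw [Real.inv_rpow (by norm_num), ← Real.rpow_neg (by norm_num)]
    calc (2 : ℝ) ^ (-(-1 - θ)) ≤ 2 ^ (2 : ℝ) :=
          Real.rpow_le_rpow_of_exponent_le (by norm_num) (by linarith)
      _ = 4 := by norm_num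
  have hc : ContinuousOn (fun τ : ℝ => 4 * (τ + 1) ^ (-1 - θ)) (uIcc s t) := by
    rw [uIcc_of_le hst]
    refine continuousOn_const.mul (ContinuousOn.rpow_const (by fun_prop) fun τ hτ => Or.inl ?_)
    linarith [hτ.1]
  rw [← intervalIntegral.integral_of_le hst]
  calc ∫ τ in s..t, bracket τ ^ (-1 - θ) ≤ ∫ τ in s..t, 4 * (τ + 1) ^ (-1 - θ) :=
        intervalIntegral.integral_mono_on hst
          ((continuous_bracket_rpow _).intervalIntegrable _ _) hc.intervalIntegrable hpt
    _ = 4 * (((s + 1) ^ (-θ) - (t + 1) ^ (-θ)) / θ) := by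
        rw [intervalIntegral.integral_const_mul,
          intervalIntegral.integral_comp_add_right (fun τ => τ ^ (-1 - θ)),
          integral_rpow (Or.inr ⟨by linarith, fun h => by
            rw [uIcc_of_le (by linarith)] at h
            linarith [h.1]⟩)]
        rw [show -1 - θ + 1 = -θ by ring]
        field_simp
        ring
    _ ≤ 4 / θ * bracket s ^ (-θ) := by
        have h1 : (s + 1) ^ (-θ) ≤ bracket s ^ (-θ) :=
          Real.rpow_le_rpow_of_nonpos (bracket_pos s) (by linarith [(hbr s hs).1]) (by linarith)
        have h2 : 0 ≤ (t + 1) ^ (-θ) := Real.rpow_nonneg (by linarith) _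
        rw [div_mul_eq_mul_div, mul_div_assoc]
        gcongr
        linarith

end Weights

/-! ### The continuity method -/

section Continuity

/-- The continuity method, backwards in time: a continuous function that is not positive at the end
of an interval stays below `1` if, as long as it does so on `[s, t]`, it is at most `1 / 2`
at `s`. -/
theorem le_one_of_bootstrap {q : ℝ → ℝ} {t : ℝ} (hc : ContinuousOn q (Icc 0 t)) (ht : q t ≤ 0)
    (h : ∀ s ∈ Icc 0 t, (∀ τ ∈ Icc s t, q τ ≤ 1) → q s ≤ 1 / 2) : ∀ s ∈ Icc 0 t, q s ≤ 1 := by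
  intro s hs
  by_contra! hq
  have hcs : ContinuousOn q (Icc s t) := hc.mono (Icc_subset_Icc_left hs.1)
  have hcl : IsClosed (Icc s t ∩ q ⁻¹' Ici 1) := hcs.preimage_isClosed_of_isClosed isClosed_Icc
    isClosed_Ici
  -- the last time `c` at which `q ≥ 1`
  obtain ⟨c, ⟨hc1, hc2⟩, hmax⟩ := (isCompact_Icc.of_isClosed_subset hcl
    inter_subset_left).exists_isGreatest ⟨s, ⟨le_rfl, hs.2⟩, hq.le⟩
  have hc2' : 1 ≤ q c := hc2
  have hlast : ∀ τ ∈ Icc c t, q τ ≤ 1 := by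
    intro τ hτ
    by_contra! hτ1
    obtain ⟨d, hd, hd1⟩ := intermediate_value_Icc' hτ.2
      (hcs.mono (Icc_subset_Icc_left (hc1.1.trans hτ.1))) ⟨ht.trans zero_le_one, hτ1.le⟩
    have hdc : d ≤ c := hmax ⟨⟨hc1.1.trans (hτ.1.trans hd.1), hd.2⟩, hd1.ge⟩
    have : d = τ := le_antisymm (hdc.trans hτ.1) hd.1
    rw [this] at hd1
    linarith
  have := h c ⟨hs.1.trans hc1.1, hc1.2⟩ hlast
  linarith

end Continuity

/-! ### Composition with almost geometric weights -/

section Composition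

/-- The chain rule of higher order, with derivatives of the outer function that grow by a factor
`B` and derivatives of the inner function with an almost geometric growth `Λ`. -/
theorem norm_iteratedFDeriv_comp_le_weight {G G' : Type} [NormedAddCommGroup G] [NormedSpace ℝ G]
    [NormedAddCommGroup G'] [NormedSpace ℝ G'] {g : G → G'} {f : R3 → G} {m : ℕ}
    (hg : ContDiff ℝ m g) (hf : ContDiff ℝ m f) {A B c : ℝ} (hA : 0 ≤ A) (hB : 0 < B) (hc : 1 ≤ c)
    {w : ℕ → ℝ} (hw1 : 1 ≤ w m) (hw : m ≠ 0 → ∀ a ≤ m, w a ≤ 2 * w m ^ (a / m : ℝ)) {x : R3}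
    (hgb : ∀ j ≤ m, ‖iteratedFDeriv ℝ j g (f x)‖ ≤ A * B ^ j)
    (hfb : ∀ a, 1 ≤ a → a ≤ m → B * ‖iteratedFDeriv ℝ a f x‖ ≤ c * w a) :
    ‖iteratedFDeriv ℝ m (fun y => g (f y)) x‖ ≤ m.factorial * A * (2 * c) ^ m * w m := by
  rcases eq_or_ne m 0 with rfl | hm
  · rw [norm_iteratedFDeriv_zero]
    have := hgb 0 le_rfl
    rw [norm_iteratedFDeriv_zero] at this
    simp only [pow_zero, mul_one, Nat.factorial_zero, Nat.cast_one, one_mul] at this ⊢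
    nlinarith
  have hm' : (m : ℝ) ≠ 0 := by exact_mod_cast hm
  have hw0 : 0 < w m := zero_lt_one.trans_le hw1
  -- rescaling by `B` makes the derivatives of the outer function uniformly bounded
  have e : (fun y => g (f y)) = (fun z => g (B⁻¹ • z)) ∘ (fun y => B • f y) := by
    funext y
    simp [smul_smul, inv_mul_cancel₀ hB.ne']
  have hg' : ContDiff ℝ m fun z => g (B⁻¹ • z) := hg.comp (contDiff_const_smul _)
  have hf' : ContDiff ℝ m fun y => B • f y := hf.const_smul B
  rw [e]
  have key := norm_iteratedFDeriv_comp_le (𝕜 := ℝ) (n := m) (N := m) hg' hf' le_rfl x (C := A)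
    (D := 2 * c * w m ^ (1 / m : ℝ)) (fun j hj => ?_) (fun a ha1 ha => ?_)
  · refine key.trans (le_of_eq ?_)
    rw [mul_pow, ← Real.rpow_natCast (w m ^ (1 / m : ℝ)), ← Real.rpow_mul hw0.le,
      one_div_mul_cancel hm', Real.rpow_one]
    ring
  · have hjn : (j : WithTop ℕ∞) ≤ (m : WithTop ℕ∞) := by exact_mod_cast hj
    have e1 : iteratedFDeriv ℝ j (fun z => g (B⁻¹ • z)) (B • f x) =
        B⁻¹ ^ j • iteratedFDeriv ℝ j g (f x) := by
      rw [iteratedFDeriv_comp_const_smul B⁻¹ (hg.of_le hjn)]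
      simp [smul_smul, inv_mul_cancel₀ hB.ne']
    rw [e1, norm_smul, norm_pow, norm_inv, Real.norm_of_nonneg hB.le, inv_pow,
      inv_mul_le_iff₀ (by positivity), mul_comm]
    exact hgb j hj
  · have han : (a : WithTop ℕ∞) ≤ (m : WithTop ℕ∞) := by exact_mod_cast ha
    have e1 : iteratedFDeriv ℝ a (fun y => B • f y) x = B • iteratedFDeriv ℝ a f x :=
      iteratedFDeriv_const_smul_apply (hf.contDiffAt.of_le han)
    rw [e1, norm_smul, Real.norm_of_nonneg hB.le, mul_pow]
    have h1 : (w m ^ (1 / m : ℝ)) ^ a = w m ^ (a / m : ℝ) := by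
      rw [← Real.rpow_natCast, ← Real.rpow_mul hw0.le, one_div_mul_eq_div]
    rw [h1]
    have h0 : 0 ≤ w m ^ (a / m : ℝ) := Real.rpow_nonneg hw0.le _
    calc _ ≤ c * w a := hfb a ha1 ha
      _ ≤ c * (2 * w m ^ (a / m : ℝ)) := by gcongr; exact hw hm a ha
      _ = (2 * c) * w m ^ (a / m : ℝ) := by ring
      _ ≤ (2 * c) ^ a * w m ^ (a / m : ℝ) := by
          gcongr
          exact le_self_pow₀ (by linarith) (by omega)

end Composition

/-! ### Estimates along the characteristics -/

section PathEstimates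

variable {n : ℕ}

theorem iteratedFDeriv_const_add_of_ne {G : Type} [NormedAddCommGroup G] [NormedSpace ℝ G] {j : ℕ}
    (hj : j ≠ 0) {f : R3 → G} (hf : ContDiff ℝ j f) (c : G) (x : R3) :
    iteratedFDeriv ℝ j (fun y => c + f y) x = iteratedFDeriv ℝ j f x := by
  have h : iteratedFDeriv ℝ j (fun y => c + f y) x =
      iteratedFDeriv ℝ j (fun _ : R3 => c) x + iteratedFDeriv ℝ j f x :=
    iteratedFDeriv_add_apply contDiff_const.contDiffAt hf.contDiffAt
  rw [h, iteratedFDeriv_const_of_ne hj]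
  simp

theorem norm_iteratedFDeriv_id_le {j : ℕ} (hj : 1 ≤ j) (x : R3) :
    ‖iteratedFDeriv ℝ j (fun y : R3 => y) x‖ ≤ if j = 1 then 1 else 0 := by
  obtain ⟨k, rfl⟩ : ∃ k, j = k + 1 := ⟨j - 1, by omega⟩
  rw [← norm_iteratedFDeriv_fderiv,
    show fderiv ℝ (fun y : R3 => y) = fun _ => ContinuousLinearMap.id ℝ R3 from
      funext fun y => fderiv_fun_id]
  rcases eq_or_ne k 0 with rfl | hk
  · rw [norm_iteratedFDeriv_zero, if_pos rfl]
    exact ContinuousLinearMap.norm_id_le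
  · rw [iteratedFDeriv_const_of_ne hk, if_neg (by omega)]
    simp

theorem velWeight_zero_le (hn : 3 ≤ n) (s t : ℝ) : velWeight n 0 s t ≤ 2 := by
  have := velWeight_le_rpow hn one_ne_zero (Nat.zero_le 1) s t
  simpa using this

theorem exists_relVel_bound (n : ℕ) (ρ : ℝ) : ∃ A : ℝ, 4 ≤ A ∧ ∀ j ≤ n, ∀ w, ‖w‖ ≤ ρ →
    ‖iteratedFDeriv ℝ j relVel w‖ ≤ A := by
  have hc : Continuous fun w => ∑ j ∈ Finset.range (n + 1), ‖iteratedFDeriv ℝ j relVel w‖ :=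
    continuous_finsetSum _ fun j hj =>
      ((contDiff_relVel (n := j)).continuous_iteratedFDeriv le_rfl).norm
  obtain ⟨C, hC⟩ := (isCompact_closedBall (0 : R3) ρ).exists_bound_of_continuousOn hc.continuousOn
  refine ⟨max C 4, le_max_right _ _, fun j hj w hw => ?_⟩
  have h1 := hC w (by rwa [mem_closedBall_zero_iff])
  refine le_trans ?_ (((Real.le_norm_self _).trans h1).trans (le_max_left _ _))
  exact Finset.single_le_sum (f := fun j => ‖iteratedFDeriv ℝ j relVel w‖)
    (fun _ _ => norm_nonneg _) (Finset.mem_range.2 (by omega))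

/-- The relativistic velocity inherits the bounds on the derivatives of the momentum. -/
theorem norm_iteratedFDeriv_relVel_sub_le (hn : 3 ≤ n) {ρ A : ℝ} (hA : 4 ≤ A)
    (hAb : ∀ j ≤ n, ∀ w, ‖w‖ ≤ ρ + 2 → ‖iteratedFDeriv ℝ j relVel w‖ ≤ A) {v : R3} (hv : ‖v‖ ≤ ρ)
    {η : ℝ} (hη : 0 < η) (hη1 : η ≤ 1) {s t : ℝ} {f : R3 → R3} (hf : ContDiff ℝ n f) {x : R3}
    (hfb : ∀ a ≤ n, ‖iteratedFDeriv ℝ a f x‖ ≤ η * velWeight n a s t) {m : ℕ} (hm : m ≤ n) :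
    ‖iteratedFDeriv ℝ m (fun y => relVel (v + f y) - relVel v) x‖ ≤
      n.factorial * 2 ^ n * A * η * velWeight n m s t := by
  have h0 : ‖f x‖ ≤ 2 * η := by
    have := hfb 0 (Nat.zero_le _)
    rw [norm_iteratedFDeriv_zero] at this
    nlinarith [velWeight_zero_le hn s t]
  have hm' : (m : WithTop ℕ∞) ≤ (n : WithTop ℕ∞) := by exact_mod_cast hm
  have hw0 : 0 ≤ velWeight n m s t := zero_le_one.trans (one_le_velWeight n m s t)
  -- with `B = η⁻¹`, the outer function is of size `η` while its derivatives stay bounded, so that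
  -- the result is linear in `η`
  have key := norm_iteratedFDeriv_comp_le_weight (m := m) (g := fun w => -relVel v + relVel w)
    (f := fun y => v + f y) (contDiff_const.add contDiff_relVel)
    (contDiff_const.add (hf.of_le hm')) (A := A * η) (B := η⁻¹) (c := 1) (by positivity)
    (by positivity) le_rfl (w := fun a => velWeight n a s t) (one_le_velWeight n m s t)
    (fun hm0 a ha => velWeight_le_rpow hn hm0 ha s t) (x := x) (fun j hj => ?_)
    (fun a ha1 ha => ?_)
  · have e : (fun y => relVel (v + f y) - relVel v) = fun y => -relVel v + relVel (v + f y) := by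
      funext y
      abel
    rw [e]
    refine key.trans ?_
    have h1 : (m.factorial : ℝ) ≤ n.factorial := by exact_mod_cast Nat.factorial_le hm
    have h2 : (2 * 1 : ℝ) ^ m ≤ 2 ^ n := by
      rw [mul_one]; exact pow_le_pow_right₀ (by norm_num) hm
    calc _ = m.factorial * (2 * 1) ^ m * (A * η * velWeight n m s t) := by ring
      _ ≤ n.factorial * 2 ^ n * (A * η * velWeight n m s t) := by gcongr
      _ = _ := by ring
  · rcases eq_or_ne j 0 with rfl | hj0
    · rw [norm_iteratedFDeriv_zero, pow_zero, mul_one, neg_add_eq_sub]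
      refine (norm_relVel_sub_le _ _).trans ?_
      rw [add_sub_cancel_left]
      nlinarith
    · rw [iteratedFDeriv_const_add_of_ne hj0 contDiff_relVel]
      refine (hAb j (hj.trans hm) _ ?_).trans ?_
      · refine (norm_add_le _ _).trans ?_
        linarith
      · obtain ⟨k, rfl⟩ := Nat.exists_eq_succ_of_ne_zero hj0
        rw [pow_succ', ← mul_assoc, mul_inv_cancel_right₀ hη.ne']
        exact le_mul_of_one_le_right (by linarith) (one_le_pow₀ ((one_le_inv₀ hη).2 hη1))
  · rw [iteratedFDeriv_const_add_of_ne (by omega) (hf.of_le (by exact_mod_cast ha.trans hm)),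
      one_mul, inv_mul_le_iff₀ hη]
    exact hfb a (ha.trans hm)

/-- Composition with the position, for a function whose derivatives grow like those of the
potential. -/
theorem norm_iteratedFDeriv_comp_pos_le (hn : 3 ≤ n) {G : Type} [NormedAddCommGroup G]
    [NormedSpace ℝ G] {m : ℕ} (hm : m ≤ n) {g : R3 → G} (hg : ContDiff ℝ m g) {f : R3 → R3}
    (hf : ContDiff ℝ n f) {A s t : ℝ} (hA : 0 ≤ A) {x : R3}
    (hgb : ∀ j ≤ m, ∀ z, ‖iteratedFDeriv ℝ j g z‖ ≤ A * bracket s ^ (j * growthExp n))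
    (hfb : ∀ a, 1 ≤ a → a ≤ n →
      ‖iteratedFDeriv ℝ a f x‖ ≤ bracket s ^ (-(1 / 2) : ℝ) * posWeight n a s t) :
    ‖iteratedFDeriv ℝ m (fun y => g (y + f y)) x‖ ≤
      n.factorial * 4 ^ n * A * velWeight n m s t := by
  have hm' : (m : WithTop ℕ∞) ≤ (n : WithTop ℕ∞) := by exact_mod_cast hm
  have hw0 : 0 ≤ velWeight n m s t := zero_le_one.trans (one_le_velWeight n m s t)
  have hP := bracket_rpow_pos s (growthExp n)
  have key := norm_iteratedFDeriv_comp_le_weight (m := m) (g := g) (f := fun y => y + f y) hg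
    (contDiff_id.add (hf.of_le hm')) (A := A) (B := bracket s ^ growthExp n) (c := 2) hA
    hP (by norm_num) (w := fun a => velWeight n a s t) (one_le_velWeight n m s t)
    (fun hm0 a ha => velWeight_le_rpow hn hm0 ha s t) (x := x) (fun j hj => ?_)
    (fun a ha1 ha => ?_)
  · refine key.trans ?_
    have h1 : (m.factorial : ℝ) ≤ n.factorial := by exact_mod_cast Nat.factorial_le hm
    have h2 : (2 * 2 : ℝ) ^ m ≤ 4 ^ n := by
      norm_num
      exact pow_le_pow_right₀ (by norm_num) hm
    calc _ = m.factorial * (2 * 2) ^ m * (A * velWeight n m s t) := by ring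
      _ ≤ n.factorial * 4 ^ n * (A * velWeight n m s t) := by gcongr
      _ = _ := by ring
  · rw [← Real.rpow_mul_natCast (bracket_pos s).le, mul_comm (growthExp n)]
    exact hgb j hj _
  · have e : iteratedFDeriv ℝ a (fun y => y + f y) x =
        iteratedFDeriv ℝ a (fun y : R3 => y) x + iteratedFDeriv ℝ a f x :=
      iteratedFDeriv_add_apply contDiff_id.contDiffAt
        (hf.of_le (by exact_mod_cast ha.trans hm)).contDiffAt
    have h1 : bracket s ^ growthExp n * ‖iteratedFDeriv ℝ a (fun y : R3 => y) x‖ ≤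
        velWeight n a s t := by
      have h2 := norm_iteratedFDeriv_id_le ha1 x
      have h3 := rpow_le_velWeight n a s t
      split_ifs at h2 with h
      · rw [h, Nat.cast_one, one_mul] at h3
        rw [h] at h2 ⊢
        nlinarith
      · have := one_le_velWeight n a s t
        nlinarith
    have h4 : bracket s ^ growthExp n * ‖iteratedFDeriv ℝ a f x‖ ≤ velWeight n a s t :=
      (mul_le_mul_of_nonneg_left (hfb a ha1 (ha.trans hm)) hP.le).trans
        (mul_posWeight_le_velWeight n a s t)
    rw [e]
    have h5 := mul_le_mul_of_nonneg_left
      (norm_add_le (iteratedFDeriv ℝ a (fun y : R3 => y) x) (iteratedFDeriv ℝ a f x)) hP.le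
    linarith

variable {ε T : ℝ} {S₀ : ℤˣ → Lp ℂ 2 (volume : Measure R3)} {S : ℤˣ → ℝ → R3 → ℂ}
  {Eosc : ℤˣ → ℝ → R3 → C3} {Er : ℝ → R3 → C3} {E : ℝ → R3 → R3}

/-- The integrand of the normal form identity along the characteristics, where `f` and `g` are the
displacements of position and momentum. -/
def pathRemainder (S₀ : ℤˣ → Lp ℂ 2 (volume : Measure R3)) (S : ℤˣ → ℝ → R3 → ℂ)
    (E : ℝ → R3 → R3) (v : R3) (f g : ℝ → R3 → R3) (τ : ℝ) (y : R3) : C3 :=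
  remainder (relVel v) S₀ S E τ (y + f τ y) -
    fderiv ℝ (potential (relVel v) S₀ S τ) (y + f τ y) (relVel (v + g τ y) - relVel v)

theorem normalFormConst_nonneg {w0 : ℝ} (hw : w0 < 1) : 0 ≤ normalFormConst w0 n := by
  have h10 : 0 < 1 - w0 := by linarith
  have := weightConst_nonneg
  unfold normalFormConst
  have hrz : 0 ≤ ∑ i, |rieszConst w0 i| := Finset.sum_nonneg fun _ _ => abs_nonneg _
  positivity

namespace IsOscillatoryElectricField

theorem potential_deriv_le (H : IsOscillatoryElectricField (n + 1) ε T S₀ S Eosc Er E)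
    (hε : 0 < ε) {τ : ℝ} (hτ : τ ∈ Icc 0 T) {w0 : ℝ} (hw : w0 < 1) {u : R3} (hu : ‖u‖ ≤ w0)
    {j : ℕ} (hj : j ≤ n) (z : R3) :
    ‖iteratedFDeriv ℝ j (fderiv ℝ (potential u S₀ S τ)) z‖ ≤ normalFormConst w0 n * ε *
      bracket τ ^ (-(3 / 2) + growthExp n) * bracket τ ^ (j * growthExp n) := by
  rw [norm_iteratedFDeriv_fderiv, mul_assoc _ (bracket τ ^ _), ← bracket_rpow_add]
  refine ((H.potential_bounds hε hτ hw hu).2 (j + 1) (by omega) z).trans (le_of_eq ?_)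
  push_cast
  congr 2
  ring

theorem remainder_deriv_le (hn : 3 ≤ n)
    (H : IsOscillatoryElectricField (n + 1) ε T S₀ S Eosc Er E)
    (hε : 0 < ε) {τ : ℝ} (hτ : τ ∈ Icc 0 T) {w0 : ℝ} (hw : w0 < 1) {u : R3} (hu : ‖u‖ ≤ w0)
    {j : ℕ} (hj : j ≤ n) (z : R3) :
    ‖iteratedFDeriv ℝ j (remainder u S₀ S E τ) z‖ ≤ normalFormConst w0 n * ε *
      bracket τ ^ (-3 + growthExp n) * bracket τ ^ (j * growthExp n) := by
  rw [mul_assoc _ (bracket τ ^ _), ← bracket_rpow_add]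
  refine ((remainder_bounds (by omega) H hε hτ hw hu).2 j hj z).trans ?_
  refine mul_le_mul_of_nonneg_left (bracket_rpow_mono τ ?_)
    (mul_nonneg (normalFormConst_nonneg hw) hε.le)
  have h1 := mul_le_mul_of_nonneg_left (one_div_le_growthExp hn) (Nat.cast_nonneg (α := ℝ) j)
  have := growthExp_nonneg (n := n)
  linarith

/-- The integrand of the normal form identity, differentiated in the end point. Both of its terms
decay like `⟨τ⟩^{-3}` up to the weights: the remainder by itself, the other one as a product of two
factors of size `⟨τ⟩^{-3/2}`. -/
theorem norm_iteratedFDeriv_pathRemainder_le (hn : 3 ≤ n)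
    (H : IsOscillatoryElectricField (n + 1) ε T S₀ S Eosc Er E)
    (hε : 0 < ε) {τ t : ℝ} (hτ : τ ∈ Icc 0 T) {w0 : ℝ} (hw : w0 < 1) {v : R3}
    (hu : ‖relVel v‖ ≤ w0) {f g : ℝ → R3 → R3} (hf : ContDiff ℝ n (f τ)) (hg : ContDiff ℝ n (g τ))
    {x : R3} (hfb : ∀ a, 1 ≤ a → a ≤ n →
      ‖iteratedFDeriv ℝ a (f τ) x‖ ≤ bracket τ ^ (-(1 / 2) : ℝ) * posWeight n a τ t)
    {B : ℝ} (hB : 0 ≤ B)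
    (hgb : ∀ a ≤ n, ‖iteratedFDeriv ℝ a (fun y => relVel (v + g τ y) - relVel v) x‖ ≤
      B * bracket τ ^ (-(3 / 2) : ℝ) * velWeight n a τ t) {m : ℕ} (hm : m ≤ n) :
    ‖iteratedFDeriv ℝ m (pathRemainder S₀ S E v f g τ) x‖ ≤
      n.factorial * 4 ^ n * normalFormConst w0 n * (1 + 2 ^ n * 4 * B) * ε *
        (bracket τ ^ (-3 + growthExp n) * velWeight n m τ t) := by
  have hm' : (m : WithTop ℕ∞) ≤ (n : WithTop ℕ∞) := by exact_mod_cast hm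
  have hN := normalFormConst_nonneg (n := n) hw
  have hw0 : ∀ a, 0 ≤ velWeight n a τ t := fun a => zero_le_one.trans (one_le_velWeight n a τ t)
  set N := normalFormConst w0 n with hNdef
  set M : ℝ := n.factorial * 4 ^ n with hM
  have hM0 : 0 ≤ M := by positivity
  have hrc := (remainder_bounds (by omega) H hε hτ hw hu).1
  have hpc := (H.potential_bounds hε hτ hw hu).1
  have hdc : ContDiff ℝ n (fderiv ℝ (potential (relVel v) S₀ S τ)) :=
    hpc.fderiv_right (by norm_cast)
  have hxc : ContDiff ℝ n fun y => y + f τ y := contDiff_id.add hf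
  have hWc : ContDiff ℝ n fun y => relVel (v + g τ y) - relVel v :=
    (contDiff_relVel.comp (contDiff_const.add hg)).sub contDiff_const
  have h1 : ‖iteratedFDeriv ℝ m (fun y => remainder (relVel v) S₀ S E τ (y + f τ y)) x‖ ≤
      M * (N * ε * bracket τ ^ (-3 + growthExp n)) * velWeight n m τ t :=
    norm_iteratedFDeriv_comp_pos_le hn hm (hrc.of_le hm') hf
      (mul_nonneg (mul_nonneg hN hε.le) (bracket_rpow_pos _ _).le)
      (fun j hj z => H.remainder_deriv_le hn hε hτ hw hu (hj.trans hm) z) hfb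
  have h2 : ∀ i ≤ n, ‖iteratedFDeriv ℝ i
      (fun y => fderiv ℝ (potential (relVel v) S₀ S τ) (y + f τ y)) x‖ ≤
      M * (N * ε * bracket τ ^ (-(3 / 2) + growthExp n)) * velWeight n i τ t := fun i hi =>
    norm_iteratedFDeriv_comp_pos_le hn hi (hdc.of_le (by exact_mod_cast hi)) hf
      (mul_nonneg (mul_nonneg hN hε.le) (bracket_rpow_pos _ _).le)
      (fun j hj z => H.potential_deriv_le hε hτ hw hu (hj.trans hi) z) hfb
  have h3 : ‖iteratedFDeriv ℝ m (fun y => fderiv ℝ (potential (relVel v) S₀ S τ) (y + f τ y)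
      (relVel (v + g τ y) - relVel v)) x‖ ≤
      M * N * (2 ^ n * 4 * B) * ε * (bracket τ ^ (-3 + growthExp n) * velWeight n m τ t) := by
    refine (norm_iteratedFDeriv_clm_apply (𝕜 := ℝ) (N := n) (hdc.comp hxc) hWc x hm').trans ?_
    have hterm : ∀ i ∈ Finset.range (m + 1), (m.choose i : ℝ) *
        ‖iteratedFDeriv ℝ i (fun y => fderiv ℝ (potential (relVel v) S₀ S τ) (y + f τ y)) x‖ *
        ‖iteratedFDeriv ℝ (m - i) (fun y => relVel (v + g τ y) - relVel v) x‖ ≤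
        (m.choose i : ℝ) * (M * N * (4 * B) * ε *
          (bracket τ ^ (-3 + growthExp n) * velWeight n m τ t)) := by
      intro i hi
      have hi' : i ≤ m := by simpa [Nat.lt_succ_iff] using hi
      rw [mul_assoc]
      refine mul_le_mul_of_nonneg_left ?_ (Nat.cast_nonneg _)
      have hb1 := bracket_rpow_pos τ (-(3 / 2) + growthExp n)
      have hb2 := bracket_rpow_pos τ (-(3 / 2))
      refine (mul_le_mul (h2 i (hi'.trans hm)) (hgb (m - i) ((Nat.sub_le _ _).trans hm))
        (norm_nonneg _) (mul_nonneg (mul_nonneg hM0 (mul_nonneg (mul_nonneg hN hε.le) hb1.le))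
          (hw0 i))).trans ?_
      have e : bracket τ ^ (-3 + growthExp n) =
          bracket τ ^ (-(3 / 2) + growthExp n) * bracket τ ^ (-(3 / 2) : ℝ) := by
        rw [← bracket_rpow_add]
        congr 1
        ring
      have hc : 0 ≤ M * N * B * ε *
          (bracket τ ^ (-(3 / 2) + growthExp n) * bracket τ ^ (-(3 / 2) : ℝ)) := by positivity
      have h4 := mul_le_mul_of_nonneg_left (velWeight_mul_le hn hi' τ t) hc
      rw [e]
      linarith
    refine (Finset.sum_le_sum hterm).trans ?_
    rw [← Finset.sum_mul, show ∑ i ∈ Finset.range (m + 1), (m.choose i : ℝ) = 2 ^ m by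
      exact_mod_cast Nat.sum_range_choose m]
    have h5 : (2 : ℝ) ^ m ≤ 2 ^ n := pow_le_pow_right₀ (by norm_num) hm
    have h6 : 0 ≤ M * N * (4 * B) * ε * (bracket τ ^ (-3 + growthExp n) * velWeight n m τ t) :=
      mul_nonneg (by positivity) (mul_nonneg (bracket_rpow_pos _ _).le (hw0 m))
    have := mul_le_mul_of_nonneg_right h5 h6
    linarith
  have e : iteratedFDeriv ℝ m (pathRemainder S₀ S E v f g τ) x =
      iteratedFDeriv ℝ m (fun y => remainder (relVel v) S₀ S E τ (y + f τ y)) x -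
      iteratedFDeriv ℝ m (fun y => fderiv ℝ (potential (relVel v) S₀ S τ) (y + f τ y)
        (relVel (v + g τ y) - relVel v)) x :=
    iteratedFDeriv_sub_apply ((hrc.comp hxc).of_le hm').contDiffAt
      (((hdc.comp hxc).clm_apply hWc).of_le hm').contDiffAt
  rw [e]
  have := norm_sub_le
    (iteratedFDeriv ℝ m (fun y => remainder (relVel v) S₀ S E τ (y + f τ y)) x)
    (iteratedFDeriv ℝ m (fun y => fderiv ℝ (potential (relVel v) S₀ S τ) (y + f τ y)
        (relVel (v + g τ y) - relVel v)) x)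
  linarith

/-- The integrand of the normal form identity can be differentiated under the integral. -/
theorem smoothFamily_pathRemainder (hn : 3 ≤ n)
    (H : IsOscillatoryElectricField (n + 1) ε T S₀ S Eosc Er E)
    (hε : 0 < ε) {t : ℝ} (ht : t ∈ Icc 0 T) {v : R3} (hu : ‖relVel v‖ < 1) {f g : ℝ → R3 → R3}
    (hf : SmoothFamily n (Icc 0 t) f) (hg : SmoothFamily n (Icc 0 t) g) :
    SmoothFamily n (Icc 0 t) (pathRemainder S₀ S E v f g) := by
  have hmem : ∀ τ ∈ Icc 0 t, τ ∈ Icc 0 T := fun τ hτ => ⟨hτ.1, hτ.2.trans ht.2⟩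
  have hN := normalFormConst_nonneg (n := n) hu
  have hx : SmoothFamily n (Icc 0 t) fun τ y => y + f τ y := by
    have := (smoothFamily_const n (Icc 0 t) (contDiff_id (𝕜 := ℝ) (E := R3))).add hf
    exact this
  have hV : SmoothFamily n (Icc 0 t) fun τ y => relVel (v + g τ y) - relVel v := by
    have h1 := (smoothFamily_const n (Icc 0 t) (contDiff_const (𝕜 := ℝ) (E := R3) (c := v))).add hg
    refine (h1.comp (g := fun _ => relVel) (fun _ _ => contDiff_relVel) fun ρ => ?_).sub
      (smoothFamily_const n (Icc 0 t) contDiff_const)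
    obtain ⟨A, -, hA⟩ := exists_relVel_bound n ρ
    exact ⟨A, fun _ _ z hz j hj => hA j hj z hz⟩
  have hbd : ∀ τ ∈ Icc 0 t, ∀ p ≤ (2 : ℝ), bracket τ ^ p ≤ bracket T ^ (2 : ℝ) :=
    fun τ hτ p hp => (bracket_rpow_mono τ hp).trans
      (Real.rpow_le_rpow (bracket_pos τ).le (bracket_mono hτ.1 (hmem τ hτ).2) (by norm_num))
  have hmu := fun j (hj : j ≤ n) => succ_mul_growthExp hn hj
  have hmu0 := growthExp_nonneg (n := n)
  have hr : SmoothFamily n (Icc 0 t) fun τ y => remainder (relVel v) S₀ S E τ (y + f τ y) := by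
    refine hx.comp (fun τ hτ => (remainder_bounds (by omega) H hε (hmem τ hτ) hu le_rfl).1)
      fun ρ => ⟨normalFormConst ‖relVel v‖ n * ε * bracket T ^ (2 : ℝ), fun τ hτ z _ j hj =>
        (H.remainder_deriv_le hn hε (hmem τ hτ) hu le_rfl hj z).trans ?_⟩
    rw [mul_assoc _ (bracket τ ^ _), ← bracket_rpow_add]
    exact mul_le_mul_of_nonneg_left (hbd τ hτ _ (by linarith [hmu j hj]))
      (mul_nonneg hN hε.le)
  have hp : SmoothFamily n (Icc 0 t) fun τ y =>
      fderiv ℝ (potential (relVel v) S₀ S τ) (y + f τ y) := by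
    refine hx.comp (fun τ hτ =>
      (H.potential_bounds hε (hmem τ hτ) hu le_rfl).1.fderiv_right (by norm_cast))
      fun ρ => ⟨normalFormConst ‖relVel v‖ n * ε * bracket T ^ (2 : ℝ), fun τ hτ z _ j hj =>
        (H.potential_deriv_le hε (hmem τ hτ) hu le_rfl hj z).trans ?_⟩
    rw [mul_assoc _ (bracket τ ^ _), ← bracket_rpow_add]
    exact mul_le_mul_of_nonneg_left (hbd τ hτ _ (by linarith [hmu j hj]))
      (mul_nonneg hN hε.le)
  exact hr.sub (hp.clm_apply hV)

end IsOscillatoryElectricField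
end PathEstimates

/-! ### Improvement of the bounds on the displacements -/

section Bootstrap

variable {n : ℕ} {ε T : ℝ} {S₀ : ℤˣ → Lp ℂ 2 (volume : Measure R3)} {S : ℤˣ → ℝ → R3 → ℂ}
  {Eosc : ℤˣ → ℝ → R3 → C3} {Er : ℝ → R3 → C3} {E : ℝ → R3 → R3}
  {X V : ℝ → ℝ → R3 → R3 → R3}

/-- Momenta in a bounded set have velocities bounded away from the speed of light. -/
theorem exists_norm_relVel_le (ρ : ℝ) (hρ : 0 ≤ ρ) :
    ∃ w0 < (1 : ℝ), ∀ v : R3, ‖v‖ ≤ ρ → ‖relVel v‖ ≤ w0 := by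
  obtain ⟨v₀, -, hmax⟩ := (isCompact_closedBall (0 : R3) ρ).exists_isMaxOn
    ⟨0, by simpa using hρ⟩ (contDiff_relVel (n := 0)).continuous.norm.continuousOn
  refine ⟨‖relVel v₀‖, ?_, fun v hv => hmax (by simpa using hv)⟩
  unfold relVel
  rw [norm_smul, norm_inv, Real.norm_of_nonneg (bracket_pos v₀).le,
    inv_mul_lt_iff₀ (bracket_pos v₀), mul_one]
  exact Real.lt_sqrt_of_sq_lt (by linarith)

/-- The momentum along the characteristics, by the normal form identity. -/
theorem IsOscillatoryElectricField.momentum_eq (hn : 1 ≤ n)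
    (H : IsOscillatoryElectricField (n + 1) ε T S₀ S Eosc Er E) (HC : IsCharacteristic T E X V)
    (hε : 0 ≤ ε) {t : ℝ} (ht : t ∈ Icc 0 T) {v : R3} (hu : ‖relVel v‖ < 1) {s : ℝ}
    (hs : s ∈ Icc 0 t) (y : R3) :
    IntegrableOn (fun τ => pathRemainder S₀ S E v (fun τ y => X τ t y v - y)
      (fun τ y => V τ t y v - v) τ y) (Ioc s t) ∧
    complexify (V s t y v - v) = potential (relVel v) S₀ S s (y + (X s t y v - y)) -
      potential (relVel v) S₀ S t y - ∫ τ in Ioc s t, pathRemainder S₀ S E v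
        (fun τ y => X τ t y v - y) (fun τ y => V τ t y v - v) τ y := by
  have hsub : Icc s t ⊆ Icc 0 t := Icc_subset_Icc_left hs.1
  have hX : ∀ τ ∈ Icc s t, HasDerivWithinAt (fun r => X r t y v) (relVel (V τ t y v)) (Icc s t) τ :=
    fun τ hτ => (HC.pos_deriv t ht y v τ (hsub hτ)).mono hsub
  have hV : ∀ τ ∈ Icc s t, HasDerivWithinAt (fun r => V r t y v) (E τ (X τ t y v)) (Icc s t) τ :=
    fun τ hτ => (HC.vel_deriv t ht y v τ (hsub hτ)).mono hsub
  have hXc : ContinuousOn (fun r => X r t y v) (Icc s t) := fun τ hτ => (hX τ hτ).continuousWithinAt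
  have hVc : ContinuousOn (fun r => V r t y v) (Icc s t) := fun τ hτ => (hV τ hτ).continuousWithinAt
  have hW : ContinuousOn (fun τ => relVel (V τ t y v)) (Icc s t) :=
    (contDiff_relVel (n := 0)).continuous.comp_continuousOn hVc
  obtain ⟨hint, heq⟩ := potential_path hn H hε hu hs.1 hs.2 ht.2 hX hW
  have hR : (fun τ => pathRemainder S₀ S E v (fun τ y => X τ t y v - y)
      (fun τ y => V τ t y v - v) τ y) = fun τ =>
      remainder (relVel v) S₀ S E τ (X τ t y v) -
        fderiv ℝ (potential (relVel v) S₀ S τ) (X τ t y v) (relVel (V τ t y v) - relVel v) := by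
    funext τ
    unfold pathRemainder
    simp only [add_sub_cancel]
  have hEc : ContinuousOn (fun τ => E τ (X τ t y v)) (Icc s t) :=
    H.continuous_field.comp (continuousOn_id.prodMk hXc) fun τ hτ =>
      ⟨⟨hs.1.trans hτ.1, hτ.2.trans ht.2⟩, mem_univ _⟩
  have hEi : IntervalIntegrable (fun τ => E τ (X τ t y v)) volume s t :=
    (by rwa [uIcc_of_le hs.2] : ContinuousOn _ (uIcc s t)).intervalIntegrable
  have hcEi : IntervalIntegrable (fun τ => complexify (E τ (X τ t y v))) volume s t :=
    (by rw [uIcc_of_le hs.2]; exact complexify.continuous.comp_continuousOn hEc :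
      ContinuousOn _ (uIcc s t)).intervalIntegrable
  have hFTC : ∫ τ in s..t, E τ (X τ t y v) = v - V s t y v := by
    rw [intervalIntegral.integral_eq_sub_of_hasDeriv_right_of_le hs.2 hVc
      (fun τ hτ => ((hV τ ⟨hτ.1.le, hτ.2.le⟩).hasDerivAt
        (Icc_mem_nhds hτ.1 hτ.2)).hasDerivWithinAt) hEi, HC.vel_init t ht]
  have hcE : ∫ τ in s..t, complexify (E τ (X τ t y v)) = complexify (v - V s t y v) := by
    rw [← hFTC]
    exact complexify.intervalIntegral_comp_comm hEi
  rw [hR]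
  refine ⟨(intervalIntegrable_iff_integrableOn_Ioc_of_le hs.2).1 hint, ?_⟩
  rw [intervalIntegral.integral_sub hcEi hint, hcE, HC.pos_init t ht] at heq
  rw [← intervalIntegral.integral_of_le hs.2, add_sub_cancel, ← neg_sub v, map_neg]
  have h2 : complexify (v - V s t y v) = (potential (relVel v) S₀ S t y -
      potential (relVel v) S₀ S s (X s t y v)) + ∫ τ in s..t,
      (remainder (relVel v) S₀ S E τ (X τ t y v) -
        fderiv ℝ (potential (relVel v) S₀ S τ) (X τ t y v) (relVel (V τ t y v) - relVel v)) := by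
    rw [heq]; abel
  rw [h2]; abel

/-- The position along the characteristics. The free part `-(t - s) v̂` does not depend on the end
point, so that it disappears from the derivatives. -/
theorem IsCharacteristic.position_eq (HC : IsCharacteristic T E X V) {t : ℝ} (ht : t ∈ Icc 0 T)
    (v : R3) {s : ℝ} (hs : s ∈ Icc 0 t) (y : R3) :
    IntegrableOn (fun τ => relVel (v + (V τ t y v - v)) - relVel v) (Ioc s t) ∧
    X s t y v - y = -(t - s) • relVel v -
      ∫ τ in Ioc s t, (relVel (v + (V τ t y v - v)) - relVel v) := by
  have hsub : Icc s t ⊆ Icc 0 t := Icc_subset_Icc_left hs.1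
  have hX : ∀ τ ∈ Icc s t, HasDerivWithinAt (fun r => X r t y v) (relVel (V τ t y v)) (Icc s t) τ :=
    fun τ hτ => (HC.pos_deriv t ht y v τ (hsub hτ)).mono hsub
  have hXc : ContinuousOn (fun r => X r t y v) (Icc s t) := fun τ hτ => (hX τ hτ).continuousWithinAt
  have hVc : ContinuousOn (fun r => V r t y v) (Icc s t) := fun τ hτ =>
    (HC.vel_deriv t ht y v τ (hsub hτ)).continuousWithinAt.mono hsub
  have hW : ContinuousOn (fun τ => relVel (V τ t y v)) (Icc s t) :=
    (contDiff_relVel (n := 0)).continuous.comp_continuousOn hVc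
  have hWi : IntervalIntegrable (fun τ => relVel (V τ t y v)) volume s t :=
    (by rwa [uIcc_of_le hs.2] : ContinuousOn _ (uIcc s t)).intervalIntegrable
  have hFTC : ∫ τ in s..t, relVel (V τ t y v) = y - X s t y v := by
    rw [intervalIntegral.integral_eq_sub_of_hasDeriv_right_of_le hs.2 hXc
      (fun τ hτ => ((hX τ ⟨hτ.1.le, hτ.2.le⟩).hasDerivAt
        (Icc_mem_nhds hτ.1 hτ.2)).hasDerivWithinAt) hWi, HC.pos_init t ht]
  simp only [add_sub_cancel]
  refine ⟨(intervalIntegrable_iff_integrableOn_Ioc_of_le hs.2).1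
    (hWi.sub intervalIntegrable_const), ?_⟩
  rw [← intervalIntegral.integral_of_le hs.2,
    intervalIntegral.integral_sub hWi intervalIntegrable_const, hFTC,
    intervalIntegral.integral_const, neg_smul]
  abel

theorem integral_decay_mul_le {s t W : ℝ} (hs : s ∈ Icc 0 t) (hW : 0 ≤ W) :
    ∫ τ in Ioc s t, bracket τ ^ (-1 - decayExp n) * (bracket s ^ decayExp n * W) ≤
      4 / decayExp n * W := by
  have hθ := decayExp_pos (n := n)
  have hθ1 : decayExp n ≤ 1 := by
    unfold decayExp
    rw [div_le_one (by positivity)]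
    have : (0 : ℝ) ≤ n := Nat.cast_nonneg n
    linarith
  rw [integral_mul_const]
  have h1 := integral_bracket_rpow_le hθ hθ1 hs.1 hs.2
  have h2 := bracket_rpow_pos s (decayExp n)
  calc _ ≤ 4 / decayExp n * bracket s ^ (-decayExp n) * (bracket s ^ decayExp n * W) := by gcongr
    _ = 4 / decayExp n * (bracket s ^ (-decayExp n) * bracket s ^ decayExp n) * W := by ring
    _ = _ := by rw [← bracket_rpow_add, neg_add_cancel, Real.rpow_zero, mul_one]

theorem integrableOn_decay_mul {s t p W : ℝ} :
    IntegrableOn (fun τ : ℝ => bracket τ ^ p * W) (Ioc s t) :=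
  ((continuous_bracket_rpow p).mul continuous_const).integrableOn_Ioc

/-- `complexify` as a linear isometry. -/
def complexifyIsometry : R3 →ₗᵢ[ℝ] C3 := ⟨complexify.toLinearMap, norm_complexify⟩

theorem complexifyIsometry_apply (x : R3) : complexifyIsometry x = complexify x := rfl

/-- The constant in the bound of the momentum; `A` bounds the derivatives of the relativistic
velocity. -/
def momentumConst (n : ℕ) (w0 A : ℝ) : ℝ :=
  1 + (n.factorial * 4 ^ n * normalFormConst w0 n + normalFormConst w0 n +
    n.factorial * 4 ^ n * normalFormConst w0 n *
      (1 + 2 ^ n * 4 * (n.factorial * 2 ^ n * A)) * (4 / decayExp n))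

theorem one_le_momentumConst {w0 A : ℝ} (hw : w0 < 1) (hA : 0 ≤ A) : 1 ≤ momentumConst n w0 A := by
  have h1 := normalFormConst_nonneg (n := n) hw
  have h2 := decayExp_pos (n := n)
  unfold momentumConst
  have : 0 ≤ (n.factorial * 4 ^ n * normalFormConst w0 n + normalFormConst w0 n +
    n.factorial * 4 ^ n * normalFormConst w0 n *
      (1 + 2 ^ n * 4 * (n.factorial * 2 ^ n * A)) * (4 / decayExp n)) := by positivity
  linarith

/-- The bound on the momentum improves: if the bounds on position and momentum hold on `[s, t]`,
then the one on the momentum holds at `s` with a small factor `ε`. -/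
theorem IsOscillatoryElectricField.momentum_deriv_le (hn : 3 ≤ n)
    (H : IsOscillatoryElectricField (n + 1) ε T S₀ S Eosc Er E) (HC : IsCharacteristic T E X V)
    (hε : 0 < ε) {t : ℝ} (ht : t ∈ Icc 0 T) {ρ A w0 : ℝ} (hA : 4 ≤ A)
    (hAb : ∀ j ≤ n, ∀ w, ‖w‖ ≤ ρ + 2 → ‖iteratedFDeriv ℝ j relVel w‖ ≤ A) {v : R3} (hv : ‖v‖ ≤ ρ)
    (hw : w0 < 1) (hu : ‖relVel v‖ ≤ w0)
    (hf : SmoothFamily n (Icc 0 t) fun τ y => X τ t y v - y)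
    (hg : SmoothFamily n (Icc 0 t) fun τ y => V τ t y v - v) {s : ℝ} (hs : s ∈ Icc 0 t) {x : R3}
    (hfb : ∀ τ ∈ Icc s t, ∀ a, 1 ≤ a → a ≤ n → ‖iteratedFDeriv ℝ a (fun y => X τ t y v - y) x‖ ≤
      bracket τ ^ (-(1 / 2) : ℝ) * posWeight n a τ t)
    (hgb : ∀ τ ∈ Icc s t, ∀ a ≤ n, ‖iteratedFDeriv ℝ a (fun y => V τ t y v - v) x‖ ≤
      bracket τ ^ (-(3 / 2) : ℝ) * velWeight n a τ t) {m : ℕ} (hm : m ≤ n) :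
    ‖iteratedFDeriv ℝ m (fun y => V s t y v - v) x‖ ≤
      momentumConst n w0 A * ε * (bracket s ^ (-(3 / 2) : ℝ) * velWeight n m s t) := by
  have hm' : (m : WithTop ℕ∞) ≤ (n : WithTop ℕ∞) := by exact_mod_cast hm
  have hu1 : ‖relVel v‖ < 1 := hu.trans_lt hw
  have hN := normalFormConst_nonneg (n := n) hw
  have hsub : Ioc s t ⊆ Icc 0 t := fun τ hτ => ⟨hs.1.trans hτ.1.le, hτ.2⟩
  have hsT : s ∈ Icc 0 T := ⟨hs.1, hs.2.trans ht.2⟩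
  set N := normalFormConst w0 n with hNdef
  set M : ℝ := n.factorial * 4 ^ n with hM
  set A' : ℝ := n.factorial * 2 ^ n * A with hA'
  have hM0 : 0 ≤ M := by positivity
  have hA0 : 0 ≤ A' := by positivity
  obtain ⟨R, hRdef⟩ : ∃ R, R = pathRemainder S₀ S E v (fun τ y => X τ t y v - y)
    (fun τ y => V τ t y v - v) := ⟨_, rfl⟩
  have hid : ∀ y, IntegrableOn (fun τ => R τ y) (Ioc s t) ∧
      complexify (V s t y v - v) = potential (relVel v) S₀ S s (y + (X s t y v - y)) -
        potential (relVel v) S₀ S t y - ∫ τ in Ioc s t, R τ y := by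
    rw [hRdef]
    exact fun y => H.momentum_eq (by omega) HC hε.le ht hu1 hs y
  have hR : SmoothFamily n (Ioc s t) R := by
    rw [hRdef]
    exact (H.smoothFamily_pathRemainder hn hε ht hu1 hf hg).mono hsub
  obtain ⟨hI1, hI2⟩ := contDiff_setIntegral s t n hR fun y => (hid y).1.aestronglyMeasurable
  have hps := (H.potential_bounds hε hsT hw hu)
  have hpt := (H.potential_bounds hε ht hw hu)
  set W : ℝ := bracket s ^ (-(3 / 2) : ℝ) * velWeight n m s t with hWdef
  have hW0 : 0 ≤ W := mul_nonneg (bracket_rpow_pos _ _).le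
    (zero_le_one.trans (one_le_velWeight n m s t))
  -- the potential at time `s`
  have b1 : ‖iteratedFDeriv ℝ m
      (fun y => potential (relVel v) S₀ S s (y + (X s t y v - y))) x‖ ≤ M * N * ε * W := by
    have h1 := norm_iteratedFDeriv_comp_pos_le (A := N * ε * bracket s ^ (-(3 / 2) : ℝ)) (s := s)
      (t := t) hn hm
      (hps.1.of_le (by exact_mod_cast hm.trans (Nat.le_succ n))) (hf.contDiff s hs)
      (mul_nonneg (mul_nonneg hN hε.le) (bracket_rpow_pos _ _).le)
      (fun j hj z => by
        rw [mul_assoc _ (bracket s ^ _), ← bracket_rpow_add]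
        exact hps.2 j (by omega) z) (hfb s ⟨le_rfl, hs.2⟩)
    refine h1.trans (le_of_eq ?_)
    rw [hWdef]
    ring
  -- the potential at time `t`
  have b2 : ‖iteratedFDeriv ℝ m (potential (relVel v) S₀ S t) x‖ ≤ N * ε * W :=
    (hpt.2 m (by omega) x).trans (mul_le_mul_of_nonneg_left
      (rpow_terminal_le hn hm hs.1 hs.2) (mul_nonneg hN hε.le))
  -- the remainder
  have b3 : ‖iteratedFDeriv ℝ m (fun y => ∫ τ in Ioc s t, R τ y) x‖ ≤
      M * N * (1 + 2 ^ n * 4 * A') * ε * (4 / decayExp n * W) := by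
    have hK : 0 ≤ M * N * (1 + 2 ^ n * 4 * A') * ε := by positivity
    have h1 := hI2 m hm x (fun τ => M * N * (1 + 2 ^ n * 4 * A') * ε *
      (bracket τ ^ (-1 - decayExp n) * (bracket s ^ decayExp n * W)))
      (integrableOn_decay_mul.const_mul _) fun τ hτ => ?_
    · refine h1.trans ?_
      rw [integral_const_mul]
      exact mul_le_mul_of_nonneg_left (integral_decay_mul_le hs hW0) hK
    · have hτ' : τ ∈ Icc s t := ⟨hτ.1.le, hτ.2⟩
      have hτ0 := hsub hτ
      rw [hRdef]
      refine (H.norm_iteratedFDeriv_pathRemainder_le (f := fun τ y => X τ t y v - y)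
        (g := fun τ y => V τ t y v - v) (t := t) (B := A') hn hε ⟨hτ0.1, hτ0.2.trans ht.2⟩ hw hu
        (hf.contDiff τ hτ0) (hg.contDiff τ hτ0) (hfb τ hτ') hA0 (fun a ha => ?_) hm).trans ?_
      · exact norm_iteratedFDeriv_relVel_sub_le hn hA hAb hv (bracket_rpow_pos _ _)
          (Real.rpow_le_one_of_one_le_of_nonpos (one_le_bracket τ) (by norm_num))
          (hg.contDiff τ hτ0) (hgb τ hτ') ha
      · exact mul_le_mul_of_nonneg_left (rpow_mul_velWeight_le hn hm hs.1 hτ.1.le) hK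
  have c1 : ContDiff ℝ n fun y => potential (relVel v) S₀ S s (y + (X s t y v - y)) :=
    (hps.1.of_le (by exact_mod_cast Nat.le_succ n)).comp
      (contDiff_id.add (hf.contDiff s hs))
  have c2 : ContDiff ℝ n (potential (relVel v) S₀ S t) :=
    hpt.1.of_le (by exact_mod_cast Nat.le_succ n)
  have e1 : complexifyIsometry ∘ (fun y => V s t y v - v) =
      fun y => (potential (relVel v) S₀ S s (y + (X s t y v - y)) -
        potential (relVel v) S₀ S t y) - ∫ τ in Ioc s t, R τ y := by
    funext y
    rw [Function.comp_apply, complexifyIsometry_apply, (hid y).2]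
  have e2 : iteratedFDeriv ℝ m (complexifyIsometry ∘ (fun y => V s t y v - v)) x =
      (iteratedFDeriv ℝ m (fun y => potential (relVel v) S₀ S s (y + (X s t y v - y))) x -
        iteratedFDeriv ℝ m (potential (relVel v) S₀ S t) x) -
        iteratedFDeriv ℝ m (fun y => ∫ τ in Ioc s t, R τ y) x := by
    have e3 : iteratedFDeriv ℝ m (fun y => potential (relVel v) S₀ S s (y + (X s t y v - y)) -
        potential (relVel v) S₀ S t y) x =
        iteratedFDeriv ℝ m (fun y => potential (relVel v) S₀ S s (y + (X s t y v - y))) x -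
        iteratedFDeriv ℝ m (potential (relVel v) S₀ S t) x :=
      iteratedFDeriv_sub_apply (c1.of_le hm').contDiffAt (c2.of_le hm').contDiffAt
    rw [← e3, e1]
    exact iteratedFDeriv_sub_apply ((c1.sub c2).of_le hm').contDiffAt (hI1.of_le hm').contDiffAt
  rw [← complexifyIsometry.norm_iteratedFDeriv_comp_left (hg.contDiff s hs).contDiffAt hm', e2]
  have h1 := norm_sub_le (iteratedFDeriv ℝ m
      (fun y => potential (relVel v) S₀ S s (y + (X s t y v - y))) x -
        iteratedFDeriv ℝ m (potential (relVel v) S₀ S t) x)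
        (iteratedFDeriv ℝ m (fun y => ∫ τ in Ioc s t, R τ y) x)
  have h2 := norm_sub_le (iteratedFDeriv ℝ m
      (fun y => potential (relVel v) S₀ S s (y + (X s t y v - y))) x)
        (iteratedFDeriv ℝ m (potential (relVel v) S₀ S t) x)
  have h3 : 0 ≤ ε * W := mul_nonneg hε.le hW0
  have h4 : momentumConst n w0 A * ε * W = ε * W + M * N * ε * W + N * ε * W +
      M * N * (1 + 2 ^ n * 4 * A') * ε * (4 / decayExp n * W) := by
    unfold momentumConst
    rw [← hNdef, ← hM, ← hA']
    ring
  linarith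

/-- The constant in the bound of the position. -/
def positionConst (n : ℕ) (A : ℝ) : ℝ := n.factorial * 2 ^ n * A * 2 * (4 / decayExp n)

theorem positionConst_nonneg {A : ℝ} (hA : 0 ≤ A) : 0 ≤ positionConst n A := by
  have h2 := decayExp_pos (n := n)
  unfold positionConst
  positivity

/-- A small bound on the momentum on `[s, t]` gives a small bound on the position at `s`. -/
theorem IsCharacteristic.position_deriv_le (hn : 3 ≤ n) (HC : IsCharacteristic T E X V)
    {t : ℝ} (ht : t ∈ Icc 0 T) {ρ A : ℝ} (hA : 4 ≤ A)
    (hAb : ∀ j ≤ n, ∀ w, ‖w‖ ≤ ρ + 2 → ‖iteratedFDeriv ℝ j relVel w‖ ≤ A) {v : R3} (hv : ‖v‖ ≤ ρ)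
    (hg : SmoothFamily n (Icc 0 t) fun τ y => V τ t y v - v) {s : ℝ} (hs : s ∈ Icc 0 t) {x : R3}
    {η : ℝ} (hη : 0 < η) (hη1 : η ≤ 1)
    (hgb : ∀ τ ∈ Icc s t, ∀ a ≤ n, ‖iteratedFDeriv ℝ a (fun y => V τ t y v - v) x‖ ≤
      η * (bracket τ ^ (-(3 / 2) : ℝ) * velWeight n a τ t)) {m : ℕ} (hm1 : 1 ≤ m) (hm : m ≤ n) :
    ‖iteratedFDeriv ℝ m (fun y => X s t y v - y) x‖ ≤
      positionConst n A * η * (bracket s ^ (-(1 / 2) : ℝ) * posWeight n m s t) := by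
  have hm' : (m : WithTop ℕ∞) ≤ (n : WithTop ℕ∞) := by exact_mod_cast hm
  have hsub : Ioc s t ⊆ Icc 0 t := fun τ hτ => ⟨hs.1.trans hτ.1.le, hτ.2⟩
  set A' : ℝ := n.factorial * 2 ^ n * A with hA'
  have hA0 : 0 ≤ A' := by positivity
  have hid := fun y => HC.position_eq ht v hs y
  have hV : SmoothFamily n (Icc 0 t) fun τ y => relVel (v + (V τ t y v - v)) - relVel v := by
    have h1 := (smoothFamily_const n (Icc 0 t) (contDiff_const (𝕜 := ℝ) (E := R3) (c := v))).add hg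
    refine (h1.comp (g := fun _ => relVel) (fun _ _ => contDiff_relVel) fun ρ => ?_).sub
      (smoothFamily_const n (Icc 0 t) contDiff_const)
    obtain ⟨A, -, hA⟩ := exists_relVel_bound n ρ
    exact ⟨A, fun _ _ z hz j hj => hA j hj z hz⟩
  obtain ⟨hI1, hI2⟩ := contDiff_setIntegral s t n (hV.mono hsub)
    fun y => (hid y).1.aestronglyMeasurable
  set W : ℝ := bracket s ^ (-(1 / 2) : ℝ) * posWeight n m s t with hWdef
  have hW0 : 0 ≤ W := mul_nonneg (bracket_rpow_pos _ _).le (posWeight_pos n m s t).le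
  have e1 : (fun y => X s t y v - y) = fun y => -(t - s) • relVel v +
      -∫ τ in Ioc s t, (relVel (v + (V τ t y v - v)) - relVel v) :=
    funext fun y => (hid y).2.trans (sub_eq_add_neg _ _)
  have e2 : iteratedFDeriv ℝ m
      (fun y => -∫ τ in Ioc s t, (relVel (v + (V τ t y v - v)) - relVel v)) x =
      -iteratedFDeriv ℝ m
      (fun y => ∫ τ in Ioc s t, (relVel (v + (V τ t y v - v)) - relVel v)) x :=
    iteratedFDeriv_neg_apply
  rw [e1, iteratedFDeriv_const_add_of_ne (by omega) (hI1.neg.of_le hm'), e2, norm_neg]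
  have hK : 0 ≤ A' * 2 * η := by positivity
  have h1 := hI2 m hm x (fun τ => A' * 2 * η *
      (bracket τ ^ (-1 - decayExp n) * (bracket s ^ decayExp n * W)))
      (integrableOn_decay_mul.const_mul _) fun τ hτ => ?_
  · refine h1.trans ?_
    rw [integral_const_mul]
    refine (mul_le_mul_of_nonneg_left (integral_decay_mul_le hs hW0) hK).trans (le_of_eq ?_)
    unfold positionConst
    ring
  · have hτ' : τ ∈ Icc s t := ⟨hτ.1.le, hτ.2⟩
    have hb := bracket_rpow_pos τ (-(3 / 2))
    have hb1 : bracket τ ^ (-(3 / 2) : ℝ) ≤ 1 :=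
      Real.rpow_le_one_of_one_le_of_nonpos (one_le_bracket τ) (by norm_num)
    refine (norm_iteratedFDeriv_relVel_sub_le hn hA hAb hv (mul_pos hη hb)
      (mul_le_one₀ hη1 hb.le hb1) (hg.contDiff τ (hsub hτ)) (t := t) (s := τ)
      (fun a ha => (hgb τ hτ' a ha).trans (le_of_eq (by ring))) hm).trans ?_
    have h2 := mul_le_mul_of_nonneg_left
      (rpow_mul_velWeight_le_posWeight hn hm hm1 hs.1 hτ.1.le hτ.2) (mul_nonneg hA0 hη.le)
    rw [← hWdef] at h2
    linarith

end Bootstrap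

/-! ### Bounds on the displacements -/

section DisplacementBounds

variable {n : ℕ} {ε T : ℝ} {S₀ : ℤˣ → Lp ℂ 2 (volume : Measure R3)} {S : ℤˣ → ℝ → R3 → ℂ}
  {Eosc : ℤˣ → ℝ → R3 → C3} {Er : ℝ → R3 → C3} {E : ℝ → R3 → R3}
  {X V : ℝ → ℝ → R3 → R3 → R3}

/-- The displacements of position and momentum are smooth in space, locally uniformly in time. -/
theorem IsOscillatoryElectricField.displacement_smooth (hn : 1 ≤ n)
    (H : IsOscillatoryElectricField (n + 1) ε T S₀ S Eosc Er E) (HC : IsCharacteristic T E X V)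
    (hε : 0 ≤ ε) {t : ℝ} (ht : t ∈ Icc 0 T) (v : R3) :
    (SmoothFamily n (Icc 0 t) (fun τ y => X τ t y v - y) ∧ ∀ j ≤ n, ∀ x,
      ContinuousOn (fun τ => iteratedFDeriv ℝ j (fun y => X τ t y v - y) x) (Icc 0 t)) ∧
    SmoothFamily n (Icc 0 t) (fun τ y => V τ t y v - v) ∧ ∀ j ≤ n, ∀ x,
      ContinuousOn (fun τ => iteratedFDeriv ℝ j (fun y => V τ t y v - v) x) (Icc 0 t) := by
  obtain ⟨L, hL0, h1, h2, h3⟩ := H.field_regularity hε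
  obtain ⟨Z, hZ, hZe⟩ := HC.exists_contDiff hn hL0 h1 h2 H.continuous_field h3 ht v
  constructor
  · refine smoothFamily_of_contDiff (ContinuousLinearMap.fst ℝ R3 R3) hZ fun τ x hτ => ?_
    rw [hZe]
    simp
  · refine smoothFamily_of_contDiff (ContinuousLinearMap.snd ℝ R3 R3) hZ fun τ x hτ => ?_
    rw [hZe]
    simp

/-- The bootstrap argument: both displacements satisfy their bounds on the whole time interval. -/
theorem IsOscillatoryElectricField.displacement_bounds (hn : 3 ≤ n)
    (H : IsOscillatoryElectricField (n + 1) ε T S₀ S Eosc Er E) (HC : IsCharacteristic T E X V)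
    (hε : 0 < ε) {t : ℝ} (ht : t ∈ Icc 0 T) {ρ A w0 : ℝ} (hA : 4 ≤ A)
    (hAb : ∀ j ≤ n, ∀ w, ‖w‖ ≤ ρ + 2 → ‖iteratedFDeriv ℝ j relVel w‖ ≤ A) {v : R3} (hv : ‖v‖ ≤ ρ)
    (hw : w0 < 1) (hu : ‖relVel v‖ ≤ w0)
    (hsmall : (n + 1) * (momentumConst n w0 A * (1 + positionConst n A)) * ε ≤ 1 / 2)
    {s : ℝ} (hs : s ∈ Icc 0 t) (x : R3) :
    (∀ m ≤ n, ‖iteratedFDeriv ℝ m (fun y => V s t y v - v) x‖ ≤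
      momentumConst n w0 A * ε * (bracket s ^ (-(3 / 2) : ℝ) * velWeight n m s t)) ∧
    ∀ m, 1 ≤ m → m ≤ n → ‖iteratedFDeriv ℝ m (fun y => X s t y v - y) x‖ ≤
      positionConst n A * (momentumConst n w0 A * ε) *
        (bracket s ^ (-(1 / 2) : ℝ) * posWeight n m s t) := by
  obtain ⟨⟨hf, hfc⟩, hg, hgc⟩ := H.displacement_smooth (by omega) HC hε.le ht v
  have hA0 : 0 ≤ A := by linarith
  have hM1 := one_le_momentumConst (n := n) hw hA0
  have hP0 := positionConst_nonneg (n := n) hA0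
  set M := momentumConst n w0 A with hM
  set P := positionConst n A with hP
  have hMε : 0 < M * ε := by positivity
  have hn0 : (0 : ℝ) ≤ n := Nat.cast_nonneg n
  have hMε1 : M * ε ≤ 1 := by
    have : M * ε ≤ (n + 1) * (M * (1 + P)) * ε := by
      have h1 : M ≤ (n + 1) * (M * (1 + P)) := by
        nlinarith [mul_nonneg hn0 (mul_nonneg (zero_le_one.trans hM1) hP0),
          mul_nonneg (zero_le_one.trans hM1) hP0, mul_nonneg hn0 (zero_le_one.trans hM1)]
      exact mul_le_mul_of_nonneg_right h1 hε.le
    linarith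
  have hwv : ∀ m τ, 0 < bracket τ ^ (-(3 / 2) : ℝ) * velWeight n m τ t := fun m τ =>
    mul_pos (bracket_rpow_pos _ _) (zero_lt_one.trans_le (one_le_velWeight n m τ t))
  have hwx : ∀ m τ, 0 < bracket τ ^ (-(1 / 2) : ℝ) * posWeight n m τ t := fun m τ =>
    mul_pos (bracket_rpow_pos _ _) (posWeight_pos n m τ t)
  set qv : ℕ → ℝ → ℝ := fun m τ => ‖iteratedFDeriv ℝ m (fun y => V τ t y v - v) x‖ /
    (bracket τ ^ (-(3 / 2) : ℝ) * velWeight n m τ t) with hqv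
  set qx : ℕ → ℝ → ℝ := fun m τ => ‖iteratedFDeriv ℝ m (fun y => X τ t y v - y) x‖ /
    (bracket τ ^ (-(1 / 2) : ℝ) * posWeight n m τ t) with hqx
  have hqv0 : ∀ m τ, 0 ≤ qv m τ := fun m τ => div_nonneg (norm_nonneg _) (hwv m τ).le
  have hqx0 : ∀ m τ, 0 ≤ qx m τ := fun m τ => div_nonneg (norm_nonneg _) (hwx m τ).le
  set q : ℝ → ℝ := fun τ => ∑ m ∈ Finset.range (n + 1), qv m τ + ∑ m ∈ Finset.Icc 1 n, qx m τ
    with hq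
  -- as long as `q ≤ 1`, the bounds hold with a small constant
  have step : ∀ s ∈ Icc 0 t, (∀ τ ∈ Icc s t, q τ ≤ 1) →
      (∀ m ≤ n, ‖iteratedFDeriv ℝ m (fun y => V s t y v - v) x‖ ≤
        M * ε * (bracket s ^ (-(3 / 2) : ℝ) * velWeight n m s t)) ∧
      ∀ m, 1 ≤ m → m ≤ n → ‖iteratedFDeriv ℝ m (fun y => X s t y v - y) x‖ ≤
        P * (M * ε) * (bracket s ^ (-(1 / 2) : ℝ) * posWeight n m s t) := by
    intro s hs hle
    have hv1 : ∀ τ ∈ Icc s t, ∀ a ≤ n, ‖iteratedFDeriv ℝ a (fun y => V τ t y v - v) x‖ ≤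
        bracket τ ^ (-(3 / 2) : ℝ) * velWeight n a τ t := fun τ hτ a ha => by
      have h1 : qv a τ ≤ ∑ m ∈ Finset.range (n + 1), qv m τ :=
        Finset.single_le_sum (f := fun m => qv m τ) (fun m _ => hqv0 m τ)
          (Finset.mem_range.2 (by omega))
      have h2 : 0 ≤ ∑ m ∈ Finset.Icc 1 n, qx m τ := Finset.sum_nonneg fun m _ => hqx0 m τ
      have h3 : qv a τ ≤ 1 := by linarith [hle τ hτ]
      rwa [hqv, div_le_one (hwv a τ)] at h3
    have hx1 : ∀ τ ∈ Icc s t, ∀ a, 1 ≤ a → a ≤ n →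
        ‖iteratedFDeriv ℝ a (fun y => X τ t y v - y) x‖ ≤
        bracket τ ^ (-(1 / 2) : ℝ) * posWeight n a τ t := fun τ hτ a ha1 ha => by
      have h1 : qx a τ ≤ ∑ m ∈ Finset.Icc 1 n, qx m τ :=
        Finset.single_le_sum (f := fun m => qx m τ) (fun m _ => hqx0 m τ)
          (Finset.mem_Icc.2 ⟨ha1, ha⟩)
      have h2 : 0 ≤ ∑ m ∈ Finset.range (n + 1), qv m τ := Finset.sum_nonneg fun m _ => hqv0 m τ
      have h3 : qx a τ ≤ 1 := by linarith [hle τ hτ]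
      rwa [hqx, div_le_one (hwx a τ)] at h3
    have hv2 : ∀ τ ∈ Icc s t, ∀ m ≤ n, ‖iteratedFDeriv ℝ m (fun y => V τ t y v - v) x‖ ≤
        M * ε * (bracket τ ^ (-(3 / 2) : ℝ) * velWeight n m τ t) := fun τ hτ m hm =>
      H.momentum_deriv_le hn HC hε ht hA hAb hv hw hu hf hg ⟨hs.1.trans hτ.1, hτ.2⟩
        (fun r hr => hx1 r ⟨hτ.1.trans hr.1, hr.2⟩) (fun r hr => hv1 r ⟨hτ.1.trans hr.1, hr.2⟩) hm
    exact ⟨hv2 s ⟨le_rfl, hs.2⟩, fun m hm1 hm =>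
      HC.position_deriv_le hn ht hA hAb hv hg hs hMε hMε1 hv2 hm1 hm⟩
  refine step s hs fun τ hτ => ?_
  refine le_one_of_bootstrap (q := q) (t := t) ?_ ?_ (fun s hs hle => ?_) τ
    ⟨hs.1.trans hτ.1, hτ.2⟩
  · refine (continuousOn_finsetSum _ fun m hm => ?_).add (continuousOn_finsetSum _ fun m hm => ?_)
    · have hm' : m ≤ n := Nat.lt_succ_iff.1 (Finset.mem_range.1 hm)
      exact (hgc m hm' x).norm.div ((continuous_bracket_rpow _).mul
        (continuous_velWeight n m t)).continuousOn fun τ _ => (hwv m τ).ne'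
    · have hm' : m ≤ n := (Finset.mem_Icc.1 hm).2
      exact (hfc m hm' x).norm.div ((continuous_bracket_rpow _).mul
        (continuous_posWeight n m t)).continuousOn fun τ _ => (hwx m τ).ne'
  · have e1 : (fun y => V t t y v - v) = fun _ => 0 := by
      funext y; rw [HC.vel_init t ht, sub_self]
    have e2 : (fun y => X t t y v - y) = fun _ => 0 := by
      funext y; rw [HC.pos_init t ht, sub_self]
    have e3 : ∀ m, iteratedFDeriv ℝ m (fun _ : R3 => (0 : R3)) x = 0 := fun m => by
      rw [iteratedFDeriv_fun_zero]; rfl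
    simp only [hq, hqv, hqx, e1, e2, e3, norm_zero, zero_div, Finset.sum_const_zero, add_zero,
      le_refl]
  · obtain ⟨h1, h2⟩ := step s hs hle
    have h3 : ∑ m ∈ Finset.range (n + 1), qv m s ≤ (n + 1) * (M * ε) := by
      refine (Finset.sum_le_card_nsmul _ _ (M * ε) fun m hm => ?_).trans (le_of_eq ?_)
      · rw [hqv, div_le_iff₀ (hwv m s)]
        exact h1 m (Nat.lt_succ_iff.1 (Finset.mem_range.1 hm))
      · simp
    have h4 : ∑ m ∈ Finset.Icc 1 n, qx m s ≤ n * (P * (M * ε)) := by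
      refine (Finset.sum_le_card_nsmul _ _ (P * (M * ε)) fun m hm => ?_).trans (le_of_eq ?_)
      · rw [hqx, div_le_iff₀ (hwx m s)]
        exact h2 m (Finset.mem_Icc.1 hm).1 (Finset.mem_Icc.1 hm).2
      · simp
    have h5 : 0 ≤ P * (M * ε) := by positivity
    have h6 : (n + 1) * (M * (1 + P)) * ε = (n + 1) * (M * ε) + n * (P * (M * ε)) +
        P * (M * ε) := by ring
    change ∑ m ∈ Finset.range (n + 1), qv m s + ∑ m ∈ Finset.Icc 1 n, qx m s ≤ 1 / 2
    linarith

end DisplacementBounds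

/-! ### Partial derivatives and total derivatives -/

section MultiIndices

variable {G : Type} [NormedAddCommGroup G] [NormedSpace ℝ G] {n : ℕ} {f : R3 → G}

/-- Iterated partial derivatives are values of the total derivative of higher order. -/
theorem exists_pderiv_iterate_eq (hf : ContDiff ℝ n f) (i : Fin 3) (k : ℕ) {j : ℕ}
    (hjk : j + k ≤ n) {h : R3 → G} (hh : ∃ w : Fin j → R3, (∀ l, ‖w l‖ ≤ 1) ∧
      h = fun y => iteratedFDeriv ℝ j f y w) :
    ∃ w : Fin (j + k) → R3, (∀ l, ‖w l‖ ≤ 1) ∧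
      (pderiv i)^[k] h = fun y => iteratedFDeriv ℝ (j + k) f y w := by
  induction k with
  | zero => exact hh
  | succ k ih =>
    obtain ⟨w, hw, he⟩ := ih (by omega)
    refine ⟨Fin.cons (EuclideanSpace.single i 1) w, fun l => ?_, ?_⟩
    · refine Fin.cases ?_ (fun l => ?_) l
      · simp
      · simpa using hw l
    · rw [Function.iterate_succ_apply', he]
      funext y
      have hd : DifferentiableAt ℝ (iteratedFDeriv ℝ (j + k) f) y :=
        (hf.differentiable_iteratedFDeriv (by exact_mod_cast (by omega : j + k < n))) y
      refine Eq.trans ?_ (iteratedFDeriv_succ_apply_left (n := j + k)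
        (Fin.cons (EuclideanSpace.single i 1) w : Fin (j + k + 1) → R3)).symm
      unfold pderiv
      rw [fderiv_continuousMultilinear_apply_const_apply hd]
      simp

/-- A partial derivative is bounded by the total derivative of the same order. -/
theorem norm_multiDeriv_le {α : Fin 3 → ℕ} (hα : order α ≤ n) (hf : ContDiff ℝ n f) (x : R3) :
    ‖multiDeriv α f x‖ ≤ ‖iteratedFDeriv ℝ (order α) f x‖ := by
  have ho : order α = 0 + α 2 + α 1 + α 0 := by
    unfold order
    rw [Fin.sum_univ_three]
    ring
  rw [ho] at hα ⊢
  obtain ⟨w, hw, he⟩ := exists_pderiv_iterate_eq hf 0 (α 0) hα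
    (exists_pderiv_iterate_eq hf 1 (α 1) (by omega)
      (exists_pderiv_iterate_eq hf 2 (α 2) (by omega) (h := f)
        ⟨Fin.elim0, fun l => l.elim0, by funext y; simp⟩))
  unfold multiDeriv
  rw [he]
  refine (ContinuousMultilinearMap.le_opNorm _ _).trans
    (mul_le_of_le_one_right (norm_nonneg _) ?_)
  exact Finset.prod_le_one (fun _ _ => norm_nonneg _) fun l _ => hw l

end MultiIndices

end VKG

end

theorem proposition3p6 (α₀ : ℕ) (hα₀ : 4 ≤ α₀) (K : Set VKG.R3) (hK : IsCompact K) :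
    ∃ ε₁ > (0 : ℝ), ∃ C > (0 : ℝ), ∀ ε : ℝ, 0 < ε → ε ≤ ε₁ → ∀ T : ℝ, 0 ≤ T →
      ∀ (S₀ : ℤˣ → Lp ℂ 2 (volume : Measure VKG.R3)) (S : ℤˣ → ℝ → VKG.R3 → ℂ)
        (Eosc : ℤˣ → ℝ → VKG.R3 → VKG.C3) (Er : ℝ → VKG.R3 → VKG.C3)
        (E : ℝ → VKG.R3 → VKG.R3) (X V : ℝ → ℝ → VKG.R3 → VKG.R3 → VKG.R3),
        VKG.IsOscillatoryElectricField α₀ ε T S₀ S Eosc Er E →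
        VKG.IsCharacteristic T E X V →
        ∀ s t : ℝ, 0 ≤ s → s ≤ t → t ≤ T → ∀ v ∈ K,
          ContDiff ℝ ((α₀ - 1 : ℕ) : WithTop ℕ∞) (fun x => V s t x v) ∧
          ContDiff ℝ ((α₀ - 1 : ℕ) : WithTop ℕ∞) (fun x => X s t x v) ∧
          ∀ α : Fin 3 → ℕ, 1 ≤ VKG.order α → VKG.order α ≤ α₀ - 1 → ∀ x : VKG.R3,
            ‖VKG.multiDeriv α (fun y => V s t y v - v) x‖ ≤
                C * ε * VKG.bracket s ^ (-(3 / 2) * (1 - VKG.delta α₀ (VKG.order α))) *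
                  VKG.bracket t ^ VKG.delta α₀ (VKG.order α) ∧
            ‖VKG.multiDeriv α (fun y => X s t y v - y) x‖ ≤
                C * ε * VKG.bracket s ^ (-(1 / 2) * (1 - VKG.delta α₀ (VKG.order α))) *
                  VKG.bracket t ^ VKG.delta α₀ (VKG.order α) := by
  obtain ⟨n, rfl⟩ : ∃ n, α₀ = n + 1 := ⟨α₀ - 1, by omega⟩
  have hn : 3 ≤ n := by omega
  obtain ⟨ρ, hρ0, hρ⟩ : ∃ ρ : ℝ, 0 ≤ ρ ∧ ∀ v ∈ K, ‖v‖ ≤ ρ := by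
    obtain ⟨ρ, hρ⟩ := hK.isBounded.exists_norm_le
    exact ⟨max ρ 0, le_max_right _ _, fun v hv => (hρ v hv).trans (le_max_left _ _)⟩
  obtain ⟨w0, hw, hw0⟩ := VKG.exists_norm_relVel_le ρ hρ0
  obtain ⟨A, hA, hAb⟩ := VKG.exists_relVel_bound n (ρ + 2)
  have hA0 : 0 ≤ A := by linarith
  set M := VKG.momentumConst n w0 A
  set P := VKG.positionConst n A
  have hM : 1 ≤ M := VKG.one_le_momentumConst hw hA0
  have hP : 0 ≤ P := VKG.positionConst_nonneg hA0
  have hc : 0 < (n + 1) * (M * (1 + P)) := by positivity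
  refine ⟨1 / 2 / ((n + 1) * (M * (1 + P))), by positivity, 2 * M * (1 + P), by positivity, ?_⟩
  intro ε hε hε1 T hT S₀ S Eosc Er E X V H HC s t hs hst htT v hv
  have ht : t ∈ Set.Icc 0 T := ⟨hs.trans hst, htT⟩
  have hst' : s ∈ Set.Icc 0 t := ⟨hs, hst⟩
  have hsmall : (n + 1) * (M * (1 + P)) * ε ≤ 1 / 2 := by
    rwa [le_div_iff₀' hc] at hε1
  obtain ⟨⟨hX, -⟩, hV, -⟩ := H.displacement_smooth (by omega) HC hε.le ht v
  have hXs := hX.contDiff s hst'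
  have hVs := hV.contDiff s hst'
  rw [Nat.add_sub_cancel]
  refine ⟨?_, ?_, fun α hα1 hα x => ?_⟩
  · have e : (fun x => V s t x v) = fun x => (V s t x v - v) + v := by
      funext x
      rw [sub_add_cancel]
    rw [e]
    exact hVs.add contDiff_const
  · have e : (fun x => X s t x v) = fun x => (X s t x v - x) + x := by
      funext x
      rw [sub_add_cancel]
    rw [e]
    exact hXs.add contDiff_id
  · obtain ⟨b1, b2⟩ := H.displacement_bounds hn HC hε ht hA hAb (hρ v hv) hw (hw0 v (hρ v hv))
      hsmall hst' x
    have hbs := VKG.bracket_rpow_pos s (-(3 / 2) * (1 - (VKG.order α / n : ℝ)))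
    have hbs' := VKG.bracket_rpow_pos s (-(1 / 2) * (1 - (VKG.order α / n : ℝ)))
    have hbt := VKG.bracket_rpow_pos t (VKG.order α / n : ℝ)
    rw [VKG.delta_succ]
    constructor
    · refine (VKG.norm_multiDeriv_le hα hVs x).trans ((b1 _ hα).trans ?_)
      have h1 := mul_le_mul_of_nonneg_left (VKG.velWeight_le hn (VKG.order α) s t)
        (by positivity : 0 ≤ M * ε)
      refine h1.trans ?_
      have h2 : 0 ≤ M * ε * P * (VKG.bracket s ^ (-(3 / 2) * (1 - (VKG.order α / n : ℝ))) *
        VKG.bracket t ^ (VKG.order α / n : ℝ)) := by positivity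
      linarith
    · refine (VKG.norm_multiDeriv_le hα hXs x).trans ((b2 _ hα1 hα).trans ?_)
      rw [VKG.rpow_mul_posWeight hn]
      have h2 : 0 ≤ M * ε * (2 + P) * (VKG.bracket s ^ (-(1 / 2) * (1 - (VKG.order α / n : ℝ))) *
        VKG.bracket t ^ (VKG.order α / n : ℝ)) := by positivity
      linarith
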